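/- Let $n\ge 2$, let $M$ be a smooth (Hausdorff, $\sigma$-compact) manifold of dimension $m$, and let $(\Pi T)^nM$ be the supermanifold of maps $\mathbb R^{0|n}\to M$. Local coordinates $x^i$ on $M$ give coordinates $z^i_I$ on it ($I=\{a_1<\dots<a_k\}\subseteq\{1,\dots,n\}$, of the parity of $|I|$, $z^i_\emptyset=x^i$), the Taylor coefficients in $x^i(\theta)=\sum_I\theta^{a_k}\cdots\theta^{a_1}z^i_I$. A (pseudodifferential) worm $\alpha$ is a smooth function on $(\Pi T)^nM$; it is *rapidly decreasing along the fibres* if, in all coordinates and uniformly over compact sets of $x$'s, every derivative of every coefficient of its expansion in the odd coordinates decreases faster than any power of the even coordinates. The coordinate Berezin integral of $\alpha$ takes the coefficient at the product of all odd coordinates and integrates it over the even fibre coordinates $z_I^i$ ($|I|$ even, $I\neq\emptyset$) and then over the $x^i$; over all of $M$ the results are summed by means of a smooth partition of unity $(\rho_j)$ on $M$ with $\operatorname{supp}\rho_j$ contained in the domain of the $j$-th coordinates. Call a worm *integrable* if it is rapidly decreasing along the fibres and its fibre integral is absolutely integrable over $M$. Let $\alpha$ be a worm that is rapidly decreasing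 along the fibres. Then: 1. (Independence of coordinates.) The fibre integrals converge absolutely. If $V\subseteq M$ is open and contained in the domains of two coordinate systems, the coordinate Berezin integrals of $\alpha$ over the part of $(\Pi T)^nM$ over $V$ computed in the two systems agree (and one is absolutely convergent over $V$ iff the other is). Integrability of $\alpha$, and $\int\alpha$ for integrable $\alpha$, do not depend on the partition of unity and on the coordinates. 2. (Invariance under $\mathit{Diff}(M)$.) For every diffeomorphism $F$ of $M$ the pullback $F^*\alpha$ is again a worm, rapidly decreasing along the fibres; if $\alpha$ is integrable, so is $F^*\alpha$, and $\int F^*\alpha=\int\alpha$. 3. (Invariance under the supergroup $\mathit{Diff}(\mathbb R^{0|n})$.) Let $\varphi$ be a diffeomorphism of $\mathbb R^{0|n}$ depending on any number $L$ of odd parameters $\tau$, and let $A$ be the body of its Jacobian matrix at $\theta=0$. The pullback $\varphi^*\alpha$ along $x(\theta)\mapsto x(\varphi(\theta))$ is again a worm (depending on $\tau$), rapidly decreasing along the fibres. If $\alpha$ is integrable and either has compact support over $M$ (automatic for compact $M$) or $\varphi$ fixes the origin $\theta=0$, then $\varphi^*\alpha$ is integrable and $$\int\varphi^*\alpha=\operatorname{sgn}(\det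 A)^{\,m\,2^{n-2}}\int\alpha .$$ So the integral is invariant under all of $\mathit{Diff}(\mathbb R^{0|n})$ if $n\ge3$ or $m$ is even, and for $n=2$ and $m$ odd under the diffeomorphisms with $\det A>0$, the other ones reversing the sign. 4. (Stokes.) Let $u$ be a vector field on $\mathbb R^{0|n}$ (of any parity, or inhomogeneous), acting on worms by its natural lift $u^\flat$. Then $u^\flat\alpha$ is again a worm, rapidly decreasing along the fibres. If $\alpha$ is integrable and either has compact support over $M$ or $u$ vanishes at $\theta=0$, then $u^\flat\alpha$ is integrable and $\int u^\flat\alpha=0$. More generally, $\int u^\flat\alpha=0$ whenever $\alpha$ and $u^\flat\alpha$ are integrable and $\alpha$ has no flux at infinity, that is, there are compactly supported smooth functions $\chi_k:M\to[0,1]$, eventually equal to $1$ on each compact set, such that for each $a$ the integral over $M$ of the absolute value of the fibre integral of $(d_a\chi_k)\,\alpha$ tends to $0$ as $k\to\infty$; here $d_a=-(\partial_{\theta^a})^\flat$. -/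

import Mathlib

open Set Filter Topology MeasureTheory
open scoped Manifold ContDiff

noncomputable section

namespace Worm

/-! ### Grassmann algebras -/

/-- The real Grassmann algebra on generators indexed by `ι`. -/
abbrev Gr (ι : Type) : Type := ExteriorAlgebra ℝ (ι → ℝ)

/-- The generator with index `i`. -/
def gen {ι : Type} [DecidableEq ι] (i : ι) : Gr ι := ExteriorAlgebra.ι ℝ (Pi.single i 1)

/-- The monomial basis; the factors of a monomial are taken in increasing order. -/
def mon {ι : Type} [Fintype ι] [LinearOrder ι] (S : Finset ι) : Gr ι :=
  (Pi.basisFun ℝ ι).ExteriorAlgebra S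

/-- The coefficient of the monomial with index set `S`. -/
def coeff {ι : Type} [Fintype ι] [LinearOrder ι] (S : Finset ι) : Gr ι →ₗ[ℝ] ℝ :=
  (Pi.basisFun ℝ ι).ExteriorAlgebra.coord S

/-- The body (constant term). -/
def body {ι : Type} : Gr ι →ₐ[ℝ] ℝ := ExteriorAlgebra.algebraMapInv

/-- Renaming of generators along an injective map. -/
def rename {ι κ : Type} (f : ι → κ) : Gr ι →ₐ[ℝ] Gr κ :=
  ExteriorAlgebra.map (Function.ExtendByZero.linearMap ℝ f)

/-- The left partial derivative with respect to an odd generator. -/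
def dLeft {ι : Type} (i : ι) : Gr ι →ₗ[ℝ] Gr ι :=
  CliffordAlgebra.contractLeft (Q := (0 : QuadraticForm ℝ (ι → ℝ))) (LinearMap.proj i)

/-- The product of `v s`, `s ∈ S`, in increasing order of `s`. -/
def ordProd {ι A : Type} [LinearOrder ι] [Monoid A] (S : Finset ι) (v : ι → A) : A :=
  ((S.sort (· ≤ ·)).map v).prod

/-- The value of a smooth function `h` at even elements `a c` of a Grassmann algebra, by (finite)
Taylor expansion around the body of `a` in the nilpotent parts. -/
def taylor {κ ι : Type} [Fintype κ] [DecidableEq κ] [Fintype ι]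
    (h : (κ → ℝ) → ℝ) (a : κ → Gr ι) : Gr ι :=
  ∑ k ∈ Finset.range (Fintype.card ι + 1), ((k.factorial : ℝ)⁻¹) •
    ∑ c : Fin k → κ,
      iteratedFDeriv ℝ k h (fun d => body (a d)) (fun j => Pi.single (c j) 1) •
        (List.ofFn fun j => a (c j) - algebraMap ℝ (Gr ι) (body (a (c j)))).prod

/-! ### Coordinates on the space of maps from the odd space to a manifold -/

/-- Even coordinates: pairs `(i, I)` with `|I|` even (for `I = ∅` these are the `x i`). -/
abbrev EvenIdx (m n : ℕ) : Type := {c : Fin m × Finset (Fin n) // Even c.2.card}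

/-- Even coordinates in the fibre over `M`: pairs `(i, I)` with `|I|` even and positive. -/
abbrev FibIdx (m n : ℕ) : Type :=
  {c : Fin m × Finset (Fin n) // Even c.2.card ∧ c.2.Nonempty}

/-- Odd coordinates: pairs `(i, I)` with `|I|` odd. -/
def OddIdx (m n : ℕ) : Type := {c : Fin m × Finset (Fin n) // ¬ Even c.2.card}

instance (m n : ℕ) : Fintype (OddIdx m n) :=
  inferInstanceAs (Fintype {c : Fin m × Finset (Fin n) // ¬ Even c.2.card})

/-- The odd coordinates are ordered lexicographically in `(i, I)`, with the colexicographic order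
on the sets `I`; so for `n = 2` the order is `ξ₁¹, ξ₂¹, ξ₁², ξ₂², …` (upper index `i`). -/
instance (m n : ℕ) : LinearOrder (OddIdx m n) :=
  LinearOrder.lift'
    (fun c : OddIdx m n => (toLex (c.1.1, toColex c.1.2) : Fin m ×ₗ Colex (Finset (Fin n))))
    (by
      intro a b h
      have h' := toLex.injective h
      simp only [Prod.mk.injEq] at h'
      exact Subtype.ext (Prod.ext h'.1 (toColex.injective h'.2)))

/-- Odd generators: `L` auxiliary odd parameters, followed by the odd coordinates. -/
abbrev Par (L m n : ℕ) : Type := Fin L ⊕ₗ OddIdx m n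

/-- The parameter with index `t`. -/
def parL {L m n : ℕ} (t : Fin L) : Par L m n := toLex (Sum.inl t)

/-- The odd coordinate with index `c`. -/
def parO {L m n : ℕ} (c : OddIdx m n) : Par L m n := toLex (Sum.inr c)

/-- Generators: the coordinates `θ¹, …, θⁿ` of the odd space, followed by those in `g`. -/
abbrev WithTheta (n : ℕ) (g : Type) : Type := Fin n ⊕ₗ g

/-- The element of `Gr g` that stands to the right of `θ^I`, when an element is expanded in
monomials in the `θ`'s. -/
def thetaPart {n : ℕ} {g : Type} [Fintype g] [LinearOrder g] (I : Finset (Fin n))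
    (w : Gr (WithTheta n g)) : Gr g :=
  ∑ S : Finset g, coeff ((I.disjSum S).map toLex.toEmbedding) w • mon S

/-- The sign with `θ^{a₁} ⋯ θ^{aₖ} = sgnRev I • θ^{aₖ} ⋯ θ^{a₁}`, `I = {a₁ < … < aₖ}`. -/
def sgnRev {n : ℕ} (I : Finset (Fin n)) : ℝ := (-1) ^ (I.card * (I.card - 1) / 2)

/-- The map `x^i(θ) = e^{θ^a d_a} x^i = ∑_I θ^{aₖ} ⋯ θ^{a₁} z_I^i` with Taylor coefficients
`z_I^i` (that is `d_{a₁} ⋯ d_{aₖ} x^i`), evaluated at `θ^a = T a`. -/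
def curve {m n : ℕ} {ι : Type} (T : Fin n → Gr ι)
    (z : Fin m → Finset (Fin n) → Gr ι) (i : Fin m) : Gr ι :=
  ∑ I : Finset (Fin n), sgnRev I • (ordProd I T * z i I)

/-- The Taylor coefficient `z_I` of a map, inverse to `curve`. -/
def taylorCoeff {n : ℕ} {g : Type} [Fintype g] [LinearOrder g] (I : Finset (Fin n))
    (w : Gr (WithTheta n g)) : Gr g :=
  sgnRev I • thetaPart I w

/-- The coordinate functions `z_I^i`, at the point with even coordinates `p`. -/
def coordFun {L m n : ℕ} (p : EvenIdx m n → ℝ) (i : Fin m) (I : Finset (Fin n)) :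
    Gr (Par L m n) :=
  if h : Even I.card then algebraMap ℝ _ (p ⟨(i, I), h⟩) else gen (parO ⟨(i, I), h⟩)

/-- The generic map `x(θ)` over the point with even coordinates `p`. -/
def genericCurve {L m n : ℕ} (p : EvenIdx m n → ℝ) (i : Fin m) :
    Gr (WithTheta n (Par L m n)) :=
  curve (fun a => gen (toLex (Sum.inl a)))
    (fun i I => rename (fun s => toLex (Sum.inr s)) (coordFun p i I)) i

/-- The coordinates `x^i` of a point with even coordinates `p`. -/
def baseOf {m n : ℕ} (p : EvenIdx m n → ℝ) : Fin m → ℝ := fun i => p ⟨(i, ∅), by simp⟩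

/-- The even coordinates `(x, y)`, `y` being the coordinates `z_I^i` with `|I|` even, `I ≠ ∅`. -/
def assemble {m n : ℕ} (x : Fin m → ℝ) (y : FibIdx m n → ℝ) : EvenIdx m n → ℝ :=
  fun c => if h : c.1.2 = ∅ then x c.1.1
    else y ⟨c.1, c.2, Finset.nonempty_iff_ne_empty.mpr h⟩

/-- A function in coordinates on the space of maps (times `ℝ^{0|L}`): a function of the even
coordinates with values in the Grassmann algebra of the odd ones and of the parameters. -/
abbrev SFun (L m n : ℕ) : Type := (EvenIdx m n → ℝ) → Gr (Par L m n)

/-- The function `f` with the values `t` inserted for the parameters, and `Z` for the coordinates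
`z_I^i`. -/
def substitute {L m n : ℕ} {ι : Type} [Fintype ι] (f : SFun L m n)
    (t : Fin L → Gr ι) (Z : Fin m → Finset (Fin n) → Gr ι) : Gr ι :=
  ∑ S : Finset (Par L m n),
    taylor (fun q => coeff S (f q)) (fun c : EvenIdx m n => Z c.1.1 c.1.2) *
      ordProd S (fun s => Sum.elim t (fun c : OddIdx m n => Z c.1.1 c.1.2) (ofLex s))

/-- The pullback of `f` along the map `x(θ) ↦ ψ(x(θ))` of spaces of maps. -/
def pullAlong {L m n : ℕ} (ψ : (Fin m → ℝ) → (Fin m → ℝ)) (f : SFun L m n) : SFun L m n :=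
  fun p => substitute f (fun t => gen (parL t))
    (fun i I => taylorCoeff I (taylor (fun x => ψ x i) (genericCurve p)))

/-! ### Worms on a manifold -/

section Manifold

variable (m : ℕ) (M : Type*) [TopologicalSpace M] [ChartedSpace (Fin m → ℝ) M]

/-- Local coordinate systems on `M`: all smooth charts. -/
abbrev Coord : Type _ :=
  {e : OpenPartialHomeomorph M (Fin m → ℝ) //
    e ∈ IsManifold.maximalAtlas 𝓘(ℝ, Fin m → ℝ) ∞ M}

/-- A family of functions in coordinates, one for each coordinate system on `M`. -/
abbrev Family (L n : ℕ) : Type _ := Coord m M → SFun L m n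

end Manifold

variable {m n L : ℕ} {M : Type*} [TopologicalSpace M] [ChartedSpace (Fin m → ℝ) M]

/-- The body of the coordinate domain of `e`. -/
def dom (n : ℕ) (e : Coord m M) : Set (EvenIdx m n → ℝ) := {p | baseOf p ∈ e.1.target}

/-- The point of `M` under the point with even coordinates `p`. -/
def point (e : Coord m M) (p : EvenIdx m n → ℝ) : M := e.1.symm (baseOf p)

/-- `α` is a smooth function on the supermanifold of maps from the odd space of dimension `n` to
`M` (times `ℝ^{0|L}`), i.e. a (pseudodifferential) worm of level `n` with `L` odd parameters: its
coordinate expressions are smooth and agree under changes of coordinates. -/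
structure IsWorm (α : Family m M L n) : Prop where
  smooth : ∀ (e : Coord m M) (S : Finset (Par L m n)),
    ContDiffOn ℝ ∞ (fun p => coeff S (α e p)) (dom n e)
  compatible : ∀ (e e' : Coord m M) (p : EvenIdx m n → ℝ), p ∈ dom n e →
    point e p ∈ e'.1.source →
    α e p = pullAlong (fun x => e'.1 (e.1.symm x)) (α e') p

/-- `α` is rapidly decreasing along the fibres over `M`: locally uniformly over `M`, all
derivatives of all its coefficients decrease faster than any power of the coordinates. -/
def RapidlyDecreasing (α : Family m M L n) : Prop :=
  ∀ (e : Coord m M) (S : Finset (Par L m n)) (K : Set (Fin m → ℝ)), IsCompact K →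
    K ⊆ e.1.target → ∀ k N : ℕ, ∃ C : ℝ, ∀ p : EvenIdx m n → ℝ, baseOf p ∈ K →
      ‖p‖ ^ N * ‖iteratedFDeriv ℝ k (fun q => coeff S (α e q)) p‖ ≤ C

/-- `α` vanishes over the complement of a compact subset of `M`. -/
def CompactBase (α : Family m M L n) : Prop :=
  ∃ K : Set M, IsCompact K ∧ ∀ (e : Coord m M) (p : EvenIdx m n → ℝ), p ∈ dom n e →
    point e p ∉ K → α e p = 0

/-- Multiplication by a function on `M`. -/
def mulFun (χ : M → ℝ) (α : Family m M L n) : Family m M L n :=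
  fun e p => χ (point e p) • α e p

/-! ### The Berezin integral -/

/-- The index set of the monomial `τ^T ∏ ξ`: all odd coordinates, and the parameters in `T`. -/
def topIdx (m n : ℕ) {L : ℕ} (T : Finset (Fin L)) : Finset (Par L m n) :=
  (T.disjSum Finset.univ).map toLex.toEmbedding

/-- The coefficient at the product of all odd coordinates (and at `τ^T`), as a function of the
coordinates along the fibre over the point with coordinates `x`. -/
def topCoeff (e : Coord m M) (α : Family m M L n) (T : Finset (Fin L)) (x : Fin m → ℝ)
    (y : FibIdx m n → ℝ) : ℝ :=
  coeff (topIdx m n T) (α e (assemble x y))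

/-- The coordinate Berezin integral over the fibre. -/
def fibreInt (e : Coord m M) (α : Family m M L n) (T : Finset (Fin L)) (x : Fin m → ℝ) : ℝ :=
  ∫ y : FibIdx m n → ℝ, topCoeff e α T x y

/-- A smooth partition of unity on `M`, with coordinates chosen around the support of each of its
members. -/
structure CoordPartition (J : Type*) (m : ℕ) (M : Type*) [TopologicalSpace M]
    [ChartedSpace (Fin m → ℝ) M] where
  part : SmoothPartitionOfUnity J 𝓘(ℝ, Fin m → ℝ) M
  chart : J → Coord m M
  subordinate : ∀ j, tsupport (part j) ⊆ (chart j).1.source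

variable {J : Type*}

/-- The fibre integral in the `j`-th coordinates, multiplied by the `j`-th cut-off function. -/
def localInt (P : CoordPartition J m M) (α : Family m M L n) (T : Finset (Fin L)) (j : J)
    (x : Fin m → ℝ) : ℝ :=
  P.part j ((P.chart j).1.symm x) * fibreInt (P.chart j) α T x

/-- Absolute integrability over `M` (of the fibre integral). -/
def AbsInt (P : CoordPartition J m M) (α : Family m M L n) : Prop :=
  ∀ T : Finset (Fin L),
    (∀ j, IntegrableOn (localInt P α T j) (P.chart j).1.target) ∧
      Summable fun j => ∫ x in (P.chart j).1.target, |localInt P α T j x|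

/-- The Berezin integral, with values in the Grassmann algebra of the parameters. -/
def integral (P : CoordPartition J m M) (α : Family m M L n) : Gr (Fin L) :=
  ∑ T : Finset (Fin L),
    (∑' j, ∫ x in (P.chart j).1.target, localInt P α T j x) • mon T

/-- The integral over `M` of the absolute value of the fibre integral. -/
def absIntegral (P : CoordPartition J m M) (α : Family m M 0 n) : ℝ :=
  ∑' j, ∫ x in (P.chart j).1.target, |localInt P α ∅ j x|

/-! ### Action of diffeomorphisms of `M` -/

/-- The pullback of `α` along the map of spaces of maps induced by `F : M → M`, written in
coordinates around a point and around its image. -/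
def pullM [IsManifold 𝓘(ℝ, Fin m → ℝ) ∞ M] (F : M → M) (α : Family m M L n) :
    Family m M L n :=
  fun e p =>
    let e' : Coord m M :=
      ⟨chartAt (Fin m → ℝ) (F (point e p)), IsManifold.chart_mem_maximalAtlas _⟩
    pullAlong (fun x => e'.1 (F (e.1.symm x))) (α e') p

/-! ### Action of diffeomorphisms of the odd space -/

/-- A diffeomorphism of `ℝ^{0|n}` with `L` odd parameters: `θ ↦ φ(θ, τ)`, with all components odd
and with an invertible Jacobian matrix. -/
structure OddDiffeo (n L : ℕ) where
  comp : Fin n → Gr (WithTheta n (Fin L))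
  odd : ∀ a, comp a ∈
    CliffordAlgebra.evenOdd (0 : QuadraticForm ℝ (WithTheta n (Fin L) → ℝ)) 1
  invertible :
    IsUnit (Matrix.of fun a b : Fin n => coeff {toLex (Sum.inl b)} (comp a)).det

/-- The body of the Jacobian matrix at the origin. -/
def OddDiffeo.jac (φ : OddDiffeo n L) : Matrix (Fin n) (Fin n) ℝ :=
  Matrix.of fun a b => coeff {toLex (Sum.inl b)} (φ.comp a)

/-- `φ` fixes the origin `θ = 0`. -/
def OddDiffeo.FixesOrigin (φ : OddDiffeo n L) : Prop := ∀ a, thetaPart ∅ (φ.comp a) = 0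

/-- The pullback of `α` along `x(θ) ↦ x(φ(θ))`. -/
def reparam (φ : OddDiffeo n L) (α : Family m M 0 n) : Family m M L n :=
  fun e p => substitute (α e) (fun t => t.elim0) (fun i I => taylorCoeff I
    (curve
      (fun a => rename (fun s : WithTheta n (Fin L) =>
        (toLex (Sum.map id parL (ofLex s)) : WithTheta n (Par L m n))) (φ.comp a))
      (fun i I => rename (fun s => toLex (Sum.inr s)) (coordFun p i I)) i))

/-! ### Action of vector fields on the odd space -/

/-- A vector field `u = ∑ u^a(θ) ∂/∂θ^a` on `ℝ^{0|n}`, of any parity or inhomogeneous. -/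
abbrev OddVF (n : ℕ) : Type := Fin n → Gr (Fin n)

/-- The constant vector field `∂/∂θ^a`. -/
def partialTheta (a : Fin n) : OddVF n := Pi.single a 1

/-- `-u^♭` is the left superderivation `D`, supercommuting with the `θ`'s, for which
`D (x(θ)) = u (x(θ))`. Comparing Taylor coefficients gives `D z_K = ∑_I (flatCoeff u K I) z_I`,
where the power of `-1` comes from moving `D` (of the parity of `θ^J ∂/∂θ^a`) through `θ^K`. -/
def flatCoeff (u : OddVF n) (K I : Finset (Fin n)) : ℝ :=
  ∑ a : Fin n, ∑ J : Finset (Fin n), coeff J (u a) * (-1) ^ ((J.card + 1) * K.card) *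
    sgnRev K * sgnRev I * coeff K (mon J * dLeft a (mon I))

/-- The component `D z_K^i` of the vector field `D = -u^♭`. -/
def flatComp (u : OddVF n) (p : EvenIdx m n → ℝ) (i : Fin m) (K : Finset (Fin n)) :
    Gr (Par L m n) :=
  ∑ I : Finset (Fin n), flatCoeff u K I • coordFun p i I

/-- The partial derivative with respect to an even coordinate. -/
def dEven (c : EvenIdx m n) (f : SFun L m n) : SFun L m n :=
  fun p => ∑ S : Finset (Par L m n),
    fderiv ℝ (fun q => coeff S (f q)) p (Pi.single c 1) • mon S

/-- The action `u^♭ α` of a vector field on the odd space. -/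
def flat (u : OddVF n) (α : Family m M L n) : Family m M L n :=
  fun e p => -((∑ c : EvenIdx m n, flatComp u p c.1.1 c.1.2 * dEven c (α e) p) +
    ∑ c : OddIdx m n, flatComp u p c.1.1 c.1.2 * dLeft (parO c) (α e p))

/-- `[(∂/∂θ^a)^♭, χ] α`, that is, `-(d_a χ) α`. -/
def flatComm (a : Fin n) (χ : M → ℝ) (α : Family m M L n) : Family m M L n :=
  flat (partialTheta a) (mulFun χ α) - mulFun χ (flat (partialTheta a) α)

/-- `α` has no flux at infinity: there are compactly supported smooth cut-off functions `χ k` on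
`M`, with values in `[0, 1]` and eventually equal to `1` on each compact set, such that the
integrals of `|(d_a χ_k) α|` tend to zero. This holds whenever `α` has compact support over `M`. -/
def NoFlux (P : CoordPartition J m M) (α : Family m M 0 n) : Prop :=
  ∃ χ : ℕ → C^∞⟮𝓘(ℝ, Fin m → ℝ), M; 𝓘(ℝ, ℝ), ℝ⟯,
    (∀ k, HasCompactSupport (χ k)) ∧ (∀ k q, χ k q ∈ Icc (0 : ℝ) 1) ∧
    (∀ K : Set M, IsCompact K → ∀ᶠ k in atTop, ∀ q ∈ K, χ k q = 1) ∧
    ∀ a : Fin n, Tendsto (fun k => absIntegral P (flatComm a (χ k) α)) atTop (𝓝 0)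

end Worm

end

open Set Filter Topology MeasureTheory
open scoped Manifold ContDiff
noncomputable section
set_option linter.unusedSectionVars false
set_option linter.unusedSimpArgs false
open Finset (sum_congr sum_comm mul_sum sum_mul sum_eq_single sum_eq_zero sum_add_distrib smul_sum
  sum_sub_distrib sum_range_succ sum_smul sum_singleton sum_neg_distrib sum_filter sum_le_sum
  sum_const sum_insert induction_on_min sum_range_succ' card_map card_univ card_pos
  card_insert_of_notMem inr_mem_disjSum inl_mem_disjSum map_singleton sum_subtype sum_ite_eq
  sum_ite_eq' sum_product sum_bij sum_nbij prod_congr length_sort prod_insert prod_eq_zero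
  card_eq_zero sum_subset mem_filter mem_erase)
namespace Worm

/-- The values of the even coordinates. -/
abbrev Pt (m n : ℕ) : Type := EvenIdx m n → ℝ

/-- Real vectors. -/
abbrev Vec (κ : Type) : Type := κ → ℝ

/-- The values of the coordinates on `M`. -/
abbrev Bs (m : ℕ) : Type := Fin m → ℝ

/-- Sets of odd indices. -/
abbrev Ix (n : ℕ) : Type := Finset (Fin n)

/-- Values of the coordinates in a Grassmann algebra. -/
abbrev Crd (m n : ℕ) (ι : Type) : Type := Fin m → Ix n → Gr ι

/-! ### Monomials and parity -/

section

variable {ι σ : Type}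

/-- The submodule of elements of parity `i`. -/
abbrev pty (ι : Type) (i : ZMod 2) : Submodule ℝ (Gr ι) :=
  CliffordAlgebra.evenOdd (0 : QuadraticForm ℝ (ι → ℝ)) i

/-- Families of odd elements. -/
abbrev Odds {X : Type} (b : X → Gr ι) : Prop := ∀ s, b s ∈ pty ι 1

/-- Families of even elements. -/
abbrev Evens {X : Type} (b : X → Gr ι) : Prop := ∀ s, b s ∈ pty ι 0

lemma ordProd_empty {A : Type} [LinearOrder ι] [Monoid A] (v : ι → A) : ordProd ∅ v = 1 := by
  simp [ordProd]

lemma ordProd_insert_min {A : Type} [LinearOrder ι] [DecidableEq ι] [Monoid A] (v : ι → A) {a : ι}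
  {S : Finset ι} (h : ∀ x ∈ S, a < x) : ordProd (insert a S) v = v a * ordProd S v := by
  rw [ordProd, Finset.sort_insert]
  · simp [ordProd]
  · exact fun b hb => (h b hb).le
  · exact fun ha => lt_irrefl _ (h a ha)

lemma ordProd_singleton {A : Type} [LinearOrder ι] [Monoid A] (v : ι → A) (a : ι) :
  ordProd {a} v = v a := by simp [ordProd]

lemma map_ordProd {A B F : Type} [LinearOrder ι] [Monoid A] [Monoid B] [FunLike F A B]
  [MonoidHomClass F A B] (f : F) (v : ι → A) (S : Finset ι) :
  f (ordProd S v) = ordProd S (fun i => f (v i)) := by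
  simp [ordProd, map_list_prod, Function.comp_def]

lemma gen_inst (d d' : DecidableEq ι) : @gen ι d = @gen ι d' := by
  rw [Subsingleton.elim d d']

lemma mon_eq_ordProd [Fintype ι] [LinearOrder ι] [d : DecidableEq ι] (S : Finset ι) :
  mon S = ordProd S (gen : ι → Gr ι) := by
  rw [gen_inst d inferInstance, mon, ExteriorAlgebra.basis_apply_ofCard _ rfl, ordProd]
  simp only [ExteriorAlgebra.ιMulti_family, ExteriorAlgebra.ιMulti_apply]
  congr 1
  apply List.ext_getElem
  · simp
  · intro i h1 h2
    simp [gen, Set.powersetCard.ofFinEmbEquiv_symm_apply, Finset.orderEmbOfFin_apply]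

lemma coeff_mon [Fintype ι] [LinearOrder ι] (S T : Finset ι) :
  coeff S (mon T) = if S = T then 1 else 0 := by
  classical
  rw [coeff, mon, Module.Basis.coord_apply, Module.Basis.repr_self, Finsupp.single_apply]
  simp [eq_comm]

lemma sum_coeff_mon [Fintype ι] [LinearOrder ι] (x : Gr ι) :
  ∑ S, coeff S x • mon S = x :=
  (Pi.basisFun ℝ ι).ExteriorAlgebra.sum_repr x

lemma gr_ext [Fintype ι] [LinearOrder ι] {x y : Gr ι} (h : ∀ S, coeff S x = coeff S y) :
  x = y := by
  rw [← sum_coeff_mon x, ← sum_coeff_mon y]; simp [h]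

lemma linearMap_ext_mon [Fintype ι] [LinearOrder ι] {V : Type*} [AddCommMonoid V] [Module ℝ V]
  {f g : Gr ι →ₗ[ℝ] V} (h : ∀ S, f (mon S) = g (mon S)) : f = g :=
  (Pi.basisFun ℝ ι).ExteriorAlgebra.ext h

@[simp] lemma mon_empty [Fintype ι] [LinearOrder ι] : (mon ∅ : Gr ι) = 1 := by
  rw [mon_eq_ordProd, ordProd_empty]

lemma mon_singleton [Fintype ι] [LinearOrder ι] [DecidableEq ι] (i : ι) : mon {i} = (gen i : Gr ι) := by
  rw [mon_eq_ordProd, ordProd_singleton]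

lemma mon_insert_min [Fintype ι] [LinearOrder ι] [d : DecidableEq ι] {a : ι} {S : Finset ι}
  (h : ∀ x ∈ S, a < x) : mon (insert a S) = gen a * mon S := by
  rw [mon_eq_ordProd (d := d), mon_eq_ordProd (d := d), ordProd_insert_min _ h]

lemma gen_mem_pty [DecidableEq ι] (i : ι) : gen i ∈ pty ι 1 :=
  CliffordAlgebra.ι_mem_evenOdd_one _ _

lemma pty_mul {i j : ZMod 2} {x y : Gr ι} (hx : x ∈ pty ι i) (hy : y ∈ pty ι j) :
  x * y ∈ pty ι (i + j) :=
  CliffordAlgebra.evenOdd_mul_le _ _ _ (Submodule.mul_mem_mul hx hy)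

lemma one_mem_pty : (1 : Gr ι) ∈ pty ι 0 :=
  CliffordAlgebra.one_le_evenOdd_zero _ (Submodule.one_le.mp le_rfl)

lemma algebraMap_mem_pty (r : ℝ) : algebraMap ℝ (Gr ι) r ∈ pty ι 0 := by
  rw [Algebra.algebraMap_eq_smul_one]; exact Submodule.smul_mem _ _ one_mem_pty

lemma ordProd_mem_pty [LinearOrder σ] {v : σ → Gr ι} (S : Finset σ)
  (hv : ∀ s ∈ S, v s ∈ pty ι 1) : ordProd S v ∈ pty ι (S.card : ZMod 2) := by
  induction S using induction_on_min with
  | empty => simpa [ordProd_empty] using one_mem_pty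
  | insert a S ha ih =>
    have : a ∉ S := fun h => lt_irrefl _ (ha a h)
    rw [ordProd_insert_min _ ha, card_insert_of_notMem this, add_comm]
    push_cast
    exact pty_mul (hv _ (by simp)) (ih fun s hs => hv s (by simp [hs]))

lemma mon_mem_pty [Fintype ι] [LinearOrder ι] (S : Finset ι) :
  (mon S : Gr ι) ∈ pty ι (S.card : ZMod 2) := by
  rw [mon_eq_ordProd]; exact ordProd_mem_pty S fun s _ => gen_mem_pty s

lemma mem_pty_of_coeff [Fintype ι] [LinearOrder ι] {i : ZMod 2} {x : Gr ι}
  (h : ∀ S : Finset ι, (S.card : ZMod 2) ≠ i → coeff S x = 0) : x ∈ pty ι i := by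
  rw [← sum_coeff_mon x]
  refine Submodule.sum_mem _ fun S _ => ?_
  by_cases hS : (S.card : ZMod 2) = i
  · exact Submodule.smul_mem _ _ (hS ▸ mon_mem_pty S)
  · rw [h S hS]; simp

lemma eq_zero_of_mem_pty {x : Gr ι} {i j : ZMod 2} (hi : x ∈ pty ι i) (hj : x ∈ pty ι j)
  (h : i ≠ j) : x = 0 := by
  have := (CliffordAlgebra.evenOdd_isCompl (Q := (0 : QuadraticForm ℝ (ι → ℝ)))).disjoint
  rw [Submodule.disjoint_def] at this
  fin_cases i <;> fin_cases j <;> first | exact absurd rfl h | exact this x hi hj | exact this x hj hi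

/-- The projection to the part of parity `i`. -/
def ptyProj [Fintype ι] [LinearOrder ι] (i : ZMod 2) : Gr ι →ₗ[ℝ] Gr ι :=
  ∑ S ∈ Finset.univ.filter (fun S : Finset ι => (S.card : ZMod 2) = i),
    (coeff S).smulRight (mon S)

lemma ptyProj_mon [Fintype ι] [LinearOrder ι] (i : ZMod 2) (S : Finset ι) :
  ptyProj i (mon S) = if (S.card : ZMod 2) = i then mon S else 0 := by
  simp [ptyProj, coeff_mon, sum_ite_eq, ite_smul]

lemma ptyProj_mem [Fintype ι] [LinearOrder ι] (i : ZMod 2) (x : Gr ι) :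
  ptyProj i x ∈ pty ι i := by
  rw [← sum_coeff_mon x, map_sum]
  refine Submodule.sum_mem _ fun S _ => ?_
  rw [map_smul, ptyProj_mon]
  split_ifs with h
  · exact Submodule.smul_mem _ _ (h ▸ mon_mem_pty S)
  · simp

lemma zmod2_cases (i : ZMod 2) : i = 0 ∨ i = 1 := by revert i; decide

lemma ptyProj_add [Fintype ι] [LinearOrder ι] (x : Gr ι) :
  ptyProj 0 x + ptyProj 1 x = x := by
  suffices h : (ptyProj 0 + ptyProj 1 : Gr ι →ₗ[ℝ] Gr ι) = LinearMap.id from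
    LinearMap.congr_fun h x
  refine linearMap_ext_mon fun S => ?_
  rcases zmod2_cases (S.card : ZMod 2) with h | h <;> simp [ptyProj_mon, h]

lemma ptyProj_of_mem [Fintype ι] [LinearOrder ι] {i : ZMod 2} {x : Gr ι} (h : x ∈ pty ι i) :
  ptyProj i x = x ∧ ptyProj (i + 1) x = 0 := by
  have h1 : ptyProj i x + ptyProj (i + 1) x = x := by
    rcases zmod2_cases i with rfl | rfl
    · simpa using ptyProj_add x
    · rw [add_comm]; exact ptyProj_add x
  have h2 : ptyProj (i + 1) x = x - ptyProj i x := eq_sub_of_add_eq' h1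
  have h3 : ptyProj (i + 1) x = 0 := by
    refine eq_zero_of_mem_pty (ptyProj_mem (i + 1) x) (j := i) ?_ (by simp)
    rw [h2]; exact Submodule.sub_mem _ h (ptyProj_mem _ _)
  exact ⟨by rw [h3, add_zero] at h1; exact h1, h3⟩

lemma coeff_ptyProj [Fintype ι] [LinearOrder ι] (i : ZMod 2) (S : Finset ι) (x : Gr ι) :
  coeff S (ptyProj i x) = if (S.card : ZMod 2) = i then coeff S x else 0 := by
  simp only [ptyProj, LinearMap.sum_apply, LinearMap.smulRight_apply, map_sum, map_smul,
    smul_eq_mul, coeff_mon, mul_ite, mul_one, mul_zero]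
  rw [sum_ite_eq]
  simp

lemma coeff_eq_zero_of_mem_pty [Fintype ι] [LinearOrder ι] {i : ZMod 2} {x : Gr ι}
  (h : x ∈ pty ι i) {S : Finset ι} (hS : (S.card : ZMod 2) ≠ i) : coeff S x = 0 := by
  rw [← (ptyProj_of_mem h).1, coeff_ptyProj, if_neg hS]

lemma ptyProj_mul [Fintype ι] [LinearOrder ι] (i : ZMod 2) (x : Gr ι) {y : Gr ι}
  (hy : y ∈ pty ι 0) : ptyProj i (x * y) = ptyProj i x * y := by
  have key : ∀ j : ZMod 2, ∀ z ∈ pty ι j, ptyProj i (z * y) = ptyProj i z * y := by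
    intro j z hz
    have hzy : z * y ∈ pty ι j := by simpa using pty_mul hz hy
    by_cases hij : i = j
    · subst hij; rw [(ptyProj_of_mem hzy).1, (ptyProj_of_mem hz).1]
    · have : i = j + 1 := by clear hz hzy; revert i j; decide
      rw [this, (ptyProj_of_mem hzy).2, (ptyProj_of_mem hz).2, zero_mul]
  conv_lhs => rw [← ptyProj_add x]
  conv_rhs => rw [← ptyProj_add x]
  rw [add_mul, map_add, map_add, add_mul, key _ _ (ptyProj_mem 0 x), key _ _ (ptyProj_mem 1 x)]

/-! ### Commutation -/

lemma ι_mul_eq (v : ι → ℝ) (y : Gr ι) :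
  ExteriorAlgebra.ι ℝ v * y = CliffordAlgebra.involute y * ExteriorAlgebra.ι ℝ v := by
  induction y using ExteriorAlgebra.induction with
  | algebraMap r => simp [Algebra.commutes]
  | ι w =>
    rw [ExteriorAlgebra.ι, CliffordAlgebra.involute_ι, neg_mul]
    exact eq_neg_of_add_eq_zero_left (ExteriorAlgebra.ι_add_mul_swap v w)
  | mul a b ha hb => rw [← mul_assoc, ha, mul_assoc, hb, map_mul, mul_assoc]
  | add a b ha hb => rw [mul_add, ha, hb, map_add, add_mul]

lemma involute_even {x : Gr ι} (hx : x ∈ pty ι 0) : CliffordAlgebra.involute x = x :=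
  CliffordAlgebra.involute_eq_of_mem_even hx

lemma involute_odd {x : Gr ι} (hx : x ∈ pty ι 1) : CliffordAlgebra.involute x = -x :=
  CliffordAlgebra.involute_eq_of_mem_odd hx

lemma even_commute {x : Gr ι} (hx : x ∈ pty ι 0) (y : Gr ι) : Commute x y := by
  induction y using ExteriorAlgebra.induction with
  | algebraMap r => exact (Algebra.commutes r x).symm
  | ι w => have := ι_mul_eq w x; rw [involute_even hx] at this; exact this.symm
  | mul a b ha hb => exact ha.mul_right hb
  | add a b ha hb => exact ha.add_right hb

lemma odd_anticomm {x y : Gr ι} (hx : x ∈ pty ι 1) (hy : y ∈ pty ι 1) :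
  x * y = -(y * x) := by
  induction x, hx using CliffordAlgebra.odd_induction with
  | ι v => rw [← ExteriorAlgebra.ι, ι_mul_eq, involute_odd hy, neg_mul]
  | add a b _ _ ha hb => rw [add_mul, mul_add, ha, hb, neg_add]
  | ι_mul_ι_mul a b c _ hc =>
    have h := even_commute (CliffordAlgebra.ι_mul_ι_mem_evenOdd_zero (0 : QuadraticForm ℝ (ι → ℝ)) a b) y
    rw [mul_assoc, hc, mul_neg, ← mul_assoc, h.eq, mul_assoc]

lemma odd_sq {x : Gr ι} (hx : x ∈ pty ι 1) : x * x = 0 := by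
  have h := odd_anticomm hx hx
  have h2 : (2 : ℝ) • (x * x) = 0 := by
    rw [two_smul]; nth_rewrite 1 [h]; simp
  exact (smul_eq_zero.mp h2).resolve_left two_ne_zero

/-! ### Left derivatives -/

lemma dLeft_mul (i : ι) (x y : Gr ι) :
  dLeft i (x * y) = dLeft i x * y + CliffordAlgebra.involute x * dLeft i y := by
  induction x using ExteriorAlgebra.induction generalizing y with
  | algebraMap r =>
    simp [dLeft, CliffordAlgebra.contractLeft_algebraMap_mul, CliffordAlgebra.contractLeft_algebraMap]
  | ι w =>
    simp [dLeft, ExteriorAlgebra.ι, CliffordAlgebra.contractLeft_ι_mul, CliffordAlgebra.contractLeft_ι,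
      Algebra.smul_def, sub_eq_add_neg]
  | mul a b ha hb =>
    rw [mul_assoc, ha, hb, ha, map_mul]
    simp only [mul_add, add_mul, mul_assoc, add_assoc]
  | add a b ha hb => rw [add_mul, map_add, ha, hb, map_add, map_add, add_mul, add_mul]; abel

lemma dLeft_mul_even (i : ι) {x : Gr ι} (hx : x ∈ pty ι 0) (y : Gr ι) :
  dLeft i (x * y) = dLeft i x * y + x * dLeft i y := by
  rw [dLeft_mul, involute_even hx]

lemma dLeft_mul_odd (i : ι) {x : Gr ι} (hx : x ∈ pty ι 1) (y : Gr ι) :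
  dLeft i (x * y) = dLeft i x * y - x * dLeft i y := by
  rw [dLeft_mul, involute_odd hx, neg_mul, sub_eq_add_neg]

lemma dLeft_gen [DecidableEq ι] (i j : ι) :
  dLeft i (gen j) = if i = j then (1 : Gr ι) else 0 := by
  rw [dLeft, gen, ExteriorAlgebra.ι, CliffordAlgebra.contractLeft_ι]
  by_cases h : i = j
  · subst h; simp
  · simp [h]

@[simp] lemma dLeft_algebraMap (i : ι) (r : ℝ) : dLeft i (algebraMap ℝ (Gr ι) r) = 0 :=
  CliffordAlgebra.contractLeft_algebraMap (Q := (0 : QuadraticForm ℝ (ι → ℝ))) _ r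

@[simp] lemma dLeft_one (i : ι) : dLeft i (1 : Gr ι) = 0 :=
  CliffordAlgebra.contractLeft_one (Q := (0 : QuadraticForm ℝ (ι → ℝ))) _

/-- The operator counting the occurrences of a generator. -/
def num [DecidableEq ι] (s : ι) : Gr ι →ₗ[ℝ] Gr ι := LinearMap.mulLeft ℝ (gen s) ∘ₗ dLeft s

lemma num_mul [DecidableEq ι] (s : ι) (x y : Gr ι) : num s (x * y) = num s x * y + x * num s y := by
  simp only [num, LinearMap.comp_apply, LinearMap.mulLeft_apply, dLeft_mul, mul_add]
  rw [← mul_assoc, ← mul_assoc, ← mul_assoc]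
  congr 2
  rw [gen, ι_mul_eq, CliffordAlgebra.involute_involute]

lemma num_gen [DecidableEq ι] (s j : ι) : num s (gen j) = if s = j then gen j else 0 := by
  simp only [num, LinearMap.comp_apply, LinearMap.mulLeft_apply, dLeft_gen]
  split_ifs with h <;> simp [h]

@[simp] lemma num_one [DecidableEq ι] (s : ι) : num s (1 : Gr ι) = 0 := by simp [num]

lemma num_mon [Fintype ι] [LinearOrder ι] (s : ι) (S : Finset ι) :
  num s (mon S) = if s ∈ S then mon S else 0 := by
  induction S using induction_on_min with
  | empty => simp
  | insert a S ha ih =>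
    have h : a ∉ S := fun h => lt_irrefl _ (ha a h)
    rw [mon_insert_min ha, num_mul, num_gen, ih]
    by_cases hs : s = a
    · subst hs; simp [h]
    · by_cases h' : s ∈ S <;> simp [hs, h']

lemma coeff_num [Fintype ι] [LinearOrder ι] (s : ι) (S : Finset ι) (x : Gr ι) :
  coeff S (num s x) = if s ∈ S then coeff S x else 0 := by
  conv_lhs => rw [← sum_coeff_mon x]
  rw [map_sum, map_sum, sum_eq_single S]
  · rw [map_smul, num_mon]; split_ifs <;> simp [coeff_mon]
  · intro T _ hT; rw [map_smul, num_mon]; split_ifs <;> simp [coeff_mon, hT.symm]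
  · simp

lemma coeff_mon_mul_mon [Fintype ι] [LinearOrder ι] {U S T : Finset ι}
  (h : coeff U (mon S * mon T : Gr ι) ≠ 0) : Disjoint S T ∧ U = S ∪ T := by
  have key : ∀ s : ι, (if s ∈ U then (1 : ℝ) else 0) =
      (if s ∈ S then 1 else 0) + if s ∈ T then 1 else 0 := by
    intro s
    have h1 := coeff_num s U (mon S * mon T)
    rw [num_mul, num_mon, num_mon, map_add] at h1
    apply mul_right_cancel₀ h
    rw [add_mul]
    by_cases hS : s ∈ S <;> by_cases hT : s ∈ T <;> by_cases hU : s ∈ U <;>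
      simp_all
  constructor
  · rw [Finset.disjoint_left]
    intro s hS hT
    have := key s
    rw [if_pos hS, if_pos hT] at this
    split_ifs at this
    · norm_num at this
    · norm_num at this
  · ext s
    have := key s
    rw [Finset.mem_union]
    by_cases hS : s ∈ S <;> by_cases hT : s ∈ T <;> by_cases hU : s ∈ U <;>
      simp only [hS, hT, hU, if_true, if_false] at this ⊢ <;> first | tauto | norm_num at this

/-! ### The body and the degree filtration -/

lemma body_eq_coeff [Fintype ι] [LinearOrder ι] (x : Gr ι) : body x = coeff ∅ x := by
  suffices h : (body : Gr ι →ₐ[ℝ] ℝ).toLinearMap = coeff ∅ from LinearMap.congr_fun h x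
  refine linearMap_ext_mon fun S => ?_
  rw [coeff_mon, AlgHom.toLinearMap_apply]
  rcases S.eq_empty_or_nonempty with rfl | hS
  · simp
  · rw [if_neg hS.ne_empty.symm]
    obtain ⟨a, ha⟩ : ∃ a, a = S.min' hS := ⟨_, rfl⟩
    have : S = insert a (S.erase a) := by rw [Finset.insert_erase]; rw [ha]; exact S.min'_mem hS
    rw [this, mon_insert_min, map_mul]
    · simp [body, gen, ExteriorAlgebra.algebraMapInv]
    · intro x hx
      rw [mem_erase] at hx
      exact lt_of_le_of_ne (ha ▸ S.min'_le x hx.2) hx.1.symm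

@[simp] lemma body_algebraMap (r : ℝ) : body (algebraMap ℝ (Gr ι) r) = r := by
  simp

lemma body_odd {x : Gr ι} (hx : x ∈ pty ι 1) : body x = 0 := by
  induction x, hx using CliffordAlgebra.odd_induction with
  | ι v => rw [← ExteriorAlgebra.ι]; simp [body, ExteriorAlgebra.algebraMapInv]
  | add a b _ _ ha hb => rw [map_add, ha, hb, add_zero]
  | ι_mul_ι_mul a b c _ hc => rw [map_mul, hc, mul_zero]

@[simp] lemma body_gen [DecidableEq ι] (i : ι) : body (gen i) = 0 := body_odd (gen_mem_pty i)

/-- Elements all of whose monomials have degree at least `r`. -/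
def fil (ι : Type) [Fintype ι] [LinearOrder ι] (r : ℕ) : Submodule ℝ (Gr ι) where
  carrier := {x | ∀ S : Finset ι, S.card < r → coeff S x = 0}
  add_mem' := by intro a b ha hb S hS; rw [map_add, ha S hS, hb S hS, add_zero]
  zero_mem' := by intro S _; simp
  smul_mem' := by intro c x hx S hS; rw [map_smul, hx S hS, smul_zero]

variable [Fintype ι] [LinearOrder ι]

lemma fil_mono {r s : ℕ} (h : r ≤ s) : fil ι s ≤ fil ι r := fun _ hx S hS => hx S (by omega)

lemma fil_zero (x : Gr ι) : x ∈ fil ι 0 := fun S hS => absurd hS (by omega)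

lemma fil_eq_zero {r : ℕ} (h : Fintype.card ι < r) {x : Gr ι} (hx : x ∈ fil ι r) : x = 0 :=
  gr_ext fun S => by rw [hx S (lt_of_le_of_lt (Finset.card_le_univ S) h), map_zero]

lemma coeff_mul (U : Finset ι) (x y : Gr ι) :
  coeff U (x * y) = ∑ S, ∑ T, coeff S x * coeff T y * coeff U (mon S * mon T) := by
  conv_lhs => rw [← sum_coeff_mon x, ← sum_coeff_mon y]
  simp only [Finset.sum_mul_sum, map_sum, smul_mul_smul_comm, map_smul, smul_eq_mul]

lemma fil_mul {r s : ℕ} {x y : Gr ι} (hx : x ∈ fil ι r) (hy : y ∈ fil ι s) :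
  x * y ∈ fil ι (r + s) := by
  intro U hU
  rw [coeff_mul]
  refine sum_eq_zero fun S _ => sum_eq_zero fun T _ => ?_
  by_cases h : coeff U (mon S * mon T) = 0
  · rw [h, mul_zero]
  · obtain ⟨hd, rfl⟩ := coeff_mon_mul_mon h
    rw [Finset.card_union_of_disjoint hd] at hU
    by_cases h1 : S.card < r
    · rw [hx S h1]; simp
    · rw [hy T (by omega)]; simp

lemma mem_fil_one {x : Gr ι} : x ∈ fil ι 1 ↔ body x = 0 := by
  rw [body_eq_coeff]
  constructor
  · intro h; exact h ∅ (by simp)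
  · intro h S hS
    rw [Nat.lt_one_iff, card_eq_zero] at hS
    rw [hS, h]

lemma nil_mem_fil (x : Gr ι) : x - algebraMap ℝ (Gr ι) (body x) ∈ fil ι 1 := by
  rw [mem_fil_one]; simp

lemma fil_list_prod (l : List (Gr ι)) (h : ∀ x ∈ l, x ∈ fil ι 1) : l.prod ∈ fil ι l.length := by
  induction l with
  | nil => exact fil_zero _
  | cons a l ih =>
    rw [List.prod_cons, List.length_cons, add_comm]
    exact fil_mul (h a (by simp)) (ih fun x hx => h x (by simp [hx]))

/-- The operator counting the occurrences of generators in `A`. -/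
def euler (A : Finset ι) : Gr ι →ₗ[ℝ] Gr ι := ∑ s ∈ A, num s

lemma euler_mul (A : Finset ι) (x y : Gr ι) :
  euler A (x * y) = euler A x * y + x * euler A y := by
  simp only [euler, LinearMap.sum_apply, num_mul, sum_add_distrib, sum_mul,
    mul_sum]

@[simp] lemma euler_one (A : Finset ι) : euler A (1 : Gr ι) = 0 := by
  simp [euler, LinearMap.sum_apply]

lemma coeff_euler (A S : Finset ι) (x : Gr ι) :
  coeff S (euler A x) = (A ∩ S).card * coeff S x := by
  simp only [euler, LinearMap.sum_apply, map_sum, coeff_num]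
  rw [← sum_filter, sum_const, nsmul_eq_mul, Finset.filter_mem_eq_inter]

lemma euler_mon (A S : Finset ι) : euler A (mon S : Gr ι) = ((A ∩ S).card : ℝ) • mon S := by
  refine gr_ext fun T => ?_
  rw [coeff_euler, map_smul, coeff_mon]
  split_ifs with h <;> simp [h]

lemma euler_algebraMap (A : Finset ι) (r : ℝ) : euler A (algebraMap ℝ (Gr ι) r) = 0 := by
  rw [Algebra.algebraMap_eq_smul_one, map_smul, euler_one, smul_zero]

lemma mem_fil_of_euler {r : ℕ} {x : Gr ι} (h0 : body x = 0)
  (h : euler Finset.univ x ∈ fil ι r) : x ∈ fil ι r := by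
  intro S hS
  have := h S hS
  rw [coeff_euler, Finset.univ_inter] at this
  rcases S.eq_empty_or_nonempty with rfl | hne
  · rw [← body_eq_coeff, h0]
  · exact (mul_eq_zero.mp this).resolve_left (by simpa using hne.ne_empty)

lemma euler_mem_fil_one (A : Finset ι) (x : Gr ι) : euler A x ∈ fil ι 1 := by
  rw [mem_fil_one, body_eq_coeff, coeff_euler]; simp

lemma euler_mem_pty {i : ZMod 2} {x : Gr ι} (A : Finset ι) (h : x ∈ pty ι i) :
  euler A x ∈ pty ι i :=
  mem_pty_of_coeff fun S hS => by rw [coeff_euler, coeff_eq_zero_of_mem_pty h hS, mul_zero]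

end

variable {m n L : ℕ} {ι σ g κ : Type} [Fintype ι] [LinearOrder ι] [Fintype σ] [LinearOrder σ]
  [Fintype g] [LinearOrder g] [Fintype κ] [DecidableEq κ] {E V W M : Type*}
  [NormedAddCommGroup E] [NormedSpace ℝ E] [NormedAddCommGroup V] [NormedSpace ℝ V]
  [NormedAddCommGroup W] [NormedSpace ℝ W] [TopologicalSpace M] [ChartedSpace (Fin m → ℝ) M]

/-! ### A norm on the Grassmann algebra -/

section

variable (ι)

/-- The left regular representation of the Grassmann algebra in the monomial basis. -/
def regRep : Gr ι →ₐ[ℝ] ((Finset ι → ℝ) →L[ℝ] (Finset ι → ℝ)) :=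
  ((Module.End.toContinuousLinearMap (𝕜 := ℝ) (Finset ι → ℝ)).toAlgHom.comp
    (LinearEquiv.conjAlgEquiv ℝ (Pi.basisFun ℝ ι).ExteriorAlgebra.equivFun).toAlgHom).comp
    (Algebra.lmul ℝ (Gr ι))

lemma regRep_injective : Function.Injective (regRep ι) :=
  ((Module.End.toContinuousLinearMap (𝕜 := ℝ) (Finset ι → ℝ)).injective.comp
    (LinearEquiv.conjAlgEquiv ℝ (Pi.basisFun ℝ ι).ExteriorAlgebra.equivFun).injective).comp
    Algebra.lmul_injective

/-- The norm of an element is the operator norm of left multiplication by it. -/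
instance grNormedRing : NormedRing (Gr ι) :=
  NormedRing.induced (Gr ι) ((Finset ι → ℝ) →L[ℝ] (Finset ι → ℝ)) (regRep ι) (regRep_injective ι)

instance grNormedAlgebra : NormedAlgebra ℝ (Gr ι) :=
  NormedAlgebra.induced ℝ (Gr ι) ((Finset ι → ℝ) →L[ℝ] (Finset ι → ℝ)) (regRep ι)

instance grFinite : Module.Finite ℝ (Gr ι) :=
  Module.Finite.of_basis (Pi.basisFun ℝ ι).ExteriorAlgebra

end

/-! ### Germs of smooth functions -/

/-- Smoothness in a neighbourhood of a point. -/
def SmAt (f : E → V) (x : E) : Prop := ∀ᶠ y in 𝓝 x, ContDiffAt ℝ ∞ f y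

lemma SmAt.contDiffAt {f : E → V} {x : E} (h : SmAt f x) : ContDiffAt ℝ ∞ f x := h.self_of_nhds

lemma SmAt.differentiableAt {f : E → V} {x : E} (h : SmAt f x) : DifferentiableAt ℝ f x :=
  h.contDiffAt.differentiableAt (by simp)

lemma SmAt.eventually {f : E → V} {x : E} (h : SmAt f x) : ∀ᶠ y in 𝓝 x, SmAt f y :=
  eventually_eventually_nhds.mpr h

lemma SmAt.congr {f g : E → V} {x : E} (h : SmAt f x) (hfg : g =ᶠ[𝓝 x] f) : SmAt g x := by
  filter_upwards [h, hfg.eventually_nhds] with y hy hy' using hy.congr_of_eventuallyEq hy'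

lemma smAt_of_contDiff {f : E → V} (h : ContDiff ℝ ∞ f) (x : E) : SmAt f x :=
  Eventually.of_forall fun _ => h.contDiffAt

lemma SmAt.const (v : V) (x : E) : SmAt (fun _ : E => v) x := smAt_of_contDiff contDiff_const x

lemma SmAt.add {f g : E → V} {x : E} (hf : SmAt f x) (hg : SmAt g x) :
  SmAt (fun y => f y + g y) x := by
  filter_upwards [hf, hg] with y h1 h2 using h1.add h2

lemma SmAt.sub {f g : E → V} {x : E} (hf : SmAt f x) (hg : SmAt g x) :
  SmAt (fun y => f y - g y) x := by
  filter_upwards [hf, hg] with y h1 h2 using h1.sub h2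

lemma SmAt.sum {α : Type*} {s : Finset α} {f : α → E → V} {x : E} (hf : ∀ i ∈ s, SmAt (f i) x) :
  SmAt (fun y => ∑ i ∈ s, f i y) x := by
  have : ∀ᶠ y in 𝓝 x, ∀ i ∈ s, ContDiffAt ℝ ∞ (f i) y := (Filter.eventually_all_finset s).mpr hf
  filter_upwards [this] with y hy using ContDiffAt.sum hy

lemma SmAt.mul {A : Type*} [NormedRing A] [NormedAlgebra ℝ A] {f g : E → A} {x : E}
  (hf : SmAt f x) (hg : SmAt g x) : SmAt (fun y => f y * g y) x := by
  filter_upwards [hf, hg] with y h1 h2 using h1.mul h2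

lemma SmAt.smul {f : E → ℝ} {g : E → V} {x : E}
  (hf : SmAt f x) (hg : SmAt g x) : SmAt (fun y => f y • g y) x := by
  filter_upwards [hf, hg] with y h1 h2 using h1.smul h2

lemma SmAt.comp {g : V → W} {f : E → V} {x : E} (hg : SmAt g (f x)) (hf : SmAt f x) :
  SmAt (fun y => g (f y)) x := by
  filter_upwards [hf, hf.contDiffAt.continuousAt.eventually hg] with y h1 h2 using h2.comp y h1

lemma SmAt.pi {κ : Type*} [Fintype κ] {f : κ → E → V} {x : E} (h : ∀ c, SmAt (f c) x) :
  SmAt (fun y c => f c y) x := by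
  have := eventually_all.mpr h
  filter_upwards [this] with y hy using contDiffAt_pi.mpr hy

lemma SmAt.linear {A B : Type*} [NormedAddCommGroup A] [NormedSpace ℝ A]
  [FiniteDimensional ℝ A] [NormedAddCommGroup B] [NormedSpace ℝ B] (L : A →ₗ[ℝ] B) {f : E → A}
  {x : E} (hf : SmAt f x) : SmAt (fun y => L (f y)) x := by
  filter_upwards [hf] with y hy
  exact (LinearMap.toContinuousLinearMap L).contDiff.contDiffAt.comp y hy

lemma fderiv_linear_comp {A B : Type*} [NormedAddCommGroup A] [NormedSpace ℝ A]
  [FiniteDimensional ℝ A] [NormedAddCommGroup B] [NormedSpace ℝ B] (L : A →ₗ[ℝ] B) {f : E → A}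
  {x : E} (hf : DifferentiableAt ℝ f x) (v : E) :
  fderiv ℝ (fun y => L (f y)) x v = L (fderiv ℝ f x v) := by
  have := (LinearMap.toContinuousLinearMap L).hasFDerivAt.comp x hf.hasFDerivAt
  have h2 : fderiv ℝ (fun y => L (f y)) x = _ := this.fderiv
  rw [h2]; rfl

lemma SmAt.fderiv_apply {f : E → V} {x : E} (h : SmAt f x) (v : E) :
  SmAt (fun y => fderiv ℝ f y v) x := by
  filter_upwards [h] with y hy
  exact (hy.fderiv_right (m := ∞) (by simp)).clm_apply contDiffAt_const

lemma fderiv_mul_apply {A : Type*} [NormedRing A] [NormedAlgebra ℝ A] {f g : E → A} {x : E}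
  (hf : DifferentiableAt ℝ f x) (hg : DifferentiableAt ℝ g x) (v : E) :
  fderiv ℝ (fun y => f y * g y) x v = fderiv ℝ f x v * g x + f x * fderiv ℝ g x v := by
  have := fderiv_mul' hf hg
  rw [show (fun y => f y * g y) = f * g from rfl, this]
  simp [add_comm]

lemma fderiv_sum_apply {α : Type*} {s : Finset α} {f : α → E → V} {x : E}
  (hf : ∀ i ∈ s, DifferentiableAt ℝ (f i) x) (v : E) :
  fderiv ℝ (fun y => ∑ i ∈ s, f i y) x v = ∑ i ∈ s, fderiv ℝ (f i) x v := by
  rw [fderiv_fun_sum hf, sum_apply]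

/-- The partial derivative of a vector-valued function. -/
def pd (d : κ) (h : Vec κ → V) : Vec κ → V := fun x => fderiv ℝ h x (Pi.single d 1)

lemma SmAt.pd {h : Vec κ → V} {x : κ → ℝ} (hh : SmAt h x) (d : κ) : SmAt (pd d h) x :=
  hh.fderiv_apply _

lemma pd_congr {h h' : Vec κ → V} {x : κ → ℝ} (e : h =ᶠ[𝓝 x] h') (d : κ) :
  pd d h =ᶠ[𝓝 x] pd d h' := by
  filter_upwards [e.eventually_nhds] with y hy
  rw [pd, pd, Filter.EventuallyEq.fderiv_eq hy]

lemma pd_comm {h : Vec κ → V} {x : κ → ℝ} (hh : SmAt h x) (d e : κ) :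
  pd d (pd e h) =ᶠ[𝓝 x] pd e (pd d h) := by
  filter_upwards [hh] with y hy
  have hs : IsSymmSndFDerivAt ℝ h y := hy.isSymmSndFDerivAt (by
    rw [minSmoothness_of_isRCLikeNormedField]; exact WithTop.coe_le_coe.mpr le_top)
  have hd : DifferentiableAt ℝ (fderiv ℝ h) y :=
    (hy.fderiv_right (m := ∞) (by simp)).differentiableAt (by simp)
  have key : ∀ a b : κ, pd a (pd b h) y =
      fderiv ℝ (fderiv ℝ h) y (Pi.single a 1) (Pi.single b 1) := by
    intro a b
    change fderiv ℝ (fun z => fderiv ℝ h z (Pi.single b 1)) y (Pi.single a 1) = _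
    rw [fderiv_clm_apply hd (differentiableAt_const _)]
    simp
  rw [key, key, hs.eq]

lemma fderiv_eq_sum_pd {h : Vec κ → V} (x v : κ → ℝ) :
  fderiv ℝ h x v = ∑ d, v d • pd d h x := by
  conv_lhs => rw [pi_eq_sum_univ' v]
  rw [map_sum]
  refine sum_congr rfl fun d _ => ?_
  rw [map_smul, pd]

lemma pd_add {h h' : Vec κ → V} {x : κ → ℝ} (hh : SmAt h x) (hh' : SmAt h' x) (d : κ) :
  pd d (fun y => h y + h' y) =ᶠ[𝓝 x] fun y => pd d h y + pd d h' y := by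
  filter_upwards [hh, hh'] with y h1 h2
  rw [pd, fderiv_fun_add (h1.differentiableAt (by simp)) (h2.differentiableAt (by simp))]; rfl

lemma pd_const_smul {h : Vec κ → V} {x : κ → ℝ} (c : ℝ) (hh : SmAt h x) (d : κ) :
  pd d (fun y => c • h y) =ᶠ[𝓝 x] fun y => c • pd d h y := by
  filter_upwards [hh] with y h1
  rw [pd, fderiv_fun_const_smul (h1.differentiableAt (by simp))]; rfl

lemma pd_mul {A : Type*} [NormedRing A] [NormedAlgebra ℝ A] {h h' : Vec κ → A} {x : κ → ℝ}
  (hh : SmAt h x) (hh' : SmAt h' x) (d : κ) :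
  pd d (fun y => h y * h' y) =ᶠ[𝓝 x] fun y => pd d h y * h' y + h y * pd d h' y := by
  filter_upwards [hh, hh'] with y h1 h2
  exact fderiv_mul_apply (h1.differentiableAt (by simp)) (h2.differentiableAt (by simp)) _

lemma pd_comp {κ' : Type} [Fintype κ'] [DecidableEq κ'] {h : Vec κ' → V}
  {g : κ' → Vec κ → ℝ} {x : κ → ℝ}
  (hg : ∀ d, SmAt (g d) x) (hh : SmAt h (fun d => g d x)) (c : κ) :
  pd c (fun y => h (fun d => g d y)) =ᶠ[𝓝 x]
      fun y => ∑ d, pd c (g d) y • pd d h (fun d => g d y) := by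
  have hG : SmAt (fun y d => g d y) x := SmAt.pi hg
  filter_upwards [eventually_all.mpr hg, hG.contDiffAt.continuousAt.eventually hh] with y h1 h2
  have h3 : HasFDerivAt (fun y d => g d y)
      (ContinuousLinearMap.pi fun d => fderiv ℝ (g d) y) y :=
    hasFDerivAt_pi.mpr fun d => ((h1 d).differentiableAt (by simp)).hasFDerivAt
  have h4 := (h2.differentiableAt (by simp)).hasFDerivAt.comp y h3
  have h5 : fderiv ℝ (fun y => h (fun d => g d y)) y = _ := h4.fderiv
  rw [pd, h5, ContinuousLinearMap.comp_apply, fderiv_eq_sum_pd]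
  rfl

/-! ### Taylor expansion in nilpotent elements -/

section

variable {κ' ι' : Type} [Fintype κ'] [DecidableEq κ'] [Fintype ι'] [LinearOrder ι']

/-- The `k`-fold derivative of `h` at `b` in the directions `ν`. -/
def tt (ν : κ → Gr ι) (b : κ → ℝ) : ℕ → (Vec κ → ℝ) → Gr ι
  | 0, h => algebraMap ℝ _ (h b)
  | k + 1, h => ∑ d, tt ν b k (pd d h) * ν d

lemma tt_congr (ν : κ → Gr ι) {b : κ → ℝ} (k : ℕ) {h h' : Vec κ → ℝ} (e : h =ᶠ[𝓝 b] h') :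
  tt ν b k h = tt ν b k h' := by
  induction k generalizing h h' with
  | zero => simp [tt, e.eq_of_nhds]
  | succ k ih => exact sum_congr rfl fun d _ => by rw [ih (pd_congr e d)]

lemma iteratedFDeriv_clm_apply_const
  {h : E → V} {b : E}
  (hh : SmAt h b) (k : ℕ) (v : E) (w : Fin k → E) :
  iteratedFDeriv ℝ k (fun y => fderiv ℝ h y v) b w =
      iteratedFDeriv ℝ k (fun y => fderiv ℝ h y) b w v := by
  have h1 : ContDiffAt ℝ k (fderiv ℝ h) b :=
    (hh.contDiffAt.fderiv_right (m := ∞) (by simp)).of_le (by exact_mod_cast le_top)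
  have := (ContinuousLinearMap.apply ℝ V v).iteratedFDeriv_comp_left h1 le_rfl
  rw [show (fun y => fderiv ℝ h y v) = (ContinuousLinearMap.apply ℝ V v) ∘ fderiv ℝ h from rfl,
    this]
  rfl

lemma tt_eq (ν : κ → Gr ι) {b : κ → ℝ} (k : ℕ) {h : Vec κ → ℝ} (hh : SmAt h b) :
  ∑ c : Fin k → κ, iteratedFDeriv ℝ k h b (fun j => Pi.single (c j) 1) •
      (List.ofFn fun j => ν (c j)).prod = tt ν b k h := by
  induction k generalizing h with
  | zero => simp [tt, Algebra.algebraMap_eq_smul_one]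
  | succ k ih =>
    rw [← (Fin.snocEquiv fun _ => κ).sum_comp, Fintype.sum_prod_type]
    refine sum_congr rfl fun d _ => ?_
    rw [← ih (hh.pd d), sum_mul]
    refine sum_congr rfl fun c _ => ?_
    rw [iteratedFDeriv_succ_apply_right, List.ofFn_succ', List.concat_eq_append,
      List.prod_append, smul_mul_assoc]
    have h1 := iteratedFDeriv_clm_apply_const hh k (Pi.single d 1) (fun j => Pi.single (c j) 1)
    unfold pd
    rw [h1]
    congr 1
    · congr 1
      · congr 1
        ext j
        simp [Fin.init_def, Fin.snocEquiv]
      · simp [Fin.snocEquiv]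
    · simp [Fin.snocEquiv]

/-- The nilpotent part. -/
def nilp (x : Gr ι) : Gr ι := x - algebraMap ℝ _ (body x)

lemma nilp_mem_fil (x : Gr ι) : nilp x ∈ fil ι 1 := nil_mem_fil x

lemma nilp_mem_pty {x : Gr ι} (hx : x ∈ pty ι 0) : nilp x ∈ pty ι 0 :=
  Submodule.sub_mem _ hx (algebraMap_mem_pty _)

lemma tt_mem_fil {ν : κ → Gr ι} (hν : ∀ d, ν d ∈ fil ι 1) (b : κ → ℝ) (k : ℕ)
  (h : Vec κ → ℝ) : tt ν b k h ∈ fil ι k := by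
  induction k generalizing h with
  | zero => exact fil_zero _
  | succ k ih => exact Submodule.sum_mem _ fun d _ => fil_mul (ih _) (hν d)

lemma tt_mem_pty {ν : κ → Gr ι} (hν : Evens ν) (b : κ → ℝ) (k : ℕ)
  (h : Vec κ → ℝ) : tt ν b k h ∈ pty ι 0 := by
  induction k generalizing h with
  | zero => exact algebraMap_mem_pty _
  | succ k ih => exact Submodule.sum_mem _ fun d _ => by simpa using pty_mul (ih _) (hν d)

/-- The body of a tuple. -/
abbrev bod (a : κ → Gr ι) : κ → ℝ := fun c => body (a c)

lemma taylor_eq {h : Vec κ → ℝ} {a : κ → Gr ι} (hh : SmAt h (bod a)) {N : ℕ}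
  (hN : Fintype.card ι < N) :
  taylor h a = ∑ k ∈ Finset.range N, ((k.factorial : ℝ)⁻¹) •
      tt (fun c => nilp (a c)) (bod a) k h := by
  rw [← sum_subset (Finset.range_mono (Nat.succ_le_of_lt hN))]
  · exact sum_congr rfl fun k _ => by rw [← tt_eq _ _ hh]; rfl
  · intro k _ hk
    rw [fil_eq_zero (r := k) (by simpa using hk) (tt_mem_fil (fun d => nilp_mem_fil _) _ _ _),
      smul_zero]

lemma taylor_congr {h h' : Vec κ → ℝ} {a : κ → Gr ι} (hh : SmAt h (bod a))
  (e : h' =ᶠ[𝓝 (bod a)] h) : taylor h' a = taylor h a := by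
  rw [taylor_eq hh (Nat.lt_succ_self _), taylor_eq (hh.congr e) (Nat.lt_succ_self _)]
  exact sum_congr rfl fun k _ => by rw [tt_congr _ _ e]

lemma taylor_mem_pty {h : Vec κ → ℝ} {a : κ → Gr ι} (hh : SmAt h (bod a))
  (ha : Evens a) : taylor h a ∈ pty ι 0 := by
  rw [taylor_eq hh (Nat.lt_succ_self _)]
  exact Submodule.sum_mem _ fun k _ => Submodule.smul_mem _ _
    (tt_mem_pty (fun c => nilp_mem_pty (ha c)) _ _ _)

lemma body_taylor {h : Vec κ → ℝ} {a : κ → Gr ι} (hh : SmAt h (bod a)) :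
  body (taylor h a) = h (bod a) := by
  rw [taylor_eq hh (Nat.lt_succ_self _), map_sum, sum_range_succ', sum_eq_zero]
  · simp [tt]
  · intro k _
    have := mem_fil_one.mp (fil_mono (Nat.le_add_left 1 k)
      (tt_mem_fil (fun c => nilp_mem_fil (a c)) (bod a) (k + 1) h))
    rw [map_smul, this, smul_zero]

lemma tt_add (ν : κ → Gr ι) {b : κ → ℝ} (k : ℕ) {h h' : Vec κ → ℝ} (hh : SmAt h b)
  (hh' : SmAt h' b) : tt ν b k (fun y => h y + h' y) = tt ν b k h + tt ν b k h' := by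
  induction k generalizing h h' with
  | zero => simp [tt]
  | succ k ih =>
    simp only [tt, ← sum_add_distrib, ← add_mul]
    exact sum_congr rfl fun d _ => by
      rw [tt_congr ν k (pd_add hh hh' d), ih (hh.pd d) (hh'.pd d)]

lemma taylor_add {h h' : Vec κ → ℝ} {a : κ → Gr ι} (hh : SmAt h (bod a))
  (hh' : SmAt h' (bod a)) : taylor (fun y => h y + h' y) a = taylor h a + taylor h' a := by
  rw [taylor_eq hh (Nat.lt_succ_self _), taylor_eq hh' (Nat.lt_succ_self _),
    taylor_eq (hh.add hh') (Nat.lt_succ_self _), ← sum_add_distrib]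
  exact sum_congr rfl fun k _ => by rw [tt_add _ _ hh hh', smul_add]

lemma tt_scalar {ν : κ → Gr ι} (hν : ∀ d, ν d = 0) (b : κ → ℝ) (k : ℕ) (h : Vec κ → ℝ) :
  tt ν b (k + 1) h = 0 := by simp [tt, hν]

lemma taylor_scalar {h : Vec κ → ℝ} {b : κ → ℝ} (hh : SmAt h b) :
  taylor h (fun c => algebraMap ℝ (Gr ι) (b c)) = algebraMap ℝ _ (h b) := by
  have hb : bod (fun c => algebraMap ℝ (Gr ι) (b c)) = b := by ext; simp
  rw [taylor_eq (by rwa [hb]) (Nat.lt_succ_self _), hb, sum_range_succ',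
    sum_eq_zero]
  · simp [tt]
  · intro k _; rw [tt_scalar (fun d => by simp [nilp]), smul_zero]

lemma tt_const (ν : κ → Gr ι) (b : κ → ℝ) (k : ℕ) (r : ℝ) :
  tt ν b (k + 1) (fun _ => r) = 0 := by
  induction k generalizing r with
  | zero => simp [tt, pd]
  | succ k ih =>
    rw [tt]
    refine sum_eq_zero fun d _ => ?_
    rw [show pd d (fun _ : κ → ℝ => r) = fun _ => 0 by ext; simp [pd], ih, zero_mul]

lemma taylor_const (r : ℝ) (a : κ → Gr ι) : taylor (fun _ => r) a = algebraMap ℝ _ r := by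
  rw [taylor_eq (SmAt.const _ _) (Nat.lt_succ_self _), sum_range_succ',
    sum_eq_zero]
  · simp [tt]
  · intro k _; rw [tt_const, smul_zero]

/-- A linear map which is a derivation on even elements. -/
def EvenDer (D : Gr ι →ₗ[ℝ] Gr ι) : Prop :=
  ∀ x ∈ pty ι 0, ∀ y, D (x * y) = D x * y + x * D y

lemma EvenDer.algebraMap {D : Gr ι →ₗ[ℝ] Gr ι} (hD : EvenDer D) (r : ℝ) :
  D (algebraMap ℝ _ r) = 0 := by
  have := hD 1 one_mem_pty 1
  simp only [mul_one, one_mul] at this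
  rw [Algebra.algebraMap_eq_smul_one, map_smul, left_eq_add.mp this, smul_zero]

lemma EvenDer.euler (A : Finset ι) : EvenDer (euler A) := fun x _ y => euler_mul A x y

lemma EvenDer.dLeft (i : ι) : EvenDer (dLeft i) := fun _ hx y => dLeft_mul_even i hx y

lemma derivation_tt {D : Gr ι →ₗ[ℝ] Gr ι} (hD : EvenDer D) {ν : κ → Gr ι}
  (hν : Evens ν) {b : κ → ℝ} (k : ℕ) {h : Vec κ → ℝ} (hh : SmAt h b) :
  D (tt ν b (k + 1) h) = ((k + 1 : ℕ) : ℝ) • ∑ d, D (ν d) * tt ν b k (pd d h) := by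
  induction k generalizing h with
  | zero =>
    simp only [zero_add, tt, map_sum, Nat.cast_one, one_smul]
    refine sum_congr rfl fun d _ => ?_
    rw [hD _ (algebraMap_mem_pty _), hD.algebraMap, zero_mul, zero_add, Algebra.commutes]
  | succ k ih =>
    rw [tt, map_sum]
    have h1 : ∀ d, D (tt ν b (k + 1) (pd d h) * ν d) =
        ((k + 1 : ℕ) : ℝ) • (∑ e, D (ν e) * (tt ν b k (pd d (pd e h)) * ν d)) +
          D (ν d) * tt ν b (k + 1) (pd d h) := by
      intro d
      rw [hD _ (tt_mem_pty hν _ _ _), ih (hh.pd d), (even_commute (tt_mem_pty hν _ _ _) _).eq,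
        smul_mul_assoc, sum_mul]
      congr 2
      refine sum_congr rfl fun e _ => ?_
      rw [mul_assoc, tt_congr ν k (pd_comm hh e d)]
    simp_rw [h1]
    rw [sum_add_distrib, ← smul_sum, sum_comm]
    simp_rw [← mul_sum]
    have h2 : ∀ e, ∑ d, tt ν b k (pd d (pd e h)) * ν d = tt ν b (k + 1) (pd e h) := fun e => rfl
    simp_rw [h2]
    rw [Nat.cast_succ (k + 1), add_smul, one_smul]

lemma derivation_taylor {D : Gr ι →ₗ[ℝ] Gr ι} (hD : EvenDer D) {a : κ → Gr ι}
  (ha : Evens a) {h : Vec κ → ℝ} (hh : SmAt h (bod a)) :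
  D (taylor h a) = ∑ c, D (a c) * taylor (pd c h) a := by
  have hν : ∀ c, nilp (a c) ∈ pty ι 0 := fun c => nilp_mem_pty (ha c)
  have hDν : ∀ c, D (nilp (a c)) = D (a c) := fun c => by
    rw [nilp, map_sub, hD.algebraMap, sub_zero]
  rw [taylor_eq hh (N := Fintype.card ι + 1 + 1) (by omega), sum_range_succ', map_add,
    map_sum]
  simp_rw [taylor_eq (hh.pd _) (N := Fintype.card ι + 1) (by omega)]
  simp_rw [map_smul, derivation_tt hD hν _ hh, mul_sum, hDν]
  rw [sum_comm (s := (Finset.univ : Finset κ))]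
  simp only [tt, hD.algebraMap, smul_zero, add_zero]
  refine sum_congr rfl fun k _ => ?_
  rw [smul_smul, smul_sum]
  refine sum_congr rfl fun c _ => ?_
  rw [mul_smul_comm]
  congr 1
  rw [Nat.factorial_succ]
  have : (k.factorial : ℝ) ≠ 0 := by positivity
  have : ((k + 1 : ℕ) : ℝ) ≠ 0 := by positivity
  push_cast at this ⊢
  field_simp

/-- A family which vanishes in degree zero and reproduces itself under the Euler operator
vanishes. -/
lemma eq_zero_of_step {X : Type*} (s : X → Prop) (P : X → Gr ι)
  (h0 : ∀ x, s x → body (P x) = 0)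
  (hs : ∀ r, (∀ x, s x → P x ∈ fil ι r) → ∀ x, s x → euler Finset.univ (P x) ∈ fil ι (r + 1))
  (x : X) (hx : s x) : P x = 0 := by
  have key : ∀ r, ∀ x, s x → P x ∈ fil ι r := by
    intro r
    induction r with
    | zero => exact fun x _ => fil_zero _
    | succ r ih => exact fun x hx => mem_fil_of_euler (h0 x hx) (hs r ih x hx)
  exact fil_eq_zero (Nat.lt_succ_self _) (key _ x hx)

lemma taylor_mul {a : κ → Gr ι} (ha : Evens a) {h h' : Vec κ → ℝ}
  (hh : SmAt h (bod a)) (hh' : SmAt h' (bod a)) :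
  taylor (fun y => h y * h' y) a = taylor h a * taylor h' a := by
  rw [← sub_eq_zero]
  refine eq_zero_of_step (X := (Vec κ → ℝ) × (Vec κ → ℝ))
    (fun q => SmAt q.1 (bod a) ∧ SmAt q.2 (bod a))
    (fun q => taylor (fun y => q.1 y * q.2 y) a - taylor q.1 a * taylor q.2 a) ?_ ?_ (h, h')
    ⟨hh, hh'⟩
  · rintro ⟨h, h'⟩ ⟨hh, hh'⟩
    simp only [map_sub, map_mul, body_taylor hh, body_taylor hh', body_taylor (hh.mul hh'), sub_self]
  · rintro r ih ⟨h, h'⟩ ⟨hh, hh'⟩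
    have hD := EvenDer.euler (Finset.univ : Finset ι)
    have e : euler Finset.univ (taylor (fun y => h y * h' y) a - taylor h a * taylor h' a) =
        ∑ c, euler Finset.univ (a c) *
          ((taylor (fun y => pd c h y * h' y) a - taylor (pd c h) a * taylor h' a) +
          (taylor (fun y => h y * pd c h' y) a - taylor h a * taylor (pd c h') a)) := by
      rw [map_sub, euler_mul, derivation_taylor hD ha hh, derivation_taylor hD ha hh',
        derivation_taylor hD ha (hh.mul hh'), sum_mul, mul_sum,
        ← sum_add_distrib, ← sum_sub_distrib]
      refine sum_congr rfl fun c _ => ?_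
      rw [taylor_congr (((hh.pd c).mul hh').add (hh.mul (hh'.pd c))) (pd_mul hh hh' c),
        taylor_add ((hh.pd c).mul hh') (hh.mul (hh'.pd c)), ← mul_assoc (taylor h a),
        (even_commute (taylor_mem_pty hh ha) _).eq]
      noncomm_ring
    simp only [e]
    refine Submodule.sum_mem _ fun c _ => ?_
    rw [add_comm r]
    exact fil_mul (euler_mem_fil_one _ _) (Submodule.add_mem _ (ih (_, _) ⟨hh.pd c, hh'⟩)
      (ih (_, _) ⟨hh, hh'.pd c⟩))

lemma taylor_sum {α : Type*} {s : Finset α} {f : α → Vec κ → ℝ} {a : κ → Gr ι}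
  (hf : ∀ i ∈ s, SmAt (f i) (bod a)) :
  taylor (fun y => ∑ i ∈ s, f i y) a = ∑ i ∈ s, taylor (f i) a := by
  classical
  induction s using Finset.induction_on with
  | empty => simpa using taylor_const 0 a
  | insert i s hi ih =>
    have h1 : ∀ j ∈ s, SmAt (f j) (bod a) := fun j hj => hf j (by simp [hj])
    simp_rw [sum_insert hi]
    rw [taylor_add (hf i (by simp)) (SmAt.sum h1), ih h1]

lemma taylor_const_mul {a : κ → Gr ι} (ha : Evens a) (r : ℝ) {h : Vec κ → ℝ}
  (hh : SmAt h (bod a)) : taylor (fun y => r * h y) a = r • taylor h a := by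
  rw [taylor_mul ha (SmAt.const r _) hh, taylor_const, Algebra.smul_def]

lemma pd_coord (d c : κ) :
  pd d (fun y : κ → ℝ => y c) = fun _ => if c = d then (1 : ℝ) else 0 := by
  ext y
  change fderiv ℝ (ContinuousLinearMap.proj (R := ℝ) (φ := fun _ : κ => ℝ) c) y _ = _
  rw [ContinuousLinearMap.fderiv]
  simp [Pi.single_apply]

lemma taylor_coord {a : κ → Gr ι} (ha : Evens a) (c : κ) :
  taylor (fun y => y c) a = a c := by
  have hsm : SmAt (fun y : κ → ℝ => y c) (bod a) :=
    smAt_of_contDiff (contDiff_apply ℝ ℝ c) _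
  rw [← sub_eq_zero]
  refine eq_zero_of_step (X := Unit) (fun _ => True) (fun _ => taylor (fun y => y c) a - a c)
    ?_ ?_ () trivial
  · intro _ _; rw [map_sub, body_taylor hsm, sub_self]
  · intro r _ _ _
    have : euler Finset.univ (taylor (fun y => y c) a - a c) = 0 := by
      rw [map_sub, derivation_taylor (EvenDer.euler _) ha hsm, sum_eq_single c]
      · rw [pd_coord, if_pos rfl, taylor_const, map_one, mul_one, sub_self]
      · intro d _ hd
        rw [pd_coord, if_neg hd.symm, taylor_const, map_zero, mul_zero]
      · simp
    rw [this]; exact Submodule.zero_mem _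

lemma taylor_comp {a : κ → Gr ι} (ha : Evens a) {g : κ' → Vec κ → ℝ}
  (hg : ∀ d, SmAt (g d) (bod a)) {h : Vec κ' → ℝ} (hh : SmAt h (fun d => g d (bod a))) :
  taylor (fun y => h (fun d => g d y)) a = taylor h (fun d => taylor (g d) a) := by
  have hga : ∀ d, taylor (g d) a ∈ pty ι 0 := fun d => taylor_mem_pty (hg d) ha
  have hbod : bod (fun d => taylor (g d) a) = fun d => g d (bod a) := by
    ext d; exact body_taylor (hg d)
  have hG : SmAt (fun y d => g d y) (bod a) := SmAt.pi hg
  rw [← sub_eq_zero]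
  refine eq_zero_of_step (fun h : Vec κ' → ℝ => SmAt h (fun d => g d (bod a)))
    (fun h => taylor (fun y => h (fun d => g d y)) a - taylor h (fun d => taylor (g d) a))
    ?_ ?_ h hh
  · intro h hh
    rw [map_sub, body_taylor (SmAt.comp (f := fun y d => g d y) hh hG), body_taylor (by rwa [hbod]),
      hbod, sub_self]
  · intro r ih h hh
    have hD := EvenDer.euler (Finset.univ : Finset ι)
    have hc : ∀ {h : Vec κ' → ℝ}, SmAt h (fun d => g d (bod a)) →
        SmAt (fun y => h (fun d => g d y)) (bod a) := fun hh =>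
      SmAt.comp (f := fun y d => g d y) hh hG
    have e : euler Finset.univ
        (taylor (fun y => h (fun d => g d y)) a - taylor h (fun d => taylor (g d) a)) =
        ∑ d, euler Finset.univ (taylor (g d) a) *
          (taylor (fun y => pd d h (fun d => g d y)) a -
            taylor (pd d h) (fun d => taylor (g d) a)) := by
      rw [map_sub, derivation_taylor hD ha (hc hh), derivation_taylor hD hga (by rwa [hbod])]
      simp_rw [mul_sub]
      rw [sum_sub_distrib]
      congr 1
      simp_rw [derivation_taylor hD ha (hg _), sum_mul]
      rw [sum_comm]
      refine sum_congr rfl fun c _ => ?_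
      have h1 : ∀ d ∈ (Finset.univ : Finset κ'),
          SmAt (fun y => pd c (g d) y * pd d h (fun d => g d y)) (bod a) :=
        fun d _ => ((hg d).pd c).mul (hc (hh.pd d))
      have h2 := pd_comp hg hh c
      simp only [smul_eq_mul] at h2
      rw [taylor_congr (SmAt.sum h1) h2, taylor_sum h1, mul_sum]
      refine sum_congr rfl fun d _ => ?_
      rw [taylor_mul ha ((hg d).pd c) (hc (hh.pd d)), mul_assoc]
    simp only [e]
    refine Submodule.sum_mem _ fun d _ => ?_
    rw [add_comm r]
    exact fil_mul (euler_mem_fil_one _ _) (ih _ (hh.pd d))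

lemma map_tt (Λ : Gr ι →ₐ[ℝ] Gr ι') (ν : κ → Gr ι) (b : κ → ℝ) (k : ℕ) (h : Vec κ → ℝ) :
  Λ (tt ν b k h) = tt (fun d => Λ (ν d)) b k h := by
  induction k generalizing h with
  | zero => simp [tt]
  | succ k ih => simp [tt, map_sum, map_mul, ih]

lemma map_taylor (Λ : Gr ι →ₐ[ℝ] Gr ι') (hΛ : ∀ x, body (Λ x) = body x) {h : Vec κ → ℝ}
  {a : κ → Gr ι} (hh : SmAt h (bod a)) : Λ (taylor h a) = taylor h (fun c => Λ (a c)) := by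
  have hb : bod (fun c => Λ (a c)) = bod a := by ext c; exact hΛ _
  rw [taylor_eq hh (N := max (Fintype.card ι) (Fintype.card ι') + 1) (by omega),
    taylor_eq (a := fun c => Λ (a c)) (by rwa [hb])
      (N := max (Fintype.card ι) (Fintype.card ι') + 1) (by omega), map_sum, hb]
  refine sum_congr rfl fun k _ => ?_
  rw [map_smul, map_tt]
  simp [nilp, hΛ]

lemma taylor_add_single {a : κ → Gr ι} (ha : Evens a) {η : Gr ι} (hη : η ∈ pty ι 0)
  (hb : body η = 0) {N : ℕ} (hN : η ^ N = 0) (k : κ) {h : Vec κ → ℝ} (hh : SmAt h (bod a)) :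
  taylor h (fun c => a c + Pi.single (M := fun _ => Gr ι) k η c) =
      ∑ j ∈ Finset.range (N + 1), ((j.factorial : ℝ)⁻¹) • (η ^ j * taylor ((pd k)^[j] h) a) := by
  have hpow : ∀ j, η ^ j ∈ pty ι 0 := by
    intro j; induction j with
    | zero => simpa using one_mem_pty
    | succ j ih => rw [pow_succ]; simpa using pty_mul ih hη
  have hs : ∀ c, (Pi.single k η : κ → Gr ι) c ∈ pty ι 0 := by
    intro c; by_cases h : c = k
    · subst h; simpa
    · simp [h]
  have ha' : ∀ c, a c + (Pi.single k η : κ → Gr ι) c ∈ pty ι 0 := fun c =>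
    Submodule.add_mem _ (ha c) (hs c)
  have hbod : bod (fun c => a c + (Pi.single k η : κ → Gr ι) c) = bod a := by
    ext c; by_cases h : c = k
    · subst h; simp [hb]
    · simp [h]
  have hit : ∀ (j : ℕ) {h : Vec κ → ℝ}, SmAt h (bod a) → SmAt ((pd k)^[j] h) (bod a) := by
    intro j; induction j with
    | zero => exact fun hh => hh
    | succ j ih => exact fun hh => ih (hh.pd k)
  have hcomm : ∀ (j : ℕ) {h : Vec κ → ℝ} (c : κ), SmAt h (bod a) →
      pd c ((pd k)^[j] h) =ᶠ[𝓝 (bod a)] (pd k)^[j] (pd c h) := by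
    intro j; induction j with
    | zero => exact fun c _ => EventuallyEq.rfl
    | succ j ih =>
      intro h c hh
      have hcg : ∀ (i : ℕ) {f g : Vec κ → ℝ}, f =ᶠ[𝓝 (bod a)] g →
          (pd k)^[i] f =ᶠ[𝓝 (bod a)] (pd k)^[i] g := by
        intro i; induction i with
        | zero => exact fun e => e
        | succ i ih => exact fun e => ih (pd_congr e k)
      rw [Function.iterate_succ_apply, Function.iterate_succ_apply]
      exact (ih c (hh.pd k)).trans (hcg j (pd_comm hh c k))
  have hNf : Fintype.card ι < Fintype.card ι + 1 := by omega
  rw [← sub_eq_zero]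
  refine eq_zero_of_step (fun h : Vec κ → ℝ => SmAt h (bod a))
    (fun h => taylor h (fun c => a c + (Pi.single k η : κ → Gr ι) c) -
      ∑ j ∈ Finset.range (N + 1), ((j.factorial : ℝ)⁻¹) • (η ^ j * taylor ((pd k)^[j] h) a))
    ?_ ?_ h hh
  · intro h hh
    rw [map_sub, body_taylor (by rwa [hbod]), hbod, map_sum, sum_range_succ',
      sum_eq_zero]
    · simp [body_taylor hh]
    · intro j _; rw [map_smul, map_mul, map_pow, hb]; simp
  · intro r ih h hh
    have hD := EvenDer.euler (Finset.univ : Finset ι)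
    set A : κ → Gr ι := fun c => a c + (Pi.single k η : κ → Gr ι) c with hA
    have hpowD : ∀ j : ℕ, euler Finset.univ (η ^ (j + 1)) =
        ((j + 1 : ℕ) : ℝ) • (euler Finset.univ η * η ^ j) := by
      intro j; induction j with
      | zero => simp
      | succ j ih =>
        rw [pow_succ, euler_mul, ih, (even_commute (hpow (j + 1)) _).eq, smul_mul_assoc, mul_assoc,
          ← pow_succ, Nat.cast_succ (j + 1), add_smul, one_smul]
    have hterm : ∀ j : ℕ, euler Finset.univ
        (((j.factorial : ℝ)⁻¹) • (η ^ j * taylor ((pd k)^[j] h) a)) =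
        ((j.factorial : ℝ)⁻¹) • (euler Finset.univ (η ^ j) * taylor ((pd k)^[j] h) a) +
        ∑ c, euler Finset.univ (a c) *
          (((j.factorial : ℝ)⁻¹) • (η ^ j * taylor ((pd k)^[j] (pd c h)) a)) := by
      intro j
      rw [map_smul, euler_mul, derivation_taylor hD ha (hit j hh), smul_add, mul_sum,
        smul_sum]
      congr 1
      refine sum_congr rfl fun c _ => ?_
      rw [taylor_congr (hit j (hh.pd c)) (hcomm j c hh), ← mul_assoc, (even_commute (hpow j) _).eq,
        mul_assoc, mul_smul_comm]
    have hshift : ∑ j ∈ Finset.range (N + 1),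
        ((j.factorial : ℝ)⁻¹) • (euler Finset.univ (η ^ j) * taylor ((pd k)^[j] h) a) =
        euler Finset.univ η * ∑ j ∈ Finset.range (N + 1),
          ((j.factorial : ℝ)⁻¹) • (η ^ j * taylor ((pd k)^[j] (pd k h)) a) := by
      rw [sum_range_succ', sum_range_succ, hN]
      simp only [pow_zero, euler_one, zero_mul, smul_zero, add_zero]
      rw [mul_sum]
      refine sum_congr rfl fun j _ => ?_
      rw [hpowD, Function.iterate_succ_apply, smul_mul_assoc, smul_smul, mul_smul_comm, mul_assoc]
      congr 1
      rw [Nat.factorial_succ]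
      have : (j.factorial : ℝ) ≠ 0 := by positivity
      have : ((j + 1 : ℕ) : ℝ) ≠ 0 := by positivity
      push_cast at this ⊢
      field_simp
    have e : euler Finset.univ (taylor h A -
        ∑ j ∈ Finset.range (N + 1), ((j.factorial : ℝ)⁻¹) • (η ^ j * taylor ((pd k)^[j] h) a)) =
        (∑ c, euler Finset.univ (a c) * (taylor (pd c h) A - ∑ j ∈ Finset.range (N + 1),
          ((j.factorial : ℝ)⁻¹) • (η ^ j * taylor ((pd k)^[j] (pd c h)) a))) +
        euler Finset.univ η * (taylor (pd k h) A - ∑ j ∈ Finset.range (N + 1),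
          ((j.factorial : ℝ)⁻¹) • (η ^ j * taylor ((pd k)^[j] (pd k h)) a)) := by
      rw [map_sub, derivation_taylor hD ha' (by rwa [hbod]), map_sum]
      simp_rw [hterm]
      rw [sum_add_distrib, hshift, sum_comm]
      simp only [hA, map_add, add_mul, sum_add_distrib, mul_sub, sum_sub_distrib,
        mul_sum]
      rw [sum_eq_single (f := fun c => euler Finset.univ ((Pi.single k η : κ → Gr ι) c) * _) k]
      · rw [Pi.single_eq_same]; abel
      · intro c _ hc; simp [hc]
      · simp
    simp only [e]
    refine Submodule.add_mem _ (Submodule.sum_mem _ fun c _ => ?_) ?_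
    · rw [add_comm r]
      exact fil_mul (euler_mem_fil_one _ _) (ih _ (hh.pd c))
    · rw [add_comm r]
      exact fil_mul (euler_mem_fil_one _ _) (ih _ (hh.pd k))

end

/-! ### Dependence of Taylor expansions on parameters -/

lemma SmAt.body {A : E → Gr ι} {p : E} (hA : SmAt A p) : SmAt (fun q => body (A q)) p :=
  hA.linear (Worm.body : Gr ι →ₐ[ℝ] ℝ).toLinearMap

lemma SmAt.algebraMap {h : E → ℝ} {p : E} (hh : SmAt h p) :
  SmAt (fun q => algebraMap ℝ (Gr ι) (h q)) p :=
  hh.linear (Algebra.linearMap ℝ (Gr ι))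

lemma SmAt.nilp {A : E → Gr ι} {p : E} (hA : SmAt A p) : SmAt (fun q => nilp (A q)) p :=
  hA.sub hA.body.algebraMap

lemma smAt_of_coeff {f : E → Gr σ} {p : E}
  (h : ∀ S, SmAt (fun q => coeff S (f q)) p) : SmAt f p := by
  have : SmAt (fun q => ∑ S, coeff S (f q) • (mon S : Gr σ)) p :=
    SmAt.sum fun S _ => (h S).smul (SmAt.const _ _)
  simpa only [sum_coeff_mon] using this

lemma SmAt.tt {ν : E → κ → Gr ι} {b : E → κ → ℝ} {p : E} (hν : ∀ c, SmAt (fun q => ν q c) p)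
  (hb : ∀ c, SmAt (fun q => b q c) p) (k : ℕ) {h : Vec κ → ℝ} (hh : SmAt h (b p)) :
  SmAt (fun q => tt (ν q) (b q) k h) p := by
  induction k generalizing h with
  | zero => exact (SmAt.comp (f := b) hh (SmAt.pi hb)).algebraMap
  | succ k ih => exact SmAt.sum fun d _ => (ih (hh.pd d)).mul (hν d)

lemma SmAt.eventually_bod {A : E → κ → Gr ι} {p : E} (hA : ∀ c, SmAt (fun q => A q c) p)
  {P : Vec κ → Prop} (h : ∀ᶠ y in 𝓝 (bod (A p)), P y) : ∀ᶠ q in 𝓝 p, P (bod (A q)) := by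
  have : SmAt (fun q c => Worm.body (A q c)) p := SmAt.pi fun c => (hA c).body
  exact this.contDiffAt.continuousAt.eventually h

lemma SmAt.taylor {A : E → κ → Gr ι} {p : E} (hA : ∀ c, SmAt (fun q => A q c) p)
  {h : Vec κ → ℝ} (hh : SmAt h (bod (A p))) : SmAt (fun q => taylor h (A q)) p := by
  have h1 : SmAt (fun q => ∑ k ∈ Finset.range (Fintype.card ι + 1), ((k.factorial : ℝ)⁻¹) •
      Worm.tt (fun c => Worm.nilp (A q c)) (bod (A q)) k h) p :=
    SmAt.sum fun k _ => (SmAt.const _ _).smul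
      (SmAt.tt (fun c => (hA c).nilp) (fun c => (hA c).body) k hh)
  refine h1.congr ?_
  filter_upwards [SmAt.eventually_bod hA hh.eventually] with q hq
  exact taylor_eq hq (Nat.lt_succ_self _)

lemma fderiv_mem_pty {A : E → Gr ι} {p : E} {i : ZMod 2} (hd : DifferentiableAt ℝ A p)
  (hA : ∀ᶠ q in 𝓝 p, A q ∈ pty ι i) (v : E) : fderiv ℝ A p v ∈ pty ι i := by
  have h := fderiv_linear_comp (ptyProj i) hd v
  have e : (fun y => ptyProj i (A y)) =ᶠ[𝓝 p] A := by
    filter_upwards [hA] with q hq using (ptyProj_of_mem hq).1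
  rw [e.fderiv_eq] at h
  rw [h]; exact ptyProj_mem _ _

lemma fderiv_taylor {A : E → κ → Gr ι} {p : E} (hA : ∀ c, SmAt (fun q => A q c) p)
  (hA0 : ∀ᶠ q in 𝓝 p, ∀ c, A q c ∈ pty ι 0)
  {h : Vec κ → ℝ} (hh : SmAt h (bod (A p))) (v : E) :
  fderiv ℝ (fun q => taylor h (A q)) p v =
      ∑ c, fderiv ℝ (fun q => A q c) p v * taylor (pd c h) (A p) := by
  have hv : ∀ c, fderiv ℝ (fun q => A q c) p v ∈ pty ι 0 := fun c =>
    fderiv_mem_pty (hA c).differentiableAt (hA0.mono fun q hq => hq c) v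
  have hAp : ∀ c, A p c ∈ pty ι 0 := hA0.self_of_nhds
  rw [← sub_eq_zero]
  refine eq_zero_of_step (fun h : Vec κ → ℝ => SmAt h (bod (A p)))
    (fun h => fderiv ℝ (fun q => taylor h (A q)) p v -
      ∑ c, fderiv ℝ (fun q => A q c) p v * taylor (pd c h) (A p)) ?_ ?_ h hh
  · intro h hh
    have h1 := fderiv_linear_comp (Worm.body : Gr ι →ₐ[ℝ] ℝ).toLinearMap
      (SmAt.taylor hA hh).differentiableAt v
    simp only [AlgHom.toLinearMap_apply] at h1
    have e : (fun q => Worm.body (Worm.taylor h (A q))) =ᶠ[𝓝 p] fun q => h (bod (A q)) := by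
      filter_upwards [SmAt.eventually_bod hA hh.eventually] with q hq using body_taylor hq
    have hB : HasFDerivAt (fun q => bod (A q))
        (ContinuousLinearMap.pi fun c => fderiv ℝ (fun q => Worm.body (A q c)) p) p :=
      hasFDerivAt_pi.mpr fun c => (hA c).body.differentiableAt.hasFDerivAt
    have h2 : fderiv ℝ (fun q => h (bod (A q))) p = _ :=
      (hh.differentiableAt.hasFDerivAt.comp p hB).fderiv
    rw [map_sub, map_sum, ← h1, e.fderiv_eq, h2, ContinuousLinearMap.comp_apply, fderiv_eq_sum_pd,
      sub_eq_zero]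
    refine sum_congr rfl fun c _ => ?_
    have h3 := fderiv_linear_comp (Worm.body : Gr ι →ₐ[ℝ] ℝ).toLinearMap (hA c).differentiableAt v
    simp only [AlgHom.toLinearMap_apply] at h3
    rw [map_mul, body_taylor (hh.pd c), ContinuousLinearMap.pi_apply, h3, smul_eq_mul]
  · intro r ih h hh
    have hD := EvenDer.euler (Finset.univ : Finset ι)
    have e1 : (fun q => euler Finset.univ (Worm.taylor h (A q))) =ᶠ[𝓝 p]
        fun q => ∑ c, euler Finset.univ (A q c) * Worm.taylor (Worm.pd c h) (A q) := by
      filter_upwards [SmAt.eventually_bod hA hh.eventually, hA0] with q hq h0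
      exact derivation_taylor hD h0 hq
    have hs : ∀ c ∈ (Finset.univ : Finset κ), SmAt
        (fun q => euler Finset.univ (A q c) * Worm.taylor (Worm.pd c h) (A q)) p := fun c _ =>
      ((hA c).linear (euler Finset.univ)).mul (SmAt.taylor hA (hh.pd c))
    have e2 : euler Finset.univ (fderiv ℝ (fun q => Worm.taylor h (A q)) p v) =
        ∑ c, (euler Finset.univ (fderiv ℝ (fun q => A q c) p v) *
            Worm.taylor (Worm.pd c h) (A p) +
          euler Finset.univ (A p c) *
            fderiv ℝ (fun q => Worm.taylor (Worm.pd c h) (A q)) p v) := by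
      rw [← fderiv_linear_comp (euler Finset.univ) (SmAt.taylor hA hh).differentiableAt,
        e1.fderiv_eq, fderiv_sum_apply (fun c hc => (hs c hc).differentiableAt)]
      refine sum_congr rfl fun c _ => ?_
      rw [fderiv_mul_apply ((hA c).linear (euler Finset.univ)).differentiableAt
        (SmAt.taylor hA (hh.pd c)).differentiableAt,
        fderiv_linear_comp (euler Finset.univ) (hA c).differentiableAt]
    have e : euler Finset.univ (fderiv ℝ (fun q => Worm.taylor h (A q)) p v -
        ∑ c, fderiv ℝ (fun q => A q c) p v * Worm.taylor (Worm.pd c h) (A p)) =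
        ∑ d, euler Finset.univ (A p d) *
          (fderiv ℝ (fun q => Worm.taylor (Worm.pd d h) (A q)) p v -
            ∑ c, fderiv ℝ (fun q => A q c) p v *
              Worm.taylor (Worm.pd c (Worm.pd d h)) (A p)) := by
      rw [map_sub, e2, map_sum]
      simp_rw [euler_mul, derivation_taylor hD hAp (hh.pd _), mul_sub, sum_add_distrib,
        sum_sub_distrib, mul_sum]
      rw [sum_comm (f := fun c d => fderiv ℝ (fun q => A q c) p v *
        (euler Finset.univ (A p d) * Worm.taylor (Worm.pd d (Worm.pd c h)) (A p)))]
      have : ∀ d c, fderiv ℝ (fun q => A q c) p v *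
          (euler Finset.univ (A p d) * Worm.taylor (Worm.pd d (Worm.pd c h)) (A p)) =
          euler Finset.univ (A p d) * (fderiv ℝ (fun q => A q c) p v *
            Worm.taylor (Worm.pd c (Worm.pd d h)) (A p)) := by
        intro d c
        rw [taylor_congr ((hh.pd d).pd c) (pd_comm hh d c), ← mul_assoc, (even_commute (hv c) _).eq,
          mul_assoc]
      simp_rw [this]
      abel
    simp only [e]
    refine Submodule.sum_mem _ fun d _ => ?_
    rw [add_comm r]
    exact fil_mul (euler_mem_fil_one _ _) (ih _ (hh.pd d))

/-! ### Substitution -/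

section

variable {κ' σ' ι' : Type} [Fintype κ'] [DecidableEq κ'] [Fintype σ'] [LinearOrder σ']
  [Fintype ι'] [LinearOrder ι']

/-- The homomorphism sending the generators to given odd elements. -/
def lam (b : σ → Gr ι) (hb : Odds b) : Gr σ →ₐ[ℝ] Gr ι :=
  ExteriorAlgebra.lift ℝ ⟨∑ s, (LinearMap.proj s : (σ → ℝ) →ₗ[ℝ] ℝ).smulRight (b s), fun v =>
    odd_sq (by
      rw [LinearMap.sum_apply]
      exact Submodule.sum_mem _ fun s _ => Submodule.smul_mem _ _ (hb s))⟩

lemma lam_ι (b : σ → Gr ι) (hb : Odds b) (v : σ → ℝ) :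
  lam b hb (ExteriorAlgebra.ι ℝ v) = ∑ s, v s • b s := by
  rw [lam, ExteriorAlgebra.lift_ι_apply]; simp [LinearMap.sum_apply]

lemma lam_gen [DecidableEq σ] (b : σ → Gr ι) (hb : Odds b) (s : σ) : lam b hb (gen s) = b s := by
  rw [gen, lam_ι, sum_eq_single s] <;> simp +contextual

lemma lam_mon (b : σ → Gr ι) (hb : Odds b) (S : Finset σ) :
  lam b hb (mon S) = ordProd S b := by
  rw [mon_eq_ordProd, map_ordProd]; simp only [lam_gen]

lemma derivation_lam {D : Gr ι →ₗ[ℝ] Gr ι} (hD : EvenDer D) (ε : ℝ)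
  (hD1 : ∀ x ∈ pty ι 1, ∀ y, D (x * y) = D x * y + ε • (x * D y)) (b : σ → Gr ι)
  (hb : Odds b) (hc : ∀ s t, ε • (b s * D (b t)) = -(D (b t) * b s)) (x : Gr σ) :
  D (lam b hb x) = ∑ s, D (b s) * lam b hb (dLeft s x) := by
  induction x using CliffordAlgebra.left_induction with
  | algebraMap r =>
    rw [AlgHom.commutes, hD.algebraMap]
    exact (sum_eq_zero fun s _ => by
      rw [dLeft_algebraMap, map_zero, mul_zero]).symm
  | add x y hx hy => simp only [map_add, hx, hy, mul_add, sum_add_distrib]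
  | ι_mul y v hy =>
    rw [← ExteriorAlgebra.ι]
    have h1 : lam b hb (ExteriorAlgebra.ι ℝ v) ∈ pty ι 1 := by
      rw [lam_ι]; exact Submodule.sum_mem _ fun s _ => Submodule.smul_mem _ _ (hb s)
    have h2 : ∀ s, ε • (lam b hb (ExteriorAlgebra.ι ℝ v) * D (b s)) =
        -(D (b s) * lam b hb (ExteriorAlgebra.ι ℝ v)) := by
      intro s
      simp only [lam_ι, sum_mul, mul_sum, smul_sum, ← sum_neg_distrib]
      refine sum_congr rfl fun t _ => ?_
      rw [smul_mul_assoc, smul_comm, hc, mul_smul_comm, smul_neg]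
    have h3 : ∀ s, dLeft s (ExteriorAlgebra.ι ℝ v * y) =
        v s • y - ExteriorAlgebra.ι ℝ v * dLeft s y := fun s => by
      simp [dLeft, ExteriorAlgebra.ι, CliffordAlgebra.contractLeft_ι_mul]
    rw [map_mul, hD1 _ h1, hy, mul_sum, smul_sum]
    simp only [h3, map_sub, map_smul, map_mul, mul_sub, sum_sub_distrib, mul_smul_comm]
    rw [sub_eq_add_neg, ← sum_neg_distrib]
    congr 1
    · rw [lam_ι, map_sum, sum_mul]
      exact sum_congr rfl fun s _ => by rw [map_smul, smul_mul_assoc]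
    · refine sum_congr rfl fun s _ => ?_
      rw [← mul_assoc, ← smul_mul_assoc, h2, neg_mul, mul_assoc]

lemma lam_add_single (b : σ → Gr ι) (hb : Odds b) (k : σ) {γ : Gr ι}
  (hγ : γ ∈ pty ι 1) (hb' : ∀ s, b s + (Pi.single k γ : σ → Gr ι) s ∈ pty ι 1) (x : Gr σ) :
  lam (fun s => b s + (Pi.single k γ : σ → Gr ι) s) hb' x =
      lam b hb x + γ * lam b hb (dLeft k x) := by
  induction x using CliffordAlgebra.left_induction with
  | algebraMap r =>
    rw [AlgHom.commutes, AlgHom.commutes, dLeft_algebraMap, map_zero, mul_zero, add_zero]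
  | add x y hx hy => simp only [map_add, hx, hy, mul_add]; abel
  | ι_mul y v hy =>
    rw [← ExteriorAlgebra.ι]
    have h1 : lam b hb (ExteriorAlgebra.ι ℝ v) ∈ pty ι 1 := by
      rw [lam_ι]; exact Submodule.sum_mem _ fun s _ => Submodule.smul_mem _ _ (hb s)
    have h3 : dLeft k (ExteriorAlgebra.ι ℝ v * y) =
        v k • y - ExteriorAlgebra.ι ℝ v * dLeft k y := by
      simp [dLeft, ExteriorAlgebra.ι, CliffordAlgebra.contractLeft_ι_mul]
    have h4 : lam (fun s => b s + (Pi.single k γ : σ → Gr ι) s) hb' (ExteriorAlgebra.ι ℝ v) =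
        lam b hb (ExteriorAlgebra.ι ℝ v) + v k • γ := by
      simp only [lam_ι, smul_add, sum_add_distrib]
      congr 1
      rw [sum_eq_single k] <;> simp +contextual
    rw [map_mul, map_mul, hy, h4, h3, map_sub, map_smul, map_mul]
    simp only [add_mul, mul_add, mul_sub, smul_mul_assoc, mul_smul_comm]
    rw [← mul_assoc γ γ, odd_sq hγ, zero_mul, smul_zero, add_zero, ← mul_assoc _ γ,
      odd_anticomm h1 hγ, neg_mul, mul_assoc]
    abel

/-- Substitution of Grassmann algebra elements for the even and odd variables. -/
def gsub (f : Vec κ → Gr σ) (a : κ → Gr ι) (b : σ → Gr ι) : Gr ι :=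
  ∑ S : Finset σ, taylor (fun q => coeff S (f q)) a * ordProd S b

lemma SmAt.coeff {f : E → Gr σ} {p : E}
  (hf : SmAt f p) (S : Finset σ) : SmAt (fun q => coeff S (f q)) p := hf.linear _

lemma gsub_congr {f g : Vec κ → Gr σ} {a : κ → Gr ι} {b : σ → Gr ι} (hf : SmAt f (bod a))
  (e : g =ᶠ[𝓝 (bod a)] f) : gsub g a b = gsub f a b :=
  sum_congr rfl fun S _ => by
    rw [taylor_congr (hf.coeff S) (e.mono fun q hq => by simp only [hq])]

lemma gsub_eq_lam (f : Vec κ → Gr σ) (a : κ → Gr ι) {b : σ → Gr ι}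
  (hb : Odds b) :
  gsub f a b = ∑ S, taylor (fun q => coeff S (f q)) a * lam b hb (mon S) := by
  simp only [lam_mon]; rfl

lemma gsub_linear {f : Vec κ → Gr σ} {a : κ → Gr ι} {b : σ' → Gr ι} (hf : SmAt f (bod a))
  (ha : Evens a) (hb : Odds b) (T : Gr σ →ₗ[ℝ] Gr σ') :
  gsub (fun q => T (f q)) a b =
      ∑ S, taylor (fun q => coeff S (f q)) a * lam b hb (T (mon S)) := by
  rw [gsub_eq_lam _ _ hb]
  have h1 : ∀ U q, coeff U (T (f q)) = ∑ S, coeff U (T (mon S)) * coeff S (f q) := by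
    intro U q
    conv_lhs => rw [← sum_coeff_mon (f q)]
    simp [map_sum, mul_comm]
  simp_rw [h1]
  have h2 : ∀ U : Finset σ', taylor (fun q => ∑ S, coeff U (T (mon S)) * coeff S (f q)) a =
      ∑ S, coeff U (T (mon S)) • taylor (fun q => coeff S (f q)) a := by
    intro U
    rw [taylor_sum (fun S _ => (SmAt.const _ _).mul (hf.coeff S))]
    exact sum_congr rfl fun S _ => taylor_const_mul ha _ (hf.coeff S)
  simp_rw [h2, sum_mul]
  rw [sum_comm]
  refine sum_congr rfl fun S _ => ?_
  conv_rhs => rw [← sum_coeff_mon (T (mon S)), map_sum, mul_sum]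
  exact sum_congr rfl fun U _ => by rw [map_smul, smul_mul_assoc, mul_smul_comm]

lemma gsub_const (x : Gr σ) (a : κ → Gr ι) {b : σ → Gr ι} (hb : Odds b) :
  gsub (fun _ => x) a b = lam b hb x := by
  rw [gsub_eq_lam _ _ hb]
  simp_rw [taylor_const]
  conv_rhs => rw [← sum_coeff_mon x, map_sum]
  exact sum_congr rfl fun S _ => by rw [map_smul, Algebra.smul_def]

lemma gsub_gen [DecidableEq σ] (s : σ) (a : κ → Gr ι) {b : σ → Gr ι} (hb : Odds b) :
  gsub (fun _ => gen s) a b = b s := by rw [gsub_const _ _ hb, lam_gen]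

lemma gsub_algebraMap (h : Vec κ → ℝ) (a : κ → Gr ι) (b : σ → Gr ι) :
  gsub (fun q => algebraMap ℝ (Gr σ) (h q)) a b = taylor h a := by
  rw [gsub, sum_eq_single ∅]
  · rw [ordProd_empty, mul_one]
    congr 1
    ext q
    rw [← body_eq_coeff, body_algebraMap]
  · intro S _ hS
    have : (fun q => coeff S (algebraMap ℝ (Gr σ) (h q))) = fun _ => 0 := by
      ext q
      rw [Algebra.algebraMap_eq_smul_one, map_smul, ← mon_empty, coeff_mon, if_neg hS, smul_zero]
    rw [this, taylor_const, map_zero, zero_mul]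
  · simp

lemma gsub_coord (c : κ) {a : κ → Gr ι} (ha : Evens a) (b : σ → Gr ι) :
  gsub (fun q => algebraMap ℝ (Gr σ) (q c)) a b = a c := by
  rw [gsub_algebraMap, taylor_coord ha]

lemma gsub_add {f g : Vec κ → Gr σ} {a : κ → Gr ι} (b : σ → Gr ι) (hf : SmAt f (bod a))
  (hg : SmAt g (bod a)) : gsub (fun q => f q + g q) a b = gsub f a b + gsub g a b := by
  simp only [gsub, ← sum_add_distrib, ← add_mul, map_add]
  exact sum_congr rfl fun S _ => by rw [taylor_add (hf.coeff S) (hg.coeff S)]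

lemma gsub_sum {α : Type*} {s : Finset α} {f : α → Vec κ → Gr σ} {a : κ → Gr ι}
  (b : σ → Gr ι) (hf : ∀ i ∈ s, SmAt (f i) (bod a)) :
  gsub (fun q => ∑ i ∈ s, f i q) a b = ∑ i ∈ s, gsub (f i) a b := by
  simp only [gsub, map_sum]
  rw [sum_comm]
  refine sum_congr rfl fun S _ => ?_
  rw [taylor_sum (fun i hi => (hf i hi).coeff S), sum_mul]

lemma gsub_mul {f g : Vec κ → Gr σ} {a : κ → Gr ι} {b : σ → Gr ι} (hf : SmAt f (bod a))
  (hg : SmAt g (bod a)) (ha : Evens a) (hb : Odds b) :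
  gsub (fun q => f q * g q) a b = gsub f a b * gsub g a b := by
  have h1 : ∀ q, f q * g q = ∑ S, LinearMap.mulRight ℝ (mon S) (coeff S (g q) • f q) := by
    intro q
    conv_lhs => rw [← sum_coeff_mon (g q), mul_sum]
    simp
  have hs : ∀ S, SmAt (fun q => coeff S (g q) • f q) (bod a) := fun S => (hg.coeff S).smul hf
  simp_rw [h1]
  rw [gsub_sum b (fun S _ => (hs S).linear (LinearMap.mulRight ℝ (mon S)))]
  have h2 : ∀ S, gsub (fun q => LinearMap.mulRight ℝ (mon S) (coeff S (g q) • f q)) a b =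
      gsub f a b * (taylor (fun q => coeff S (g q)) a * ordProd S b) := by
    intro S
    rw [gsub_linear (hs S) ha hb, gsub, sum_mul]
    refine sum_congr rfl fun T _ => ?_
    have h3 : (fun q => coeff T (coeff S (g q) • f q)) =
        fun q => coeff S (g q) * coeff T (f q) := by
      ext q; rw [map_smul, smul_eq_mul]
    have hgS := taylor_mem_pty (hg.coeff S) ha
    rw [h3, taylor_mul ha (hg.coeff S) (hf.coeff T), LinearMap.mulRight_apply, map_mul, lam_mon,
      lam_mon, (even_commute hgS _).eq, mul_assoc, mul_assoc, ← mul_assoc _ (ordProd T b),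
      (even_commute hgS _).eq, mul_assoc]
  simp_rw [h2]
  rw [← mul_sum]
  rfl

lemma gsub_smul {h : Vec κ → ℝ} {g : Vec κ → Gr σ} {a : κ → Gr ι} {b : σ → Gr ι}
  (hh : SmAt h (bod a)) (hg : SmAt g (bod a)) (ha : Evens a)
  (hb : Odds b) :
  gsub (fun q => h q • g q) a b = taylor h a * gsub g a b := by
  simp_rw [Algebra.smul_def]
  rw [gsub_mul hh.algebraMap hg ha hb, gsub_algebraMap]

lemma gsub_const_smul (r : ℝ) {g : Vec κ → Gr σ} {a : κ → Gr ι} {b : σ → Gr ι}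
  (hg : SmAt g (bod a)) (ha : Evens a) (hb : Odds b) :
  gsub (fun q => r • g q) a b = r • gsub g a b := by
  rw [gsub_smul (SmAt.const r _) hg ha hb, taylor_const, Algebra.smul_def]

lemma gsub_ordProd {τ : Type} [LinearOrder τ] {B : Vec κ → τ → Gr σ} {a : κ → Gr ι}
  {b : σ → Gr ι} (hB : ∀ s, SmAt (fun q => B q s) (bod a)) (ha : Evens a)
  (hb : Odds b) (S : Finset τ) :
  SmAt (fun q => ordProd S (B q)) (bod a) ∧
  gsub (fun q => ordProd S (B q)) a b = ordProd S (fun s => gsub (fun q => B q s) a b) := by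
  induction S using induction_on_min with
  | empty =>
    simp only [ordProd_empty]
    exact ⟨SmAt.const _ _, by rw [gsub_const _ _ hb, map_one]⟩
  | insert s S hs ih =>
    simp only [ordProd_insert_min _ hs]
    exact ⟨(hB s).mul ih.1, by rw [gsub_mul (hB s) ih.1 ha hb, ih.2]⟩

lemma gsub_mem_pty {f : Vec κ → Gr σ} {a : κ → Gr ι} {b : σ → Gr ι} {i : ZMod 2}
  (hf : SmAt f (bod a)) (hi : ∀ᶠ q in 𝓝 (bod a), f q ∈ pty σ i) (ha : Evens a)
  (hb : Odds b) : gsub f a b ∈ pty ι i := by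
  refine Submodule.sum_mem _ fun S _ => ?_
  by_cases hS : (S.card : ZMod 2) = i
  · have := pty_mul (taylor_mem_pty (hf.coeff S) ha) (ordProd_mem_pty S fun s _ => hb s)
    rwa [zero_add, hS] at this
  · have e : (fun q => coeff S (f q)) =ᶠ[𝓝 (bod a)] fun _ => 0 := by
      filter_upwards [hi] with q hq using coeff_eq_zero_of_mem_pty hq hS
    rw [taylor_congr (SmAt.const _ _) e, taylor_const, map_zero, zero_mul]
    exact Submodule.zero_mem _

lemma body_gsub {f : Vec κ → Gr σ} {a : κ → Gr ι} {b : σ → Gr ι} (hf : SmAt f (bod a))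
  (hb : Odds b) : body (gsub f a b) = body (f (bod a)) := by
  rw [gsub_eq_lam _ _ hb, map_sum]
  conv_rhs => rw [← sum_coeff_mon (f (bod a)), map_sum]
  refine sum_congr rfl fun S _ => ?_
  rw [map_mul, body_taylor (hf.coeff S), map_smul, smul_eq_mul]
  congr 1
  suffices h : body.comp (lam b hb) = body from AlgHom.congr_fun h _
  refine ExteriorAlgebra.hom_ext (LinearMap.ext fun v => ?_)
  have h1 : lam b hb (ExteriorAlgebra.ι ℝ v) ∈ pty ι 1 := by
    rw [lam_ι]; exact Submodule.sum_mem _ fun s _ => Submodule.smul_mem _ _ (hb s)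
  exact (body_odd h1).trans (body_odd (CliffordAlgebra.ι_mem_evenOdd_one _ v)).symm

lemma map_gsub (Λ : Gr ι →ₐ[ℝ] Gr ι') (hΛ : ∀ x, body (Λ x) = body x) {f : Vec κ → Gr σ}
  {a : κ → Gr ι} (hf : SmAt f (bod a)) (b : σ → Gr ι) :
  Λ (gsub f a b) = gsub f (fun c => Λ (a c)) (fun s => Λ (b s)) := by
  rw [gsub, map_sum]
  exact sum_congr rfl fun S _ => by
    rw [map_mul, map_taylor Λ hΛ (hf.coeff S), map_ordProd]

lemma coeff_pd {f : Vec κ → Gr σ} {p : κ → ℝ} (hf : SmAt f p) (S : Finset σ) (c : κ) :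
  (fun q => coeff S (pd c f q)) =ᶠ[𝓝 p] pd c (fun q => coeff S (f q)) := by
  filter_upwards [hf] with q hq
  exact (fderiv_linear_comp (coeff S) (hq.differentiableAt (by simp)) _).symm

lemma derivation_gsub {D : Gr ι →ₗ[ℝ] Gr ι} (hD : EvenDer D) (ε : ℝ)
  (hD1 : ∀ x ∈ pty ι 1, ∀ y, D (x * y) = D x * y + ε • (x * D y))
  {f : Vec κ → Gr σ} {a : κ → Gr ι} {b : σ → Gr ι} (hf : SmAt f (bod a))
  (ha : Evens a) (hb : Odds b)
  (hc : ∀ s t, ε • (b s * D (b t)) = -(D (b t) * b s)) :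
  D (gsub f a b) = ∑ c, D (a c) * gsub (pd c f) a b +
      ∑ s, D (b s) * gsub (fun q => dLeft s (f q)) a b := by
  rw [gsub_eq_lam _ _ hb, map_sum]
  simp_rw [gsub_linear hf ha hb (dLeft _), gsub_eq_lam _ _ hb, mul_sum]
  rw [sum_comm (s := (Finset.univ : Finset κ)),
    sum_comm (s := (Finset.univ : Finset σ)), ← sum_add_distrib]
  refine sum_congr rfl fun S _ => ?_
  have hS := taylor_mem_pty (hf.coeff S) ha
  rw [hD _ hS, derivation_taylor hD ha (hf.coeff S), derivation_lam hD ε hD1 b hb hc,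
    sum_mul, mul_sum]
  congr 1
  · refine sum_congr rfl fun c _ => ?_
    rw [taylor_congr ((hf.coeff S).pd c) (coeff_pd hf S c), mul_assoc]
  · refine sum_congr rfl fun s _ => ?_
    rw [← mul_assoc, (even_commute hS _).eq, mul_assoc]

lemma euler_gsub (A : Finset ι) {f : Vec κ → Gr σ} {a : κ → Gr ι} {b : σ → Gr ι}
  (hf : SmAt f (bod a)) (ha : Evens a) (hb : Odds b) :
  euler A (gsub f a b) = ∑ c, euler A (a c) * gsub (pd c f) a b +
      ∑ s, euler A (b s) * gsub (fun q => dLeft s (f q)) a b :=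
  derivation_gsub (EvenDer.euler A) 1 (fun x _ y => by rw [one_smul, euler_mul]) hf ha hb
    (fun s t => by rw [one_smul, odd_anticomm (hb s) (euler_mem_pty A (hb t))])

lemma gsub_taylor {A : Vec κ → κ' → Gr σ} {a : κ → Gr ι} {b : σ → Gr ι}
  (hA : ∀ c, SmAt (fun q => A q c) (bod a)) (hA0 : ∀ᶠ q in 𝓝 (bod a), ∀ c, A q c ∈ pty σ 0)
  (ha : Evens a) (hb : Odds b) {h : Vec κ' → ℝ}
  (hh : SmAt h (bod (A (bod a)))) :
  gsub (fun q => taylor h (A q)) a b = taylor h (fun c => gsub (fun q => A q c) a b) := by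
  have hg0 : ∀ c, gsub (fun q => A q c) a b ∈ pty ι 0 := fun c =>
    gsub_mem_pty (hA c) (hA0.mono fun q hq => hq c) ha hb
  have hbod : bod (fun c => gsub (fun q => A q c) a b) = bod (A (bod a)) := by
    ext c; exact body_gsub (hA c) hb
  rw [← sub_eq_zero]
  refine eq_zero_of_step (fun h : Vec κ' → ℝ => SmAt h (bod (A (bod a))))
    (fun h => gsub (fun q => taylor h (A q)) a b -
      taylor h (fun c => gsub (fun q => A q c) a b)) ?_ ?_ h hh
  · intro h hh
    rw [map_sub, body_gsub (SmAt.taylor hA hh) hb, body_taylor hh,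
      body_taylor (a := fun c => gsub (fun q => A q c) a b) (by rwa [hbod]), hbod, sub_self]
  · intro r ih h hh
    have hD := EvenDer.euler (Finset.univ : Finset ι)
    have hT : ∀ d, SmAt (fun q => Worm.taylor (pd d h) (A q)) (bod a) := fun d =>
      SmAt.taylor hA (hh.pd d)
    have e1 : ∀ c, gsub (pd c fun q => taylor h (A q)) a b =
        ∑ d, gsub (pd c fun q => A q d) a b * gsub (fun q => taylor (pd d h) (A q)) a b := by
      intro c
      have : (pd c fun q => taylor h (A q)) =ᶠ[𝓝 (bod a)]
          fun q => ∑ d, pd c (fun q => A q d) q * taylor (pd d h) (A q) := by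
        filter_upwards [(eventually_all.mpr fun d => (hA d).eventually), hA0.eventually_nhds,
          SmAt.eventually_bod hA hh.eventually] with q h1 h2 h3
        exact fderiv_taylor h1 h2 h3 _
      have hs : ∀ d ∈ (Finset.univ : Finset κ'), SmAt
          (fun q => pd c (fun q => A q d) q * taylor (pd d h) (A q)) (bod a) :=
        fun d _ => ((hA d).pd c).mul (hT d)
      rw [gsub_congr (SmAt.sum hs) this, gsub_sum b hs]
      exact sum_congr rfl fun d _ => gsub_mul ((hA d).pd c) (hT d) ha hb
    have e2 : ∀ s, gsub (fun q => dLeft s (taylor h (A q))) a b =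
        ∑ d, gsub (fun q => dLeft s (A q d)) a b * gsub (fun q => taylor (pd d h) (A q)) a b := by
      intro s
      have : (fun q => dLeft s (taylor h (A q))) =ᶠ[𝓝 (bod a)]
          fun q => ∑ d, dLeft s (A q d) * taylor (pd d h) (A q) := by
        filter_upwards [hA0, SmAt.eventually_bod hA hh.eventually] with q h2 h3
        exact derivation_taylor (EvenDer.dLeft s) h2 h3
      have hs : ∀ d ∈ (Finset.univ : Finset κ'), SmAt
          (fun q => dLeft s (A q d) * taylor (pd d h) (A q)) (bod a) :=
        fun d _ => ((hA d).linear (dLeft s)).mul (hT d)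
      rw [gsub_congr (SmAt.sum hs) this, gsub_sum b hs]
      exact sum_congr rfl fun d _ => gsub_mul ((hA d).linear (dLeft s)) (hT d) ha hb
    have e : euler Finset.univ (gsub (fun q => taylor h (A q)) a b -
        taylor h (fun c => gsub (fun q => A q c) a b)) =
        ∑ d, euler Finset.univ (gsub (fun q => A q d) a b) *
          (gsub (fun q => taylor (pd d h) (A q)) a b -
            taylor (pd d h) (fun c => gsub (fun q => A q c) a b)) := by
      rw [map_sub, derivation_taylor hD hg0 (by rwa [hbod]),
        euler_gsub _ (SmAt.taylor hA hh) ha hb]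
      simp_rw [mul_sub, sum_sub_distrib]
      congr 1
      simp_rw [e1, e2, euler_gsub _ (hA _) ha hb, add_mul, sum_add_distrib, sum_mul,
        mul_sum, mul_assoc]
      rw [sum_comm, sum_comm (s := (Finset.univ : Finset σ))]
    simp only [e]
    refine Submodule.sum_mem _ fun d _ => ?_
    rw [add_comm r]
    exact fil_mul (euler_mem_fil_one _ _) (ih _ (hh.pd d))

lemma SmAt.ordProd {τ : Type}
  [LinearOrder τ] {B : E → τ → Gr ι} {p : E} (hB : ∀ s, SmAt (fun q => B q s) p)
  (S : Finset τ) : SmAt (fun q => ordProd S (B q)) p := by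
  induction S using induction_on_min with
  | empty => simp only [ordProd_empty]; exact SmAt.const _ _
  | insert s S hs ih => simp only [ordProd_insert_min _ hs]; exact (hB s).mul ih

lemma SmAt.gsub {f : Vec κ → Gr σ}
  {A : E → κ → Gr ι} {B : E → σ → Gr ι} {p : E} (hA : ∀ c, SmAt (fun q => A q c) p)
  (hB : ∀ s, SmAt (fun q => B q s) p) (hf : SmAt f (bod (A p))) :
  SmAt (fun q => gsub f (A q) (B q)) p :=
  SmAt.sum fun S _ => (SmAt.taylor hA (hf.coeff S)).mul (SmAt.ordProd hB S)

lemma gsub_gsub {f : Vec κ' → Gr σ'} {A : Vec κ → κ' → Gr σ} {B : Vec κ → σ' → Gr σ}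
  {a : κ → Gr ι} {b : σ → Gr ι}
  (hA : ∀ c, SmAt (fun q => A q c) (bod a)) (hA0 : ∀ᶠ q in 𝓝 (bod a), ∀ c, A q c ∈ pty σ 0)
  (hB : ∀ s, SmAt (fun q => B q s) (bod a))
  (ha : Evens a) (hb : Odds b) (hf : SmAt f (bod (A (bod a)))) :
  gsub (fun q => gsub f (A q) (B q)) a b =
      gsub f (fun c => gsub (fun q => A q c) a b) (fun s => gsub (fun q => B q s) a b) := by
  have h1 : ∀ S, SmAt (fun q => taylor (fun y => coeff S (f y)) (A q)) (bod a) := fun S =>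
    SmAt.taylor hA (hf.coeff S)
  change gsub (fun q => ∑ S, taylor (fun y => coeff S (f y)) (A q) * ordProd S (B q)) a b = _
  rw [gsub_sum b (fun S _ => (h1 S).mul (SmAt.ordProd hB S))]
  refine sum_congr rfl fun S _ => ?_
  rw [gsub_mul (h1 S) (SmAt.ordProd hB S) ha hb, gsub_taylor hA hA0 ha hb (hf.coeff S),
    (gsub_ordProd hB ha hb S).2]

lemma gsub_add_single_even {f : Vec κ → Gr σ} {a : κ → Gr ι} (b : σ → Gr ι)
  (hf : SmAt f (bod a)) (ha : Evens a) {η : Gr ι} (hη : η ∈ pty ι 0)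
  (h0 : body η = 0) {N : ℕ} (hN : η ^ N = 0) (k : κ) :
  gsub f (fun c => a c + (Pi.single k η : κ → Gr ι) c) b =
      ∑ j ∈ Finset.range (N + 1), ((j.factorial : ℝ)⁻¹) • (η ^ j * gsub ((pd k)^[j] f) a b) := by
  have hit : ∀ (j : ℕ) {f : Vec κ → Gr σ}, SmAt f (bod a) → ∀ S : Finset σ,
      SmAt ((pd k)^[j] f) (bod a) ∧ (fun q => coeff S ((pd k)^[j] f q)) =ᶠ[𝓝 (bod a)]
        (pd k)^[j] (fun q => coeff S (f q)) := by
    intro j; induction j with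
    | zero => exact fun hf S => ⟨hf, EventuallyEq.rfl⟩
    | succ j ih =>
      intro f hf S
      refine ⟨(ih (hf.pd k) S).1, (ih (hf.pd k) S).2.trans ?_⟩
      have hcg : ∀ (i : ℕ) {f g : Vec κ → ℝ}, f =ᶠ[𝓝 (bod a)] g →
          (pd k)^[i] f =ᶠ[𝓝 (bod a)] (pd k)^[i] g := by
        intro i; induction i with
        | zero => exact fun e => e
        | succ i ih => exact fun e => ih (pd_congr e k)
      exact hcg j (coeff_pd hf S k)
  simp only [gsub]
  simp_rw [taylor_add_single ha hη h0 hN k (hf.coeff _), sum_mul, mul_sum,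
    smul_sum]
  rw [sum_comm]
  refine sum_congr rfl fun j _ => sum_congr rfl fun S _ => ?_
  have hs : SmAt ((pd k)^[j] fun q => coeff S (f q)) (bod a) :=
    ((hit j hf S).1.coeff S).congr (hit j hf S).2.symm
  rw [taylor_congr hs (hit j hf S).2, smul_mul_assoc, mul_assoc]

lemma gsub_add_single_odd {f : Vec κ → Gr σ} {a : κ → Gr ι} {b : σ → Gr ι}
  (hf : SmAt f (bod a)) (ha : Evens a) (hb : Odds b) {γ : Gr ι}
  (hγ : γ ∈ pty ι 1) (k : σ) :
  gsub f a (fun s => b s + (Pi.single k γ : σ → Gr ι) s) =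
      gsub f a b + γ * gsub (fun q => dLeft k (f q)) a b := by
  have hb' : ∀ s, b s + (Pi.single k γ : σ → Gr ι) s ∈ pty ι 1 := by
    intro s
    refine Submodule.add_mem _ (hb s) ?_
    by_cases h : s = k
    · subst h; simpa
    · simp [h]
  rw [gsub_eq_lam _ _ hb', gsub_eq_lam _ _ hb, gsub_linear hf ha hb (dLeft k), mul_sum,
    ← sum_add_distrib]
  refine sum_congr rfl fun S _ => ?_
  have hS := taylor_mem_pty (hf.coeff S) ha
  rw [lam_add_single b hb k hγ hb', mul_add, ← mul_assoc, (even_commute hS γ).eq, mul_assoc]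

end

/-! ### Renaming of generators -/

section

variable {ι' : Type}
  [Fintype ι'] [LinearOrder ι']

lemma map_mem_pty [d : DecidableEq σ] {Λ : Gr σ →ₐ[ℝ] Gr ι} (h : ∀ s, Λ (gen s) ∈ pty ι 1) {i : ZMod 2} {x : Gr σ}
  (hx : x ∈ pty σ i) : Λ x ∈ pty ι i := by
  rw [← sum_coeff_mon x, map_sum]
  refine Submodule.sum_mem _ fun S _ => ?_
  by_cases hS : (S.card : ZMod 2) = i
  · rw [map_smul, mon_eq_ordProd (d := d), map_ordProd]
    exact Submodule.smul_mem _ _ (hS ▸ ordProd_mem_pty S fun s _ => h s)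
  · rw [coeff_eq_zero_of_mem_pty hx hS, zero_smul, map_zero]
    exact Submodule.zero_mem _

lemma gr_hom_ext [d : DecidableEq σ] {A : Type} [Semiring A] [Algebra ℝ A] {Λ Λ' : Gr σ →ₐ[ℝ] A}
  (h : ∀ s, Λ (gen s) = Λ' (gen s)) : Λ = Λ' := by
  have : Λ.toLinearMap = Λ'.toLinearMap := linearMap_ext_mon fun S => by
    simp only [AlgHom.toLinearMap_apply, mon_eq_ordProd (d := d), map_ordProd, h]
  exact AlgHom.ext fun x => LinearMap.congr_fun this x

lemma body_map [DecidableEq σ] {Λ : Gr σ →ₐ[ℝ] Gr ι} (h : ∀ s, Λ (gen s) ∈ pty ι 1) (x : Gr σ) :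
  body (Λ x) = body x := by
  suffices h : body.comp Λ = body from AlgHom.congr_fun h x
  exact gr_hom_ext fun s => by rw [AlgHom.comp_apply, body_odd (h s), body_gen]

lemma rename_gen [DecidableEq σ] [DecidableEq ι] {f : σ → ι} (hf : Function.Injective f) (s : σ) :
  rename f (gen s) = gen (f s) := by
  rw [rename, gen, ExteriorAlgebra.map_apply_ι, gen]
  congr 1
  ext i
  rw [Function.ExtendByZero.linearMap_apply]
  by_cases h : ∃ t, f t = i
  · obtain ⟨t, rfl⟩ := h
    rw [hf.extend_apply]
    simp [Pi.single_apply, hf.eq_iff]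
  · rw [Function.extend_apply' _ _ _ h, Pi.single_apply, if_neg]
    · rfl
    · rintro rfl; exact h ⟨s, rfl⟩

lemma rename_mem_pty {f : σ → ι} (hf : Function.Injective f) {i : ZMod 2} {x : Gr σ}
  (hx : x ∈ pty σ i) : rename f x ∈ pty ι i :=
  map_mem_pty (fun s => by rw [rename_gen hf]; exact gen_mem_pty _) hx

lemma body_rename {f : σ → ι} (hf : Function.Injective f) (x : Gr σ) :
  body (rename f x) = body x :=
  body_map (fun s => by rw [rename_gen hf]; exact gen_mem_pty _) x

lemma ordProd_map {A : Type} [Monoid A] {f : σ ↪ ι} (hf : StrictMono f) (S : Finset σ)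
  (v : ι → A) : ordProd (S.map f) v = ordProd S (fun s => v (f s)) := by
  induction S using induction_on_min with
  | empty => simp [ordProd_empty]
  | insert a S ha ih =>
    rw [Finset.map_insert, ordProd_insert_min _ ha, ordProd_insert_min, ih]
    intro x hx
    obtain ⟨y, hy, rfl⟩ := Finset.mem_map.mp hx
    exact hf (ha y hy)

lemma rename_mon {f : σ ↪ ι} (hf : StrictMono f) (S : Finset σ) :
  rename f (mon S) = (mon (S.map f) : Gr ι) := by
  rw [mon_eq_ordProd, mon_eq_ordProd, map_ordProd, ordProd_map hf]
  simp only [rename_gen f.injective]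

lemma map_rename [DecidableEq σ] [DecidableEq ι] {f : σ → ι} (hf : Function.Injective f) (Λ : Gr ι →ₐ[ℝ] Gr ι')
  {Λ' : Gr σ →ₐ[ℝ] Gr ι'} (h : ∀ s, Λ (gen (f s)) = Λ' (gen s)) (x : Gr σ) :
  Λ (rename f x) = Λ' x := by
  suffices e : Λ.comp (rename f) = Λ' from AlgHom.congr_fun e x
  exact gr_hom_ext fun s => by rw [AlgHom.comp_apply, rename_gen hf, h]

lemma gsub_rename {r : σ → ι} (hr : Function.Injective r) {f : Vec κ → Gr σ} {a : κ → Gr ι'}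
  {b : ι → Gr ι'} (hf : SmAt f (bod a)) (ha : ∀ c, a c ∈ pty ι' 0) (hb : ∀ s, b s ∈ pty ι' 1) :
  gsub (fun q => rename r (f q)) a b = gsub f a (fun s => b (r s)) := by
  have h := gsub_linear hf ha hb (rename r).toLinearMap
  simp only [AlgHom.toLinearMap_apply] at h
  rw [h, gsub_eq_lam f a (fun s => hb (r s))]
  refine sum_congr rfl fun S _ => ?_
  rw [map_rename hr (lam b hb) (Λ' := lam (fun s => b (r s)) _)]
  intro s
  rw [lam_gen, lam_gen]

end

/-! ### Expansion in the first group of generators -/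

/-- The inclusion of the first group of generators. -/
def inlE (n : ℕ) (g : Type) : Fin n ↪ WithTheta n g := ⟨fun a => toLex (Sum.inl a), fun _ _ h =>
  Sum.inl_injective (toLex.injective h)⟩

/-- The inclusion of the second group of generators. -/
def inrE (n : ℕ) (g : Type) : g ↪ WithTheta n g := ⟨fun a => toLex (Sum.inr a), fun _ _ h =>
  Sum.inr_injective (toLex.injective h)⟩

lemma inlE_strictMono : StrictMono (inlE n g) := fun _ _ h => Sum.Lex.inl_lt_inl_iff.mpr h

lemma inrE_strictMono : StrictMono (inrE n g) := fun _ _ h => Sum.Lex.inr_lt_inr_iff.mpr h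

/-- The inclusion of the Grassmann algebra on the second group of generators. -/
abbrev inr (n : ℕ) (g : Type) : Gr g →ₐ[ℝ] Gr (WithTheta n g) := rename (inrE n g)

/-- The monomial of a set of generators of the first group. -/
def tm (g : Type) [Fintype g] [LinearOrder g] (I : Ix n) : Gr (WithTheta n g) :=
  rename (inlE n g) (mon I)

/-- The union of sets of generators of the two groups. -/
abbrev jm (I : Ix n) (S : Finset g) : Finset (WithTheta n g) :=
  (I.disjSum S).map toLex.toEmbedding

/-- Sets of generators are pairs of sets of generators in the two groups. -/
def jmEquiv (n : ℕ) (g : Type) [Fintype g] [LinearOrder g] :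
  Ix n × Finset g ≃ Finset (WithTheta n g) :=
  Finset.sumEquiv.symm.toEquiv.trans (Equiv.finsetCongr toLex)

lemma jmEquiv_apply (I : Ix n) (S : Finset g) : jmEquiv n g (I, S) = jm I S := rfl

lemma jm_inj {I J : Ix n} {S T : Finset g} : jm I S = jm J T ↔ I = J ∧ S = T := by
  rw [← jmEquiv_apply, ← jmEquiv_apply, (jmEquiv n g).injective.eq_iff, Prod.mk.injEq]

lemma card_jm (I : Ix n) (S : Finset g) : (jm I S).card = I.card + S.card := by
  simp [jm]

lemma mem_jm {I : Ix n} {S : Finset g} {x : WithTheta n g} :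
  x ∈ jm I S ↔ ofLex x ∈ I.disjSum S := by
  constructor
  · intro h
    obtain ⟨y, hy, rfl⟩ := Finset.mem_map.mp h
    exact hy
  · exact fun h => Finset.mem_map.mpr ⟨_, h, rfl⟩

lemma mon_jm (I : Ix n) (S : Finset g) :
  (mon (jm I S) : Gr (WithTheta n g)) = tm g I * inr n g (mon S) := by
  induction I using induction_on_min with
  | empty =>
    rw [tm, mon_empty, map_one, one_mul, inr, rename_mon inrE_strictMono]
    congr 1
    ext x
    rw [mem_jm]
    rcases x with a | b
    · refine ⟨fun h => ?_, fun h => ?_⟩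
      · simpa using inl_mem_disjSum.mp h
      · obtain ⟨y, _, hy⟩ := Finset.mem_map.mp h; cases hy
    · refine ⟨fun h => Finset.mem_map.mpr ⟨b, inr_mem_disjSum.mp h, rfl⟩, fun h => ?_⟩
      obtain ⟨y, hy, e⟩ := Finset.mem_map.mp h
      cases e
      exact inr_mem_disjSum.mpr hy
  | insert a I ha ih =>
    have e : jm (insert a I) S = insert (inlE n g a) (jm I S) := by
      ext x
      rw [Finset.mem_insert, mem_jm, mem_jm]
      rcases x with c | b
      · refine ⟨fun h => ?_, fun h => inl_mem_disjSum.mpr ?_⟩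
        · rcases Finset.mem_insert.mp (inl_mem_disjSum.mp h) with rfl | h
          · exact Or.inl rfl
          · exact Or.inr (inl_mem_disjSum.mpr h)
        · rcases h with h | h
          · cases h; exact Finset.mem_insert_self _ _
          · exact Finset.mem_insert_of_mem (inl_mem_disjSum.mp h)
      · refine ⟨fun h => Or.inr (inr_mem_disjSum.mpr (inr_mem_disjSum.mp h)),
          fun h => inr_mem_disjSum.mpr ?_⟩
        rcases h with h | h
        · cases h
        · exact inr_mem_disjSum.mp h
    rw [e, mon_insert_min (ι := WithTheta n g), ih, tm, tm, mon_insert_min ha, map_mul, rename_gen (inlE n g).injective,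
      mul_assoc]
    intro x hx
    obtain ⟨y, hy, rfl⟩ := Finset.mem_map.mp hx
    rcases Finset.mem_disjSum.mp hy with ⟨b, hb, rfl⟩ | ⟨b, hb, rfl⟩
    · exact inlE_strictMono (ha b hb)
    · exact Sum.Lex.inl_lt_inr _ _

lemma tm_eq_ordProd (I : Ix n) : tm g I = ordProd I (fun a => gen (inlE n g a)) := by
  rw [tm, mon_eq_ordProd, map_ordProd]; simp only [rename_gen (inlE n g).injective]

lemma tm_mem_pty (I : Ix n) : tm g I ∈ pty (WithTheta n g) (I.card : ZMod 2) :=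
  rename_mem_pty (inlE n g).injective (mon_mem_pty I)

/-- The expansion coefficient as a linear map. -/
def thetaL (I : Ix n) : Gr (WithTheta n g) →ₗ[ℝ] Gr g :=
  ∑ S : Finset g, (coeff (jm I S)).smulRight (mon S)

lemma thetaL_apply (I : Ix n) (w : Gr (WithTheta n g)) :
  thetaL I w = thetaPart I w := by
  simp [thetaL, thetaPart, LinearMap.sum_apply]

lemma coeff_thetaPart (I : Ix n) (S : Finset g) (w : Gr (WithTheta n g)) :
  coeff S (thetaPart I w) = coeff (jm I S) w := by
  simp [thetaPart, coeff_mon]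

lemma thetaPart_tm_mul (I J : Ix n) (y : Gr g) :
  thetaPart I (tm g J * inr n g y) = if I = J then y else 0 := by
  have : thetaL I ∘ₗ LinearMap.mulLeft ℝ (tm g J) ∘ₗ (inr n g).toLinearMap =
      if I = J then LinearMap.id else 0 := by
    refine linearMap_ext_mon fun S => gr_ext fun T => ?_
    rw [LinearMap.comp_apply, LinearMap.comp_apply, thetaL_apply, coeff_thetaPart,
      AlgHom.toLinearMap_apply, LinearMap.mulLeft_apply, ← mon_jm, coeff_mon]
    simp only [jm_inj]
    split_ifs with h1 h2 h2 <;> simp_all [coeff_mon]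
  have h := LinearMap.congr_fun this y
  rw [← thetaL_apply]
  simp only [LinearMap.comp_apply, LinearMap.mulLeft_apply, AlgHom.toLinearMap_apply] at h
  rw [h]; split_ifs <;> rfl

lemma sum_thetaPart (w : Gr (WithTheta n g)) :
  ∑ I : Ix n, tm g I * inr n g (thetaPart I w) = w := by
  conv_rhs => rw [← sum_coeff_mon w, ← (jmEquiv n g).sum_comp, Fintype.sum_prod_type]
  refine sum_congr rfl fun I _ => ?_
  rw [thetaPart, map_sum, mul_sum]
  refine sum_congr rfl fun S _ => ?_
  rw [map_smul, mul_smul_comm, ← mon_jm]; rfl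

lemma thetaPart_mem_pty {i : ZMod 2} {w : Gr (WithTheta n g)} (hw : w ∈ pty _ i)
  (I : Ix n) : thetaPart I w ∈ pty g (i + (I.card : ZMod 2)) := by
  refine mem_pty_of_coeff fun S hS => ?_
  rw [coeff_thetaPart]
  refine coeff_eq_zero_of_mem_pty hw ?_
  rw [card_jm]; push_cast
  intro h; apply hS; rw [← h]
  generalize (I.card : ZMod 2) = a; generalize (S.card : ZMod 2) = b
  revert a b; decide

lemma thetaPart_inl_mul (K : Ix n) (u : Gr (Fin n)) (w : Gr (WithTheta n g)) :
  thetaPart K (rename (inlE n g) u * w) =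
      ∑ I, coeff K (u * mon I) • thetaPart I w := by
  conv_lhs => rw [← sum_thetaPart w, mul_sum, ← thetaL_apply, map_sum]
  refine sum_congr rfl fun I _ => ?_
  rw [← mul_assoc, tm, ← map_mul, ← sum_coeff_mon (u * mon I), map_sum, sum_mul, map_sum,
    sum_eq_single K]
  · rw [map_smul, smul_mul_assoc, map_smul, thetaL_apply, ← tm, thetaPart_tm_mul, if_pos rfl,
      sum_coeff_mon]
  · intro U _ hU
    rw [map_smul, smul_mul_assoc, map_smul, thetaL_apply, ← tm, thetaPart_tm_mul, if_neg hU.symm,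
      smul_zero]
  · simp

lemma thetaPart_tm_mul_of_not_subset {J K : Ix n} (h : ¬ J ⊆ K)
  (w : Gr (WithTheta n g)) : thetaPart K (tm g J * w) = 0 := by
  rw [tm, thetaPart_inl_mul]
  refine sum_eq_zero fun I _ => ?_
  by_cases hc : coeff K (mon J * mon I) = 0
  · rw [hc, zero_smul]
  · exact absurd ((coeff_mon_mul_mon hc).2 ▸ Finset.subset_union_left) h

lemma thetaPart_tm_mul_self (J : Ix n) (w : Gr (WithTheta n g)) :
  thetaPart J (tm g J * w) = thetaPart ∅ w := by
  rw [tm, thetaPart_inl_mul, sum_eq_single ∅]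
  · rw [mon_empty, mul_one, coeff_mon, if_pos rfl, one_smul]
  · intro I _ hI
    by_cases hc : coeff J (mon J * mon I) = 0
    · rw [hc, zero_smul]
    · obtain ⟨h1, h2⟩ := coeff_mon_mul_mon hc
      have h3 : I ⊆ J := by rw [h2]; exact Finset.subset_union_right
      exact absurd (Finset.disjoint_self_iff_empty _ |>.mp
        (Finset.disjoint_of_subset_left h3 h1)) hI
  · simp

lemma thetaPart_mul_inr (K : Ix n) (w : Gr (WithTheta n g)) (y : Gr g) :
  thetaPart K (w * inr n g y) = thetaPart K w * y := by
  conv_lhs => rw [← sum_thetaPart w, sum_mul, ← thetaL_apply, map_sum]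
  rw [sum_eq_single K]
  · rw [mul_assoc, ← map_mul, thetaL_apply, thetaPart_tm_mul, if_pos rfl]
  · intro I _ hI
    rw [mul_assoc, ← map_mul, thetaL_apply, thetaPart_tm_mul, if_neg hI.symm]
  · simp

/-- Setting the first group of generators to zero. -/
def killTheta (n : ℕ) (g : Type) [Fintype g] [LinearOrder g] : Gr (WithTheta n g) →ₐ[ℝ] Gr g :=
  lam (fun s => Sum.elim (fun _ => 0) gen (ofLex s)) (fun s => by
    rcases s with a | a
    · exact Submodule.zero_mem _
    · exact gen_mem_pty a)

lemma killTheta_inl (a : Fin n) : killTheta n g (gen (inlE n g a)) = 0 := by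
  rw [killTheta, lam_gen]; rfl

lemma killTheta_inr (x : Gr g) : killTheta n g (inr n g x) = x := by
  rw [inr, map_rename (inrE n g).injective _ (Λ' := AlgHom.id ℝ _)]
  · rfl
  · intro s; rw [killTheta, lam_gen]; rfl

lemma thetaPart_empty (w : Gr (WithTheta n g)) : thetaPart ∅ w = killTheta n g w := by
  conv_rhs => rw [← sum_thetaPart w, map_sum]
  rw [sum_eq_single ∅]
  · rw [tm, mon_empty, map_one, one_mul, killTheta_inr]
  · intro I _ hI
    have hne := Finset.nonempty_iff_ne_empty.mpr hI
    have hmin : I = insert (I.min' hne) (I.erase (I.min' hne)) :=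
      (Finset.insert_erase (I.min'_mem _)).symm
    generalize hJ : I.erase (I.min' hne) = J at hmin
    rw [map_mul, hmin, tm, mon_insert_min, map_mul, rename_gen (inlE n g).injective, map_mul,
      killTheta_inl, zero_mul, zero_mul]
    intro x hx
    rw [← hJ, mem_erase] at hx
    exact lt_of_le_of_ne (I.min'_le x hx.2) hx.1.symm
  · simp

lemma body_killTheta (w : Gr (WithTheta n g)) : body (killTheta n g w) = body w :=
  body_map (fun s => by
    rw [killTheta, lam_gen]
    rcases s with a | a
    · exact Submodule.zero_mem _
    · exact gen_mem_pty a) w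

lemma body_thetaPart_empty (w : Gr (WithTheta n g)) : body (thetaPart ∅ w) = body w := by
  rw [thetaPart_empty, body_killTheta]

/-- Extension of odd elements by the generators of the first group. -/
def extOdd (n : ℕ) {σ : Type} (b : σ → Gr ι) : WithTheta n σ → Gr (WithTheta n ι) :=
  fun s => Sum.elim (fun a => gen (inlE n ι a)) (fun s => inr n ι (b s)) (ofLex s)

lemma extOdd_mem_pty {σ : Type} {b : σ → Gr ι} (hb : Odds b) (s : WithTheta n σ) :
  extOdd n b s ∈ pty (WithTheta n ι) 1 := by
  rcases s with a | a
  · exact gen_mem_pty _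
  · exact rename_mem_pty (inrE n ι).injective (hb a)

lemma SmAt.thetaPart
  {f : E → Gr (WithTheta n g)} {p : E} (hf : SmAt f p) (I : Ix n) :
  SmAt (fun q => thetaPart I (f q)) p := by
  simp only [← thetaL_apply]; exact SmAt.linear (A := Gr (WithTheta n g)) (thetaL I) hf

lemma bod_inr {κ : Type} (a : κ → Gr ι) : bod (fun c => inr n ι (a c)) = bod a := by
  ext c; exact body_rename (inrE n ι).injective _

lemma gsub_extOdd {f : Vec κ → Gr (WithTheta n g)}
  {a : κ → Gr ι} {b : g → Gr ι} (hf : SmAt f (bod a)) (ha : Evens a)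
  (hb : Odds b) (K : Ix n) :
  thetaPart K (gsub f (fun c => inr n ι (a c)) (extOdd n b)) =
      gsub (fun q => thetaPart K (f q)) a b := by
  have hb' := extOdd_mem_pty (n := n) hb
  have ha' : ∀ c, inr n ι (a c) ∈ pty (WithTheta n ι) 0 := fun c =>
    rename_mem_pty (inrE n ι).injective (ha c)
  have hf' : SmAt f (bod fun c => inr n ι (a c)) := by rwa [bod_inr]
  have h1 : f = fun q => ∑ I : Ix n, tm g I * inr n g (thetaPart I (f q)) := by
    ext q; exact (sum_thetaPart _).symm
  have hs : ∀ I, SmAt (fun q => inr n g (thetaPart I (f q))) (bod fun c => inr n ι (a c)) :=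
    fun I => SmAt.linear (A := Gr g) (inr n g).toLinearMap (hf'.thetaPart I)
  conv_lhs => rw [h1]
  rw [gsub_sum (σ := WithTheta n g) _ (fun I _ => (SmAt.const _ _).mul (hs I)), ← thetaL_apply, map_sum]
  have h2 : ∀ I, gsub (fun q => tm g I * inr n g (thetaPart I (f q)))
      (fun c => inr n ι (a c)) (extOdd n b) =
      tm ι I * inr n ι (gsub (fun q => thetaPart I (f q)) a b) := by
    intro I
    rw [gsub_mul (σ := WithTheta n g) (f := fun _ => tm g I) (SmAt.const (tm g I) _) (hs I) ha' hb',
      gsub_const (σ := WithTheta n g) (tm g I) _ hb']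
    congr 1
    · rw [tm, map_rename (inlE n g).injective _ (Λ' := rename (inlE n ι))]; rfl
      intro a; rw [lam_gen, rename_gen (inlE n ι).injective]; rfl
    · rw [gsub_rename (inrE n g).injective (hf'.thetaPart I) ha' hb',
        map_gsub (inr n ι) (body_rename (inrE n ι).injective) (hf.thetaPart I)]
      rfl
  simp_rw [h2]
  rw [sum_eq_single K]
  · rw [thetaL_apply, thetaPart_tm_mul, if_pos rfl]
  · intro I _ hI; rw [thetaL_apply, thetaPart_tm_mul, if_neg hI.symm]
  · simp

/-! ### Coordinates on the space of maps -/

section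

/-- The even coordinates of a point with values in a Grassmann algebra. -/
abbrev evn (Z : Crd m n ι) : EvenIdx m n → Gr ι := fun c => Z c.1.1 c.1.2

/-- The parameters and the odd coordinates of a point with values in a Grassmann algebra. -/
abbrev odn (t : Fin L → Gr ι) (Z : Crd m n ι) : Par L m n → Gr ι :=
  fun s => Sum.elim t (fun c : OddIdx m n => Z c.1.1 c.1.2) (ofLex s)

lemma substitute_eq (f : SFun L m n) (t : Fin L → Gr ι) (Z : Crd m n ι) :
  substitute f t Z = gsub f (evn Z) (odn t Z) := rfl

/-- Coordinates of the correct parity. -/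
def Adm (Z : Crd m n ι) : Prop := ∀ i I, Z i I ∈ pty ι (I.card : ZMod 2)

lemma even_cast {k : ℕ} (h : Even k) : (k : ZMod 2) = 0 := (ZMod.natCast_eq_zero_iff_even).2 h

lemma odd_cast {k : ℕ} (h : ¬ Even k) : (k : ZMod 2) = 1 :=
  (ZMod.natCast_eq_one_iff_odd).2 (Nat.not_even_iff_odd.1 h)

lemma Adm.evn {Z : Crd m n ι} (h : Adm Z) (c : EvenIdx m n) :
  evn Z c ∈ pty ι 0 := by
  have := h c.1.1 c.1.2; rwa [even_cast c.2] at this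

lemma Adm.odn {Z : Crd m n ι} (h : Adm Z) {t : Fin L → Gr ι}
  (ht : Odds t) (s : Par L m n) : odn t Z s ∈ pty ι 1 := by
  rcases s with a | c
  · exact ht a
  · have := h c.1.1 c.1.2
    rwa [odd_cast c.2] at this

lemma adm_coordFun (p : Pt m n) : Adm (coordFun (L := L) p) := by
  intro i I
  unfold coordFun
  split_ifs with h
  · rw [even_cast h]; exact algebraMap_mem_pty _
  · rw [odd_cast h]; exact gen_mem_pty _

lemma body_coordFun (p : Pt m n) (c : EvenIdx m n) :
  body (coordFun (L := L) p c.1.1 c.1.2) = p c := by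
  unfold coordFun
  rw [dif_pos c.2, body_algebraMap]

lemma smAt_coordFun (i : Fin m) (I : Ix n) (p : Pt m n) :
  SmAt (fun q => coordFun (L := L) q i I) p := by
  unfold coordFun
  split_ifs with h
  · exact SmAt.algebraMap (smAt_of_contDiff (contDiff_apply ℝ ℝ _) _)
  · exact SmAt.const _ _

lemma gsub_coordFun {Z : Crd m n ι} (hZ : Adm Z) {t : Fin L → Gr ι}
  (ht : Odds t) (i : Fin m) (I : Ix n) :
  gsub (fun q => coordFun (L := L) q i I) (evn Z) (odn t Z) = Z i I := by
  unfold coordFun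
  split_ifs with h
  · exact gsub_coord _ hZ.evn _
  · rw [gsub_gen _ _ (hZ.odn ht)]; rfl

lemma gsub_parL {Z : Crd m n ι} (hZ : Adm Z) {t : Fin L → Gr ι}
  (ht : Odds t) (a : Fin L) :
  gsub (fun _ => gen (parL (m := m) (n := n) a)) (evn Z) (odn t Z) = t a := by
  rw [gsub_gen _ _ (hZ.odn ht)]; rfl

lemma gsub_id (f : SFun L m n) {p : Pt m n} (hf : SmAt f p) :
  gsub f (evn (coordFun p)) (odn (fun t => gen (parL t)) (coordFun p)) = f p := by
  have h1 : evn (coordFun (L := L) p) = fun c => algebraMap ℝ _ (p c) := by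
    ext c; simp only [evn, coordFun, dif_pos c.2]
  have h2 : odn (fun t => gen (parL t)) (coordFun (L := L) p) = gen := by
    ext s
    rcases s with a | c
    · rfl
    · simp only [odn]
      change coordFun p c.1.1 c.1.2 = _
      simp only [coordFun, dif_neg c.2]
      rfl
  rw [h1, h2]
  unfold gsub
  have : ∀ S : Finset (Par L m n), taylor (fun q => coeff S (f q))
      (fun c => algebraMap ℝ (Gr (Par L m n)) (p c)) * ordProd S gen = coeff S (f p) • mon S := by
    intro S
    rw [taylor_scalar (hf.coeff S), ← mon_eq_ordProd, Algebra.smul_def]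
  simp_rw [this]
  exact sum_coeff_mon _

lemma sgnRev_mul_self (I : Ix n) : sgnRev I * sgnRev I = 1 := by
  unfold sgnRev; rw [← mul_pow]; norm_num

lemma sgnRev_empty : sgnRev (∅ : Ix n) = 1 := by simp [sgnRev]

/-- The map with given Taylor coefficients. -/
def gcurve (Z : Crd m n ι) (i : Fin m) : Gr (WithTheta n ι) :=
  ∑ I : Ix n, sgnRev I • (tm ι I * inr n ι (Z i I))

lemma curve_gen [DecidableEq (WithTheta n ι)] (Z : Crd m n ι) (i : Fin m) :
  curve (fun a => gen (inlE n ι a)) (fun i I => inr n ι (Z i I)) i = gcurve Z i := by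
  unfold curve gcurve
  refine sum_congr rfl fun I _ => ?_
  rw [tm_eq_ordProd]
  congr 4
  ext a; exact congrFun (gen_inst _ _) _

lemma genericCurve_eq (p : Pt m n) (i : Fin m) :
  genericCurve (L := L) p i = gcurve (coordFun p) i := curve_gen _ _

lemma thetaPart_gcurve (Z : Crd m n ι) (i : Fin m) (K : Ix n) :
  thetaPart K (gcurve Z i) = sgnRev K • Z i K := by
  unfold gcurve
  rw [← thetaL_apply, map_sum, sum_eq_single K]
  · rw [map_smul, thetaL_apply, thetaPart_tm_mul, if_pos rfl]
  · intro I _ hI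
    rw [map_smul, thetaL_apply, thetaPart_tm_mul, if_neg hI.symm, smul_zero]
  · simp

lemma taylorCoeff_gcurve (Z : Crd m n ι) (i : Fin m) (K : Ix n) :
  taylorCoeff K (gcurve Z i) = Z i K := by
  rw [taylorCoeff, thetaPart_gcurve, smul_smul, sgnRev_mul_self, one_smul]

lemma theta_ext {w w' : Gr (WithTheta n ι)} (h : ∀ K, thetaPart K w = thetaPart K w') : w = w' := by
  rw [← sum_thetaPart w, ← sum_thetaPart w']
  simp_rw [h]

lemma gcurve_taylorCoeff (w : Fin m → Gr (WithTheta n ι)) (i : Fin m) :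
  gcurve (fun i I => taylorCoeff I (w i)) i = w i := by
  refine theta_ext fun K => ?_
  rw [thetaPart_gcurve, taylorCoeff, smul_smul, sgnRev_mul_self, one_smul]

lemma taylorCoeff_mem_pty {w : Gr (WithTheta n ι)} (hw : w ∈ pty _ 0) (K : Ix n) :
  taylorCoeff K w ∈ pty ι (K.card : ZMod 2) := by
  have := thetaPart_mem_pty hw K
  rw [zero_add] at this
  exact Submodule.smul_mem _ _ this

lemma gcurve_mem_pty {Z : Crd m n ι} (hZ : Adm Z) (i : Fin m) :
  gcurve Z i ∈ pty (WithTheta n ι) 0 := by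
  refine Submodule.sum_mem _ fun I _ => Submodule.smul_mem _ _ ?_
  have := pty_mul (tm_mem_pty (g := ι) I) (rename_mem_pty (inrE n ι).injective (hZ i I))
  rwa [CharTwo.add_self_eq_zero] at this

lemma body_gcurve (Z : Crd m n ι) (i : Fin m) :
  body (gcurve Z i) = body (Z i ∅) := by
  rw [← body_thetaPart_empty, thetaPart_gcurve, sgnRev_empty, one_smul]

lemma body_taylorCoeff_empty (w : Gr (WithTheta n ι)) : body (taylorCoeff ∅ w) = body w := by
  rw [taylorCoeff, sgnRev_empty, one_smul, body_thetaPart_empty]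

lemma SmAt.taylorCoeff
  {f : E → Gr (WithTheta n ι)} {p : E} (hf : SmAt f p) (I : Ix n) :
  SmAt (fun q => taylorCoeff I (f q)) p :=
  SmAt.linear (A := Gr ι) (sgnRev I • LinearMap.id) (hf.thetaPart I)

lemma SmAt.gcurve
  {Z : E → Crd m n ι} {p : E} (hZ : ∀ i I, SmAt (fun q => Z q i I) p)
  (i : Fin m) : SmAt (fun q => gcurve (Z q) i) p := by
  refine SmAt.sum fun I _ => SmAt.smul (SmAt.const _ _) (SmAt.mul (SmAt.const _ _) ?_)
  exact SmAt.linear (A := Gr ι) (inr n ι).toLinearMap (hZ i I)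

/-- The Taylor coefficients of the generic map composed with `ψ`. -/
def pcoord (L : ℕ) (ψ : Bs m → Bs m) (p : Pt m n) (i : Fin m)
  (I : Ix n) : Gr (Par L m n) :=
  taylorCoeff I (taylor (fun x => ψ x i) (gcurve (coordFun p)))

lemma pullAlong_eq (ψ : Bs m → Bs m) (f : SFun L m n) (p : Pt m n) :
  pullAlong ψ f p = gsub f (evn (pcoord L ψ p)) (odn (fun t => gen (parL t)) (pcoord L ψ p)) := by
  unfold pullAlong pcoord
  rw [substitute_eq]
  have : genericCurve (L := L) p = gcurve (coordFun p) := funext (genericCurve_eq p)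
  simp only [this]

lemma bod_gcurve_coordFun (p : Pt m n) :
  bod (gcurve (coordFun (L := L) p)) = baseOf p := by
  ext i
  exact (body_gcurve _ i).trans (body_coordFun p ⟨(i, ∅), by simp⟩)

variable {ψ : Bs m → Bs m} {p : Pt m n}

lemma adm_pcoord (hψ : ∀ i, SmAt (fun x => ψ x i) (baseOf p)) : Adm (pcoord L ψ p) := by
  intro i I
  refine taylorCoeff_mem_pty (taylor_mem_pty ?_ (gcurve_mem_pty (adm_coordFun p))) I
  rw [bod_gcurve_coordFun]; exact hψ i

lemma baseOf_bod_pcoord (hψ : ∀ i, SmAt (fun x => ψ x i) (baseOf p)) :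
  baseOf (bod (evn (pcoord L ψ p))) = ψ (baseOf p) := by
  ext i
  have h : SmAt (fun x => ψ x i) (bod (gcurve (coordFun (L := L) p))) := by
    rw [bod_gcurve_coordFun]; exact hψ i
  change body (taylorCoeff ∅ _) = _
  rw [body_taylorCoeff_empty, body_taylor h, bod_gcurve_coordFun]

lemma smAt_pcoord (hψ : ∀ i, SmAt (fun x => ψ x i) (baseOf p)) (i : Fin m)
  (I : Ix n) : SmAt (fun q => pcoord L ψ q i I) p := by
  refine SmAt.taylorCoeff (SmAt.taylor (fun j => SmAt.gcurve (fun i I => smAt_coordFun i I p) j) ?_) I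
  rw [bod_gcurve_coordFun]; exact hψ i

lemma gsub_gcurve_coordFun {Z : Crd m n ι} (hZ : Adm Z) {t : Fin L → Gr ι}
  (ht : Odds t) (i : Fin m) :
  gsub (fun q => gcurve (coordFun (L := L) q) i) (fun c => inr n ι (evn Z c))
      (extOdd n (odn t Z)) = gcurve Z i := by
  refine theta_ext fun K => ?_
  rw [gsub_extOdd (SmAt.gcurve (fun i I => smAt_coordFun i I _) i) hZ.evn (hZ.odn ht)]
  simp_rw [thetaPart_gcurve]
  rw [gsub_const_smul _ (smAt_coordFun _ _ _) hZ.evn (hZ.odn ht), gsub_coordFun hZ ht]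

lemma gsub_taylorCoeff
  {f : Vec κ → Gr (WithTheta n σ)}
  {a : κ → Gr ι} {b : σ → Gr ι} (hf : SmAt f (bod a)) (ha : Evens a)
  (hb : Odds b) (K : Ix n) :
  gsub (fun q => taylorCoeff K (f q)) a b =
      taylorCoeff K (gsub f (fun c => inr n ι (a c)) (extOdd n b)) := by
  unfold taylorCoeff
  rw [gsub_const_smul _ (hf.thetaPart K) ha hb, gsub_extOdd hf ha hb]

lemma gsub_pcoord {Z : Crd m n ι} (hZ : Adm Z) {t : Fin L → Gr ι}
  (ht : Odds t) (hψ : ∀ i, SmAt (fun x => ψ x i) (baseOf (bod (evn Z))))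
  (i : Fin m) (K : Ix n) :
  gsub (fun q => pcoord L ψ q i K) (evn Z) (odn t Z) =
      taylorCoeff K (taylor (fun x => ψ x i) (gcurve Z)) := by
  have hs : ∀ j, SmAt (fun q => gcurve (coordFun (L := L) q) j) (bod (evn Z)) :=
    fun j => SmAt.gcurve (fun i I => smAt_coordFun i I _) j
  have hψ' : SmAt (fun x => ψ x i) (bod (gcurve (coordFun (L := L) (bod (evn Z))))) := by
    rw [bod_gcurve_coordFun]; exact hψ i
  unfold pcoord
  rw [gsub_taylorCoeff (SmAt.taylor hs hψ') hZ.evn (hZ.odn ht)]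
  congr 1
  have hb := extOdd_mem_pty (n := n) (hZ.odn ht)
  have ha : ∀ c, inr n ι (evn Z c) ∈ pty (WithTheta n ι) 0 := fun c =>
    rename_mem_pty (inrE n ι).injective (hZ.evn c)
  have hbod := bod_inr (n := n) (evn Z)
  rw [gsub_taylor (σ := WithTheta n (Par L m n)) (by rwa [hbod])
    (Eventually.of_forall fun q j => gcurve_mem_pty (adm_coordFun q) j) ha hb (by rwa [hbod])]
  congr 1
  ext j
  exact gsub_gcurve_coordFun hZ ht j

end

/-! ### Reparametrizations of the odd space -/

section

lemma gsub_inr {f : Vec κ → Gr g}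
  {a : κ → Gr ι} {b : g → Gr ι} (hf : SmAt f (bod a)) (ha : Evens a)
  (hb : Odds b) :
  gsub (fun q => inr n g (f q)) (fun c => inr n ι (a c)) (extOdd n b) = inr n ι (gsub f a b) := by
  have hb' := extOdd_mem_pty (n := n) hb
  have ha' : ∀ c, inr n ι (a c) ∈ pty (WithTheta n ι) 0 := fun c =>
    rename_mem_pty (inrE n ι).injective (ha c)
  rw [gsub_rename (inrE n g).injective (by rwa [bod_inr]) ha' hb',
    map_gsub (inr n ι) (body_rename (inrE n ι).injective) hf]
  rfl

/-- The generators of `Gr (WithTheta n ι)`, with the odd coordinates replaced by `w`. -/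
def rgen (w : Fin n → Gr (WithTheta n ι)) : WithTheta n ι → Gr (WithTheta n ι) :=
  fun s => Sum.elim w (fun x => gen (inrE n ι x)) (ofLex s)

lemma rgen_mem_pty {w : Fin n → Gr (WithTheta n ι)} (hw : Odds w)
  (s : WithTheta n ι) : rgen w s ∈ pty (WithTheta n ι) 1 := by
  rcases s with a | x
  · exact hw a
  · exact gen_mem_pty _

/-- Substitution of `w` for the odd coordinates. -/
def Th (w : Fin n → Gr (WithTheta n ι)) (hw : Odds w) :
  Gr (WithTheta n ι) →ₐ[ℝ] Gr (WithTheta n ι) := lam (rgen w) (rgen_mem_pty hw)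

lemma body_lam (b : σ → Gr ι) (hb : Odds b)
  (x : Gr σ) : body (lam b hb x) = body x :=
  body_map (fun s => by rw [lam_gen]; exact hb s) x

variable {w : Fin n → Gr (WithTheta n ι)} (hw : Odds w)

lemma Th_inr (x : Gr ι) : Th w hw (inr n ι x) = inr n ι x := by
  refine map_rename (inrE n ι).injective _ (fun s => ?_) x
  rw [Th, lam_gen, rename_gen (inrE n ι).injective]; rfl

lemma Th_tm (I : Ix n) : Th w hw (tm ι I) = ordProd I w := by
  rw [tm_eq_ordProd, map_ordProd]
  congr 1
  ext a; rw [Th, lam_gen]; rfl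

lemma Th_gcurve (Z : Crd m n ι) (i : Fin m) :
  Th w hw (gcurve Z i) = curve w (fun i I => inr n ι (Z i I)) i := by
  unfold gcurve curve
  rw [map_sum]
  refine sum_congr rfl fun I _ => ?_
  rw [map_smul, map_mul, Th_tm, Th_inr]

lemma Th_mem_pty {i : ZMod 2} {x : Gr (WithTheta n ι)} (hx : x ∈ pty _ i) :
  Th w hw x ∈ pty (WithTheta n ι) i :=
  map_mem_pty (fun s => by rw [Th, lam_gen]; exact rgen_mem_pty hw s) hx

/-- The Taylor coefficients of the composition of a map with `w`. -/
def rcoord (w : Fin n → Gr (WithTheta n ι)) (Z : Crd m n ι)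
  (i : Fin m) (I : Ix n) : Gr ι :=
  taylorCoeff I (curve w (fun i I => inr n ι (Z i I)) i)

lemma rcoord_eq (Z : Crd m n ι) (i : Fin m) (I : Ix n) :
  rcoord w Z i I = taylorCoeff I (Th w hw (gcurve Z i)) := by rw [Th_gcurve]; rfl

lemma adm_rcoord (hw : Odds w) {Z : Crd m n ι} (hZ : Adm Z) : Adm (rcoord w Z) := by
  intro i I
  rw [rcoord_eq hw]
  exact taylorCoeff_mem_pty (Th_mem_pty hw (gcurve_mem_pty hZ i)) I

lemma gcurve_rcoord (Z : Crd m n ι) (i : Fin m) :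
  gcurve (rcoord w Z) i = Th w hw (gcurve Z i) := by
  have := gcurve_taylorCoeff (fun i => Th w hw (gcurve Z i)) i
  rw [← this]
  congr 1
  ext i I; exact rcoord_eq hw Z i I

lemma body_rcoord_empty (hw : Odds w) (Z : Crd m n ι) (i : Fin m) :
  body (rcoord w Z i ∅) = body (Z i ∅) := by
  rw [rcoord_eq hw, body_taylorCoeff_empty, Th, body_lam, body_gcurve]

lemma SmAt.rcoord
  {Z : E → Crd m n ι} {p : E} (hZ : ∀ i I, SmAt (fun q => Z q i I) p)
  (i : Fin m) (I : Ix n) : SmAt (fun q => rcoord w (Z q) i I) p := by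
  have h : SmAt (fun q => curve w (fun i I => inr n ι (Z q i I)) i) p :=
    SmAt.sum fun I _ => SmAt.smul (SmAt.const _ _) (SmAt.mul (SmAt.const _ _)
      (SmAt.linear (A := Gr ι) (inr n ι).toLinearMap (hZ i I)))
  exact h.taylorCoeff I

end

section

/-- The embedding of the generators `θ`, `τ`. -/
def ttE (m n L : ℕ) : WithTheta n (Fin L) ↪ WithTheta n (Par L m n) :=
  ⟨fun s => toLex (Sum.map id parL (ofLex s)), toLex.injective.comp
    ((Function.Injective.sumMap Function.injective_id
      (toLex.injective.comp Sum.inl_injective)).comp ofLex.injective)⟩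

variable (φ : OddDiffeo n L)

/-- The components of a diffeomorphism of the odd space, among all generators. -/
def phat (m : ℕ) (φ : OddDiffeo n L) (a : Fin n) : Gr (WithTheta n (Par L m n)) :=
  rename (ttE m n L) (φ.comp a)

lemma phat_mem_pty (a : Fin n) : phat m φ a ∈ pty (WithTheta n (Par L m n)) 1 :=
  rename_mem_pty (ttE m n L).injective (φ.odd a)

/-- The coordinates of the composition of the generic map with `φ`. -/
abbrev zr (φ : OddDiffeo n L) (p : Pt m n) :
  Fin m → Ix n → Gr (Par L m n) := rcoord (phat m φ) (coordFun p)

lemma adm_zr (p : Pt m n) : Adm (zr φ p) :=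
  adm_rcoord (phat_mem_pty φ) (adm_coordFun p)

lemma smAt_zr (p : Pt m n) (i : Fin m) (I : Ix n) :
  SmAt (fun q => zr φ q i I) p :=
  SmAt.rcoord (fun i I => smAt_coordFun i I p) i I

lemma baseOf_bod_zr (p : Pt m n) : baseOf (bod (evn (zr φ p))) = baseOf p := by
  ext i
  exact (body_rcoord_empty (phat_mem_pty φ) _ i).trans (body_coordFun p ⟨(i, ∅), by simp⟩)

lemma eq_parO (s : Par 0 m n) : ∃ c, s = parO c := by
  rcases s with t | c
  · exact t.elim0
  · exact ⟨c, rfl⟩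

/-- The parameters when there are none. -/
abbrev t0 {ι : Type} : Fin 0 → Gr ι := fun t => t.elim0

lemma t0_mem {ι : Type} (t : Fin 0) : (t0 t : Gr ι) ∈ pty ι 1 := t.elim0

/-- Pullback of a function in coordinates along `φ`. -/
def rpar (φ : OddDiffeo n L) (f : SFun 0 m n) : SFun L m n :=
  fun p => gsub f (evn (zr φ p)) (odn t0 (zr φ p))

lemma reparam_eq
  (α : Family m M 0 n) (e : Coord m M) : reparam φ α e = rpar φ (α e) := rfl

lemma tparL_mem (t : Fin L) : gen (parL (m := m) (n := n) t) ∈ pty (Par L m n) 1 := gen_mem_pty _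

lemma lam_phat {Z : Fin m → Ix n → Gr (Par L m n)} (hZ : Adm Z) (a : Fin n) :
  lam (extOdd n (odn (fun t => gen (parL t)) Z))
      (extOdd_mem_pty (hZ.odn tparL_mem)) (phat m φ a) = phat m φ a := by
  refine map_rename (ttE m n L).injective _ (fun s => ?_) (φ.comp a)
  rw [lam_gen, rename_gen (ttE m n L).injective]
  rcases s with a | t
  · rfl
  · exact rename_gen (inrE n _).injective _

lemma gsub_zr {Z : Fin m → Ix n → Gr (Par L m n)} (hZ : Adm Z) (i : Fin m)
  (I : Ix n) :
  gsub (fun q => zr φ q i I) (evn Z) (odn (fun t => gen (parL t)) Z) =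
      rcoord (phat m φ) Z i I := by
  have hb := hZ.odn (tparL_mem (m := m) (n := n) (L := L))
  have hb' := extOdd_mem_pty (n := n) hb
  have hbod := bod_inr (n := n) (evn Z)
  have ha : ∀ c, inr n (Par L m n) (evn Z c) ∈ pty (WithTheta n (Par L m n)) 0 := fun c =>
    rename_mem_pty (inrE n _).injective (hZ.evn c)
  have hs : ∀ (J : Ix n) (p : Pt m n),
      SmAt (fun q => inr n (Par L m n) (coordFun q i J)) p := fun J p =>
    SmAt.linear (A := Gr (Par L m n)) (inr n _).toLinearMap (smAt_coordFun i J p)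
  have hs' : ∀ (J : Ix n) (p : Pt m n),
      SmAt (fun q => ordProd J (phat m φ) * inr n (Par L m n) (coordFun q i J)) p := fun J p =>
    SmAt.mul (SmAt.const _ _) (hs J p)
  unfold zr rcoord
  rw [gsub_taylorCoeff _ hZ.evn hb]
  · congr 1
    unfold curve
    rw [gsub_sum (σ := WithTheta n (Par L m n)) _
      (fun J _ => SmAt.smul (SmAt.const _ _) (hs' J _))]
    refine sum_congr rfl fun J _ => ?_
    rw [gsub_const_smul (σ := WithTheta n (Par L m n)) _ (hs' J _) ha hb',
      gsub_mul (σ := WithTheta n (Par L m n)) (f := fun _ => ordProd J (phat m φ))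
        (SmAt.const (ordProd J (phat m φ)) _) (hs J _) ha hb',
      gsub_const (σ := WithTheta n (Par L m n)) _ _ hb', gsub_inr (smAt_coordFun i J _) hZ.evn hb,
      gsub_coordFun hZ tparL_mem, map_ordProd]
    congr 3
    ext a; exact lam_phat φ hZ a
  · exact SmAt.sum fun J _ => SmAt.smul (SmAt.const _ _) (hs' J _)

/-- Reparametrizations commute with changes of coordinates. -/
lemma rpar_pullAlong {ψ : Bs m → Bs m} {p : Pt m n}
  (hψ : ∀ i, SmAt (fun x => ψ x i) (baseOf p)) {f f' : SFun 0 m n}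
  (hf' : ∀ q : Pt m n, baseOf q = ψ (baseOf p) → SmAt f' q)
  (h : ∀ q : Pt m n, baseOf q = baseOf p → f =ᶠ[𝓝 q] pullAlong ψ f') :
  rpar φ f p = pullAlong ψ (rpar φ f') p := by
  have hz := adm_zr φ p
  have hzb := baseOf_bod_zr φ p
  have hψz : ∀ i, SmAt (fun x => ψ x i) (baseOf (bod (evn (zr φ p)))) := by rwa [hzb]
  have hψe : ∀ᶠ q in 𝓝 (bod (evn (zr φ p))), ∀ i, SmAt (fun x => ψ x i) (baseOf q) := by
    have hc : Continuous (baseOf : Pt m n → _) := by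
      unfold baseOf; fun_prop
    rw [eventually_all]
    intro i
    exact hc.continuousAt.eventually (hψz i).eventually
  have hpz : ∀ i I, SmAt (fun q => pcoord 0 ψ q i I) (bod (evn (zr φ p))) := smAt_pcoord hψz
  have hf1 : SmAt f' (bod (evn (pcoord 0 ψ (bod (evn (zr φ p)))))) := by
    refine hf' _ ?_
    rw [baseOf_bod_pcoord hψz, hzb]
  have hpe : pullAlong ψ f' = fun q => gsub f' (evn (pcoord 0 ψ q)) (odn t0 (pcoord 0 ψ q)) := by
    ext q; rw [pullAlong_eq]
    congr 1; ext s; obtain ⟨c, rfl⟩ := eq_parO s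
    rfl
  have hpo : ∀ s : Par 0 m n, SmAt (fun q => odn t0 (pcoord 0 ψ q) s) (bod (evn (zr φ p))) := by
    intro s; obtain ⟨c, rfl⟩ := eq_parO s
    exact hpz _ _
  have lhs : rpar φ f p = gsub f'
      (evn fun i I => taylorCoeff I (taylor (fun x => ψ x i) (gcurve (zr φ p))))
      (odn t0 fun i I => taylorCoeff I (taylor (fun x => ψ x i) (gcurve (zr φ p)))) := by
    unfold rpar
    have hsm : SmAt (pullAlong ψ f') (bod (evn (zr φ p))) := by
      rw [hpe]
      exact SmAt.gsub (fun c => hpz _ _) hpo hf1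
    rw [gsub_congr hsm (h _ hzb), hpe, gsub_gsub (fun c => hpz _ _)
      (hψe.mono fun q hq c => (adm_pcoord hq).evn c) hpo hz.evn (hz.odn t0_mem) hf1]
    congr 1
    · ext c; exact gsub_pcoord hz t0_mem hψz _ _
    · ext s; obtain ⟨c, rfl⟩ := eq_parO s
      exact gsub_pcoord hz t0_mem hψz _ _
  have hq := adm_pcoord (L := L) hψ
  have hqb := baseOf_bod_pcoord (L := L) hψ
  have hf2 : SmAt f' (bod (evn (zr φ (bod (evn (pcoord L ψ p)))))) := by
    refine hf' _ ?_
    rw [baseOf_bod_zr, hqb]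
  have hro : ∀ s : Par 0 m n, SmAt (fun q => odn t0 (zr φ q) s) (bod (evn (pcoord L ψ p))) := by
    intro s; obtain ⟨c, rfl⟩ := eq_parO s
    exact smAt_zr φ _ _ _
  rw [lhs, pullAlong_eq]
  unfold rpar
  rw [gsub_gsub (fun c => smAt_zr φ _ _ _) (Eventually.of_forall fun q c => (adm_zr φ q).evn c) hro
    hq.evn (hq.odn tparL_mem) hf2]
  have key : ∀ i I, taylorCoeff I (taylor (fun x => ψ x i) (gcurve (zr φ p))) =
      gsub (fun q => zr φ q i I) (evn (pcoord L ψ p))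
        (odn (fun t => gen (parL t)) (pcoord L ψ p)) := by
    intro i I
    have hw := phat_mem_pty (m := m) φ
    rw [gsub_zr φ hq, rcoord_eq hw]
    have e1 : gcurve (pcoord L ψ p) i = taylor (fun x => ψ x i) (gcurve (coordFun p)) :=
      gcurve_taylorCoeff (fun i => taylor (fun x => ψ x i) (gcurve (coordFun p))) i
    rw [e1]
    congr 1
    rw [map_taylor (ι := WithTheta n (Par L m n)) (Th _ hw) (body_lam _ _)
      (by rw [bod_gcurve_coordFun]; exact hψ i)]
    congr 1
    ext j; exact gcurve_rcoord hw _ _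
  congr 1
  · ext c; exact key _ _
  · ext s; obtain ⟨c, rfl⟩ := eq_parO s
    exact key _ _

end

/-! ### Growth and decay -/

section

variable {κ' : Type} [Fintype κ'] [DecidableEq κ']

/-- Polynomial growth on `Ω`. -/
def PG (Ω : Set (Vec κ)) (u : Vec κ → ℝ) : Prop :=
  ∃ (N : ℕ) (C : ℝ), 0 ≤ C ∧ ∀ p ∈ Ω, u p ≤ C * (1 + ‖p‖) ^ N

/-- Rapid decrease on `Ω`. -/
def DE (Ω : Set (Vec κ)) (u : Vec κ → ℝ) : Prop :=
  ∀ N : ℕ, ∃ C : ℝ, ∀ p ∈ Ω, (1 + ‖p‖) ^ N * u p ≤ C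

/-- Growth conditions which are compatible with multiplication by functions of polynomial growth. -/
class Wt (Ω : Set (Vec κ)) (Q : (Vec κ → ℝ) → Prop) : Prop where
  mono : ∀ {u v}, Q v → (∀ p ∈ Ω, u p ≤ v p) → Q u
  zero : Q fun _ => 0
  add : ∀ {u v}, Q u → Q v → Q fun p => u p + v p
  mul : ∀ {u v}, PG Ω u → Q v → (∀ p, 0 ≤ v p) → Q fun p => u p * v p

lemma one_le_one_add_norm (p : κ → ℝ) : 1 ≤ 1 + ‖p‖ := by linarith [norm_nonneg p]

lemma PG.const (Ω : Set (Vec κ)) (r : ℝ) : PG Ω fun _ => r :=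
  ⟨0, |r|, abs_nonneg _, fun p _ => by simpa using le_abs_self r⟩

instance wt_PG (Ω : Set (Vec κ)) : Wt Ω (PG Ω) where
  mono := by
    rintro u v ⟨N, C, hC, h⟩ huv
    exact ⟨N, C, hC, fun p hp => (huv p hp).trans (h p hp)⟩
  zero := PG.const Ω 0
  add := by
    rintro u v ⟨N, C, hC, h⟩ ⟨N', C', hC', h'⟩
    refine ⟨N + N', C + C', by positivity, fun p hp => (add_le_add (h p hp) (h' p hp)).trans ?_⟩
    have h1 := one_le_one_add_norm p
    have a1 : (1 + ‖p‖) ^ N ≤ (1 + ‖p‖) ^ (N + N') := pow_le_pow_right₀ h1 (by omega)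
    have a2 : (1 + ‖p‖) ^ N' ≤ (1 + ‖p‖) ^ (N + N') := pow_le_pow_right₀ h1 (by omega)
    rw [add_mul]; gcongr
  mul := by
    rintro u v ⟨N, C, hC, h⟩ ⟨N', C', hC', h'⟩ hv
    refine ⟨N + N', C * C', by positivity, fun p hp => ?_⟩
    calc u p * v p ≤ (C * (1 + ‖p‖) ^ N) * v p := by gcongr; exacts [hv p, h p hp]
      _ ≤ (C * (1 + ‖p‖) ^ N) * (C' * (1 + ‖p‖) ^ N') := by gcongr; exact h' p hp
      _ = _ := by ring

instance wt_DE (Ω : Set (Vec κ)) : Wt Ω (DE Ω) where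
  mono := by
    intro u v h huv N
    obtain ⟨C, hC⟩ := h N
    exact ⟨C, fun p hp => (mul_le_mul_of_nonneg_left (huv p hp) (by positivity)).trans (hC p hp)⟩
  zero := fun N => ⟨0, fun p _ => by simp⟩
  add := by
    intro u v h h' N
    obtain ⟨C, hC⟩ := h N
    obtain ⟨C', hC'⟩ := h' N
    exact ⟨C + C', fun p hp => by rw [mul_add]; exact add_le_add (hC p hp) (hC' p hp)⟩
  mul := by
    rintro u v ⟨N', C', hC', h'⟩ h hv N
    obtain ⟨C, hC⟩ := h (N + N')
    refine ⟨C' * C, fun p hp => ?_⟩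
    calc (1 + ‖p‖) ^ N * (u p * v p) ≤ (1 + ‖p‖) ^ N * ((C' * (1 + ‖p‖) ^ N') * v p) := by
          gcongr; exacts [hv p, h' p hp]
      _ = C' * ((1 + ‖p‖) ^ (N + N') * v p) := by ring
      _ ≤ C' * C := by gcongr; exact hC p hp

/-- Functions which satisfy a growth condition on `Ω` together with their derivatives of order at
most `k`. -/
@[reducible] def Cl (Ω : Set (Vec κ)) (Q : (Vec κ → ℝ) → Prop) : ℕ → (Vec κ → V) → Prop
  | 0, f => (∀ p ∈ Ω, SmAt f p) ∧ Q fun p => ‖f p‖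
  | k + 1, f => ((∀ p ∈ Ω, SmAt f p) ∧ Q fun p => ‖f p‖) ∧ ∀ c, Cl Ω Q k (pd c f)

variable {Ω : Set (Vec κ)} {Q : (Vec κ → ℝ) → Prop}

lemma Cl.zero {k : ℕ} {f : Vec κ → V} (h : Cl Ω Q k f) : Cl Ω Q 0 f := by
  cases k
  · exact h
  · exact h.1

lemma Cl.smAt {k : ℕ} {f : Vec κ → V} (h : Cl Ω Q k f) {p : κ → ℝ} (hp : p ∈ Ω) : SmAt f p :=
  h.zero.1 p hp

lemma Cl.of_succ {k : ℕ} {f : Vec κ → V} (h : Cl Ω Q (k + 1) f) : Cl Ω Q k f := by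
  induction k generalizing f with
  | zero => exact h.1
  | succ k ih => exact ⟨h.1, fun c => ih (h.2 c)⟩

lemma Cl.congr [hQ : Wt Ω Q] {k : ℕ} {f g : Vec κ → V} (h : Cl Ω Q k f)
  (e : ∀ p ∈ Ω, g =ᶠ[𝓝 p] f) : Cl Ω Q k g := by
  have h0 : Cl Ω Q 0 g := ⟨fun p hp => (h.smAt hp).congr (e p hp),
    hQ.mono h.zero.2 fun p hp => by rw [(e p hp).eq_of_nhds]⟩
  induction k generalizing f g with
  | zero => exact h0
  | succ k ih =>
    refine ⟨h0, fun c => ?_⟩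
    have e' : ∀ p ∈ Ω, pd c g =ᶠ[𝓝 p] pd c f := fun p hp => pd_congr (e p hp) c
    exact ih (h.2 c) e' ⟨fun p hp => ((h.2 c).smAt hp).congr (e' p hp),
      hQ.mono (h.2 c).zero.2 fun p hp => by rw [(e' p hp).eq_of_nhds]⟩

lemma DE.mono_set {Ω' : Set (Vec κ)} {u : Vec κ → ℝ} (h : DE Ω u) (hs : Ω' ⊆ Ω) : DE Ω' u :=
  fun N => let ⟨C, hC⟩ := h N; ⟨C, fun p hp => hC p (hs hp)⟩

lemma Cl.mono_set {Ω' : Set (Vec κ)} (hs : Ω' ⊆ Ω) {k : ℕ} {f : Vec κ → V}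
  (h : Cl Ω (DE Ω) k f) : Cl Ω' (DE Ω') k f := by
  induction k generalizing f with
  | zero => exact ⟨fun p hp => h.1 p (hs hp), h.2.mono_set hs⟩
  | succ k ih => exact ⟨⟨fun p hp => h.1.1 p (hs hp), h.1.2.mono_set hs⟩, fun c => ih (h.2 c)⟩

lemma Cl.add [hQ : Wt Ω Q] {k : ℕ} {f g : Vec κ → V} (hf : Cl Ω Q k f) (hg : Cl Ω Q k g) :
  Cl Ω Q k fun p => f p + g p := by
  induction k generalizing f g with
  | zero => exact ⟨fun p hp => (hf.1 p hp).add (hg.1 p hp),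
      hQ.mono (hQ.add hf.2 hg.2) fun p _ => norm_add_le _ _⟩
  | succ k ih =>
    refine ⟨⟨fun p hp => (hf.smAt hp).add (hg.smAt hp),
      hQ.mono (hQ.add hf.1.2 hg.1.2) fun p _ => norm_add_le _ _⟩, fun c => ?_⟩
    exact (ih (hf.2 c) (hg.2 c)).congr fun p hp => pd_add (hf.smAt hp) (hg.smAt hp) c

lemma pd_const (c : κ) (v : V) : pd c (fun _ : κ → ℝ => v) = fun _ => 0 := by
  ext p; simp [pd]

lemma Cl.const_zero [hQ : Wt Ω Q] (k : ℕ) : Cl Ω Q k fun _ => (0 : V) := by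
  have h0 : Cl Ω Q 0 fun _ => (0 : V) := ⟨fun p _ => SmAt.const _ _, by simpa using hQ.zero⟩
  induction k with
  | zero => exact h0
  | succ k ih => exact ⟨h0, fun c => by rw [pd_const]; exact ih⟩

lemma Cl.sum [hQ : Wt Ω Q] {α : Type*} {s : Finset α} {k : ℕ} {f : α → Vec κ → V}
  (h : ∀ i ∈ s, Cl Ω Q k (f i)) : Cl Ω Q k fun p => ∑ i ∈ s, f i p := by
  classical
  induction s using Finset.induction_on with
  | empty => simpa using Cl.const_zero k
  | insert a s ha ih =>
    simp_rw [sum_insert ha]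
    exact (h a (by simp)).add (ih fun i hi => h i (by simp [hi]))

lemma Cl.const (k : ℕ) (v : V) : Cl Ω (PG Ω) k fun _ => v := by
  have h0 : Cl Ω (PG Ω) 0 fun _ => v := ⟨fun p _ => SmAt.const _ _, PG.const Ω _⟩
  cases k with
  | zero => exact h0
  | succ k => exact ⟨h0, fun c => by rw [pd_const]; exact Cl.const_zero k⟩

lemma pd_linear {A : Type*} [NormedAddCommGroup A] [NormedSpace ℝ A] [FiniteDimensional ℝ A]
  (T : A →ₗ[ℝ] W) {f : Vec κ → A} {p : κ → ℝ} (hf : SmAt f p) (c : κ) :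
  pd c (fun q => T (f q)) =ᶠ[𝓝 p] fun q => T (pd c f q) := by
  filter_upwards [hf.eventually] with q hq using fderiv_linear_comp T hq.differentiableAt _

lemma Cl.linear [hQ : Wt Ω Q] {A : Type*} [NormedAddCommGroup A] [NormedSpace ℝ A]
  [FiniteDimensional ℝ A] (T : A →ₗ[ℝ] W) {k : ℕ} {f : Vec κ → A} (hf : Cl Ω Q k f) :
  Cl Ω Q k fun p => T (f p) := by
  have h0 : ∀ {f : Vec κ → A}, Cl Ω Q 0 f → Cl Ω Q 0 fun p => T (f p) := by
    intro f hf
    refine ⟨fun p hp => SmAt.linear T (hf.smAt hp),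
      hQ.mono (hQ.mul (PG.const Ω ‖LinearMap.toContinuousLinearMap T‖) hf.2
        fun p => norm_nonneg _) fun p _ => ?_⟩
    exact (LinearMap.toContinuousLinearMap T).le_opNorm (f p)
  induction k generalizing f with
  | zero => exact h0 hf
  | succ k ih =>
    refine ⟨h0 hf.1, fun c => (ih (hf.2 c)).congr fun p hp => pd_linear T (hf.smAt hp) c⟩

lemma Cl.mul [hQ : Wt Ω Q] {A : Type*} [NormedRing A] [NormedAlgebra ℝ A] {k : ℕ}
  {f g : Vec κ → A} (hf : Cl Ω (PG Ω) k f) (hg : Cl Ω Q k g) : Cl Ω Q k fun p => f p * g p := by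
  have h0 : ∀ {f g : Vec κ → A}, Cl Ω (PG Ω) 0 f → Cl Ω Q 0 g → Cl Ω Q 0 fun p => f p * g p :=
    fun hf hg => ⟨fun p hp => (hf.smAt hp).mul (hg.smAt hp),
      hQ.mono (hQ.mul hf.2 hg.2 fun p => norm_nonneg _) fun p _ => norm_mul_le _ _⟩
  induction k generalizing f g with
  | zero => exact h0 hf hg
  | succ k ih =>
    refine ⟨h0 hf.1 hg.1, fun c => ?_⟩
    exact ((ih (hf.2 c) hg.of_succ).add (ih hf.of_succ (hg.2 c))).congr
      fun p hp => pd_mul (hf.smAt hp) (hg.smAt hp) c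

lemma Cl.mul' [hQ : Wt Ω Q] {A : Type*} [NormedRing A] [NormedAlgebra ℝ A] {k : ℕ}
  {f g : Vec κ → A} (hf : Cl Ω Q k f) (hg : Cl Ω (PG Ω) k g) : Cl Ω Q k fun p => f p * g p := by
  have h0 : ∀ {f g : Vec κ → A}, Cl Ω Q 0 f → Cl Ω (PG Ω) 0 g → Cl Ω Q 0 fun p => f p * g p :=
    fun hf hg => ⟨fun p hp => (hf.smAt hp).mul (hg.smAt hp),
      hQ.mono (hQ.mul hg.2 hf.2 fun p => norm_nonneg _) fun p _ =>
        (norm_mul_le _ _).trans (mul_comm _ _).le⟩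
  induction k generalizing f g with
  | zero => exact h0 hf hg
  | succ k ih =>
    refine ⟨h0 hf.1 hg.1, fun c => ?_⟩
    exact ((ih (hf.2 c) hg.of_succ).add (ih hf.of_succ (hg.2 c))).congr
      fun p hp => pd_mul (hf.smAt hp) (hg.smAt hp) c

lemma pd_smul {h : Vec κ → ℝ} {g : Vec κ → V} {p : κ → ℝ} (hh : SmAt h p) (hg : SmAt g p)
  (c : κ) : pd c (fun q => h q • g q) =ᶠ[𝓝 p] fun q => pd c h q • g q + h q • pd c g q := by
  filter_upwards [hh.eventually, hg.eventually] with q h1 h2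
  have := fderiv_fun_smul h1.differentiableAt h2.differentiableAt
  simp only [pd, this]
  simp [add_comm]

lemma Cl.smul [hQ : Wt Ω Q] {k : ℕ} {h : Vec κ → ℝ} {g : Vec κ → V}
  (hf : Cl Ω (PG Ω) k h) (hg : Cl Ω Q k g) : Cl Ω Q k fun p => h p • g p := by
  have h0 : ∀ {h : Vec κ → ℝ} {g : Vec κ → V}, Cl Ω (PG Ω) 0 h → Cl Ω Q 0 g →
      Cl Ω Q 0 fun p => h p • g p :=
    fun hf hg => ⟨fun p hp => (hf.smAt hp).smul (hg.smAt hp),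
      hQ.mono (hQ.mul hf.2 hg.2 fun p => norm_nonneg _) fun p _ => (norm_smul _ _).le⟩
  induction k generalizing h g with
  | zero => exact h0 hf hg
  | succ k ih =>
    refine ⟨h0 hf.1 hg.1, fun c => ?_⟩
    exact ((ih (hf.2 c) hg.of_succ).add (ih hf.of_succ (hg.2 c))).congr
      fun p hp => pd_smul (hf.smAt hp) (hg.smAt hp) c

lemma Cl.comp [hQ : Wt Ω Q] {Ω' : Set (κ' → ℝ)} {Q' : (Vec κ' → ℝ) → Prop}
  {φ : κ' → Vec κ → ℝ} (hφ : ∀ k d, Cl Ω (PG Ω) k (φ d))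
  (hm : ∀ p ∈ Ω, (fun d => φ d p) ∈ Ω')
  (hc : ∀ u, Q' u → Q fun p => u fun d => φ d p) {k : ℕ} {f : Vec κ' → V}
  (hf : Cl Ω' Q' k f) : Cl Ω Q k fun p => f fun d => φ d p := by
  have h0 : ∀ {f : Vec κ' → V}, Cl Ω' Q' 0 f → Cl Ω Q 0 fun p => f fun d => φ d p :=
    fun {f} hf => ⟨fun p hp => SmAt.comp (g := f) (hf.smAt (hm p hp))
      (SmAt.pi fun d => (hφ 0 d).smAt hp), hc _ hf.2⟩
  induction k generalizing f with
  | zero => exact h0 hf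
  | succ k ih =>
    refine ⟨h0 hf.1, fun c => ?_⟩
    refine Cl.congr (Cl.sum (s := Finset.univ)
      (f := fun d p => pd c (φ d) p • pd d f (fun d => φ d p)) fun d _ =>
        Cl.smul ((hφ (k + 1) d).2 c) (ih (hf.2 d))) fun p hp => ?_
    exact pd_comp (fun d => (hφ 0 d).smAt hp) (hf.smAt (hm p hp)) c

lemma Cl.coord (c : κ) (k : ℕ) : Cl Ω (PG Ω) k fun p : κ → ℝ => p c := by
  have h0 : Cl Ω (PG Ω) 0 fun p : κ → ℝ => p c :=
    ⟨fun p _ => smAt_of_contDiff (contDiff_apply ℝ ℝ c) p, 1, 1, zero_le_one, fun p _ => by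
      have := norm_le_pi_norm p c
      simp only [one_mul, pow_one]; linarith⟩
  cases k with
  | zero => exact h0
  | succ k => exact ⟨h0, fun d => by rw [pd_coord]; exact Cl.const k _⟩

/-- Growth conditions for substitutions. -/
structure Subst (Ω : Set (Vec κ)) (Q : (Vec κ → ℝ) → Prop) (Ω' : Set (κ' → ℝ))
  (Q' : (Vec κ' → ℝ) → Prop) (A : Vec κ → κ' → Gr ι) : Prop where
  tame : ∀ k c, Cl Ω (PG Ω) k fun p => A p c
  maps : ∀ p ∈ Ω, bod (A p) ∈ Ω'
  comp : ∀ u, Q' u → Q fun p => u (bod (A p))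

lemma Cl.tt [hQ : Wt Ω Q] {Ω' : Set (κ' → ℝ)} {Q' : (Vec κ' → ℝ) → Prop}
  {A : Vec κ → κ' → Gr ι} (hA : Subst Ω Q Ω' Q' A) (r : ℕ)
  {h : Vec κ' → ℝ} (hh : ∀ k, Cl Ω' Q' k h) (k : ℕ) :
  Cl Ω Q k fun p => tt (fun c => nilp (A p c)) (bod (A p)) r h := by
  have hb : ∀ k c, Cl Ω (PG Ω) k fun p => body (A p c) := fun k c =>
    (hA.tame k c).linear (body (ι := ι)).toLinearMap
  induction r generalizing h with
  | zero =>
    exact Cl.linear (Algebra.linearMap ℝ (Gr ι)) (Cl.comp hb hA.maps hA.comp (hh k))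
  | succ r ih =>
    refine Cl.sum fun d _ => Cl.mul' (ih fun k => (hh (k + 1)).2 d) ?_
    have := (hA.tame k d).add
      (Cl.linear (-(Algebra.linearMap ℝ (Gr ι))) (hb k d))
    simpa [nilp, sub_eq_add_neg] using this

lemma Cl.taylor [hQ : Wt Ω Q] {Ω' : Set (κ' → ℝ)} {Q' : (Vec κ' → ℝ) → Prop}
  {A : Vec κ → κ' → Gr ι} (hA : Subst Ω Q Ω' Q' A)
  {h : Vec κ' → ℝ} (hh : ∀ k, Cl Ω' Q' k h) (k : ℕ) :
  Cl Ω Q k fun p => taylor h (A p) := by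
  refine Cl.congr (Cl.sum (s := Finset.range (Fintype.card ι + 1)) (f := fun j p =>
    ((j.factorial : ℝ)⁻¹) • Worm.tt (fun c => nilp (A p c)) (bod (A p)) j h) fun j _ =>
      Cl.smul (Cl.const k _) (Cl.tt hA j hh k)) fun p hp => ?_
  filter_upwards [SmAt.eventually_bod (fun c => (hA.tame 0 c).smAt hp)
    ((hh 0).smAt (hA.maps p hp)).eventually] with q hq
  exact taylor_eq hq (Nat.lt_succ_self _)

lemma Cl.ordProd {τ : Type} [LinearOrder τ] {B : Vec κ → τ → Gr ι} {k : ℕ}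
  (hB : ∀ s, Cl Ω (PG Ω) k fun p => B p s) (S : Finset τ) :
  Cl Ω (PG Ω) k fun p => ordProd S (B p) := by
  unfold Worm.ordProd
  induction S.sort (· ≤ ·) with
  | nil => simpa using Cl.const k _
  | cons a l ih =>
    simp only [List.map_cons, List.prod_cons]
    exact Cl.mul (hB a) ih

lemma Cl.gsub [hQ : Wt Ω Q] {Ω' : Set (κ' → ℝ)} {Q' : (Vec κ' → ℝ) → Prop}
  {A : Vec κ → κ' → Gr ι} (hA : Subst Ω Q Ω' Q' A) [Wt Ω' Q']
  {B : Vec κ → σ → Gr ι} (hB : ∀ k s, Cl Ω (PG Ω) k fun p => B p s)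
  {f : Vec κ' → Gr σ} (hf : ∀ k, Cl Ω' Q' k f) (k : ℕ) :
  Cl Ω Q k fun p => gsub f (A p) (B p) :=
  Cl.sum fun S _ => Cl.mul'
    (Cl.taylor hA (fun k => Cl.linear (coeff S) (hf k)) k) (Cl.ordProd (hB k) S)

lemma Cl.of_coeff [hQ : Wt Ω Q] {f : Vec κ → Gr σ} {k : ℕ}
  (h : ∀ S, Cl Ω Q k fun p => coeff S (f p)) : Cl Ω Q k f := by
  have : f = fun p => ∑ S, LinearMap.toSpanSingleton ℝ (Gr σ) (mon S) (coeff S (f p)) := by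
    ext p; simp [sum_coeff_mon]
  rw [this]
  exact Cl.sum fun S _ => Cl.linear _ (h S)

lemma fderiv_eq_sum_smulRight {f : Vec κ → V} :
  fderiv ℝ f = fun p => ∑ c, ContinuousLinearMap.smulRightL ℝ (Vec κ) V
      (ContinuousLinearMap.proj c) (pd c f p) := by
  ext p v
  rw [fderiv_eq_sum_pd]
  simp

lemma Cl.iteratedFDeriv [hQ : Wt Ω Q] {f : Vec κ → V} {k : ℕ} (h : Cl Ω Q k f) :
  Q fun p => ‖iteratedFDeriv ℝ k f p‖ := by
  induction k generalizing f with
  | zero => simpa using h.2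
  | succ k ih =>
    set T : κ → V →L[ℝ] (Vec κ →L[ℝ] V) := fun c =>
      ContinuousLinearMap.smulRightL ℝ (Vec κ) V (ContinuousLinearMap.proj c)
    have h1 : Q fun p => ∑ c, ‖T c‖ * ‖_root_.iteratedFDeriv ℝ k (pd c f) p‖ := by
      have : ∀ s : Finset κ, Q fun p => ∑ c ∈ s, ‖T c‖ * ‖_root_.iteratedFDeriv ℝ k (pd c f) p‖ := by
        intro s
        induction s using Finset.induction_on with
        | empty => simpa using hQ.zero
        | insert a s ha ihs =>
          simp_rw [sum_insert ha]
          exact hQ.add (hQ.mul (PG.const Ω _) (ih (h.2 a)) fun p => norm_nonneg _) ihs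
      exact this _
    refine hQ.mono h1 fun p hp => ?_
    have hs : ∀ c, ContDiffAt ℝ k (pd c f) p := fun c =>
      ((h.2 c).smAt hp).contDiffAt.of_le (by exact_mod_cast le_top)
    rw [← norm_iteratedFDeriv_fderiv, fderiv_eq_sum_smulRight]
    have hs' : ∀ c ∈ Finset.univ, ContDiffAt ℝ k (T c ∘ pd c f) p := fun c _ =>
      (T c).contDiff.contDiffAt.comp p (hs c)
    have e : (fun p => ∑ c, (T c) (pd c f p)) = fun p => ∑ c, (T c ∘ pd c f) p := rfl
    rw [e, iteratedFDeriv_fun_sum_apply hs']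
    refine (norm_sum_le _ _).trans (sum_le_sum fun c _ => ?_)
    exact (T c).norm_iteratedFDeriv_comp_left (hs c) le_rfl

lemma cl_of_iteratedFDeriv [hQ : Wt Ω Q] {f : Vec κ → V} (hs : ∀ p ∈ Ω, SmAt f p)
  (h : ∀ k, Q fun p => ‖iteratedFDeriv ℝ k f p‖) (k : ℕ) : Cl Ω Q k f := by
  have h0 : ∀ {f : Vec κ → V}, (∀ p ∈ Ω, SmAt f p) →
      (∀ k, Q fun p => ‖iteratedFDeriv ℝ k f p‖) → Cl Ω Q 0 f := fun hs h =>
    ⟨hs, by simpa using h 0⟩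
  induction k generalizing f with
  | zero => exact h0 hs h
  | succ k ih =>
    refine ⟨h0 hs h, fun c => ih (fun p hp => (hs p hp).pd c) fun j => ?_⟩
    refine hQ.mono (hQ.mul (PG.const Ω ‖(Pi.single c 1 : κ → ℝ)‖) (h (j + 1))
      fun p => norm_nonneg _) fun p hp => ?_
    rw [← norm_iteratedFDeriv_fderiv]
    have hd : ContDiffAt ℝ j (fderiv ℝ f) p :=
      (hs p hp).contDiffAt.fderiv_right (by exact_mod_cast le_top)
    exact norm_iteratedFDeriv_clm_apply_const hd le_rfl

end

/-! ### Determinants of substitutions in a Grassmann algebra -/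

section

/-- The matrix of the substitution `θ ↦ f(θ)`. -/
def cm (f : Fin n → Gr (Fin n)) : Matrix (Ix n) (Ix n) ℝ :=
  Matrix.of fun K I => coeff K (ordProd I f)

lemma prod_mem_fil (f : ι → Gr ι)
  (hf : ∀ a, f a ∈ fil ι 1) (l : List ι) : (l.map f).prod ∈ fil ι l.length := by
  simpa using fil_list_prod (l.map f) (by simpa using fun a _ => hf a)

lemma cm_eq_zero {f : Fin n → Gr (Fin n)} (hf : ∀ a, f a ∈ fil (Fin n) 1)
  {K I : Ix n} (h : K.card < I.card) : cm f K I = 0 := by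
  have := prod_mem_fil f hf (I.sort (· ≤ ·))
  rw [length_sort] at this
  exact this K h

lemma cm_congr {f g : Fin n → Gr (Fin n)} (hf : ∀ a, f a ∈ fil (Fin n) 1)
  (hg : ∀ a, g a ∈ fil (Fin n) 1) (h : ∀ a, f a - g a ∈ fil (Fin n) 2)
  {K I : Ix n} (hKI : K.card = I.card) : cm f K I = cm g K I := by
  have key : ∀ l : List (Fin n), (l.map f).prod - (l.map g).prod ∈ fil (Fin n) (l.length + 1) := by
    intro l
    induction l with
    | nil => simp
    | cons a l ih =>
      simp only [List.map_cons, List.prod_cons, List.length_cons]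
      have : f a * (l.map f).prod - g a * (l.map g).prod =
          f a * ((l.map f).prod - (l.map g).prod) + (f a - g a) * (l.map g).prod := by noncomm_ring
      rw [this]
      refine Submodule.add_mem _ ?_ ?_
      · have := fil_mul (hf a) ih; rwa [show 1 + (l.length + 1) = l.length + 1 + 1 by ring] at this
      · have := fil_mul (h a) (prod_mem_fil g hg l)
        rwa [show 2 + l.length = l.length + 1 + 1 by ring] at this
  have := key (I.sort (· ≤ ·)) K (by rw [length_sort]; omega)
  rw [map_sub, sub_eq_zero] at this
  exact this

/-- The linear substitution with matrix `A`. -/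
def lf (A : Matrix (Fin n) (Fin n) ℝ) (a : Fin n) : Gr (Fin n) := ∑ b, A a b • gen b

lemma lf_mem_pty (A : Matrix (Fin n) (Fin n) ℝ) (a : Fin n) : lf A a ∈ pty (Fin n) 1 :=
  Submodule.sum_mem _ fun b _ => Submodule.smul_mem _ _ (gen_mem_pty b)

lemma mem_fil_one_of_odd {x : Gr ι}
  (hx : x ∈ pty ι 1) : x ∈ fil ι 1 := mem_fil_one.2 (body_odd hx)

variable {P : Ix n → Prop} [DecidablePred P]

/-- A part of the matrix of a substitution. -/
def cmP (P : Ix n → Prop) (f : Fin n → Gr (Fin n)) : Matrix {I // P I} {I // P I} ℝ :=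
  Matrix.of fun K I => cm f K.1 I.1

lemma det_cmP_congr {f g : Fin n → Gr (Fin n)} (hf : ∀ a, f a ∈ fil (Fin n) 1)
  (hg : ∀ a, g a ∈ fil (Fin n) 1) (h : ∀ a, f a - g a ∈ fil (Fin n) 2) :
  (cmP P f).det = (cmP P g).det := by
  set b : {I // P I} → ℕᵒᵈ := fun I => OrderDual.toDual I.1.card
  have hbt : ∀ {f : Fin n → Gr (Fin n)}, (∀ a, f a ∈ fil (Fin n) 1) →
      (cmP P f).BlockTriangular b := fun hf K I hKI => cm_eq_zero hf hKI
  rw [(hbt hf).det, (hbt hg).det]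
  refine prod_congr rfl fun k _ => ?_
  congr 1
  ext K I
  refine cm_congr hf hg h ?_
  exact OrderDual.toDual.injective (K.2.trans I.2.symm)

lemma lam_lf (A B : Matrix (Fin n) (Fin n) ℝ) (x : Gr (Fin n)) :
  lam (lf A) (lf_mem_pty A) (lam (lf B) (lf_mem_pty B) x) =
      lam (lf (B * A)) (lf_mem_pty (B * A)) x := by
  have : (lam (lf A) (lf_mem_pty A)).comp (lam (lf B) (lf_mem_pty B)) =
      lam (lf (B * A)) (lf_mem_pty (B * A)) := by
    refine gr_hom_ext fun a => ?_
    rw [AlgHom.comp_apply, lam_gen, lam_gen]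
    simp only [lf, map_sum, map_smul]
    conv_lhs => enter [2, b]; rw [show lam (lf A) (lf_mem_pty A) (gen b) = lf A b from lam_gen _ _ _]
    simp only [lf, smul_sum, smul_smul]
    rw [sum_comm]
    simp only [Matrix.mul_apply, sum_smul]
  rw [← this]; rfl

lemma cm_lf_eq_zero (A : Matrix (Fin n) (Fin n) ℝ) {K I : Ix n} (h : K.card ≠ I.card) :
  cm (lf A) K I = 0 := by
  have he : ∀ a, euler Finset.univ (lf A a) = lf A a := by
    intro a
    simp only [lf, map_sum, map_smul]
    refine sum_congr rfl fun b _ => ?_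
    rw [← mon_singleton, euler_mon]; simp
  have key : ∀ l : List (Fin n), euler Finset.univ (l.map (lf A)).prod =
      (l.length : ℝ) • (l.map (lf A)).prod := by
    intro l
    induction l with
    | nil => simp
    | cons a l ih =>
      simp only [List.map_cons, List.prod_cons, List.length_cons]
      rw [euler_mul, he, ih, mul_smul_comm]
      push_cast
      rw [add_smul, one_smul, add_comm]
  have h1 := congrArg (coeff K) (key (I.sort (· ≤ ·)))
  rw [coeff_euler, Finset.univ_inter, map_smul, length_sort, smul_eq_mul] at h1
  have h2 : ((K.card : ℝ) - I.card) * coeff K ((I.sort (· ≤ ·)).map (lf A)).prod = 0 := by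
    rw [sub_mul, h1, sub_self]
  refine (mul_eq_zero.1 h2).resolve_left fun h3 => h ?_
  exact_mod_cast sub_eq_zero.1 h3

lemma cmP_mul (hP : ∀ I J, P I → I.card = J.card → P J) (A B : Matrix (Fin n) (Fin n) ℝ) :
  cmP P (lf (B * A)) = cmP P (lf A) * cmP P (lf B) := by
  ext K I
  change coeff K.1 (ordProd I.1 (lf (B * A))) = ∑ J : {J // P J}, cm (lf A) K.1 J.1 * cm (lf B) J.1 I.1
  rw [← lam_mon _ (lf_mem_pty (B * A)), ← lam_lf, lam_mon, ← sum_coeff_mon (ordProd I.1 (lf B)), map_sum,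
    map_sum]
  have h1 : ∀ J, coeff K.1 (lam (lf A) (lf_mem_pty A) (coeff J (ordProd I.1 (lf B)) • mon J)) =
      cm (lf A) K.1 J * cm (lf B) J I.1 := by
    intro J
    rw [map_smul, map_smul, lam_mon, smul_eq_mul, mul_comm]; rfl
  simp_rw [h1]
  rw [← Finset.sum_filter_of_ne (p := P)]
  · exact sum_subtype _ (fun J => by simp) fun J => cm (lf A) K.1 J * cm (lf B) J I.1
  · intro J _ hJ
    by_contra hPJ
    refine hJ ?_
    have h : J.card ≠ I.1.card := fun h => hPJ (hP _ _ I.2 h.symm)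
    rw [cm_lf_eq_zero B h, mul_zero]

lemma cm_diagonal (d : Fin n → ℝ) (K I : Ix n) :
  cm (lf (Matrix.diagonal d)) K I = if K = I then ∏ a ∈ I, d a else 0 := by
  have h1 : lf (Matrix.diagonal d) = fun a => d a • gen a := by
    ext a
    simp only [lf, Matrix.diagonal_apply, ite_smul, zero_smul]
    rw [sum_ite_eq Finset.univ a (fun b => d a • gen b)]; simp
  have key : ∀ l : List (Fin n), (l.map fun a => d a • (gen a : Gr (Fin n))).prod =
      (l.map d).prod • (l.map gen).prod := by
    intro l
    induction l with
    | nil => simp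
    | cons a l ih => simp only [List.map_cons, List.prod_cons]; rw [ih, smul_mul_smul_comm]
  have h2 : ordProd I (fun a => d a • (gen a : Gr (Fin n))) = (∏ a ∈ I, d a) • mon I := by
    unfold ordProd
    rw [key, mon_eq_ordProd]
    unfold ordProd
    congr 1
    rw [Finset.prod_eq_multiset_prod, ← Finset.sort_eq I (· ≤ ·), Multiset.map_coe, Multiset.prod_coe]
  change coeff K (ordProd I (lf (Matrix.diagonal d))) = _
  rw [h1, h2, map_smul, coeff_mon]
  by_cases h : K = I <;> simp [h]

lemma det_cmP_diagonal (d : Fin n → ℝ) :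
  (cmP P (lf (Matrix.diagonal d))).det = ∏ I : {I // P I}, ∏ a ∈ I.1, d a := by
  have : cmP P (lf (Matrix.diagonal d)) = Matrix.diagonal fun I : {I // P I} => ∏ a ∈ I.1, d a := by
    ext K I
    change cm (lf (Matrix.diagonal d)) K.1 I.1 = _
    rw [cm_diagonal, Matrix.diagonal_apply]
    by_cases h : K = I
    · simp [h]
    · rw [if_neg h, if_neg fun h' => h (Subtype.ext h')]
  rw [this, Matrix.det_diagonal]

/-- The determinant of a substitution on the part `P` of a Grassmann algebra, if each generator
appears in `N` of the monomials of this part. -/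
lemma det_cmP_lf (hP : ∀ I J, P I → I.card = J.card → P J) {N : ℕ}
  (hN : ∀ a : Fin n, (Finset.univ.filter fun I : {I // P I} => a ∈ I.1).card = N)
  (A : Matrix (Fin n) (Fin n) ℝ) : (cmP P (lf A)).det = A.det ^ N := by
  have hmul : ∀ A B : Matrix (Fin n) (Fin n) ℝ,
      (cmP P (lf (A * B))).det = (cmP P (lf A)).det * (cmP P (lf B)).det := fun A B => by
    rw [cmP_mul hP, Matrix.det_mul, mul_comm]
  have hdiag : ∀ d : Fin n → ℝ, (cmP P (lf (Matrix.diagonal d))).det = (∏ a, d a) ^ N := by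
    intro d
    rw [det_cmP_diagonal]
    have : ∀ I : {I // P I}, ∏ a ∈ I.1, d a = ∏ a, if a ∈ I.1 then d a else 1 := by
      intro I; rw [Finset.prod_ite_mem]; simp
    simp_rw [this]
    rw [Finset.prod_comm, ← Finset.prod_pow]
    refine prod_congr rfl fun a _ => ?_
    rw [← hN a, Finset.prod_ite]; simp
  have hone : (cmP P (lf (1 : Matrix (Fin n) (Fin n) ℝ))).det = 1 := by
    rw [← Matrix.diagonal_one, hdiag]; simp
  refine Matrix.diagonal_transvection_induction
    (fun A => (cmP P (lf A)).det = A.det ^ N) A ?_ ?_ ?_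
  · intro d _
    rw [hdiag, Matrix.det_diagonal]
  · rintro ⟨i, j, hij, c⟩
    change (cmP P (lf (Matrix.transvection i j c))).det = (Matrix.transvection i j c).det ^ N
    rw [Matrix.det_transvection_of_ne _ _ hij, one_pow]
    set D : Fin n → ℝ := Function.update 1 i 2 with hD
    have hcomm : Matrix.diagonal D * Matrix.transvection i j c =
        Matrix.transvection i j c * Matrix.transvection i j c * Matrix.diagonal D := by
      rw [Matrix.transvection_mul_transvection_same _ _ hij]
      have hDj : D j = 1 := by simp [hD, hij.symm]
      have hDi : D i = 2 := by simp [hD]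
      simp only [Matrix.transvection, mul_add, add_mul, mul_one, one_mul]
      congr 1
      ext a b
      simp only [Matrix.diagonal_mul, Matrix.mul_diagonal, Matrix.single_apply]
      by_cases h : i = a ∧ j = b
      · obtain ⟨rfl, rfl⟩ := h; simp [hDi, hDj]; ring
      · simp [h]
    have h2 := congrArg (fun M => (cmP P (lf M)).det) hcomm
    simp only [hmul] at h2
    have hinv : (cmP P (lf (Matrix.transvection i j c))).det *
        (cmP P (lf (Matrix.transvection i j (-c)))).det = 1 := by
      rw [← hmul, Matrix.transvection_mul_transvection_same _ _ hij, add_neg_cancel,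
        Matrix.transvection_zero, hone]
    have hD0 : (cmP P (lf (Matrix.diagonal D))).det ≠ 0 := by
      rw [hdiag]
      refine pow_ne_zero _ (Finset.prod_ne_zero_iff.2 fun a _ => ?_)
      by_cases h : a = i
      · subst h; simp [hD]
      · simp [hD, h]
    have ht0 := left_ne_zero_of_mul_eq_one hinv
    have h3 : (cmP P (lf (Matrix.transvection i j c))).det * (cmP P (lf (Matrix.diagonal D))).det *
        ((cmP P (lf (Matrix.transvection i j c))).det - 1) = 0 := by linear_combination -h2
    exact sub_eq_zero.1 ((mul_eq_zero.1 h3).resolve_left (mul_ne_zero ht0 hD0))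
  · intro A B hA hB
    rw [hmul, hA, hB, Matrix.det_mul, mul_pow]

lemma det_cmP_lf_ne_zero (hP : ∀ I J, P I → I.card = J.card → P J)
  {A : Matrix (Fin n) (Fin n) ℝ} (hA : IsUnit A.det) : (cmP P (lf A)).det ≠ 0 := by
  have h1 : (cmP P (lf (A * A⁻¹))).det = (cmP P (lf A)).det * (cmP P (lf A⁻¹)).det := by
    rw [cmP_mul hP, Matrix.det_mul, mul_comm]
  rw [Matrix.mul_nonsing_inv _ hA, ← Matrix.diagonal_one, det_cmP_diagonal] at h1
  refine left_ne_zero_of_mul_eq_one (b := (cmP P (lf A⁻¹)).det) ?_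
  rw [← h1]; simp

lemma card_filter_mem_even (hn : 2 ≤ n) (a : Fin n) (s : Bool) :
  (Finset.univ.filter fun I : Ix n => a ∈ I ∧ (Even I.card ↔ s = true)).card =
      2 ^ (n - 2) := by
  have h1 : ∀ s : Bool, (Finset.univ.filter fun I : Ix n => a ∈ I ∧
      (Even I.card ↔ s = true)).card =
      (((Finset.univ.erase a).powerset).filter fun J => ¬ (Even J.card ↔ s = true)).card := by
    intro s
    refine Finset.card_bij' (fun I _ => I.erase a) (fun J _ => insert a J) ?_ ?_ ?_ ?_
    · intro I hI
      simp only [mem_filter, Finset.mem_univ, true_and, Finset.mem_powerset] at hI ⊢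
      refine ⟨Finset.erase_subset_erase _ (Finset.subset_univ _), ?_⟩
      have hc := Finset.card_erase_add_one hI.1
      have := Nat.even_add_one (n := (I.erase a).card)
      rw [hc] at this
      tauto
    · intro J hJ
      simp only [mem_filter, Finset.mem_univ, true_and, Finset.mem_powerset] at hJ ⊢
      have ha : a ∉ J := fun h => by simpa using hJ.1 h
      refine ⟨Finset.mem_insert_self _ _, ?_⟩
      rw [card_insert_of_notMem ha, Nat.even_add_one]
      tauto
    · intro I hI
      simp only [mem_filter, Finset.mem_univ, true_and] at hI
      exact Finset.insert_erase hI.1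
    · intro J hJ
      simp only [mem_filter, Finset.mem_powerset] at hJ
      exact Finset.erase_insert fun h => by simpa using hJ.1 h
  have hne : (Finset.univ.erase a).Nonempty := by
    rw [← card_pos, Finset.card_erase_of_mem (Finset.mem_univ a), Finset.card_fin]; omega
  have h2 := Finset.sum_powerset_neg_one_pow_card_of_nonempty hne
  set E := ((Finset.univ.erase a).powerset).filter fun J => Even J.card
  set O := ((Finset.univ.erase a).powerset).filter fun J => ¬ Even J.card
  have h3 : E.card + O.card = 2 ^ (n - 1) := by
    rw [Finset.card_filter_add_card_filter_not, Finset.card_powerset,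
      Finset.card_erase_of_mem (Finset.mem_univ a), Finset.card_fin]
  have h4 : (E.card : ℤ) = O.card := by
    rw [← Finset.sum_filter_add_sum_filter_not _ (fun J => Even J.card)] at h2
    have e1 : ∑ J ∈ E, (-1 : ℤ) ^ J.card = ∑ J ∈ E, 1 := sum_congr rfl fun J hJ =>
      (mem_filter.1 hJ).2.neg_one_pow
    have e2 : ∑ J ∈ O, (-1 : ℤ) ^ J.card = ∑ J ∈ O, -1 := sum_congr rfl fun J hJ =>
      (Nat.not_even_iff_odd.1 (mem_filter.1 hJ).2).neg_one_pow
    rw [e1, e2] at h2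
    simp only [sum_const, nsmul_eq_mul, mul_one, mul_neg] at h2
    change (E.card : ℤ) + -(O.card : ℤ) = 0 at h2
    omega
  have h5 : 2 ^ (n - 1) = 2 * 2 ^ (n - 2) := by
    rw [← pow_succ']; congr 1; omega
  rw [h1]
  cases s
  · have : (((Finset.univ.erase a).powerset).filter fun J => ¬ (Even J.card ↔ false = true)) = E := by
      ext J; simp [E]
    rw [this]; omega
  · have : (((Finset.univ.erase a).powerset).filter fun J => ¬ (Even J.card ↔ true = true)) = O := by
      ext J; simp [O]
    rw [this]; omega

end

/-! ### Worms and rapid decrease -/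

lemma continuous_baseOf : Continuous (baseOf : Pt m n → Fin m → ℝ) := by
  unfold baseOf; fun_prop

lemma isOpen_dom (e : Coord m M) : IsOpen (dom n e) := e.1.open_target.preimage continuous_baseOf

lemma IsWorm.smAt {α : Family m M L n} (hα : IsWorm α) {e : Coord m M} {p : Pt m n}
  (hp : p ∈ dom n e) : SmAt (α e) p := by
  refine smAt_of_coeff fun S => ?_
  filter_upwards [(isOpen_dom e).mem_nhds hp] with q hq
  exact (hα.smooth e S).contDiffAt ((isOpen_dom e).mem_nhds hq)

lemma contDiffOn_of_smAt {α : Family m M L n}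
  (h : ∀ (e : Coord m M), ∀ p ∈ dom n e, SmAt (α e) p) (e : Coord m M) (S : Finset (Par L m n)) :
  ContDiffOn ℝ ∞ (fun p => coeff S (α e p)) (dom n e) := fun p hp =>
  ((h e p hp).coeff S).contDiffAt.contDiffWithinAt

/-- Changes of coordinates are smooth. -/
lemma smAt_transition (e e' : Coord m M) {x : Bs m} (hx : x ∈ e.1.target)
  (hx' : e.1.symm x ∈ e'.1.source) : SmAt (fun y => e'.1 (e.1.symm y)) x := by
  have h := (contDiffGroupoid ∞ 𝓘(ℝ, Fin m → ℝ)).compatible_of_mem_maximalAtlas e.2 e'.2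
  have h1 := (mem_groupoid_of_pregroupoid.1 h).1
  have h2 : ContDiffOn ℝ ∞ (fun y => e'.1 (e.1.symm y)) (e.1.symm ≫ₕ e'.1).source := by
    simpa [contDiffPregroupoid, Function.comp_def] using h1
  have ho := (e.1.symm ≫ₕ e'.1).open_source
  have hm : x ∈ (e.1.symm ≫ₕ e'.1).source := by
    rw [OpenPartialHomeomorph.trans_source]; exact ⟨hx, hx'⟩
  filter_upwards [ho.mem_nhds hm] with y hy using h2.contDiffAt (ho.mem_nhds hy)

lemma SmAt.apply {κ : Type*} [Fintype κ]
  {f : E → κ → ℝ} {x : E} (h : SmAt f x) (i : κ) : SmAt (fun y => f y i) x :=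
  SmAt.comp (g := fun v : κ → ℝ => v i) (smAt_of_contDiff (contDiff_apply ℝ ℝ i) _) h

lemma eventually_overlap (e e' : Coord m M) {p : Pt m n} (hp : p ∈ dom n e)
  (hp' : point e p ∈ e'.1.source) : ∀ᶠ q in 𝓝 p, q ∈ dom n e ∧ point e q ∈ e'.1.source := by
  have h : ContinuousAt (point e) p :=
    (e.1.continuousAt_symm hp).comp (f := baseOf) continuous_baseOf.continuousAt
  have h1 : ∀ᶠ q in 𝓝 p, q ∈ dom n e := (isOpen_dom e).mem_nhds hp
  exact h1.and (h.eventually (e'.1.open_source.mem_nhds hp'))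

lemma IsWorm.eventually {α : Family m M L n} (hα : IsWorm α) (e e' : Coord m M)
  {p : Pt m n} (hp : p ∈ dom n e) (hp' : point e p ∈ e'.1.source) :
  α e =ᶠ[𝓝 p] pullAlong (fun x => e'.1 (e.1.symm x)) (α e') := by
  filter_upwards [eventually_overlap e e' hp hp'] with q hq using hα.compatible e e' q hq.1 hq.2

/-- The points over `K`. -/
def ov (n : ℕ) (K : Set (Bs m)) : Set (Pt m n) := {p | baseOf p ∈ K}

/-- Rapid decrease along the fibres over `U`. -/
def RD (U : Set (Bs m)) (f : SFun L m n) : Prop :=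
  ∀ K, IsCompact K → K ⊆ U → ∀ k, Cl (ov n K) (DE (ov n K)) k f

lemma RapidlyDecreasing.rd {α : Family m M L n} (h : RapidlyDecreasing α) (hα : IsWorm α)
  (e : Coord m M) : RD e.1.target (α e) := by
  intro K hK hKe k
  refine Cl.of_coeff fun S => cl_of_iteratedFDeriv (Ω := ov n K)
    (fun p hp => (hα.smAt (e := e) (hKe hp)).coeff S) (fun j N => ?_) k
  obtain ⟨C, hC⟩ := h e S K hK hKe j N
  obtain ⟨C', hC'⟩ := h e S K hK hKe j 0
  refine ⟨2 ^ N * (C + C'), fun p hp => ?_⟩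
  have h1 := hC p hp
  have h2 := hC' p hp
  simp only [pow_zero, one_mul] at h2
  have h3 : (1 + ‖p‖) ^ N ≤ 2 ^ N * (‖p‖ ^ N + 1) := by
    have hp0 := norm_nonneg p
    rcases le_total ‖p‖ 1 with h | h
    · calc (1 + ‖p‖) ^ N ≤ 2 ^ N := by gcongr; linarith
        _ ≤ _ := le_mul_of_one_le_right (by positivity) (by linarith [pow_nonneg hp0 N])
    · calc (1 + ‖p‖) ^ N ≤ (2 * ‖p‖) ^ N := by gcongr; linarith
        _ = 2 ^ N * ‖p‖ ^ N := by rw [mul_pow]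
        _ ≤ _ := by gcongr; linarith
  calc _ ≤ 2 ^ N * (‖p‖ ^ N + 1) * ‖iteratedFDeriv ℝ j (fun q => coeff S (α e q)) p‖ := by
        gcongr
    _ = 2 ^ N * (‖p‖ ^ N * ‖iteratedFDeriv ℝ j (fun q => coeff S (α e q)) p‖ +
        ‖iteratedFDeriv ℝ j (fun q => coeff S (α e q)) p‖) := by ring
    _ ≤ _ := by gcongr

lemma rapidlyDecreasing_of_rd {α : Family m M L n} (h : ∀ e : Coord m M, RD e.1.target (α e)) :
  RapidlyDecreasing α := by
  intro e S K hK hKe k N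
  obtain ⟨C, hC⟩ := Cl.iteratedFDeriv (Cl.linear (coeff S) (h e K hK hKe k)) N
  refine ⟨C, fun p hp => le_trans ?_ (hC p hp)⟩
  gcongr
  linarith

section

/-- The projection to the Grassmann algebra of the `θ`'s. -/
def kp (n : ℕ) (g : Type) [Fintype g] [LinearOrder g] : Gr (WithTheta n g) →ₐ[ℝ] Gr (Fin n) :=
  lam (fun s => Sum.elim gen (fun _ => 0) (ofLex s)) (by
    rintro (a | x)
    · exact gen_mem_pty _
    · exact Submodule.zero_mem _)

lemma kp_inr (y : Gr g) : kp n g (inr n g y) = algebraMap ℝ _ (body y) := by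
  refine map_rename (inrE n g).injective _ (Λ' := (Algebra.ofId ℝ (Gr (Fin n))).comp body)
    (fun s => ?_) y
  rw [kp, lam_gen, AlgHom.comp_apply, body_gen, map_zero]; rfl

lemma kp_tm (I : Ix n) : kp n g (tm g I) = mon I := by
  rw [tm_eq_ordProd, map_ordProd, mon_eq_ordProd]
  congr 1
  ext a; rw [kp, lam_gen]; rfl

lemma body_thetaPart (K : Ix n) (w : Gr (WithTheta n g)) :
  body (thetaPart K w) = coeff K (kp n g w) := by
  conv_rhs => rw [← sum_thetaPart w, map_sum, map_sum]
  rw [sum_eq_single K]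
  · rw [map_mul, kp_tm, kp_inr, ← Algebra.commutes, ← Algebra.smul_def, map_smul, coeff_mon]; simp
  · intro I _ hI
    rw [map_mul, kp_tm, kp_inr, ← Algebra.commutes, ← Algebra.smul_def, map_smul, coeff_mon,
      if_neg hI.symm, smul_zero]
  · simp

variable (φ : OddDiffeo n L)

/-- The body of a diffeomorphism of the odd space. -/
def OddDiffeo.bd (φ : OddDiffeo n L) (a : Fin n) : Gr (Fin n) := kp n (Fin L) (φ.comp a)

lemma kp_phat (a : Fin n) : kp n (Par L m n) (phat m φ a) = φ.bd a := by
  refine map_rename (ttE m n L).injective _ (fun s => ?_) (φ.comp a)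
  rw [kp, lam_gen, kp, lam_gen]
  rcases s with b | t <;> rfl

lemma bd_mem_pty (a : Fin n) : φ.bd a ∈ pty (Fin n) 1 := by
  refine map_mem_pty (fun s => ?_) (φ.odd a)
  rw [kp, lam_gen]
  rcases s with a | t
  · exact gen_mem_pty _
  · exact Submodule.zero_mem _

lemma coeff_bd (a b : Fin n) : coeff {b} (φ.bd a) = φ.jac a b := by
  rw [OddDiffeo.bd, ← body_thetaPart, body_eq_coeff, coeff_thetaPart]
  have : (jm {b} (∅ : Finset (Fin L)) : Finset (WithTheta n (Fin L))) = {toLex (Sum.inl b)} := by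
    rw [jm, Finset.disjSum_empty, map_singleton, map_singleton]; rfl
  rw [this]; rfl

lemma det_cmP_bd {P : Ix n → Prop} [DecidablePred P] :
  (cmP P φ.bd).det = (cmP P (lf φ.jac)).det := by
  refine det_cmP_congr (fun a => mem_fil_one_of_odd (bd_mem_pty φ a))
    (fun a => mem_fil_one_of_odd (lf_mem_pty _ a)) fun a S hS => ?_
  have hodd : φ.bd a - lf φ.jac a ∈ pty (Fin n) 1 :=
    Submodule.sub_mem _ (bd_mem_pty φ a) (lf_mem_pty _ a)
  rcases Nat.lt_succ_iff_lt_or_eq.1 hS with h | h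
  · refine coeff_eq_zero_of_mem_pty hodd ?_
    rw [show S.card = 0 by omega]; decide
  · obtain ⟨b, rfl⟩ := Finset.card_eq_one.1 h
    rw [map_sub, coeff_bd]
    simp only [lf, map_sum, map_smul]
    rw [sum_eq_single b]
    · rw [← mon_singleton, coeff_mon]; simp
    · intro c _ hc
      rw [← mon_singleton, coeff_mon, if_neg (by simpa using hc.symm), smul_zero]
    · simp

lemma zr_eq (p : Pt m n) (i : Fin m) (K : Ix n) :
  zr φ p i K = ∑ I, (sgnRev K * sgnRev I) • (thetaPart K (ordProd I (phat m φ)) *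
      coordFun p i I) := by
  unfold zr rcoord curve taylorCoeff
  rw [← thetaL_apply, map_sum, smul_sum]
  refine sum_congr rfl fun I _ => ?_
  rw [map_smul, thetaL_apply, thetaPart_mul_inr, smul_smul]

lemma body_zr (p : Pt m n) (i : Fin m) (K : Ix n) :
  body (zr φ p i K) = ∑ I : {I : Ix n // Even I.card},
      (sgnRev K * sgnRev I.1) * (cm φ.bd K I.1 * p ⟨(i, I.1), I.2⟩) := by
  rw [zr_eq, map_sum]
  have h1 : ∀ I : Ix n, body ((sgnRev K * sgnRev I) •
      (thetaPart K (ordProd I (phat m φ)) * coordFun (L := L) p i I)) =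
      (sgnRev K * sgnRev I) * (cm φ.bd K I * body (coordFun (L := L) p i I)) := by
    intro I
    rw [map_smul, map_mul, body_thetaPart, map_ordProd, smul_eq_mul]
    simp only [kp_phat]; rfl
  simp_rw [h1]
  rw [← Finset.sum_filter_of_ne (p := fun I : Ix n => Even I.card)]
  · rw [sum_subtype _ (p := fun I : Ix n => Even I.card) (fun J => by simp)]
    refine sum_congr rfl fun I _ => ?_
    rw [body_coordFun p ⟨(i, I.1), I.2⟩]
  · intro I _ h
    by_contra hI
    refine h ?_
    have : coordFun (L := L) p i I ∈ pty _ 1 := by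
      have := adm_coordFun (L := L) p i I; rwa [odd_cast hI] at this
    rw [body_odd this, mul_zero, mul_zero]

/-- The body of `zr`, as a linear map. -/
def zrLin (φ : OddDiffeo n L) (m : ℕ) : Pt m n →ₗ[ℝ] (Pt m n) :=
  LinearMap.pi fun c => ∑ I : {I : Ix n // Even I.card},
    (sgnRev c.1.2 * sgnRev I.1 * cm φ.bd c.1.2 I.1) • LinearMap.proj ⟨(c.1.1, I.1), I.2⟩

lemma zrLin_apply (p : Pt m n) : zrLin φ m p = bod (evn (zr φ p)) := by
  ext c
  rw [bod, body_zr]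
  simp [zrLin, mul_assoc]

lemma sgnRev_ne_zero (I : Ix n) : sgnRev I ≠ 0 :=
  left_ne_zero_of_mul_eq_one (sgnRev_mul_self I)

lemma zrLin_injective : Function.Injective (zrLin φ m) := by
  rw [← LinearMap.ker_eq_bot, LinearMap.ker_eq_bot']
  intro p hp
  have hdet : (cmP (fun I : Ix n => Even I.card) φ.bd).det ≠ 0 := by
    rw [det_cmP_bd]
    exact det_cmP_lf_ne_zero (fun I J h h' => h' ▸ h) φ.invertible
  ext ⟨⟨i, I⟩, hI⟩
  have h1 : (cmP (fun I : Ix n => Even I.card) φ.bd).mulVec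
      (fun I => sgnRev I.1 * p ⟨(i, I.1), I.2⟩) = 0 := by
    ext K
    have h2 := congrFun hp ⟨(i, K.1), K.2⟩
    simp only [zrLin, LinearMap.pi_apply, LinearMap.sum_apply, LinearMap.smul_apply,
      LinearMap.proj_apply, smul_eq_mul, Pi.zero_apply] at h2
    have h3 : sgnRev K.1 * ∑ I : {I : Ix n // Even I.card}, cm φ.bd K.1 I.1 *
        (sgnRev I.1 * p ⟨(i, I.1), I.2⟩) = 0 := by
      rw [← h2, mul_sum]
      exact sum_congr rfl fun I _ => by ring
    exact (mul_eq_zero.1 h3).resolve_left (sgnRev_ne_zero _)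
  have h4 := congrFun (Matrix.eq_zero_of_mulVec_eq_zero hdet h1) ⟨I, hI⟩
  exact (mul_eq_zero.1 h4).resolve_left (sgnRev_ne_zero _)

lemma Cl.coordFun {Ω : Set (Pt m n)} (k : ℕ) (i : Fin m) (I : Ix n) :
  Cl Ω (PG Ω) k fun p => coordFun (L := L) p i I := by
  unfold Worm.coordFun
  split_ifs with h
  · exact Cl.linear (Algebra.linearMap ℝ (Gr (Par L m n))) (Cl.coord _ k)
  · exact Cl.const k _

lemma Cl.zr {Ω : Set (Pt m n)} (k : ℕ) (i : Fin m) (I : Ix n) :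
  Cl Ω (PG Ω) k fun p => zr φ p i I := by
  simp_rw [zr_eq]
  exact Cl.sum fun J _ => Cl.smul (Cl.const k _)
    (Cl.mul (Cl.const k _) (Cl.coordFun k i J))

lemma DE.comp {κ κ' : Type} [Fintype κ] [Fintype κ'] {Ω : Set (Vec κ)} {Ω' : Set (κ' → ℝ)}
  {A : Vec κ → κ' → ℝ} (hA : ∀ p ∈ Ω, A p ∈ Ω') {C : ℝ} {r : ℕ}
  (hC : ∀ p ∈ Ω, 1 + ‖p‖ ≤ C * (1 + ‖A p‖) ^ r) {u : Vec κ' → ℝ} (hu : DE Ω' u) :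
  DE Ω fun p => u (A p) := by
  intro N
  obtain ⟨D, hD⟩ := hu (r * N)
  obtain ⟨D', hD'⟩ := hu 0
  refine ⟨|C| ^ N * |D|, fun p hp => ?_⟩
  rcases le_total (u (A p)) 0 with h | h
  · exact (mul_nonpos_of_nonneg_of_nonpos (by positivity) h).trans (by positivity)
  · calc (1 + ‖p‖) ^ N * u (A p) ≤ (|C| * (1 + ‖A p‖) ^ r) ^ N * u (A p) := by
          gcongr
          exact (hC p hp).trans (by gcongr; exact le_abs_self C)
      _ = |C| ^ N * ((1 + ‖A p‖) ^ (r * N) * u (A p)) := by rw [mul_pow, ← pow_mul]; ring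
      _ ≤ |C| ^ N * |D| := by gcongr; exact (hD _ (hA p hp)).trans (le_abs_self D)

lemma RD.rpar {U : Set (Bs m)} {f : SFun 0 m n} (hf : RD U f) : RD U (rpar φ f) := by
  intro K hK hKU k
  have hmap : ∀ p ∈ ov n K, bod (evn (Worm.zr φ p)) ∈ ov n K := fun p hp => by
    change baseOf _ ∈ K
    rw [baseOf_bod_zr]; exact hp
  obtain ⟨c, hc0, hc⟩ := (zrLin φ m).exists_antilipschitzWith
    (LinearMap.ker_eq_bot.2 (zrLin_injective φ))
  have hS : Subst (ov n K) (DE (ov n K)) (ov n K) (DE (ov n K)) fun p => evn (Worm.zr φ p) := by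
    refine ⟨fun k c => Cl.zr φ k _ _, hmap, fun u hu => DE.comp hmap (C := 1 + c) (r := 1) ?_ hu⟩
    intro p _
    have := hc.le_mul_norm (map_zero _) p
    rw [zrLin_apply] at this
    rw [pow_one]
    have hc' : (0 : ℝ) ≤ c := c.2
    have hb := norm_nonneg (bod (evn (Worm.zr φ p)))
    nlinarith
  refine Cl.gsub hS (fun k s => ?_) (hf K hK hKU) k
  obtain ⟨c, rfl⟩ := eq_parO s
  exact Cl.zr φ k _ _

lemma smAt_rpar {f : SFun 0 m n} {p : Pt m n} (hf : SmAt f (bod (evn (zr φ p)))) :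
  SmAt (rpar φ f) p := by
  refine SmAt.gsub (fun c => smAt_zr φ _ _ _) (fun s => ?_) hf
  obtain ⟨c, rfl⟩ := eq_parO s
  exact smAt_zr φ _ _ _

lemma IsWorm.reparam {α : Family m M 0 n} (hα : IsWorm α) : IsWorm (reparam φ α) where
  smooth := contDiffOn_of_smAt fun e p hp => smAt_rpar φ (hα.smAt (by
    change baseOf _ ∈ e.1.target
    rw [baseOf_bod_zr]; exact hp))
  compatible e e' p hp hp' := by
    have hψ := smAt_transition e e' hp hp'
    refine rpar_pullAlong φ (fun i => hψ.apply i) (fun q hq => hα.smAt ?_) fun q hq => ?_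
    · change baseOf q ∈ e'.1.target
      rw [hq]; exact e'.1.map_source hp'
    · refine hα.eventually e e' ?_ ?_
      · change baseOf q ∈ e.1.target
        rw [hq]; exact hp
      · change e.1.symm (baseOf q) ∈ e'.1.source
        rw [hq]; exact hp'

lemma rapidlyDecreasing_reparam {α : Family m M 0 n} (hα : IsWorm α) (h : RapidlyDecreasing α) :
  RapidlyDecreasing (reparam φ α) :=
  rapidlyDecreasing_of_rd fun e => RD.rpar φ (h.rd hα e)

end

/-! ### Infinitesimal reparametrizations -/

lemma dLeft_mem_pty (i : ι) {j : ZMod 2} {x : Gr ι} (hx : x ∈ pty ι j) :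
  dLeft i x ∈ pty ι (j + 1) := by
  have key : ∀ l : List ι, (l.map (gen : ι → Gr ι)).prod ∈ pty ι (l.length : ZMod 2) ∧
      dLeft i (l.map gen).prod ∈ pty ι (l.length + 1 : ZMod 2) := by
    intro l
    induction l with
    | nil => exact ⟨by simpa using one_mem_pty, by simp⟩
    | cons a l ih =>
      simp only [List.map_cons, List.prod_cons, List.length_cons, Nat.cast_add, Nat.cast_one]
      constructor
      · have := pty_mul (gen_mem_pty a) ih.1; rwa [add_comm] at this
      · rw [dLeft_mul_odd i (gen_mem_pty a), dLeft_gen]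
        have e : (l.length : ZMod 2) + 1 + 1 = l.length := by rw [add_assoc, CharTwo.add_self_eq_zero, add_zero]
        rw [e]
        refine Submodule.sub_mem _ ?_ ?_
        · split_ifs
          · rw [one_mul]; exact ih.1
          · rw [zero_mul]; exact Submodule.zero_mem _
        · have := pty_mul (gen_mem_pty a) ih.2
          rwa [add_comm, e] at this
  rw [← sum_coeff_mon x, map_sum]
  refine Submodule.sum_mem _ fun S _ => ?_
  rw [map_smul]
  by_cases h : (S.card : ZMod 2) = j
  · refine Submodule.smul_mem _ _ ?_
    have := (key (S.sort (· ≤ ·))).2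
    rw [length_sort, h] at this
    rw [mon_eq_ordProd]; exact this
  · rw [coeff_eq_zero_of_mem_pty hx h, zero_smul]; exact Submodule.zero_mem _

lemma body_dLeft (s : ι) (x : Gr ι) : body (dLeft s x) = coeff {s} x := by
  have h1 : ∀ y : Gr ι, coeff {s} (mon {s} * y) = coeff ∅ y := by
    intro y
    have : coeff {s} ∘ₗ LinearMap.mulLeft ℝ (mon {s} : Gr ι) = coeff ∅ := by
      refine linearMap_ext_mon fun T => ?_
      simp only [LinearMap.comp_apply, LinearMap.mulLeft_apply, coeff_mon]
      by_cases hT : ∅ = T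
      · subst hT; rw [mon_empty, mul_one, coeff_mon]; simp
      · rw [if_neg hT]
        by_contra h
        obtain ⟨hd, hu⟩ := coeff_mon_mul_mon h
        refine hT (Finset.eq_empty_of_forall_notMem fun t ht => ?_).symm
        have : t ∈ ({s} : Finset ι) := by rw [hu]; exact Finset.mem_union_right _ ht
        exact Finset.disjoint_left.1 hd this ht
    exact LinearMap.congr_fun this y
  rw [body_eq_coeff, ← h1, mon_singleton]
  change coeff {s} (num s x) = _
  rw [coeff_num]; simp

lemma dLeft_lam (k : ι) (b : σ → Gr ι) (hb : Odds b) (x : Gr σ) :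
  dLeft k (lam b hb x) = ∑ s, dLeft k (b s) * lam b hb (dLeft s x) :=
  derivation_lam (EvenDer.dLeft k) (-1)
    (fun x hx y => by rw [dLeft_mul_odd k hx, neg_smul, one_smul, sub_eq_add_neg]) b hb
    (fun s t => by
      have := dLeft_mem_pty k (hb t)
      rw [neg_smul, one_smul, (even_commute this (b s)).eq]) x

lemma euler_lam (A : Finset ι) (b : σ → Gr ι) (hb : Odds b) (x : Gr σ) :
  euler A (lam b hb x) = ∑ s, euler A (b s) * lam b hb (dLeft s x) :=
  derivation_lam (EvenDer.euler A) 1 (fun x _ y => by rw [one_smul, euler_mul]) b hb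
    (fun s t => by rw [one_smul, odd_anticomm (hb s) (euler_mem_pty A (hb t))]) x

lemma dLeft_rename {f : σ ↪ ι} {i : ι} (h : ∀ s, f s ≠ i) (x : Gr σ) :
  dLeft i (rename f x) = 0 := by
  have e : lam (fun s => (gen (f s) : Gr ι)) (fun s => gen_mem_pty _) = rename f :=
    gr_hom_ext fun s => by rw [lam_gen, rename_gen f.injective]
  rw [← e, dLeft_lam]
  refine sum_eq_zero fun s _ => ?_
  rw [dLeft_gen, if_neg (h s).symm, zero_mul]

lemma dLeft_rename_self {f : σ ↪ ι} (s : σ) (x : Gr σ) :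
  dLeft (f s) (rename f x) = rename f (dLeft s x) := by
  have e : lam (fun s => (gen (f s) : Gr ι)) (fun s => gen_mem_pty _) = rename f :=
    gr_hom_ext fun s => by rw [lam_gen, rename_gen f.injective]
  rw [← e, dLeft_lam, sum_eq_single s]
  · rw [dLeft_gen, if_pos rfl, one_mul]
  · intro t _ ht
    rw [dLeft_gen, if_neg fun h => ht (f.injective h).symm, zero_mul]
  · simp

lemma euler_rename {f : σ ↪ ι} {A : Finset ι} (h : ∀ s, f s ∉ A) (x : Gr σ) :
  euler A (rename f x) = 0 := by
  have e : lam (fun s => (gen (f s) : Gr ι)) (fun s => gen_mem_pty _) = rename f :=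
    gr_hom_ext fun s => by rw [lam_gen, rename_gen f.injective]
  rw [← e, euler_lam]
  refine sum_eq_zero fun s _ => ?_
  have : A ∩ {f s} = ∅ := by
    rw [Finset.inter_singleton_of_notMem (h s)]
  rw [← mon_singleton, euler_mon, this]; simp

lemma inr_mem_jm {K : Ix n} {S : Finset g} {a : g} : inrE n g a ∈ jm K S ↔ a ∈ S := by
  rw [mem_jm]; exact inr_mem_disjSum

lemma card_inter_jm [DecidableEq (WithTheta n g)] [DecidableEq g] (A : Finset g)
  (K : Ix n) (S : Finset g) : (A.map (inrE n g) ∩ jm K S).card = (A ∩ S).card := by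
  have : A.map (inrE n g) ∩ jm K S = (A ∩ S).map (inrE n g) := by
    ext x
    rw [Finset.mem_inter]
    constructor
    · rintro ⟨h1, h⟩
      obtain ⟨a, ha, rfl⟩ := Finset.mem_map.1 h1
      exact Finset.mem_map_of_mem _ (Finset.mem_inter.2 ⟨ha, inr_mem_jm.1 h⟩)
    · intro h
      obtain ⟨a, ha, rfl⟩ := Finset.mem_map.1 h
      exact ⟨Finset.mem_map_of_mem _ (Finset.mem_inter.1 ha).1,
        inr_mem_jm.2 (Finset.mem_inter.1 ha).2⟩
  rw [this, card_map]

lemma thetaPart_euler (A : Finset g) (K : Ix n) (w : Gr (WithTheta n g)) :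
  thetaPart K (euler (A.map (inrE n g)) w) = euler A (thetaPart K w) := by
  refine gr_ext fun S => ?_
  rw [coeff_thetaPart, coeff_euler, coeff_euler, coeff_thetaPart, card_inter_jm]

lemma pty_commute {ι : Type} {a b : ℕ} {x y : Gr ι} (hx : x ∈ pty ι (a : ZMod 2))
  (hy : y ∈ pty ι (b : ZMod 2)) : x * y = (-1 : ℝ) ^ (a * b) • (y * x) := by
  rcases Nat.even_or_odd a with ha | ha
  · rw [even_cast ha] at hx
    rw [(even_commute hx y).eq, Even.neg_one_pow (ha.mul_right b), one_smul]
  · rcases Nat.even_or_odd b with hb | hb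
    · rw [even_cast hb] at hy
      rw [← (even_commute hy x).eq, Even.neg_one_pow (hb.mul_left a), one_smul]
    · rw [odd_cast (Nat.not_even_iff_odd.2 ha)] at hx
      rw [odd_cast (Nat.not_even_iff_odd.2 hb)] at hy
      rw [odd_anticomm hx hy, Odd.neg_one_pow (ha.mul hb), neg_smul, one_smul]

lemma thetaPart_inr_mul {k : ℕ} {y : Gr g} (hy : y ∈ pty g (k : ZMod 2)) (K : Ix n)
  (w : Gr (WithTheta n g)) :
  thetaPart K (inr n g y * w) = (-1 : ℝ) ^ (k * K.card) • (y * thetaPart K w) := by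
  have hy' : inr n g y ∈ pty (WithTheta n g) (k : ZMod 2) := rename_mem_pty (inrE n g).injective hy
  conv_lhs => rw [← sum_thetaPart w, mul_sum, ← thetaL_apply, map_sum]
  rw [sum_eq_single K]
  · rw [← mul_assoc, pty_commute hy' (tm_mem_pty K), smul_mul_assoc, map_smul, mul_assoc, ← map_mul,
      thetaL_apply, thetaPart_tm_mul, if_pos rfl]
  · intro I _ hI
    rw [← mul_assoc, pty_commute hy' (tm_mem_pty I), smul_mul_assoc, map_smul, mul_assoc, ← map_mul,
      thetaL_apply, thetaPart_tm_mul, if_neg hI.symm, smul_zero]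
  · simp

lemma tm_eq_rename (I : Ix n) : tm g I = rename (inlE n g) (mon I) := by
  rw [rename_mon inlE_strictMono, mon_eq_ordProd, ordProd_map inlE_strictMono, tm_eq_ordProd]

lemma dLeft_inl_inr (b : Fin n) (y : Gr g) : dLeft (inlE n g b) (inr n g y) = 0 :=
  dLeft_rename (f := inrE n g) (fun _ h => Sum.inr_ne_inl (toLex.injective h)) y

lemma dLeft_tm_mul_inr (b : Fin n) (I : Ix n) (y : Gr g) :
  dLeft (inlE n g b) (tm g I * inr n g y) = rename (inlE n g) (dLeft b (mon I)) * inr n g y := by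
  rw [dLeft_mul, dLeft_inl_inr, mul_zero, add_zero,
    tm_eq_rename, dLeft_rename_self]

section

/-- The action of `-u^♭` on functions in coordinates. -/
def flatS (u : OddVF n) (f : SFun L m n) : SFun L m n := fun p =>
  ∑ c : EvenIdx m n, flatComp u p c.1.1 c.1.2 * pd c f p +
    ∑ c : OddIdx m n, flatComp u p c.1.1 c.1.2 * dLeft (parO c) (f p)

/-- The indices of the parameters. -/
def parLE (L m n : ℕ) : Fin L ↪ Par L m n := ⟨parL, toLex.injective.comp Sum.inl_injective⟩

lemma parLE_strictMono : StrictMono (parLE L m n) := fun _ _ h => Sum.Lex.inl_lt_inl_iff.mpr h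

/-- The monomials in the parameters. -/
abbrev mT (m n : ℕ) (T : Finset (Fin L)) : Gr (Par L m n) := mon (T.map (parLE L m n))

lemma coordFun_tau (p : Pt m n) (i : Fin m) (I : Ix n) :
  euler (Finset.univ.map (parLE L m n)) (coordFun (L := L) p i I) = 0 := by
  unfold coordFun
  split_ifs with h
  · rw [euler_algebraMap]
  · rw [← mon_singleton, euler_mon, Finset.inter_singleton_of_notMem]
    · simp
    · simp only [Finset.mem_map, Finset.mem_univ, true_and, not_exists]
      exact fun t h => Sum.inl_ne_inr (toLex.injective h)

lemma euler_inr (A : Finset (Par L m n)) (y : Gr (Par L m n)) :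
  euler (A.map (inrE n _)) (inr n (Par L m n) y) = inr n _ (euler A y) := by
  refine theta_ext fun K => ?_
  have h : ∀ x : Gr (Par L m n), thetaPart K (inr n (Par L m n) x) = if K = ∅ then x else 0 := by
    intro x
    have := thetaPart_tm_mul (g := Par L m n) K ∅ x
    rwa [tm_eq_rename, mon_empty, map_one, one_mul] at this
  rw [thetaPart_euler, h, h]
  split_ifs <;> simp

variable (φ : OddDiffeo n L)

/-- The vector field which is the coefficient of a monomial in the parameters. -/
def coeffVF (w : Fin n → Gr (WithTheta n (Fin L))) (T : Finset (Fin L)) : OddVF n :=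
  fun a => ∑ J, coeff (jm J T) (w a) • mon J

lemma coeff_coeffVF (w : Fin n → Gr (WithTheta n (Fin L))) (T : Finset (Fin L)) (a : Fin n)
  (J : Ix n) : coeff J (coeffVF w T a) = coeff (jm J T) (w a) := by
  simp only [coeffVF, map_sum, map_smul, coeff_mon, smul_eq_mul]
  simp

lemma rename_ttE_tm (J : Ix n) (T : Finset (Fin L)) :
  rename (ttE m n L) (mon (jm J T)) = tm (Par L m n) J * inr n _ (mT m n T) := by
  rw [mon_jm, map_mul, tm_eq_rename, tm_eq_rename]
  congr 1
  · refine map_rename (inlE n _).injective _ (fun s => ?_) _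
    rw [rename_gen (ttE m n L).injective, rename_gen (inlE n _).injective]; rfl
  · rw [mT, ← rename_mon parLE_strictMono]
    refine map_rename (Λ' := (inr n _).comp (rename (parLE L m n))) (inrE n _).injective _ (fun s => ?_) _
    rw [rename_gen (ttE m n L).injective, AlgHom.comp_apply, rename_gen (parLE L m n).injective,
      rename_gen (inrE n _).injective]; rfl

lemma euler_zr {w : Fin n → Gr (WithTheta n (Fin L))} (hw : Odds w)
  (hwφ : ∀ a, ∑ b, w b * dLeft (inlE n _ b) (φ.comp a) =
      euler (Finset.univ.map (inrE n (Fin L))) (φ.comp a))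
  (p : Pt m n) (i : Fin m) (K : Ix n) :
  euler (Finset.univ.map (parLE L m n)) (zr φ p i K) =
      ∑ T, mT m n T * ∑ I, flatCoeff (coeffVF w T) K I • zr φ p i I := by
  set AT := Finset.univ.map (parLE L m n)
  set A' := AT.map (inrE n (Par L m n)) with hA'
  have hφ := phat_mem_pty (m := m) φ
  set Λ := lam (phat m φ) hφ with hΛ
  -- the equation for `w` among all generators
  have hbig : ∀ a, ∑ b, rename (ttE m n L) (w b) * dLeft (inlE n _ b) (phat m φ a) =
      euler A' (phat m φ a) := by
    intro a
    have h1 := congrArg (rename (ttE m n L)) (hwφ a)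
    rw [map_sum] at h1
    have h2 : ∀ b, rename (ttE m n L) (w b * dLeft (inlE n _ b) (φ.comp a)) =
        rename (ttE m n L) (w b) * dLeft (inlE n _ b) (phat m φ a) := by
      intro b
      rw [map_mul, phat]
      congr 1
      exact (dLeft_rename_self (f := ttE m n L) (inlE n _ b) (φ.comp a)).symm
    simp_rw [h2] at h1
    rw [h1, phat]
    -- the Euler operator commutes with renaming
    have h3 : ∀ x : Gr (WithTheta n (Fin L)), rename (ttE m n L)
        (euler (Finset.univ.map (inrE n (Fin L))) x) = euler A' (rename (ttE m n L) x) := by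
      intro x
      have : (rename (ttE m n L)).toLinearMap ∘ₗ euler (Finset.univ.map (inrE n (Fin L))) =
          euler A' ∘ₗ (rename (ttE m n L)).toLinearMap := by
        refine linearMap_ext_mon fun S => ?_
        obtain ⟨⟨J, T⟩, rfl⟩ := (jmEquiv n (Fin L)).surjective S
        simp only [LinearMap.comp_apply, AlgHom.toLinearMap_apply, jmEquiv_apply]
        rw [euler_mon, map_smul, rename_ttE_tm, ← mon_jm, euler_mon]
        rw [hA', card_inter_jm, card_inter_jm, Finset.univ_inter]
        congr 2
        have e : AT ∩ T.map (parLE L m n) = T.map (parLE L m n) := Finset.inter_eq_right.2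
          (Finset.map_subset_map.2 (Finset.subset_univ _))
        rw [e, card_map]
      exact LinearMap.congr_fun this x
    exact h3 _
  have hcurve : gcurve (zr φ p) i =
      ∑ I, sgnRev I • (Λ (mon I) * inr n (Par L m n) (coordFun p i I)) := by
    rw [gcurve_rcoord hφ, Th_gcurve hφ]
    exact sum_congr rfl fun I _ => by rw [hΛ, lam_mon]
  have hE : euler A' (gcurve (zr φ p) i) =
      ∑ b, rename (ttE m n L) (w b) * dLeft (inlE n _ b) (gcurve (zr φ p) i) := by
    rw [hcurve, map_sum]
    simp only [map_sum, map_smul, mul_sum, mul_smul_comm]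
    rw [sum_comm]
    refine sum_congr rfl fun I _ => ?_
    rw [← smul_sum, euler_mul, euler_inr, coordFun_tau, map_zero, mul_zero, add_zero,
      euler_lam, sum_mul]
    congr 1
    have h4 : ∀ b, dLeft (inlE n (Par L m n) b) (Λ (mon I) * inr n _ (coordFun p i I)) =
        ∑ a, dLeft (inlE n _ b) (phat m φ a) * Λ (dLeft a (mon I)) * inr n _ (coordFun p i I) := by
      intro b
      rw [dLeft_mul, dLeft_inl_inr, mul_zero,
        add_zero, dLeft_lam, sum_mul]
    simp_rw [h4, mul_sum]
    rw [sum_comm]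
    refine sum_congr rfl fun a _ => ?_
    rw [← hbig a, sum_mul, sum_mul]
    exact sum_congr rfl fun b _ => by simp only [mul_assoc]; rfl
  have hzr : zr φ p i K = taylorCoeff K (gcurve (zr φ p) i) := (taylorCoeff_gcurve _ i K).symm
  rw [hzr, taylorCoeff, map_smul, ← thetaPart_euler, hE, ← thetaL_apply, map_sum]
  have h5 : ∀ b, thetaL K (rename (ttE m n L) (w b) * dLeft (inlE n _ b) (gcurve (zr φ p) i)) =
      ∑ T : Finset (Fin L), mT m n T * ∑ I, ∑ J, (coeff (jm J T) (w b) *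
        (-1) ^ ((J.card + 1) * K.card) * (sgnRev I * coeff K (mon J * dLeft b (mon I)))) •
          zr φ p i I := by
    intro b
    have hw1 : rename (ttE m n L) (w b) =
        ∑ T, ∑ J, coeff (jm J T) (w b) • (tm (Par L m n) J * inr n _ (mT m n T)) := by
      conv_lhs => rw [← sum_coeff_mon (w b), map_sum]
      rw [← (jmEquiv n (Fin L)).sum_comp, Fintype.sum_prod_type, sum_comm]
      refine sum_congr rfl fun T _ => sum_congr rfl fun J _ => ?_
      rw [map_smul, jmEquiv_apply, rename_ttE_tm]
    rw [hw1, sum_mul, map_sum]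
    refine sum_congr rfl fun T _ => ?_
    rw [sum_mul, map_sum, sum_comm, mul_sum]
    refine sum_congr rfl fun J _ => ?_
    rw [smul_mul_assoc, map_smul]
    by_cases hc : coeff (jm J T) (w b) = 0
    · rw [hc, zero_smul]; simp
    have hpar : ((J.card + T.card : ℕ) : ZMod 2) = 1 := by
      by_contra h
      exact hc (coeff_eq_zero_of_mem_pty (hw b) (by rwa [card_jm]))
    have hpar' : Odd (J.card + T.card) := ZMod.natCast_eq_one_iff_odd.1 hpar
    have hmT : mT m n T ∈ pty (Par L m n) (T.card : ZMod 2) := by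
      have := mon_mem_pty (T.map (parLE L m n)); rwa [card_map] at this
    have hmT' : inr n _ (mT m n T) ∈ pty (WithTheta n (Par L m n)) (T.card : ZMod 2) :=
      rename_mem_pty (inrE n _).injective hmT
    have hJT : Even (J.card * T.card) := by
      rcases Nat.even_or_odd J.card with h | h
      · exact h.mul_right _
      · exact ((Nat.odd_add.1 hpar').1 h).mul_left _
    have hsgn : (-1 : ℝ) ^ (T.card * K.card) = (-1) ^ ((J.card + 1) * K.card) := by
      rw [pow_mul, pow_mul]
      congr 1
      rcases Nat.even_or_odd J.card with h | h
      · have hT : Odd T.card := by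
          rw [add_comm] at hpar'; exact (Nat.odd_add.1 hpar').2 h
        rw [hT.neg_one_pow, h.add_one.neg_one_pow]
      · have hT : Even T.card := (Nat.odd_add.1 hpar').1 h
        rw [hT.neg_one_pow, h.add_one.neg_one_pow]
    rw [pty_commute (tm_mem_pty J) hmT', hJT.neg_one_pow, one_smul, mul_assoc, thetaL_apply,
      thetaPart_inr_mul hmT, hsgn]
    have h6 : thetaPart K (tm (Par L m n) J * dLeft (inlE n _ b) (gcurve (zr φ p) i)) =
        ∑ I, (sgnRev I * coeff K (mon J * dLeft b (mon I))) • zr φ p i I := by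
      unfold gcurve
      rw [map_sum, mul_sum, ← thetaL_apply, map_sum]
      refine sum_congr rfl fun I _ => ?_
      have hK : thetaPart K (rename (inlE n (Par L m n)) (mon J * dLeft b (mon I)) *
          inr n _ (zr φ p i I)) = coeff K (mon J * dLeft b (mon I)) • zr φ p i I := by
        rw [thetaPart_inl_mul, sum_eq_single ∅]
        · rw [mon_empty, mul_one, thetaPart_empty, killTheta_inr]
        · intro I' _ hI'
          have := thetaPart_tm_mul (g := Par L m n) I' ∅ (zr φ p i I)
          rw [tm_eq_rename, mon_empty, map_one, one_mul, if_neg hI'] at this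
          rw [this, smul_zero]
        · simp
      rw [map_smul, dLeft_tm_mul_inr, mul_smul_comm, map_smul, thetaL_apply, ← mul_assoc,
        tm_eq_rename, ← map_mul, hK, smul_smul]
    rw [h6, mul_sum, mul_sum, smul_sum, smul_sum]
    refine sum_congr rfl fun I _ => ?_
    rw [mul_smul_comm, mul_smul_comm, smul_smul, smul_smul]
  simp_rw [h5]
  rw [sum_comm, smul_sum]
  refine sum_congr rfl fun T _ => ?_
  rw [← mul_sum, ← mul_smul_comm]
  congr 1
  rw [sum_comm, smul_sum]
  refine sum_congr rfl fun I _ => ?_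
  unfold flatCoeff
  simp_rw [coeff_coeffVF]
  rw [sum_smul, smul_sum]
  refine sum_congr rfl fun b _ => ?_
  rw [sum_smul, smul_sum]
  refine sum_congr rfl fun J _ => ?_
  rw [smul_smul]
  congr 1; ring

end

section

lemma sum_par {A : Type*} [AddCommMonoid A] (F : Par L m n → A) :
  ∑ s, F s = ∑ t, F (parL t) + ∑ c, F (parO c) :=
  (toLex.sum_comp F).symm.trans (Fintype.sum_sum_type _)

lemma SmAt.flatComp {u : OddVF n} (p : Pt m n) (i : Fin m) (K : Ix n) :
  SmAt (fun q => flatComp (L := L) u q i K) p :=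
  SmAt.sum fun _ _ => SmAt.smul (SmAt.const _ _) (smAt_coordFun _ _ _)

lemma zero_flatS (f : SFun L m n) : flatS (0 : OddVF n) f = fun _ => 0 := by
  ext q; simp [flatS, flatComp, flatCoeff]

lemma SmAt.flatS {u : OddVF n} {f : SFun L m n} {p : Pt m n} (hf : SmAt f p) :
  SmAt (flatS u f) p :=
  (SmAt.sum fun _ _ => (SmAt.flatComp p _ _).mul (hf.pd _)).add
    (SmAt.sum fun _ _ => (SmAt.flatComp p _ _).mul (SmAt.linear (A := Gr (Par L m n)) _ hf))

lemma RD.flatS {u : OddVF n} {U : Set (Bs m)} {f : SFun L m n} (hf : RD U f) :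
  RD U (flatS u f) := by
  intro K hK hKU k
  have hc : ∀ i I, Cl (ov n K) (PG (ov n K)) k fun q => flatComp (L := L) u q i I := fun i I =>
    Cl.sum fun J _ => Cl.smul (Cl.const k _) (Cl.coordFun k i J)
  exact Cl.add (Cl.sum fun c _ => Cl.mul (hc _ _)
    ((hf K hK hKU (k + 1)).2 c)) (Cl.sum fun c _ => Cl.mul (hc _ _)
    (Cl.linear _ (hf K hK hKU k)))

lemma gsub_flatS (u : OddVF n) {f : SFun L m n}
  {Z : Crd m n ι} (hZ : Adm Z) {t : Fin L → Gr ι}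
  (ht : Odds t) (hf : SmAt f (bod (evn Z))) :
  gsub (flatS u f) (evn Z) (odn t Z) =
      ∑ c : EvenIdx m n, (∑ I, flatCoeff u c.1.2 I • Z c.1.1 I) * gsub (pd c f) (evn Z) (odn t Z) +
      ∑ c : OddIdx m n, (∑ I, flatCoeff u c.1.2 I • Z c.1.1 I) *
        gsub (fun q => dLeft (parO c) (f q)) (evn Z) (odn t Z) := by
  have hb := hZ.odn ht
  have h1 : ∀ i K, gsub (fun q => flatComp (L := L) u q i K) (evn Z) (odn t Z) =
      ∑ I, flatCoeff u K I • Z i I := by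
    intro i K
    unfold Worm.flatComp
    rw [gsub_sum _ fun I _ => SmAt.smul (SmAt.const _ _) (smAt_coordFun _ _ _)]
    refine sum_congr rfl fun I _ => ?_
    rw [gsub_const_smul _ (smAt_coordFun _ _ _) hZ.evn hb, gsub_coordFun hZ ht]
  have hl : ∀ c : OddIdx m n, SmAt (fun q => dLeft (parO c) (f q)) (bod (evn Z)) := fun c =>
    SmAt.linear (A := Gr (Par L m n)) _ hf
  unfold flatS
  rw [gsub_add _ (SmAt.sum fun c _ => (SmAt.flatComp _ _ _).mul (hf.pd c))
      (SmAt.sum fun c _ => (SmAt.flatComp _ _ _).mul (hl c)),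
    gsub_sum _ fun c _ => (SmAt.flatComp _ _ _).mul (hf.pd c),
    gsub_sum _ fun c _ => (SmAt.flatComp _ _ _).mul (hl c)]
  congr 1
  · refine sum_congr rfl fun c _ => ?_
    rw [gsub_mul (SmAt.flatComp _ _ _) (hf.pd c) hZ.evn hb, h1]
  · refine sum_congr rfl fun c _ => ?_
    rw [gsub_mul (SmAt.flatComp _ _ _) (hl c) hZ.evn hb, h1]

variable (φ : OddDiffeo n L)

/-- The derivative of a reparametrization with respect to the parameters. -/
lemma euler_rpar {w : Fin n → Gr (WithTheta n (Fin L))} (hw : Odds w)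
  (hwφ : ∀ a, ∑ b, w b * dLeft (inlE n _ b) (φ.comp a) =
      euler (Finset.univ.map (inrE n (Fin L))) (φ.comp a))
  {f : SFun 0 m n} {p : Pt m n} (hf : SmAt f (bod (evn (zr φ p)))) :
  euler (Finset.univ.map (parLE L m n)) (rpar φ f p) =
      ∑ T, mT m n T * rpar φ (flatS (coeffVF w T) f) p := by
  have hz := adm_zr φ p
  unfold rpar
  rw [euler_gsub _ hf hz.evn (hz.odn t0_mem), sum_par]
  simp_rw [gsub_flatS _ hz t0_mem hf, mul_add, sum_add_distrib]
  congr 1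
  · simp_rw [mul_sum (Finset.univ : Finset (EvenIdx m n))]
    rw [sum_comm]
    refine sum_congr rfl fun c _ => ?_
    rw [evn, euler_zr φ hw hwφ, sum_mul]
    exact sum_congr rfl fun T _ => by rw [mul_assoc]
  · simp_rw [mul_sum (Finset.univ : Finset (OddIdx m n))]
    rw [sum_comm, sum_eq_zero (s := (Finset.univ : Finset (Fin 0))) fun t _ => t.elim0,
      zero_add]
    refine sum_congr rfl fun c _ => ?_
    change euler _ (zr φ p c.1.1 c.1.2) * _ = _
    rw [euler_zr φ hw hwφ, sum_mul]
    exact sum_congr rfl fun T _ => by rw [mul_assoc]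

lemma matrix_isUnit (X : Matrix (Fin n) (Fin n) (Gr ι))
  (h : IsUnit (X.map body).det) : ∃ Y : Matrix (Fin n) (Fin n) (Gr ι), Y * X = 1 := by
  set B : Matrix (Fin n) (Fin n) ℝ := X.map body
  set Y0 : Matrix (Fin n) (Fin n) (Gr ι) := B⁻¹.map (algebraMap ℝ (Gr ι))
  set N := 1 - Y0 * X
  have hN : ∀ i j, N i j ∈ fil ι 1 := by
    intro i j
    rw [mem_fil_one]
    have h1 : (Y0 * X).map body = B⁻¹ * B := by
      rw [Matrix.map_mul]
      congr 1
      ext i j; simp [Y0, body_algebraMap]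
    have h2 : body ((Y0 * X) i j) = (1 : Matrix (Fin n) (Fin n) ℝ) i j := by
      rw [Matrix.nonsing_inv_mul _ h] at h1
      exact congrFun (congrFun h1 i) j
    change body ((1 : Matrix (Fin n) (Fin n) (Gr ι)) i j - (Y0 * X) i j) = 0
    rw [map_sub, h2, Matrix.one_apply, Matrix.one_apply]
    split_ifs <;> simp
  have hpow : ∀ r i j, (N ^ r) i j ∈ fil ι r := by
    intro r
    induction r with
    | zero => intro i j; exact fil_zero _
    | succ r ih =>
      intro i j
      rw [pow_succ, Matrix.mul_apply]
      exact Submodule.sum_mem _ fun k _ => fil_mul (ih i k) (hN k j)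
  have hnil : IsNilpotent N := ⟨Fintype.card ι + 1, by
    ext i j; exact fil_eq_zero (Nat.lt_succ_self _) (hpow _ i j)⟩
  obtain ⟨V, hV⟩ := (hnil.isUnit_one_sub).exists_left_inv
  refine ⟨V * Y0, ?_⟩
  rw [mul_assoc, ← hV]
  simp [N]

lemma exists_generator : ∃ w : Fin n → Gr (WithTheta n (Fin L)), (Odds w) ∧
  (∀ a, ∑ b, w b * dLeft (inlE n _ b) (φ.comp a) =
      euler (Finset.univ.map (inrE n (Fin L))) (φ.comp a)) ∧
  (∀ b J, coeff (jm J ∅) (w b) = 0) ∧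
  (φ.FixesOrigin → ∀ b T, coeff (jm ∅ T) (w b) = 0) := by
  set E := euler (Finset.univ.map (inrE n (Fin L)))
  set X : Matrix (Fin n) (Fin n) (Gr (WithTheta n (Fin L))) :=
    Matrix.of fun b a => dLeft (inlE n _ b) (φ.comp a) with hX
  have hdet : IsUnit (X.map body).det := by
    have : X.map body = (φ.jac).transpose := by
      ext b a
      change body (dLeft _ (φ.comp a)) = _
      rw [body_dLeft]; rfl
    rw [this, Matrix.det_transpose]; exact φ.invertible
  obtain ⟨Y, hY⟩ := matrix_isUnit X hdet
  set w0 : Fin n → Gr (WithTheta n (Fin L)) := fun b => ∑ a, E (φ.comp a) * Y a b with hw0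
  have h0 : ∀ a, ∑ b, w0 b * X b a = E (φ.comp a) := by
    intro a
    simp_rw [hw0, sum_mul]
    rw [sum_comm]
    simp_rw [mul_assoc, ← mul_sum]
    have h1 : ∀ c, ∑ b, Y c b * X b a = if c = a then 1 else 0 := by
      intro c
      have := congrFun (congrFun hY c) a
      rwa [Matrix.mul_apply, Matrix.one_apply] at this
    simp_rw [h1]; simp
  have hpr : ∀ (b : Fin n) (S : Finset (WithTheta n (Fin L))), coeff S (w0 b) = 0 →
      coeff S (ptyProj 1 (w0 b)) = 0 := fun b S h => by
    rw [coeff_ptyProj, h]; simp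
  refine ⟨fun b => ptyProj 1 (w0 b), fun b => ptyProj_mem _ _, fun a => ?_, fun b J => ?_,
    fun hfix b T => ?_⟩
  · have h1 : ∀ b, ptyProj 1 (w0 b) * dLeft (inlE n _ b) (φ.comp a) =
        ptyProj 1 (w0 b * X b a) := by
      intro b
      rw [ptyProj_mul]; · rfl
      have := dLeft_mem_pty (inlE n _ b) (φ.odd a)
      rwa [CharTwo.add_self_eq_zero] at this
    simp_rw [h1]
    rw [← map_sum, h0]
    exact (ptyProj_of_mem (euler_mem_pty _ (φ.odd a))).1
  · refine hpr b _ ?_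
    rw [← coeff_thetaPart, ← body_eq_coeff, body_thetaPart, hw0, map_sum]
    have : ∀ a, kp n (Fin L) (E (φ.comp a)) = 0 := by
      intro a
      refine gr_ext fun K => ?_
      rw [← body_thetaPart, body_eq_coeff, coeff_thetaPart, coeff_euler, card_inter_jm]; simp
    simp [this]
  · refine hpr b _ ?_
    rw [← coeff_thetaPart, thetaPart_empty, hw0, map_sum]
    have : ∀ a, killTheta n (Fin L) (E (φ.comp a)) = 0 := by
      intro a
      rw [← thetaPart_empty, thetaPart_euler, hfix, map_zero]
    simp [this]

end

section

variable [DecidableEq g] (Λ : Gr g →ₐ[ℝ] Gr ι) (hΛ : ∀ s, Λ (gen s) ∈ pty ι 1)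

/-- The extension of a homomorphism which preserves the `θ`'s. -/
def lift (n : ℕ) : Gr (WithTheta n g) →ₐ[ℝ] Gr (WithTheta n ι) :=
  lam (extOdd n fun s => Λ (gen s)) (extOdd_mem_pty hΛ)

lemma body_lift (x : Gr (WithTheta n g)) : body (lift Λ hΛ n x) = body x := body_lam _ _ x

lemma lift_inl (a : Fin n) : lift Λ hΛ n (gen (inlE n g a)) = gen (inlE n ι a) := by
  rw [lift, lam_gen]; rfl

lemma lift_inr (y : Gr g) : lift Λ hΛ n (inr n g y) = inr n ι (Λ y) :=
  map_rename (Λ' := (inr n ι).comp Λ) (inrE n g).injective _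
    (fun s => by rw [lift, lam_gen]; rfl) y

lemma lift_tm (I : Ix n) : lift Λ hΛ n (tm g I) = tm ι I := by
  rw [tm_eq_ordProd, tm_eq_ordProd, map_ordProd]
  congr 1; ext a; convert lift_inl Λ hΛ a

lemma thetaPart_lift (K : Ix n) (w : Gr (WithTheta n g)) :
  thetaPart K (lift Λ hΛ n w) = Λ (thetaPart K w) := by
  conv_lhs => rw [← sum_thetaPart w, map_sum, ← thetaL_apply, map_sum]
  rw [sum_eq_single K]
  · rw [map_mul, lift_tm, lift_inr, thetaL_apply, thetaPart_tm_mul, if_pos rfl]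
  · intro I _ hI
    rw [map_mul, lift_tm, lift_inr, thetaL_apply, thetaPart_tm_mul, if_neg hI.symm]
  · simp

lemma lift_gcurve (Z : Fin m → Ix n → Gr g) (i : Fin m) :
  lift Λ hΛ n (gcurve Z i) = gcurve (fun i I => Λ (Z i I)) i := by
  refine theta_ext fun K => ?_
  rw [thetaPart_lift, thetaPart_gcurve, thetaPart_gcurve, map_smul]

end

/-- The odd coordinates among the parameters and the odd coordinates. -/
def embE (L m n : ℕ) : Par 0 m n ↪ Par L m n :=
  ⟨fun s => Sum.elim (fun t => t.elim0) parO (ofLex s), by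
    rintro (t | c) (t' | c') h
    · exact t.elim0
    · exact t.elim0
    · exact t'.elim0
    · exact congrArg (fun c => toLex (Sum.inr c)) (Sum.inr_injective (toLex.injective h))⟩

/-- The inclusion of the functions which do not depend on the parameters. -/
abbrev emb (L m n : ℕ) : Gr (Par 0 m n) →ₐ[ℝ] Gr (Par L m n) := rename (embE L m n)

lemma emb_mem (s : Par 0 m n) : emb L m n (gen s) ∈ pty (Par L m n) 1 := by
  rw [rename_gen (embE L m n).injective]; exact gen_mem_pty _

lemma emb_coordFun (p : Pt m n) (i : Fin m) (I : Ix n) :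
  emb L m n (coordFun p i I) = coordFun p i I := by
  unfold coordFun
  split_ifs with h
  · rw [AlgHom.commutes]
  · rw [rename_gen (embE L m n).injective]; rfl

lemma emb_pcoord {ψ : Bs m → Bs m} {p : Pt m n}
  (hψ : ∀ i, SmAt (fun x => ψ x i) (baseOf p)) (i : Fin m) (I : Ix n) :
  emb L m n (pcoord 0 ψ p i I) = pcoord L ψ p i I := by
  unfold pcoord taylorCoeff
  rw [map_smul, ← thetaPart_lift (emb L m n) emb_mem]
  have h := map_taylor (lift (emb L m n) emb_mem n) (body_lift _ _)
    (a := gcurve (coordFun (L := 0) p)) (h := fun x => ψ x i)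
    (by rw [bod_gcurve_coordFun]; exact hψ i)
  rw [h]
  congr 3
  ext j
  refine (lift_gcurve _ emb_mem _ j).trans ?_
  simp_rw [emb_coordFun]

/-- The restriction to the zero values of the parameters. -/
def kl (L m n : ℕ) : Gr (Par L m n) →ₐ[ℝ] Gr (Par 0 m n) :=
  lam (fun s => Sum.elim (fun _ => 0) (fun c => gen (parO c)) (ofLex s)) (by
    rintro (t | c)
    · exact Submodule.zero_mem _
    · exact gen_mem_pty _)

lemma kl_mem (s : Par L m n) : kl L m n (gen s) ∈ pty (Par 0 m n) 1 := by
  rw [kl, lam_gen]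
  rcases s with t | c
  · exact Submodule.zero_mem _
  · exact gen_mem_pty _

lemma body_kl (x : Gr (Par L m n)) : body (kl L m n x) = body x := body_lam _ _ x

lemma kl_emb (x : Gr (Par 0 m n)) : kl L m n (emb L m n x) = x := by
  refine map_rename (Λ' := AlgHom.id ℝ _) (embE L m n).injective _ (fun s => ?_) x
  rw [kl, lam_gen]
  obtain ⟨c, rfl⟩ := eq_parO s
  rfl

lemma kl_coordFun (p : Pt m n) (i : Fin m) (I : Ix n) :
  kl L m n (coordFun p i I) = coordFun p i I := by
  rw [← emb_coordFun, kl_emb]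

lemma kl_mT {T : Finset (Fin L)} (hT : T.Nonempty) : kl L m n (tm (OddIdx m n) T) = 0 := by
  have : kl L m n (rename (inlE L (OddIdx m n)) (mon T)) = algebraMap ℝ _ (body (mon T)) := by
    refine map_rename (Λ' := (Algebra.ofId ℝ _).comp body) (inlE L _).injective _ (fun t => ?_) _
    rw [kl, lam_gen, AlgHom.comp_apply, body_gen, map_zero]; rfl
  rw [tm_eq_rename, this, body_eq_coeff, coeff_mon, if_neg hT.ne_empty.symm, map_zero]

lemma emb_kl_inr (y : Gr (OddIdx m n)) :
  emb L m n (kl L m n (inr L (OddIdx m n) y)) = inr L (OddIdx m n) y := by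
  have : ((emb L m n).comp ((kl L m n).comp (inr L (OddIdx m n)))) = inr L (OddIdx m n) := by
    refine gr_hom_ext fun c => ?_
    simp only [AlgHom.comp_apply]
    rw [rename_gen (inrE L (OddIdx m n)).injective, kl, lam_gen]
    exact rename_gen (embE L m n).injective _
  exact AlgHom.congr_fun this y

lemma mT_eq_tm (T : Finset (Fin L)) : mT m n T = tm (OddIdx m n) T := by
  rw [tm_eq_rename, rename_mon inlE_strictMono]; rfl

lemma mon_mul_self {S T : Finset ι}
  (h : ¬ Disjoint S T) : (mon S * mon T : Gr ι) = 0 := by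
  refine gr_ext fun U => ?_
  rw [map_zero]
  by_contra h'
  exact h (coeff_mon_mul_mon h').1

lemma mT_univ_mul (W : Gr (Par L m n)) :
  mT m n Finset.univ * W = mT m n Finset.univ * emb L m n (kl L m n W) := by
  have : LinearMap.mulLeft ℝ (mT m n (L := L) Finset.univ) =
      LinearMap.mulLeft ℝ (mT m n Finset.univ) ∘ₗ ((emb L m n).comp (kl L m n)).toLinearMap := by
    refine linearMap_ext_mon fun S => ?_
    obtain ⟨⟨T, S'⟩, rfl⟩ := (jmEquiv L (OddIdx m n)).surjective S
    simp only [LinearMap.coe_comp, Function.comp_apply, LinearMap.mulLeft_apply,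
      AlgHom.toLinearMap_apply, AlgHom.comp_apply]
    rw [jmEquiv_apply, mon_jm, map_mul, map_mul, emb_kl_inr, ← mul_assoc, ← mul_assoc]
    congr 1
    rcases T.eq_empty_or_nonempty with rfl | hT
    · rw [← mT_eq_tm]; simp [mT, mon_empty]
    · rw [kl_mT hT, map_zero, mul_zero, ← mT_eq_tm, mon_mul_self]
      rw [Finset.disjoint_map]
      intro h
      obtain ⟨t, ht⟩ := hT
      exact Finset.disjoint_left.mp h (Finset.mem_univ t) ht
  exact LinearMap.congr_fun this W

/-! ### The action of vector fields on worms -/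

section

variable (φ : OddDiffeo n L)

lemma lift_kl_phat (a : Fin n) :
  lift (kl L m n) kl_mem n (phat m φ a) = rename (inlE n (Par 0 m n)) (φ.bd a) := by
  refine map_rename (Λ' := (rename (inlE n (Par 0 m n))).comp (kp n (Fin L))) (ttE m n L).injective
    _ (fun s => ?_) (φ.comp a)
  rw [AlgHom.comp_apply]
  rcases s with b | t
  · have h1 : kp n (Fin L) (gen (inlE n _ b)) = gen b := by
      rw [← mon_singleton, ← mon_singleton]
      have := kp_tm (n := n) (g := Fin L) {b}
      rwa [tm_eq_rename, rename_mon inlE_strictMono, map_singleton] at this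
    have h2 := lift_inl (kl L m n) kl_mem b
    change _ = rename _ (kp n (Fin L) (gen (inlE n _ b)))
    rw [h1, rename_gen (inlE n (Par 0 m n)).injective]
    exact h2
  · have h1 : kp n (Fin L) (gen (inrE n _ t)) = 0 := by
      rw [← rename_gen (inrE n (Fin L)).injective, kp_inr, body_gen, map_zero]
    have h2 := lift_inr (kl L m n) kl_mem (n := n) (gen (parL t))
    have h3 : kl L m n (gen (parL t)) = 0 := by rw [kl, lam_gen]; rfl
    rw [h3, rename_gen (inrE n (Par L m n)).injective] at h2
    change _ = rename _ (kp n (Fin L) (gen (inrE n _ t)))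
    rw [h1, map_zero]
    exact h2.trans (map_zero _)

lemma kl_zr (p : Pt m n) (i : Fin m) (K : Ix n) : kl L m n (zr φ p i K) =
  ∑ I, (sgnRev K * sgnRev I * cm φ.bd K I) • coordFun p i I := by
  rw [zr_eq, map_sum]
  refine sum_congr rfl fun I _ => ?_
  rw [mul_smul _ (cm φ.bd K I), map_smul, map_mul, kl_coordFun, ← thetaPart_lift _ kl_mem, map_ordProd]
  simp_rw [lift_kl_phat]
  rw [← map_ordProd, ← mul_one (rename _ _), thetaPart_inl_mul, sum_eq_single ∅]
  · rw [mon_empty, mul_one]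
    have : thetaPart ∅ (1 : Gr (WithTheta n (Par 0 m n))) = 1 := by
      rw [thetaPart_empty, map_one]
    rw [this, smul_mul_assoc, one_mul]; rfl
  · intro J _ hJ
    have := thetaPart_tm_mul J ∅ (1 : Gr (Par 0 m n))
    rw [map_one, mul_one, if_neg hJ] at this
    rw [show (1 : Gr (WithTheta n (Par 0 m n))) = tm _ ∅ by rw [tm_eq_rename, mon_empty, map_one],
      this, smul_zero]
  · simp

lemma kl_rpar {f : SFun 0 m n} {p : Pt m n} (hf : SmAt f (bod (evn (zr φ p)))) :
  kl L m n (rpar φ f p) = gsub f (evn fun i K => kl L m n (zr φ p i K))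
      (odn t0 fun i K => kl L m n (zr φ p i K)) := by
  unfold rpar
  rw [map_gsub _ body_kl hf]
  congr 1
  ext s
  obtain ⟨c, rfl⟩ := eq_parO s
  rfl

end

section

variable (L : ℕ) (J : Ix n) (a : Fin n)

/-- The monomial `θ^J τ^{1,…,L}`. -/
def eta : Gr (WithTheta n (Fin L)) := mon (jm J Finset.univ)

lemma eta_mul_dLeft (hL : L ≠ 0) : eta L J * dLeft (inlE n _ a) (eta L J) = 0 := by
  have : NeZero L := ⟨hL⟩
  have hy := rename_mem_pty (inrE n (Fin L)).injective
    (mon_mem_pty (Finset.univ : Finset (Fin L)))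
  have hr : rename (inlE n (Fin L)) (dLeft a (mon J)) ∈ pty _ ((J.card + 1 : ℕ) : ZMod 2) := by
    push_cast
    exact rename_mem_pty (inlE n (Fin L)).injective (dLeft_mem_pty a (mon_mem_pty J))
  unfold eta
  rw [mon_jm, dLeft_tm_mul_inr, mul_assoc, ← mul_assoc (inr _ _ _), pty_commute hy hr,
    smul_mul_assoc, mul_assoc, ← map_mul, mon_mul_self, map_zero, mul_zero, smul_zero, mul_zero]
  rw [disjoint_self, Finset.bot_eq_empty]
  exact Finset.univ_nonempty.ne_empty

/-- The diffeomorphism `θ^a ↦ θ^a + θ^J τ^{1,…,L}`. -/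
def elemDiffeo (hL : L ≠ 0) (hJ : ¬ Even (J.card + L)) : OddDiffeo n L where
  comp b := gen (inlE n _ b) + if b = a then eta L J else 0
  odd b := by
    refine Submodule.add_mem _ (gen_mem_pty _) ?_
    split_ifs
    · have := mon_mem_pty (jm J (Finset.univ : Finset (Fin L)))
      rwa [card_jm, card_univ, Fintype.card_fin, odd_cast hJ] at this
    · exact Submodule.zero_mem _
  invertible := by
    have : (Matrix.of fun b c : Fin n => coeff {toLex (Sum.inl c)}
        (gen (inlE n (Fin L) b) + if b = a then eta L J else 0)) = 1 := by
      ext b c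
      have h1 : coeff {inlE n (Fin L) c} (if b = a then eta L J else 0) = 0 := by
        split_ifs
        · rw [eta, coeff_mon, if_neg]
          intro h
          have : inrE n (Fin L) ⟨0, Nat.pos_of_ne_zero hL⟩ ∈ ({inlE n (Fin L) c} : Finset _) := by
            rw [h, inr_mem_jm]; exact Finset.mem_univ _
          rw [Finset.mem_singleton] at this
          exact Sum.inr_ne_inl (toLex.injective this)
        · exact map_zero _
      change coeff {inlE n (Fin L) c} (_ + _) = _
      rw [map_add, h1, add_zero, ← mon_singleton, coeff_mon, Matrix.one_apply]
      simp only [Finset.singleton_inj, (inlE n (Fin L)).injective.eq_iff, eq_comm]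
    rw [this, Matrix.det_one]; exact isUnit_one

variable (hL : L ≠ 0) (hJ : ¬ Even (J.card + L))

lemma elemDiffeo_bd (b : Fin n) : (elemDiffeo L J a hL hJ).bd b = gen b := by
  have : NeZero L := ⟨hL⟩
  have h1 : kp n (Fin L) (gen (inlE n _ b)) = gen b := by
    rw [← mon_singleton, ← mon_singleton]
    have := kp_tm (n := n) (g := Fin L) {b}
    rwa [tm_eq_rename, rename_mon inlE_strictMono, map_singleton] at this
  have h2 : kp n (Fin L) (eta L J) = 0 := by
    rw [eta, mon_jm, map_mul, kp_inr, body_eq_coeff, coeff_mon,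
      if_neg Finset.univ_nonempty.ne_empty.symm, map_zero, mul_zero]
  change kp n (Fin L) (_ + _) = _
  rw [map_add, h1, apply_ite (kp n (Fin L)), h2, map_zero, ite_self, add_zero]

lemma kl_zr_elem (p : Pt m n) (i : Fin m) (K : Ix n) :
  kl L m n (zr (elemDiffeo L J a hL hJ) p i K) = coordFun p i K := by
  rw [kl_zr, sum_eq_single K]
  · have : cm (elemDiffeo L J a hL hJ).bd K K = 1 := by
      rw [cm, Matrix.of_apply, funext (elemDiffeo_bd L J a hL hJ)]
      rw [← mon_eq_ordProd, coeff_mon, if_pos rfl]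
    rw [this, sgnRev_mul_self, one_mul, one_smul]
  · intro I _ hI
    have : cm (elemDiffeo L J a hL hJ).bd K I = 0 := by
      rw [cm, Matrix.of_apply, funext (elemDiffeo_bd L J a hL hJ)]
      rw [← mon_eq_ordProd, coeff_mon, if_neg hI.symm]
    rw [this, mul_zero, zero_smul]
  · simp

lemma euler_rpar_elem {f : SFun 0 m n} {p : Pt m n}
  (hf : ∀ q : Pt m n, baseOf q = baseOf p → SmAt f q) :
  euler (Finset.univ.map (parLE L m n)) (rpar (elemDiffeo L J a hL hJ) f p) =
      mT m n Finset.univ *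
        emb L m n (flatS ((L : ℝ) • Pi.single a (mon J) : OddVF n) f p) := by
  set φ := elemDiffeo L J a hL hJ
  set w : Fin n → Gr (WithTheta n (Fin L)) := fun b => if b = a then (L : ℝ) • eta L J else 0
  have hη : eta L J ∈ pty (WithTheta n (Fin L)) 1 := by
    have := mon_mem_pty (jm J (Finset.univ : Finset (Fin L)))
    rwa [card_jm, card_univ, Fintype.card_fin, odd_cast hJ] at this
  have hw : Odds w := by
    intro b
    simp only [w]
    split_ifs
    · exact Submodule.smul_mem _ _ hη
    · exact Submodule.zero_mem _
  have hwφ : ∀ b, ∑ c, w c * dLeft (inlE n _ c) (φ.comp b) =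
      euler (Finset.univ.map (inrE n (Fin L))) (φ.comp b) := by
    intro b
    have h1 : euler (Finset.univ.map (inrE n (Fin L))) (gen (inlE n (Fin L) b)) = 0 := by
      rw [← rename_gen (inlE n (Fin L)).injective]
      refine euler_rename (fun s h => ?_) _
      obtain ⟨t, -, ht⟩ := Finset.mem_map.mp h
      exact Sum.inr_ne_inl (toLex.injective ht)
    have h2 : euler (Finset.univ.map (inrE n (Fin L))) (eta L J) = (L : ℝ) • eta L J := by
      rw [eta, euler_mon, card_inter_jm, Finset.univ_inter, card_univ, Fintype.card_fin]
    change _ = euler _ (_ + _)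
    rw [map_add, h1, zero_add, sum_eq_single a]
    · simp only [w, if_true]
      change _ * dLeft _ (gen _ + ite _ _ _) = _
      rw [map_add, dLeft_gen]
      simp only [(inlE n (Fin L)).injective.eq_iff, @eq_comm _ b a]
      split_ifs with h
      · rw [h2, mul_add, mul_one, smul_mul_assoc, eta_mul_dLeft L J a hL, smul_zero, add_zero]
      · rw [map_zero, map_zero, add_zero, mul_zero]
    · intro c _ hc
      simp only [w, if_neg hc, zero_mul]
    · simp
  have hb : SmAt f (bod (evn (zr φ p))) := hf _ (baseOf_bod_zr _ p)
  rw [euler_rpar φ hw hwφ hb, sum_eq_single Finset.univ]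
  · have h3 : coeffVF w Finset.univ = ((L : ℝ) • Pi.single a (mon J) : OddVF n) := by
      ext b
      refine gr_ext fun K => ?_
      rw [coeff_coeffVF]
      simp only [w, Pi.smul_apply, Pi.single_apply]
      split_ifs
      · rw [map_smul, map_smul, eta, coeff_mon, coeff_mon]; simp only [jm_inj, and_true]
      · rw [smul_zero, map_zero, map_zero]
    rw [h3, mT_univ_mul, kl_rpar φ hb.flatS]
    simp_rw [φ, kl_zr_elem]
    congr 2
    rw [← gsub_id (flatS _ f) (hf p rfl).flatS]
    congr 1
    ext s
    obtain ⟨c, rfl⟩ := eq_parO s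
    rfl
  · intro T _ hT
    have h3 : coeffVF w T = 0 := by
      ext b
      refine gr_ext fun K => ?_
      rw [coeff_coeffVF]
      simp only [w]
      split_ifs
      · rw [map_smul, eta, coeff_mon, if_neg fun h => hT (jm_inj.mp h).2, smul_zero]
        exact (map_zero _).symm
      · rw [map_zero]; exact (map_zero _).symm
    rw [h3, zero_flatS, rpar]
    simp [gsub_const _ _ ((adm_zr φ p).odn t0_mem)]
  · simp

end

section

lemma mT_univ_mul_emb_injective {x y : Gr (Par 0 m n)}
  (h : mT m n (Finset.univ : Finset (Fin L)) * emb L m n x = mT m n Finset.univ * emb L m n y) :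
  x = y := by
  have h1 : ∀ z, inr 0 (OddIdx m n) (killTheta L (OddIdx m n) (emb L m n z)) = z := by
    have : ((inr 0 (OddIdx m n)).comp ((killTheta L (OddIdx m n)).comp (emb L m n))) =
        AlgHom.id ℝ _ := by
      refine gr_hom_ext fun s => ?_
      simp only [AlgHom.comp_apply]
      rw [rename_gen (embE L m n).injective]
      obtain ⟨c, rfl⟩ := eq_parO s
      change inr 0 _ (killTheta L _ (gen (inrE L _ c))) = gen (inrE 0 _ c)
      rw [← rename_gen (inrE L (OddIdx m n)).injective, killTheta_inr,
        rename_gen (inrE 0 (OddIdx m n)).injective]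
    exact AlgHom.congr_fun this
  rw [mT_eq_tm] at h
  have h2 := congrArg (thetaPart Finset.univ) h
  rw [thetaPart_tm_mul_self, thetaPart_tm_mul_self, thetaPart_empty, thetaPart_empty] at h2
  rw [← h1 x, ← h1 y, h2]

variable {ψ : Bs m → Bs m} {p : Pt m n}

lemma euler_pullAlong (hψ : ∀ i, SmAt (fun x => ψ x i) (baseOf p)) {f : SFun L m n}
  (hf : SmAt f (bod (evn (pcoord L ψ p)))) :
  euler (Finset.univ.map (parLE L m n)) (pullAlong ψ f p) =
      pullAlong ψ (fun q => euler (Finset.univ.map (parLE L m n)) (f q)) p := by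
  have hz := adm_pcoord (L := L) hψ
  have hb := hz.odn tparL_mem
  have hl : ∀ s, SmAt (fun q => dLeft s (f q)) (bod (evn (pcoord L ψ p))) := fun s =>
    SmAt.linear (A := Gr (Par L m n)) _ hf
  have h0 : ∀ i I, euler (Finset.univ.map (parLE L m n)) (pcoord L ψ p i I) = 0 := by
    intro i I
    rw [← emb_pcoord hψ]
    refine euler_rename (fun s h => ?_) _
    obtain ⟨t, -, ht⟩ := Finset.mem_map.mp h
    obtain ⟨c, rfl⟩ := eq_parO s
    exact Sum.inl_ne_inr (toLex.injective ht)
  rw [pullAlong_eq, pullAlong_eq, euler_gsub _ hf hz.evn hb, sum_eq_zero, zero_add, sum_par,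
    sum_eq_zero (s := (Finset.univ : Finset (OddIdx m n))), add_zero]
  · have h1 : (fun q => euler (Finset.univ.map (parLE L m n)) (f q)) = fun q =>
        ∑ t : Fin L, gen (parL t) * dLeft (parL t) (f q) := by
      ext q
      rw [euler, Finset.sum_map, LinearMap.sum_apply]; rfl
    rw [h1, gsub_sum _ fun t _ => (SmAt.const _ _).mul (hl _)]
    refine sum_congr rfl fun t _ => ?_
    rw [gsub_mul (SmAt.const (gen (parL t) : Gr (Par L m n)) _) (hl _) hz.evn hb, gsub_parL hz tparL_mem]
    congr 1
    change euler _ (gen (parL t)) = _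
    rw [← mon_singleton, euler_mon, Finset.inter_singleton_of_mem, Finset.card_singleton,
      Nat.cast_one, one_smul]
    exact Finset.mem_map_of_mem (parLE L m n) (Finset.mem_univ t)
  · intro c _
    change euler _ (pcoord L ψ p c.1.1 c.1.2) * _ = 0
    rw [h0, zero_mul]
  · intro c _
    rw [evn, h0, zero_mul]

lemma pullAlong_mT_mul_emb (hψ : ∀ i, SmAt (fun x => ψ x i) (baseOf p)) (T : Finset (Fin L))
  {f : SFun 0 m n} (hf : SmAt f (bod (evn (pcoord 0 ψ p)))) :
  pullAlong ψ (fun q => mT m n T * emb L m n (f q)) p =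
      mT m n T * emb L m n (pullAlong ψ f p) := by
  have hz := adm_pcoord (L := L) hψ
  have hb := hz.odn tparL_mem
  have h1 : bod (evn (pcoord L ψ p)) = bod (evn (pcoord 0 ψ p)) := by
    ext c
    simp only [bod, evn]
    rw [← emb_pcoord (L := L) hψ, body_rename (embE L m n).injective]
  have hf' : SmAt f (bod (evn (pcoord L ψ p))) := by rwa [h1]
  have he : SmAt (fun q => emb L m n (f q)) (bod (evn (pcoord L ψ p))) :=
    SmAt.linear (A := Gr (Par 0 m n)) (B := Gr (Par L m n)) (emb L m n).toLinearMap hf'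
  have hm : mT m n T = ordProd T fun t => gen (parL t) := by
    rw [mT, mon_eq_ordProd, ordProd_map parLE_strictMono]; rfl
  rw [pullAlong_eq, pullAlong_eq, gsub_mul (SmAt.const (mT m n T) _) he hz.evn hb, gsub_const _ _ hb, lam_mon,
    ordProd_map parLE_strictMono, hm]
  congr 1
  change gsub (fun q => emb L m n (f q)) _ _ = _
  rw [gsub_rename (embE L m n).injective hf' hz.evn hb,
    map_gsub _ (body_rename (embE L m n).injective) hf]
  congr 1
  · ext c; exact (emb_pcoord hψ _ _).symm
  · ext s
    obtain ⟨c, rfl⟩ := eq_parO s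
    exact (emb_pcoord hψ _ _).symm

lemma flatS_sum_smul {X : Type*} [Fintype X] {u : OddVF n} (r : X → ℝ) (v : X → OddVF n)
  (hu : u = ∑ x, r x • v x) (f : SFun L m n) (p : Pt m n) :
  flatS u f p = ∑ x, r x • flatS (v x) f p := by
  have h1 : ∀ K I, flatCoeff u K I = ∑ x, r x * flatCoeff (v x) K I := by
    intro K I
    simp only [flatCoeff, hu, Finset.sum_apply, Pi.smul_apply, map_sum, map_smul, smul_eq_mul,
      mul_sum, sum_mul]
    refine (sum_congr rfl fun a _ => sum_comm).trans ?_
    rw [sum_comm]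
    exact sum_congr rfl fun x _ => sum_congr rfl fun a _ =>
      sum_congr rfl fun J _ => by ring
  have h2 : ∀ i K, flatComp (L := L) u p i K = ∑ x, r x • flatComp (v x) p i K := by
    intro i K
    simp only [flatComp, h1, sum_smul, mul_smul, smul_sum]
    exact sum_comm
  simp only [flatS, h2, sum_mul, smul_mul_assoc, smul_add, sum_add_distrib,
    smul_sum]
  congr 1 <;> exact sum_comm

lemma pullAlong_sum_smul {X : Type*} [Fintype X] (hψ : ∀ i, SmAt (fun x => ψ x i) (baseOf p))
  (r : X → ℝ) {f : X → SFun L m n} (hf : ∀ x, SmAt (f x) (bod (evn (pcoord L ψ p)))) :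
  pullAlong ψ (fun q => ∑ x, r x • f x q) p = ∑ x, r x • pullAlong ψ (f x) p := by
  have hz := adm_pcoord (L := L) hψ
  simp_rw [pullAlong_eq]
  rw [gsub_sum _ fun x _ => SmAt.smul (SmAt.const _ _) (hf x)]
  exact sum_congr rfl fun x _ => gsub_const_smul _ (hf x) hz.evn (hz.odn tparL_mem)

/-- The natural lifts of vector fields are independent of coordinates. -/
lemma flatS_pullAlong (u : OddVF n) (hψ : ∀ i, SmAt (fun x => ψ x i) (baseOf p))
  {f f' : SFun 0 m n} (hfe : ∀ᶠ y in 𝓝 (ψ (baseOf p)), ∀ q : Pt m n, baseOf q = y → SmAt f' q)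
  (hf : ∀ q : Pt m n, baseOf q = baseOf p → SmAt f q)
  (h : ∀ q : Pt m n, baseOf q = baseOf p → f =ᶠ[𝓝 q] pullAlong ψ f') :
  flatS u f p = pullAlong ψ (flatS u f') p := by
  have hf' := hfe.self_of_nhds
  have hb := baseOf_bod_pcoord (L := 0) hψ
  set N : Ix n → ℕ := fun J => if Even J.card then 1 else 2
  have hN : ∀ J, N J ≠ 0 := fun J => by simp only [N]; split_ifs <;> norm_num
  have hNJ : ∀ J, ¬ Even (J.card + N J) := fun J => by
    simp only [N]; split_ifs with hJ <;> simp [hJ, parity_simps]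
  have hu : u = ∑ x : Fin n × Ix n, (coeff x.2 (u x.1) * (N x.2 : ℝ)⁻¹) •
      ((N x.2 : ℝ) • Pi.single x.1 (mon x.2) : OddVF n) := by
    ext a
    rw [Fintype.sum_prod_type]
    simp only [smul_smul, mul_assoc, Finset.sum_apply, Pi.smul_apply, Pi.single_apply]
    rw [sum_eq_single a, ← sum_coeff_mon (u a)]
    · refine sum_congr rfl fun J _ => ?_
      rw [inv_mul_cancel₀ (Nat.cast_ne_zero.mpr (hN J)), mul_one, if_pos rfl, sum_coeff_mon]
    · intro b _ hba
      exact sum_eq_zero fun J _ => by rw [if_neg hba.symm, smul_zero]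
    · simp
  rw [flatS_sum_smul _ _ hu]
  rw [show flatS u f' = _ from funext fun q => flatS_sum_smul _ _ hu f' q]
  rw [pullAlong_sum_smul hψ _ fun x => (hf' _ hb).flatS]
  refine sum_congr rfl fun x _ => ?_
  congr 1
  obtain ⟨a, J⟩ := x
  set φ := elemDiffeo (N J) J a (hN J) (hNJ J)
  have hbL := baseOf_bod_pcoord (L := N J) hψ
  have hz : ∀ q : Pt m n, baseOf (bod (evn (zr φ q))) = baseOf q := baseOf_bod_zr φ
  refine mT_univ_mul_emb_injective (L := N J) ?_
  rw [← euler_rpar_elem (N J) J a (hN J) (hNJ J) hf, rpar_pullAlong φ hψ hf' h,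
    euler_pullAlong hψ (smAt_rpar φ (hf' _ ((hz _).trans hbL))),
    ← pullAlong_mT_mul_emb hψ _ (hf' _ hb).flatS]
  have he : (fun q => euler (Finset.univ.map (parLE _ m n)) (rpar φ f' q))
      =ᶠ[𝓝 (bod (evn (pcoord (N J) ψ p)))] fun q => mT m n Finset.univ * emb (N J) m n
        (flatS ((N J : ℝ) • Pi.single a (mon J) : OddVF n) f' q) := by
    have hc := continuous_baseOf.tendsto (bod (evn (pcoord (n := n) (N J) ψ p)))
    rw [hbL] at hc
    filter_upwards [hc.eventually hfe] with q hq
    exact euler_rpar_elem (N J) J a (hN J) (hNJ J) hq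
  rw [pullAlong_eq, pullAlong_eq, gsub_congr _ he]
  exact (SmAt.const (mT m n Finset.univ) _).mul
    (SmAt.linear (A := Gr (Par 0 m n)) (B := Gr (Par (N J) m n)) (emb (N J) m n).toLinearMap
      (hf' _ hbL).flatS)

lemma flat_eq {α : Family m M L n} (hα : IsWorm α) (u : OddVF n) {e : Coord m M}
  {p : Pt m n} (hp : p ∈ dom n e) : flat u α e p = -flatS u (α e) p := by
  have h : ∀ c, dEven c (α e) p = pd c (α e) p := by
    intro c
    rw [← sum_coeff_mon (pd c (α e) p)]
    exact sum_congr rfl fun S _ => by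
      rw [show coeff S (pd c (α e) p) = _ from (coeff_pd (hα.smAt hp) S c).self_of_nhds]; rfl
  simp only [flat, flatS, h]

lemma flat_eventually {α : Family m M L n} (hα : IsWorm α) (u : OddVF n) {e : Coord m M}
  {p : Pt m n} (hp : p ∈ dom n e) :
  flat u α e =ᶠ[𝓝 p] fun q => (-1 : ℝ) • flatS u (α e) q := by
  filter_upwards [(isOpen_dom e).mem_nhds hp] with q hq
  rw [flat_eq hα u hq, neg_one_smul]

lemma smAt_flat {α : Family m M L n} (hα : IsWorm α) (u : OddVF n) {e : Coord m M}
  {p : Pt m n} (hp : p ∈ dom n e) : SmAt (flat u α e) p :=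
  (SmAt.smul (SmAt.const _ _) (hα.smAt hp).flatS).congr (flat_eventually hα u hp)

lemma IsWorm.flat {α : Family m M 0 n} (hα : IsWorm α) (u : OddVF n) : IsWorm (flat u α) where
  smooth := contDiffOn_of_smAt fun _ _ hp => smAt_flat hα u hp
  compatible e e' p hp hp' := by
    have hψ := smAt_transition e e' hp hp'
    have hψ' : ∀ i, SmAt (fun x => e'.1 (e.1.symm x) i) (baseOf p) := fun i => hψ.apply i
    have ht : e'.1 (e.1.symm (baseOf p)) ∈ e'.1.target := e'.1.map_source hp'
    have hb := baseOf_bod_pcoord (L := 0) hψ'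
    have hd : bod (evn (pcoord 0 (fun x => e'.1 (e.1.symm x)) p)) ∈ dom n e' := by
      change baseOf _ ∈ e'.1.target
      rw [hb]; exact ht
    have hz := adm_pcoord (L := 0) hψ'
    rw [pullAlong_eq, gsub_congr (SmAt.smul (SmAt.const _ _) (hα.smAt hd).flatS)
      (flat_eventually hα u hd), gsub_const_smul _ (hα.smAt hd).flatS hz.evn (hz.odn tparL_mem),
      ← pullAlong_eq, flat_eq hα u hp, neg_one_smul, flatS_pullAlong u hψ' (f' := α e')]
    · filter_upwards [e'.1.open_target.mem_nhds ht] with y hy q hq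
      refine hα.smAt ?_
      change baseOf q ∈ e'.1.target
      rwa [hq]
    · intro q hq
      refine hα.smAt ?_
      change baseOf q ∈ e.1.target
      rw [hq]; exact hp
    · intro q hq
      refine hα.eventually e e' ?_ ?_
      · change baseOf q ∈ e.1.target
        rw [hq]; exact hp
      · change e.1.symm (baseOf q) ∈ e'.1.source
        rw [hq]; exact hp'

lemma RapidlyDecreasing.flat {α : Family m M L n} (h : RapidlyDecreasing α) (hα : IsWorm α)
  (u : OddVF n) : RapidlyDecreasing (flat u α) := by
  refine rapidlyDecreasing_of_rd fun e K hK hKU k => ?_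
  refine Cl.congr (Cl.smul (Cl.const k (-1 : ℝ))
    ((h.rd hα e).flatS (u := u) K hK hKU k)) fun p hp => ?_
  exact flat_eventually hα u (hKU hp)

end

/-! ### Divergence of the lifted vector fields -/

lemma dLeft_dLeft (a : ι) (x : Gr ι) : dLeft a (dLeft a x) = 0 :=
  CliffordAlgebra.contractLeft_contractLeft _ _

lemma coeff_dLeft_of_mem {a : ι} {U : Finset ι} (h : a ∈ U) (x : Gr ι) :
  coeff U (dLeft a x) = 0 := by
  have h1 := coeff_num a U (dLeft a x)
  rwa [num, LinearMap.comp_apply, dLeft_dLeft, map_zero, map_zero, if_pos h, eq_comm] at h1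

lemma eq_zero_of_gen_mul_dLeft {a : ι} {x : Gr ι} (h : gen a * dLeft a x = 0) :
  dLeft a x = 0 := by
  have h1 := congrArg (dLeft a) h
  rw [dLeft_mul_odd a (gen_mem_pty a), dLeft_gen, if_pos rfl, dLeft_dLeft, mul_zero, sub_zero,
    one_mul, map_zero] at h1
  exact h1

lemma dLeft_mon_of_notMem {a : ι} {K : Finset ι} (h : a ∉ K) : dLeft a (mon K : Gr ι) = 0 := by
  refine eq_zero_of_gen_mul_dLeft ?_
  have h1 := num_mon a K
  rwa [if_neg h] at h1

lemma dLeft_mon_of_mem {a : ι} {K : Finset ι} (h : a ∈ K) :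
  ∃ r : ℝ, dLeft a (mon K : Gr ι) = r • mon (K.erase a) := by
  set y : Gr ι := mon (K.erase a)
  set r := coeff K (gen a * y)
  have h1 : gen a * y = r • mon K := by
    refine gr_ext fun U => ?_
    rw [map_smul, coeff_mon]
    split_ifs with hU
    · rw [hU, smul_eq_mul, mul_one]
    · rw [smul_zero]
      by_contra h'
      rw [← mon_singleton] at h'
      refine hU ((coeff_mon_mul_mon h').2.trans ?_)
      rw [← Finset.insert_eq, Finset.insert_erase h]
  have h2 := congrArg (dLeft a) h1
  rw [dLeft_mul_odd a (gen_mem_pty a), dLeft_gen, if_pos rfl, one_mul,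
    dLeft_mon_of_notMem (Finset.notMem_erase a K), mul_zero, sub_zero, map_smul] at h2
  have hr : r ≠ 0 := by
    intro hr
    have := congrArg (coeff (K.erase a)) h2
    rw [hr, zero_smul, map_zero, coeff_mon, if_pos rfl] at this
    exact one_ne_zero this
  exact ⟨r⁻¹, by rw [h2, smul_smul, inv_mul_cancel₀ hr, one_smul]⟩

lemma coeff_mon_mul_dLeft_mon (J K : Ix n) (a : Fin n) :
  coeff K (mon J * dLeft a (mon K)) = if J = {a} ∧ a ∈ K then 1 else 0 := by
  split_ifs with h
  · obtain ⟨rfl, h⟩ := h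
    have := num_mon a K
    rw [mon_singleton]
    change coeff K (num a (mon K)) = 1
    rw [this, if_pos h, coeff_mon, if_pos rfl]
  · by_cases ha : a ∈ K
    · obtain ⟨r, hr⟩ := dLeft_mon_of_mem ha
      rw [hr, mul_smul_comm, map_smul, smul_eq_mul]
      refine mul_eq_zero_of_right _ ?_
      by_contra h'
      obtain ⟨h1, h2⟩ := coeff_mon_mul_mon h'
      refine h ⟨?_, ha⟩
      have h3 : J ⊆ {a} := fun b hb => by
        have hbK : b ∈ K := by rw [h2]; exact Finset.mem_union_left _ hb
        by_contra hba
        rw [Finset.mem_singleton] at hba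
        exact Finset.disjoint_left.mp h1 hb (mem_erase.mpr ⟨hba, hbK⟩)
      have h4 : a ∈ J := by
        have ha' := ha
        rw [h2] at ha'
        exact (Finset.mem_union.mp ha').resolve_right (Finset.notMem_erase a K)
      exact h3.antisymm (Finset.singleton_subset_iff.mpr h4)
    · rw [dLeft_mon_of_notMem ha, mul_zero, map_zero]

lemma flatCoeff_self (u : OddVF n) (K : Ix n) :
  flatCoeff u K K = ∑ a, coeff {a} (u a) * if a ∈ K then 1 else 0 := by
  refine sum_congr rfl fun a _ => ?_
  rw [sum_eq_single {a}]
  · rw [coeff_mon_mul_dLeft_mon, Finset.card_singleton, one_add_one_eq_two,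
      (even_two_mul _).neg_one_pow, mul_one, mul_assoc (coeff _ _), sgnRev_mul_self]
    simp
  · intro J _ hJ
    rw [coeff_mon_mul_dLeft_mon, if_neg fun h => hJ h.1, mul_zero]
  · simp

lemma supertrace_flatCoeff (hn : 2 ≤ n) (u : OddVF n) (m : ℕ) :
  ∑ c : EvenIdx m n, flatCoeff u c.1.2 c.1.2 = ∑ c : OddIdx m n, flatCoeff u c.1.2 c.1.2 := by
  have h0 : ∀ s : Bool, ∑ K : Ix n, (if (Even K.card ↔ s = true) then 1 else 0) *
      flatCoeff u K K = 2 ^ (n - 2) * ∑ a, coeff {a} (u a) := by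
    intro s
    simp_rw [flatCoeff_self, mul_sum]
    rw [sum_comm]
    refine sum_congr rfl fun a _ => ?_
    have := card_filter_mem_even hn a s
    rw [Finset.card_filter] at this
    have h2 := congrArg (Nat.cast (R := ℝ)) this
    push_cast at h2
    rw [← h2, sum_mul]
    refine sum_congr rfl fun K _ => ?_
    by_cases h1 : a ∈ K <;> by_cases h2 : (Even K.card ↔ s = true) <;> simp [h1, h2]
  have h1 : ∀ s : Bool, ∑ c : Fin m × Ix n, (if (Even c.2.card ↔ s = true) then 1 else 0) *
      flatCoeff u c.2 c.2 = m * (2 ^ (n - 2) * ∑ a, coeff {a} (u a)) := by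
    intro s
    rw [Fintype.sum_prod_type]
    simp_rw [h0]
    simp
  have he := h1 true
  have ho := h1 false
  rw [← ho] at he
  have e1 : ∑ c : EvenIdx m n, flatCoeff u c.1.2 c.1.2 = ∑ c : Fin m × Ix n,
      (if (Even c.2.card ↔ true = true) then 1 else 0) * flatCoeff u c.2 c.2 := by
    rw [← Fintype.sum_subtype_add_sum_subtype (fun c : Fin m × Ix n => Even c.2.card),
      sum_eq_zero (s := (Finset.univ : Finset {c : Fin m × Ix n // ¬ _}))
        fun c _ => by simp [c.2], add_zero]
    exact sum_congr rfl fun c _ => by simp [c.2]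
  have e2 : ∑ c : OddIdx m n, flatCoeff u c.1.2 c.1.2 = ∑ c : Fin m × Ix n,
      (if (Even c.2.card ↔ false = true) then 1 else 0) * flatCoeff u c.2 c.2 := by
    rw [← Fintype.sum_subtype_add_sum_subtype (fun c : Fin m × Ix n => Even c.2.card),
      sum_eq_zero (s := (Finset.univ : Finset (EvenIdx m n)))
        fun c _ => by simp [c.2], zero_add]
    exact sum_congr rfl fun c _ => by simp [c.2]
  rw [e1, e2, he]

/-- The coefficient at the product of all odd coordinates and of the parameters in `T`. -/
abbrev top (m n : ℕ) (T : Finset (Fin L)) : Gr (Par L m n) →ₗ[ℝ] ℝ := coeff (topIdx m n T)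

lemma top_dLeft (T : Finset (Fin L)) (c : OddIdx m n) (x : Gr (Par L m n)) :
  top m n T (dLeft (parO c) x) = 0 :=
  coeff_dLeft_of_mem (inr_mem_jm.mpr (Finset.mem_univ c)) x

lemma dLeft_coordFun (c : OddIdx m n) (p : Pt m n) (i : Fin m) (I : Ix n) :
  dLeft (parO c) (coordFun (L := L) p i I) = if c.1 = (i, I) then 1 else 0 := by
  unfold coordFun
  split_ifs with h1 h2 h2
  · exact absurd h1 (by have := c.2; rwa [h2] at this)
  · exact dLeft_algebraMap _ _
  · rw [dLeft_gen, if_pos]; exact congrArg parO (Subtype.ext h2)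
  · rw [dLeft_gen, if_neg]
    intro h
    exact h2 (congrArg Subtype.val (Sum.inr_injective (toLex.injective h)))

lemma pd_coordFun (c : EvenIdx m n) (p : Pt m n) (i : Fin m) (I : Ix n) :
  pd c (fun q => coordFun (L := L) q i I) p = if c.1 = (i, I) then 1 else 0 := by
  unfold coordFun
  split_ifs with h1 h2 h2
  · have h := (pd_linear (Algebra.linearMap ℝ (Gr (Par L m n)))
      (f := fun q : Pt m n => q ⟨(i, I), h1⟩) (p := p)
      (smAt_of_contDiff (contDiff_apply ℝ ℝ _) p) c).self_of_nhds
    refine h.trans ?_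
    dsimp only
    rw [pd_coord, if_pos (Subtype.ext h2.symm)]; simp
  · have h := (pd_linear (Algebra.linearMap ℝ (Gr (Par L m n)))
      (f := fun q : Pt m n => q ⟨(i, I), h1⟩) (p := p)
      (smAt_of_contDiff (contDiff_apply ℝ ℝ _) p) c).self_of_nhds
    refine h.trans ?_
    dsimp only
    rw [pd_coord, if_neg fun h => h2 (congrArg Subtype.val h).symm]; simp
  · exact absurd c.2 (by rw [h2]; exact h1)
  · rw [pd_const]

lemma involute_coordFun_odd (p : Pt m n) (i : Fin m) {I : Ix n} :
  CliffordAlgebra.involute (coordFun (L := L) p i I) =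
      (-1 : ℝ) ^ I.card • coordFun (L := L) p i I := by
  have h := adm_coordFun (L := L) p i I
  by_cases hI : Even I.card
  · rw [even_cast hI] at h
    rw [involute_even h, hI.neg_one_pow, one_smul]
  · rw [odd_cast hI] at h
    rw [involute_odd h, (Nat.not_even_iff_odd.mp hI).neg_one_pow, neg_one_smul]

/-- The top coefficient of a lifted vector field applied to a function is a divergence. -/
lemma top_flatS (hn : 2 ≤ n) (u : OddVF n) (T : Finset (Fin L)) {f : SFun L m n}
  {p : Pt m n} (hf : SmAt f p) : top m n T (flatS u f p) =
      ∑ c : EvenIdx m n, pd c (fun q => top m n T (flatComp u q c.1.1 c.1.2 * f q)) p := by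
  have he : ∀ c : EvenIdx m n, pd c (fun q => top m n T (flatComp u q c.1.1 c.1.2 * f q)) p =
      flatCoeff u c.1.2 c.1.2 * top m n T (f p) +
        top m n T (flatComp u p c.1.1 c.1.2 * pd c f p) := by
    intro c
    have hF := SmAt.flatComp (L := L) (u := u) p c.1.1 c.1.2
    rw [(pd_linear (top m n T) (hF.mul hf) c).self_of_nhds]
    dsimp only
    rw [(pd_mul hF hf c).self_of_nhds]
    have : pd c (fun q => flatComp (L := L) u q c.1.1 c.1.2) p =
        algebraMap ℝ _ (flatCoeff u c.1.2 c.1.2) := by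
      have h1 : (fun q => flatComp (L := L) u q c.1.1 c.1.2) = fun q =>
          ∑ I, flatCoeff u c.1.2 I • coordFun (L := L) q c.1.1 I := rfl
      rw [h1, pd, fderiv_sum_apply fun I _ =>
        (SmAt.smul (SmAt.const _ _) (smAt_coordFun c.1.1 I p)).differentiableAt]
      have h2 : ∀ I, fderiv ℝ (fun q => flatCoeff u c.1.2 I • coordFun (L := L) q c.1.1 I) p
          (Pi.single c 1) = if I = c.1.2 then algebraMap ℝ _ (flatCoeff u c.1.2 c.1.2) else 0 := by
        intro I
        refine (pd_const_smul _ (smAt_coordFun c.1.1 I p) c).self_of_nhds.trans ?_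
        dsimp only
        rw [pd_coordFun]
        by_cases h : I = c.1.2
        · subst h; simp [Algebra.algebraMap_eq_smul_one]
        · rw [if_neg h, if_neg fun h' => h (congrArg Prod.snd h').symm, smul_zero]
      simp [h2]
    dsimp only
    rw [this, map_add, ← Algebra.smul_def, map_smul, smul_eq_mul]
  have ho : ∀ c : OddIdx m n, top m n T (flatComp u p c.1.1 c.1.2 * dLeft (parO c) (f p)) =
      flatCoeff u c.1.2 c.1.2 * top m n T (f p) := by
    intro c
    have h1 := top_dLeft T c (CliffordAlgebra.involute (flatComp u p c.1.1 c.1.2) * f p)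
    have h2 : CliffordAlgebra.involute (flatComp (L := L) u p c.1.1 c.1.2) =
        ∑ I, ((-1 : ℝ) ^ I.card * flatCoeff u c.1.2 I) • coordFun p c.1.1 I := by
      rw [flatComp, map_sum]
      refine sum_congr rfl fun I _ => ?_
      rw [map_smul, involute_coordFun_odd, smul_smul, mul_comm]
    have h3 : dLeft (parO c) (CliffordAlgebra.involute (flatComp (L := L) u p c.1.1 c.1.2)) =
        algebraMap ℝ _ (-flatCoeff u c.1.2 c.1.2) := by
      rw [h2, map_sum, sum_eq_single c.1.2]
      · rw [map_smul, dLeft_coordFun, if_pos rfl,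
          (Nat.not_even_iff_odd.mp c.2).neg_one_pow, neg_one_mul, Algebra.algebraMap_eq_smul_one]
      · intro I _ hI
        rw [map_smul, dLeft_coordFun, if_neg fun h => hI (congrArg Prod.snd h).symm, smul_zero]
      · simp
    rw [dLeft_mul, CliffordAlgebra.involute_involute, h3, ← Algebra.smul_def, map_add, map_smul,
      smul_eq_mul] at h1
    linarith
  simp_rw [flatS, map_add, map_sum, he, ho, sum_add_distrib, ← sum_mul]
  rw [supertrace_flatCoeff hn, add_comm]

lemma flatComp_empty {u : OddVF n} (hu : ∀ a, coeff ∅ (u a) = 0) (p : Pt m n)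
  (i : Fin m) : flatComp (L := L) u p i ∅ = 0 := by
  refine sum_eq_zero fun I _ => ?_
  rw [flatCoeff, sum_eq_zero, zero_smul]
  intro a _
  refine sum_eq_zero fun J _ => ?_
  by_cases hJ : J = ∅
  · rw [hJ, hu]; simp
  · rw [← body_eq_coeff, map_mul, body_eq_coeff, coeff_mon, if_neg (Ne.symm hJ)]; simp

/-! ### Integrals over the fibres -/

section

lemma integrable_of_rapid {E V : Type*} [NormedAddCommGroup E] [NormedSpace ℝ E]
  [FiniteDimensional ℝ E] [MeasurableSpace E] [BorelSpace E] {μ : Measure E} [μ.IsAddHaarMeasure]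
  [NormedAddCommGroup V] {g : E → V} (hg : Continuous g)
  (h : ∀ N : ℕ, ∃ C : ℝ, ∀ z, (1 + ‖z‖) ^ N * ‖g z‖ ≤ C) : Integrable g μ := by
  set N := Module.finrank ℝ E + 1
  obtain ⟨C, hC⟩ := h N
  have hr : ((Module.finrank ℝ E : ℕ) : ℝ) < (N : ℝ) := by push_cast [N]; linarith
  refine ((integrable_one_add_norm (μ := μ) hr).const_mul C).mono'
    hg.aestronglyMeasurable (ae_of_all _ fun z => ?_)
  rw [Real.rpow_neg (by positivity), Real.rpow_natCast, ← div_eq_mul_inv, le_div_iff₀ (by positivity),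
    mul_comm]
  exact hC z

lemma integral_fderiv_eq_zero'
  [FiniteDimensional ℝ E] [MeasurableSpace E] [BorelSpace E] {μ : Measure E} [μ.IsAddHaarMeasure]
  {g : E → ℝ} (hd : Differentiable ℝ g) (v : E) (hg : Integrable g μ)
  (hg' : Integrable (fun z => fderiv ℝ g z v) μ) : ∫ z, fderiv ℝ g z v ∂μ = 0 := by
  have h := integral_bilinear_hasLineDerivAt_right_eq_neg_left_of_integrable (μ := μ)
    (f := fun _ : E => (1 : ℝ)) (f' := fun _ => 0) (g := g) (g' := fun z => fderiv ℝ g z v) (v := v)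
    (B := ContinuousLinearMap.mul ℝ ℝ) (by simp) (by simpa using hg') (by simpa using hg)
    (fun x _ => (hasFDerivAt_const (1 : ℝ) x).hasLineDerivAt v)
    (fun x _ => (hd x).hasFDerivAt.hasLineDerivAt v)
  simpa using h

instance prodAddHaar (m n : ℕ) : ((volume : Measure (Bs m)).prod
  (volume : Measure (FibIdx m n → ℝ))).IsAddHaarMeasure := Measure.prod.instIsAddHaarMeasure _ _

lemma baseOf_assemble (x : Bs m) (y : FibIdx m n → ℝ) : baseOf (assemble x y) = x := by
  ext; simp [baseOf, assemble]

lemma assemble_fib (x : Bs m) (y : FibIdx m n → ℝ) (c : FibIdx m n) :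
  assemble x y ⟨c.1, c.2.1⟩ = y c := by
  simp [assemble, c.2.2.ne_empty]

lemma assemble_mem {x : Bs m} {K : Set (Bs m)} (hx : x ∈ K) (y : FibIdx m n → ℝ) :
  assemble x y ∈ ov n K := by
  change baseOf _ ∈ K
  rwa [baseOf_assemble]

lemma norm_fib_le (x : Bs m) (y : FibIdx m n → ℝ) : ‖y‖ ≤ ‖assemble x y‖ :=
  (pi_norm_le_iff_of_nonneg (norm_nonneg _)).mpr fun c => by
    rw [← assemble_fib x y c]; exact norm_le_pi_norm _ _

lemma norm_baseOf_le (p : Pt m n) : ‖baseOf p‖ ≤ ‖p‖ :=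
  (pi_norm_le_iff_of_nonneg (norm_nonneg _)).mpr fun _ => norm_le_pi_norm p _

/-- The even coordinates as a linear function of the base and of the fibre coordinates. -/
def asmL (m n : ℕ) : ((Bs m) × (FibIdx m n → ℝ)) →L[ℝ] (Pt m n) :=
  LinearMap.toContinuousLinearMap
    { toFun := fun z => assemble z.1 z.2
      map_add' := fun z w => by ext c; simp only [assemble, Pi.add_apply]; split_ifs <;> rfl
      map_smul' := fun r z => by ext c; simp only [assemble, Pi.smul_apply]; split_ifs <;> rfl }

lemma asmL_apply (z : (Bs m) × (FibIdx m n → ℝ)) : asmL m n z = assemble z.1 z.2 := rfl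

lemma continuous_assemble (x : Bs m) :
  Continuous (assemble x : (FibIdx m n → ℝ) → Pt m n) :=
  (asmL m n).continuous.comp (Continuous.prodMk_right x)

variable {x : Bs m}
  {g : Pt m n → V}

lemma Cl.integrable (hg : Cl (ov n {x}) (DE (ov n {x})) 0 g) :
  Integrable fun y : FibIdx m n → ℝ => g (assemble x y) := by
  have hm : ∀ y : FibIdx m n → ℝ, assemble x y ∈ ov n {x} := assemble_mem (mem_singleton x)
  refine integrable_of_rapid (continuous_iff_continuousAt.mpr fun y => ?_) fun N => ?_
  · exact (hg.1 _ (hm y)).contDiffAt.continuousAt.comp (continuous_assemble x).continuousAt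
  · obtain ⟨C, hC⟩ := hg.2 N
    refine ⟨C, fun y => le_trans ?_ (hC _ (hm y))⟩
    gcongr
    exact norm_fib_le x y

lemma Cl.integrable_prod (hg : Cl univ (DE univ) 0 g) :
  Integrable (fun z : (Bs m) × (FibIdx m n → ℝ) => g (assemble z.1 z.2))
      (volume.prod volume) := by
  refine integrable_of_rapid
    (μ := (volume : Measure (Bs m)).prod (volume : Measure (FibIdx m n → ℝ)))
    (continuous_iff_continuousAt.mpr fun z => ?_) fun N => ?_
  · exact (hg.1 _ (mem_univ _)).contDiffAt.continuousAt.comp (asmL m n).continuous.continuousAt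
  · obtain ⟨C, hC⟩ := hg.2 N
    refine ⟨C, fun z => le_trans ?_ (hC (assemble z.1 z.2) (mem_univ _))⟩
    gcongr
    refine max_le ?_ (norm_fib_le z.1 z.2)
    exact (congrArg norm (baseOf_assemble z.1 z.2)).symm.le.trans (norm_baseOf_le _)

lemma fderiv_assemble
  {a : E → Pt m n} {A : E →L[ℝ] (Pt m n)} {z : E} (ha : HasFDerivAt a A z)
  (hg : DifferentiableAt ℝ g (a z)) (v : E) :
  fderiv ℝ (fun w => g (a w)) z v = fderiv ℝ g (a z) (A v) := by
  exact congrArg (fun B : E →L[ℝ] V => B v) (hg.hasFDerivAt.comp z ha).fderiv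

lemma hasFDerivAt_assemble_fib (x : Bs m) (y : FibIdx m n → ℝ) :
  HasFDerivAt (assemble x : (FibIdx m n → ℝ) → _)
      ((asmL m n).comp (ContinuousLinearMap.inr ℝ _ _)) y :=
  (asmL m n).hasFDerivAt.comp y (hasFDerivAt_prodMk_right x y)

lemma asmL_inr_single (c : FibIdx m n) : asmL m n (0, Pi.single c 1) = Pi.single ⟨c.1, c.2.1⟩ 1 := by
  ext d
  rw [asmL_apply]
  simp only [assemble, Pi.single_apply, Pi.zero_apply]
  split_ifs with h1 h2 h2 h3 <;> simp_all [Subtype.ext_iff]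
  exact c.2.2.ne_empty h1

lemma asmL_inl_single (i : Fin m) :
  asmL m n (Pi.single i 1, 0) = Pi.single ⟨(i, ∅), by simp⟩ 1 := by
  ext d
  rw [asmL_apply]
  simp only [assemble, Pi.single_apply, Pi.zero_apply]
  split_ifs with h1 h2 h2 h3 <;> simp_all [Subtype.ext_iff, Prod.ext_iff]

lemma integral_pd_fib {g : Pt m n → ℝ} (hg : Cl (ov n {x}) (DE (ov n {x})) 1 g)
  (c : FibIdx m n) : ∫ y : FibIdx m n → ℝ, pd ⟨c.1, c.2.1⟩ g (assemble x y) = 0 := by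
  have hm : ∀ y : FibIdx m n → ℝ, assemble x y ∈ ov n {x} := assemble_mem (mem_singleton x)
  have hd : ∀ y : FibIdx m n → ℝ, DifferentiableAt ℝ g (assemble x y) := fun y =>
    (hg.smAt (hm y)).differentiableAt
  have h1 : ∀ y, fderiv ℝ (fun y : FibIdx m n → ℝ => g (assemble x y)) y (Pi.single c 1) =
      pd ⟨c.1, c.2.1⟩ g (assemble x y) := fun y => by
    rw [fderiv_assemble (hasFDerivAt_assemble_fib x y) (hd y), pd, ← asmL_inr_single]; rfl
  have h := integral_fderiv_eq_zero' (μ := volume) (g := fun y : FibIdx m n → ℝ => g (assemble x y))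
    (fun y => (hd y).comp y (hasFDerivAt_assemble_fib x y).differentiableAt) (Pi.single c 1)
    hg.zero.integrable (by simp_rw [h1]; exact Cl.integrable (hg.2 _))
  simpa only [h1] using h

lemma integral_pd_base {g : Pt m n → ℝ} (hg : Cl univ (DE univ) 1 g) (i : Fin m) :
  ∫ x, ∫ y : FibIdx m n → ℝ, pd ⟨(i, ∅), by simp⟩ g (assemble x y) = 0 := by
  have hd : ∀ z, DifferentiableAt ℝ g (asmL m n z) := fun z =>
    (hg.smAt (mem_univ _)).differentiableAt
  have h1 : ∀ z, fderiv ℝ (fun z => g (asmL m n z)) z (Pi.single i 1, 0) =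
      pd ⟨(i, ∅), by simp⟩ g (assemble z.1 z.2) := fun z => by
    rw [fderiv_assemble (asmL m n).hasFDerivAt (hd z), pd, ← asmL_inl_single]; rfl
  have h := integral_fderiv_eq_zero'
    (μ := (volume : Measure (Bs m)).prod (volume : Measure (FibIdx m n → ℝ)))
    (g := fun z => g (asmL m n z))
    (fun z => (hd z).comp z (asmL m n).differentiableAt) (Pi.single i 1, 0)
    hg.zero.integrable_prod (by simp_rw [h1]; exact Cl.integrable_prod (hg.2 _))
  simp_rw [h1] at h
  rwa [integral_prod _ (Cl.integrable_prod (hg.2 _))] at h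

/-- The fibre integral of the top coefficient. -/
def fint (T : Finset (Fin L)) (f : SFun L m n) (x : Bs m) : ℝ :=
  ∫ y : FibIdx m n → ℝ, top m n T (f (assemble x y))

lemma Cl.top {Ω : Set (Pt m n)} {Q : (Pt m n → ℝ) → Prop} [hQ : Wt Ω Q]
  {k : ℕ} {f : SFun L m n} (hf : Cl Ω Q k f) (T : Finset (Fin L)) :
  Cl Ω Q k fun p => Worm.top m n T (f p) := Cl.linear _ hf

lemma Cl.flatComp {Ω : Set (Pt m n)} (k : ℕ) (u : OddVF n) (i : Fin m)
  (K : Ix n) : Cl Ω (PG Ω) k fun q => flatComp (L := L) u q i K :=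
  Cl.sum fun J _ => Cl.smul (Cl.const k _) (Cl.coordFun k i J)

/-- Stokes' theorem on a fibre. -/
lemma fint_flatS (hn : 2 ≤ n) {u : OddVF n} (hu : ∀ a, coeff ∅ (u a) = 0) (T : Finset (Fin L))
  {f : SFun L m n} (hf : Cl (ov n {x}) (DE (ov n {x})) 1 f) : fint T (flatS u f) x = 0 := by
  have hm : ∀ y : FibIdx m n → ℝ, assemble x y ∈ ov n {x} := assemble_mem (mem_singleton x)
  have hc : ∀ c : EvenIdx m n, Cl (ov n {x}) (DE (ov n {x})) 1
      fun q => top m n T (flatComp u q c.1.1 c.1.2 * f q) := fun c =>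
    Cl.top (Cl.mul (Cl.flatComp _ _ _ _) hf) T
  rw [fint]
  simp_rw [fun y => top_flatS hn u T (hf.smAt (hm y))]
  rw [integral_finsetSum _ fun c _ => Cl.integrable ((hc c).2 c)]
  refine sum_eq_zero fun c _ => ?_
  obtain ⟨⟨i, K⟩, hK⟩ := c
  rcases K.eq_empty_or_nonempty with rfl | hne
  · have : (fun q => top m n T (flatComp u q i ∅ * f q)) = fun _ => 0 := by
      ext q; rw [flatComp_empty hu, zero_mul, map_zero]
    simp [this, pd_const]
  · exact integral_pd_fib (hc ⟨(i, K), hK⟩) ⟨(i, K), hK, hne⟩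

/-- Stokes' theorem on a coordinate domain. -/
lemma integral_fint_flatS (hn : 2 ≤ n) (u : OddVF n) (T : Finset (Fin L))
  {f : SFun L m n} (hf : Cl univ (DE univ) 1 f) : ∫ x, fint T (flatS u f) x = 0 := by
  have hc : ∀ c : EvenIdx m n, Cl univ (DE univ) 1
      fun q => top m n T (flatComp u q c.1.1 c.1.2 * f q) := fun c =>
    Cl.top (Cl.mul (Cl.flatComp _ _ _ _) hf) T
  have hcx : ∀ (x : Bs m) (c : EvenIdx m n), Cl (ov n {x}) (DE (ov n {x})) 1
      fun q => top m n T (flatComp u q c.1.1 c.1.2 * f q) := fun x c =>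
    (hc c).mono_set (subset_univ _)
  simp_rw [fint, fun (x : Bs m) (y : FibIdx m n → ℝ) => top_flatS hn u T
    (hf.smAt (mem_univ (assemble x y)))]
  simp_rw [fun x : Fin m → ℝ => integral_finsetSum (μ := (volume : Measure (FibIdx m n → ℝ)))
    Finset.univ fun c _ => Cl.integrable ((hcx x c).2 c)]
  rw [integral_finsetSum _ fun c _ => (Cl.integrable_prod ((hc c).2 c)).integral_prod_left]
  refine sum_eq_zero fun c _ => ?_
  obtain ⟨⟨i, K⟩, hK⟩ := c
  rcases K.eq_empty_or_nonempty with rfl | hne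
  · exact integral_pd_base (hc ⟨(i, ∅), hK⟩) i
  · simp_rw [fun x : Fin m → ℝ => integral_pd_fib (hcx x ⟨(i, K), hK⟩) ⟨(i, K), hK, hne⟩]
    simp

end

/-! ### Linear changes of coordinates -/

lemma coeff_univ_lam_aux (C : Matrix ι ι ℝ) (hb : ∀ s, ∑ t, C s t • (gen t : Gr ι) ∈ pty ι 1)
  (w : Gr ι) : coeff Finset.univ (lam (fun s => ∑ t, C s t • (gen t : Gr ι)) hb w) =
      C.det * coeff Finset.univ w := by
  set b : ι → Gr ι := fun s => ∑ t, C s t • (gen t : Gr ι)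
  suffices h : coeff Finset.univ ∘ₗ (lam b hb).toLinearMap = C.det • coeff Finset.univ from
    LinearMap.congr_fun h w
  refine linearMap_ext_mon fun S => ?_
  simp only [LinearMap.comp_apply, AlgHom.toLinearMap_apply, LinearMap.smul_apply, smul_eq_mul,
    coeff_mon]
  split_ifs with hS
  · subst hS
    let N := (Finset.univ : Finset ι).card
    let e : Fin N ≃ ι := ((Finset.univ : Finset ι).orderIsoOfFin rfl).toEquiv.trans
      (Equiv.subtypeUnivEquiv Finset.mem_univ)
    let f : (ι → ℝ) [⋀^ι]→ₗ[ℝ] ℝ :=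
      ((coeff (ι := ι) Finset.univ).compAlternatingMap (ExteriorAlgebra.ιMulti ℝ N)).domDomCongr e
    have hf : ∀ v : ι → ι → ℝ, f v =
        coeff Finset.univ (ordProd Finset.univ fun s => ExteriorAlgebra.ι ℝ (v s) : Gr ι) := by
      intro v
      simp only [f, AlternatingMap.domDomCongr_apply, LinearMap.compAlternatingMap_apply,
        ExteriorAlgebra.ιMulti_apply, ordProd]
      congr 2
      apply List.ext_getElem
      · simp [N]
      · intro i h1 h2
        rw [List.getElem_ofFn, List.getElem_map]
        change ExteriorAlgebra.ι ℝ (v (Finset.univ.orderIsoOfFin rfl ⟨i, _⟩).1) = _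
        rw [Finset.coe_orderIsoOfFin_apply, Finset.orderEmbOfFin_apply]
        rfl
    have h1 := f.eq_smul_basis_det (Pi.basisFun ℝ ι)
    have h2 : f (Pi.basisFun ℝ ι) = 1 := by
      rw [hf]
      have : (ordProd Finset.univ fun s => ExteriorAlgebra.ι ℝ (Pi.basisFun ℝ ι s) : Gr ι) =
          mon Finset.univ := by
        rw [mon_eq_ordProd]; congr 1; ext s; rw [gen, Pi.basisFun_apply]
      rw [this, coeff_mon, if_pos rfl]
    have h3 := congrArg (fun g => g (fun s => C s)) h1
    rw [h2, one_smul, hf, Pi.basisFun_det_apply] at h3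
    rw [mul_one, lam_mon]
    refine Eq.trans ?_ h3
    congr 2
    ext s
    simp only [b]
    conv_rhs => rw [← Finset.univ_sum_single (C s)]
    rw [map_sum]
    refine sum_congr rfl fun t _ => ?_
    rw [gen, ← map_smul, ← Pi.single_smul, smul_eq_mul, mul_one]
  · have h1 := euler_lam Finset.univ b hb (mon S)
    have h2 : ∀ s, euler Finset.univ (b s) = b s := by
      intro s
      simp only [b, map_sum, map_smul]
      refine sum_congr rfl fun t _ => ?_
      rw [← mon_singleton, euler_mon]; simp
    have h3 : ∑ s, b s * lam b hb (dLeft s (mon S)) = lam b hb (euler Finset.univ (mon S)) := by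
      rw [euler, LinearMap.sum_apply, map_sum]
      refine sum_congr rfl fun s _ => ?_
      rw [num, LinearMap.comp_apply, LinearMap.mulLeft_apply, map_mul, lam_gen]
    simp_rw [h2] at h1
    rw [h3, euler_mon, map_smul] at h1
    have h4 := congrArg (coeff Finset.univ) h1
    rw [coeff_euler, map_smul, Finset.univ_inter, Finset.univ_inter, smul_eq_mul,
      ← sub_eq_zero, ← sub_mul] at h4
    rw [mul_zero]
    refine (mul_eq_zero.mp h4).resolve_left ?_
    have : S.card < (Finset.univ : Finset ι).card :=
      Finset.card_lt_card (Finset.ssubset_univ_iff.mpr (Ne.symm hS))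
    have : (S.card : ℝ) < (Finset.univ : Finset ι).card := by exact_mod_cast this
    linarith

lemma coeff_univ_lam [d : DecidableEq ι] (C : Matrix ι ι ℝ)
  (hb : ∀ s, ∑ t, C s t • (gen t : Gr ι) ∈ pty ι 1) (w : Gr ι) :
  coeff Finset.univ (lam (fun s => ∑ t, C s t • (gen t : Gr ι)) hb w) =
      C.det * coeff Finset.univ w := by
  obtain rfl : d = LinearOrder.toDecidableEq := Subsingleton.elim _ _
  exact coeff_univ_lam_aux C hb w

lemma gsub_scalar
  {f : Vec κ → Gr σ} {q : κ → ℝ} (hf : SmAt f q) {b : σ → Gr ι} (hb : Odds b) :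
  gsub f (fun c => algebraMap ℝ (Gr ι) (q c)) b = lam b hb (f q) := by
  rw [gsub_eq_lam f _ hb, ← sum_coeff_mon (f q), map_sum]
  refine sum_congr rfl fun S _ => ?_
  rw [taylor_scalar (hf.coeff S), map_smul, Algebra.smul_def]

lemma det_pairs {X A B : Type} [Fintype X] [DecidableEq X] [Fintype A] [DecidableEq A] [Fintype B]
  [DecidableEq B] (e : X ≃ A × B) (R : Matrix A A ℝ) (S : Matrix B B ℝ) :
  (Matrix.of fun x y => R (e x).1 (e y).1 * S (e x).2 (e y).2).det =
      R.det ^ Fintype.card B * S.det ^ Fintype.card A := by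
  rw [← Matrix.det_kronecker, ← Matrix.det_submatrix_equiv_self e]
  rfl

/-- Pairs with a condition on the second component. -/
def pairEquiv (m : ℕ) {β : Type} (P : β → Prop) : {c : Fin m × β // P c.2} ≃ Fin m × {b // P b} where
  toFun c := (c.1.1, ⟨c.1.2, c.2⟩)
  invFun c := ⟨(c.1, c.2.1), c.2.2⟩

lemma topIdx_zero : topIdx m n (∅ : Finset (Fin 0)) = Finset.univ := by
  ext s
  simp only [Finset.mem_univ, iff_true]
  obtain ⟨c, rfl⟩ := eq_parO s
  exact inr_mem_jm.mpr (Finset.mem_univ c)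

/-- The fibre integral after a linear change of the fibre coordinates. -/
lemma fint_linear (Re : Matrix (FibIdx m n) (FibIdx m n) ℝ) (hRe : Re.det ≠ 0)
  (Ro : Matrix (OddIdx m n) (OddIdx m n) ℝ) {x x' : Bs m} {f h : SFun 0 m n}
  (b : Par 0 m n → Gr (Par 0 m n)) (hb : Odds b)
  (hbo : ∀ c, b (parO c) = ∑ c', Ro c c' • gen (parO c'))
  (hh : ∀ y, h (assemble x y) = lam b hb (f (assemble x' (Re.mulVec y)))) :
  fint ∅ h x = Ro.det * |Re.det|⁻¹ * fint ∅ f x' := by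
  set C : Matrix (Par 0 m n) (Par 0 m n) ℝ := Matrix.of fun s t =>
    Sum.elim (fun t => t.elim0) (fun c => Sum.elim (fun t => t.elim0) (fun c' => Ro c c') (ofLex t))
      (ofLex s) with hC
  have hbC : b = fun s => ∑ t, C s t • gen t := by
    ext s
    obtain ⟨c, rfl⟩ := eq_parO s
    rw [sum_par, Finset.univ_eq_empty, Finset.sum_empty, zero_add]
    exact hbo c
  have hdet : C.det = Ro.det := by
    let e : OddIdx m n ≃ Par 0 m n := (Equiv.emptySum (Fin 0) (OddIdx m n)).symm.trans toLex
    rw [← Matrix.det_submatrix_equiv_self e C]; rfl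
  subst hbC
  have h1 : ∀ y, top m n ∅ (h (assemble x y)) =
      Ro.det * top m n ∅ (f (assemble x' (Re.mulVec y))) := by
    intro y
    rw [hh, top, topIdx_zero]
    exact (coeff_univ_lam C hb _).trans (by rw [hdet])
  rw [fint]
  simp_rw [h1]
  rw [integral_const_mul, mul_assoc]
  congr 1
  have hL : LinearMap.det (Matrix.toLin' Re) ≠ 0 := by rwa [LinearMap.det_toLin']
  have h2 := integral_map_equiv (μ := (volume : Measure (FibIdx m n → ℝ)))
    ((LinearEquiv.ofIsUnitDet (f := Matrix.toLin' Re) (v := Pi.basisFun ℝ _) (v' := Pi.basisFun ℝ _)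
      (by simpa [LinearMap.toMatrix_eq_toMatrix'] using hRe)).toContinuousLinearEquiv.toHomeomorph.toMeasurableEquiv)
    fun y => top m n ∅ (f (assemble x' y))
  have h3 : Measure.map (Matrix.toLin' Re) volume =
      ENNReal.ofReal |Re.det|⁻¹ • (volume : Measure (FibIdx m n → ℝ)) := by
    rw [Measure.map_linearMap_addHaar_eq_smul_addHaar volume hL, LinearMap.det_toLin', abs_inv]
  have h4 : ∫ y, top m n ∅ (f (assemble x' y)) ∂(Measure.map (Matrix.toLin' Re)
      (volume : Measure (FibIdx m n → ℝ))) = ∫ y, top m n ∅ (f (assemble x' (Re.mulVec y))) := h2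
  rw [← h4, h3, integral_smul_measure, ENNReal.toReal_ofReal (by positivity), smul_eq_mul]
  rfl

lemma card_odd_even (hn : 2 ≤ n) :
  Fintype.card {I : Ix n // ¬ Even I.card} =
      Fintype.card {I : Ix n // Even I.card ∧ I.Nonempty} + 1 ∧
  Even (Fintype.card {I : Ix n // ¬ Even I.card}) := by
  have : NeZero n := ⟨by omega⟩
  set E := Fintype.card {I : Ix n // Even I.card}
  set O := Fintype.card {I : Ix n // ¬ Even I.card} with hO
  have h1 : E + O = 2 ^ n := by
    rw [hO, Fintype.card_subtype_compl]
    have := Fintype.card_subtype_le fun I : Ix n => Even I.card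
    rw [Fintype.card_finset, Fintype.card_fin] at *
    omega
  have h2 : E = O := by
    have h := Finset.sum_powerset_neg_one_pow_card_of_nonempty
      (Finset.univ_nonempty (α := Fin n))
    rw [Finset.powerset_univ,
      ← Fintype.sum_subtype_add_sum_subtype (fun I : Ix n => Even I.card)] at h
    have a1 : ∑ I : {I : Ix n // Even I.card}, (-1 : ℤ) ^ I.1.card = E :=
      (sum_congr rfl fun I _ => I.2.neg_one_pow).trans (by simp [E])
    have a2 : ∑ I : {I : Ix n // ¬ Even I.card}, (-1 : ℤ) ^ I.1.card = -O :=
      (sum_congr rfl fun I _ => (Nat.not_even_iff_odd.mp I.2).neg_one_pow).trans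
        (by rw [sum_const, card_univ, nsmul_eq_mul, mul_neg_one])
    rw [a1, a2] at h
    omega
  have h3 : E = Fintype.card {I : Ix n // Even I.card ∧ I.Nonempty} + 1 := by
    rw [← Fintype.card_option]
    refine Fintype.card_congr ⟨fun I => if h : I.1.Nonempty then some ⟨I.1, I.2, h⟩ else none,
      fun o => o.elim ⟨∅, by simp⟩ fun I => ⟨I.1, I.2.1⟩, fun I => ?_, fun o => ?_⟩
    · by_cases h : I.1.Nonempty
      · simp [h]
      · simp only [dif_neg h]
        exact Subtype.ext (Finset.not_nonempty_iff_eq_empty.mp h).symm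
    · rcases o with _ | I
      · simp
      · simp [I.2.2]
  refine ⟨by omega, ?_⟩
  obtain ⟨k, rfl⟩ : ∃ k, n = k + 2 := ⟨n - 2, by omega⟩
  rw [pow_add] at h1
  exact ⟨2 ^ k, by omega⟩

/-! ### The fibre density -/

section

lemma thetaPart_smul (K : Ix n) (r : ℝ) (w : Gr (WithTheta n g)) :
  thetaPart K (r • w) = r • thetaPart K w := by
  simp only [← thetaL_apply, map_smul]

lemma thetaPart_zero (K : Ix n) : thetaPart K (0 : Gr (WithTheta n g)) = 0 := by
  simp only [← thetaL_apply, map_zero]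

lemma thetaPart_dLeft_inr (c : g) (K : Ix n) (w : Gr (WithTheta n g)) :
  thetaPart K (dLeft (inrE n g c) w) = (-1 : ℝ) ^ K.card • dLeft c (thetaPart K w) := by
  have h : ∀ I, dLeft (inrE n g c) (tm g I * inr n g (thetaPart I w)) =
      tm g I * inr n g ((-1 : ℝ) ^ I.card • dLeft c (thetaPart I w)) := by
    intro I
    rw [dLeft_mul, tm_eq_rename, dLeft_rename fun s hs => Sum.inl_ne_inr (toLex.injective hs),
      zero_mul, zero_add, dLeft_rename_self, map_smul, mul_smul_comm, ← smul_mul_assoc]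
    congr 1
    rw [← tm_eq_rename]
    have := tm_mem_pty (g := g) I
    by_cases hI : Even I.card
    · rw [even_cast hI] at this
      rw [involute_even this, hI.neg_one_pow, one_smul]
    · rw [odd_cast hI] at this
      rw [involute_odd this, (Nat.not_even_iff_odd.mp hI).neg_one_pow, neg_one_smul]
  conv_lhs => rw [← sum_thetaPart w, map_sum, ← thetaL_apply, map_sum]
  simp_rw [h, thetaL_apply, thetaPart_tm_mul]
  simp

variable {ψ : Bs m → Bs m} {p : Pt m n}

lemma killTheta_gcurve (i : Fin m) :
  killTheta n _ (gcurve (coordFun (L := L) p) i) = algebraMap ℝ _ (baseOf p i) := by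
  rw [← thetaPart_empty, thetaPart_gcurve, sgnRev_empty, one_smul, coordFun, dif_pos (by simp)]
  rfl

lemma killTheta_taylor {h : Bs m → ℝ} (hh : SmAt h (baseOf p)) :
  killTheta n _ (taylor h (gcurve (coordFun (L := L) p))) = algebraMap ℝ _ (h (baseOf p)) := by
  rw [map_taylor _ body_killTheta (by rwa [bod_gcurve_coordFun])]
  simp_rw [killTheta_gcurve]
  exact taylor_scalar hh

lemma pcoord_empty (hψ : ∀ i, SmAt (fun x => ψ x i) (baseOf p)) (i : Fin m) :
  pcoord (n := n) L ψ p i ∅ = algebraMap ℝ _ (ψ (baseOf p) i) := by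
  rw [pcoord, taylorCoeff, sgnRev_empty, one_smul, thetaPart_empty, killTheta_taylor (hψ i)]

lemma thetaPart_tm_mul_taylor {h : Bs m → ℝ} (hh : SmAt h (baseOf p))
  {K K' : Ix n} (hK : K.card ≤ K'.card) :
  thetaPart K (tm _ K' * taylor h (gcurve (coordFun (L := L) p))) =
      if K = K' then algebraMap ℝ _ (h (baseOf p)) else 0 := by
  split_ifs with h1
  · subst h1
    rw [thetaPart_tm_mul_self, thetaPart_empty, killTheta_taylor hh]
  · exact thetaPart_tm_mul_of_not_subset
      (fun h2 => h1 (Finset.eq_of_subset_of_card_le h2 hK).symm) _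

lemma pd_gcurve (c : EvenIdx m n) (j : Fin m) :
  pd c (fun q => gcurve (coordFun (L := L) q) j) p =
      if c.1.1 = j then sgnRev c.1.2 • tm _ c.1.2 else 0 := by
  refine theta_ext fun K => ?_
  have h1 := (pd_linear (thetaL K) (SmAt.gcurve (fun i I => smAt_coordFun (L := L) i I p) j)
    c).self_of_nhds
  have h2 : (fun q => thetaL K (gcurve (coordFun (L := L) q) j)) =
      fun q => sgnRev K • coordFun (L := L) q j K := by
    ext q; rw [thetaL_apply, thetaPart_gcurve]
  have h3 := (pd_const_smul (sgnRev K) (smAt_coordFun (L := L) j K p) c).self_of_nhds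
  rw [h2] at h1
  have h4 := thetaPart_tm_mul (g := Par L m n) K c.1.2 1
  rw [map_one, mul_one] at h4
  rw [← thetaL_apply]
  refine h1.symm.trans (h3.trans ?_)
  dsimp only
  rw [pd_coordFun, apply_ite (thetaPart K), thetaPart_smul, h4, thetaPart_zero]
  obtain ⟨⟨i, I⟩, hI⟩ := c
  by_cases ha : i = j <;> by_cases hb : I = K
  · subst ha; subst hb; simp
  · simp [ha, hb, Ne.symm hb]
  · simp [ha]
  · simp [ha]

lemma dLeft_gcurve (c : OddIdx m n) (j : Fin m) :
  dLeft (inrE n _ (parO c)) (gcurve (coordFun (L := L) p) j) =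
      if c.1.1 = j then (-1 : ℝ) ^ c.1.2.card • sgnRev c.1.2 • tm _ c.1.2 else 0 := by
  refine theta_ext fun K => ?_
  have h4 := thetaPart_tm_mul (g := Par L m n) K c.1.2 1
  rw [map_one, mul_one] at h4
  rw [thetaPart_dLeft_inr, thetaPart_gcurve, map_smul, dLeft_coordFun,
    apply_ite (thetaPart K), thetaPart_smul, thetaPart_smul, h4, thetaPart_zero]
  obtain ⟨⟨i, I⟩, hI⟩ := c
  by_cases ha : i = j <;> by_cases hb : I = K
  · subst ha; subst hb; simp
  · simp [ha, hb, Ne.symm hb]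
  · simp [ha]
  · simp [ha]

lemma pd_pcoord (hψ : ∀ i, SmAt (fun x => ψ x i) (baseOf p)) (c : EvenIdx m n) (i : Fin m)
  {K : Ix n} (hK : K.card ≤ c.1.2.card) : pd c (fun q => pcoord L ψ q i K) p =
      algebraMap ℝ _ (if K = c.1.2 then pd c.1.1 (fun x => ψ x i) (baseOf p) else 0) := by
  have hg : ∀ j, SmAt (fun q => gcurve (coordFun (L := L) q) j) p :=
    SmAt.gcurve fun i I => smAt_coordFun (L := L) i I p
  have hb : SmAt (fun x => ψ x i) (bod (gcurve (coordFun (n := n) (L := L) p))) := by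
    rw [bod_gcurve_coordFun]; exact hψ i
  have h1 := (pd_linear (sgnRev K • thetaL K) (SmAt.taylor hg hb) c).self_of_nhds
  have h0 : (fun q => pcoord L ψ q i K) = fun q : Pt m n =>
      (sgnRev K • thetaL K) (taylor (fun x => ψ x i) (gcurve (coordFun q))) := by
    ext q; rw [LinearMap.smul_apply, thetaL_apply]; rfl
  rw [h0, h1]
  dsimp only
  rw [pd, fderiv_taylor hg (Eventually.of_forall fun q j => gcurve_mem_pty (adm_coordFun q) j) hb,
    sum_eq_single c.1.1]
  · have := pd_gcurve (L := L) (p := p) c c.1.1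
    rw [if_pos rfl] at this
    change (sgnRev K • thetaL K) (pd c _ p * _) = _
    rw [this, smul_mul_assoc, map_smul, LinearMap.smul_apply, thetaL_apply,
      thetaPart_tm_mul_taylor ((hψ i).pd _) hK]
    split_ifs with h
    · rw [h, smul_smul, sgnRev_mul_self, one_smul]
    · simp
  · intro j _ hj
    change pd c _ p * _ = 0
    rw [pd_gcurve, if_neg hj.symm, zero_mul]
  · simp

lemma dLeft_pcoord (hψ : ∀ i, SmAt (fun x => ψ x i) (baseOf p)) (c : OddIdx m n) (i : Fin m)
  {K : Ix n} (hK : K.card ≤ c.1.2.card) : dLeft (parO c) (pcoord L ψ p i K) =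
      algebraMap ℝ _ (if K = c.1.2 then pd c.1.1 (fun x => ψ x i) (baseOf p) else 0) := by
  have hb : SmAt (fun x => ψ x i) (bod (gcurve (coordFun (n := n) (L := L) p))) := by
    rw [bod_gcurve_coordFun]; exact hψ i
  have h1 := congrArg (thetaPart K) (derivation_taylor (EvenDer.dLeft (inrE n _ (parO c)))
    (gcurve_mem_pty (adm_coordFun (L := L) p)) hb)
  rw [thetaPart_dLeft_inr, sum_eq_single c.1.1] at h1
  · rw [dLeft_gcurve, if_pos rfl, smul_mul_assoc, smul_mul_assoc, thetaPart_smul,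
      thetaPart_smul, thetaPart_tm_mul_taylor ((hψ i).pd _) hK] at h1
    have h2 := congrArg (fun z => (sgnRev K * (-1 : ℝ) ^ K.card) • z) h1
    simp only [smul_smul] at h2
    rw [mul_assoc, ← mul_pow, neg_one_mul, neg_neg, one_pow, mul_one] at h2
    rw [pcoord, taylorCoeff, map_smul, h2]
    split_ifs with h
    · rw [← h, show sgnRev K * (-1 : ℝ) ^ K.card * ((-1 : ℝ) ^ K.card * sgnRev K) =
        (sgnRev K * sgnRev K) * ((-1 : ℝ) * -1) ^ K.card by rw [mul_pow]; ring, sgnRev_mul_self]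
      simp
    · simp
  · intro j _ hj
    rw [dLeft_gcurve, if_neg hj.symm, zero_mul]
  · simp

end

section

lemma add_smul_of_fderiv {κ V : Type} [Fintype κ] [NormedAddCommGroup V] [NormedSpace ℝ V]
  {h : Vec κ → V} {w p : κ → ℝ} {r : V} (hs : ∀ s : ℝ, SmAt h (p + s • w))
  (hr : ∀ s : ℝ, fderiv ℝ h (p + s • w) w = r) (s : ℝ) : h (p + s • w) = h p + s • r := by
  have hd : ∀ t : ℝ, HasDerivAt (fun t : ℝ => h (p + t • w) - t • r) 0 t := fun t => by
    have h1 : HasDerivAt (fun t : ℝ => p + t • w) w t := by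
      simpa using ((hasDerivAt_id t).smul_const w).const_add p
    have h2 := (hs t).differentiableAt.hasFDerivAt.comp_hasDerivAt t h1
    rw [hr t] at h2
    exact (h2.sub ((hasDerivAt_id t).smul_const r)).congr_deriv (by simp)
  have := is_const_of_deriv_eq_zero (fun t => (hd t).differentiableAt) (fun t => (hd t).deriv) s 0
  simp only [zero_smul, add_zero, sub_zero] at this
  rw [← this]; abel

lemma integral_shear {κ : Type} [Fintype κ] {β : Vec κ → ℝ} {w : κ → ℝ}
  (hβ : Differentiable ℝ β) (hw : ∀ y (s : ℝ), β (y + s • w) = β y) (F : Vec κ → ℝ) :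
  ∫ y, F (y + β y • w) = ∫ y, F y := by
  have hd : ∀ y, fderiv ℝ β y w = 0 := fun y => by
    have h1 : HasDerivAt (fun t : ℝ => y + t • w) w 0 := by
      simpa using ((hasDerivAt_id (0 : ℝ)).smul_const w).const_add y
    have h2 : HasFDerivAt β (fderiv ℝ β y) (y + (0 : ℝ) • w) := by
      simpa using (hβ y).hasFDerivAt
    have h3 := h2.comp_hasDerivAt (0 : ℝ) h1
    have h4 : β ∘ (fun t : ℝ => y + t • w) = fun _ => β y := by ext t; exact hw y t
    rw [h4] at h3
    exact h3.unique (hasDerivAt_const _ _)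
  have hinj : Function.Injective fun y => y + β y • w := by
    intro y z h
    have h1 : β y = β z := by rw [← hw y (β y), ← hw z (β z)]; exact congrArg β h
    simpa [h1] using h
  have hsurj : (fun y => y + β y • w) '' univ = univ := by
    refine image_univ_of_surjective fun y => ⟨y + (-β y) • w, ?_⟩
    simp only [hw]; simp
  have key := integral_image_eq_integral_abs_det_fderiv_smul (volume : Measure (Vec κ))
    MeasurableSet.univ (f := fun y => y + β y • w)
    (f' := fun y => ContinuousLinearMap.id ℝ _ + (fderiv ℝ β y).smulRight w)
    (fun y _ => ((hasFDerivAt_id y).add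
      ((hβ y).hasFDerivAt.smul_const w)).hasFDerivWithinAt) hinj.injOn F
  rw [hsurj, setIntegral_univ, setIntegral_univ] at key
  rw [key]
  refine integral_congr_ae (Eventually.of_forall fun y => ?_)
  have hdet : (ContinuousLinearMap.id ℝ (Vec κ) + (fderiv ℝ β y).smulRight w).det = 1 := by
    have := LinearMap.transvection.det (R := ℝ) (V := κ → ℝ)
      (f := (fderiv ℝ β y).toLinearMap) (v := w)
    rw [show (fderiv ℝ β y).toLinearMap w = 0 from hd y, add_zero] at this
    exact this
  simp only [hdet, abs_one, one_smul]

/-- The pullback of `f` along the substitution `Z`. -/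
def subS (Z : Pt m n → Fin m → Ix n → Gr (Par 0 m n)) (f : SFun 0 m n) :
  SFun 0 m n := fun p => gsub f (evn (Z p)) (odn t0 (Z p))

/-- Substitutions over `x ↦ x'` which preserve rapid decrease along the fibres. -/
structure FibSubst (x x' : Bs m)
  (Z : Pt m n → Fin m → Ix n → Gr (Par 0 m n)) : Prop where
  tame : ∀ k i K, Cl (ov n {x}) (PG (ov n {x})) k fun p => Z p i K
  adm : ∀ p ∈ ov n {x}, ∀ᶠ q in 𝓝 p, Adm (Z q)
  base : ∀ p ∈ ov n {x}, baseOf (bod (evn (Z p))) = x'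
  growth : ∃ (C : ℝ) (r : ℕ), ∀ p ∈ ov n {x}, 1 + ‖p‖ ≤ C * (1 + ‖bod (evn (Z p))‖) ^ r

variable {x x' : Bs m} {Z : Pt m n → Fin m → Ix n → Gr (Par 0 m n)}

lemma mem_ov_singleton {p : Pt m n} : p ∈ ov n {x} ↔ baseOf p = x := Iff.rfl

lemma FibSubst.cl (hZ : FibSubst x x' Z) {f : SFun 0 m n}
  (hf : ∀ k, Cl (ov n {x'}) (DE (ov n {x'})) k f) (k : ℕ) :
  Cl (ov n {x}) (DE (ov n {x})) k (subS Z f) := by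
  obtain ⟨C, r, hC⟩ := hZ.growth
  refine Cl.gsub (Ω' := ov n {x'}) (Q' := DE (ov n {x'})) ⟨fun k c => hZ.tame k _ _,
    fun p hp => hZ.base p hp, fun u hu => DE.comp (A := fun p => bod (evn (Z p)))
      (fun p hp => hZ.base p hp) hC hu⟩ ?_ hf k
  intro k s
  obtain ⟨c, rfl⟩ := eq_parO s
  exact hZ.tame k _ _

lemma FibSubst.smAt (hZ : FibSubst x x' Z) {p : Pt m n} (hp : p ∈ ov n {x})
  (i : Fin m) (K : Ix n) : SmAt (fun q => Z q i K) p := (hZ.tame 0 i K).smAt hp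

/-- `w` is the fibre direction in which only the coordinate `z_K^i` of the substitution moves. -/
def Moves (x : Bs m) (Z : Pt m n → Fin m → Ix n → Gr (Par 0 m n))
  (k : EvenIdx m n) (w : Pt m n) : Prop :=
  baseOf w = 0 ∧ ∀ p ∈ ov n {x}, ∀ i K,
    fderiv ℝ (fun q => Z q i K) p w = if (i, K) = k.1 then 1 else 0

lemma add_smul_mem_ov {p w : Pt m n} (hp : p ∈ ov n {x}) (hw : baseOf w = 0) (s : ℝ) :
  p + s • w ∈ ov n {x} := by
  rw [mem_ov_singleton] at hp ⊢
  rw [← hp]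
  ext i
  have := congrFun hw i
  simp only [baseOf, Pi.zero_apply] at this
  simp [baseOf, this]

lemma Moves.apply {k : EvenIdx m n} {w : Pt m n} (h : Moves x Z k w)
  (hZ : FibSubst x x' Z) {p : Pt m n} (hp : p ∈ ov n {x}) (s : ℝ) (i : Fin m)
  (K : Ix n) :
  Z (p + s • w) i K = Z p i K + s • (if (i, K) = k.1 then (1 : Gr (Par 0 m n)) else 0) :=
  add_smul_of_fderiv (h := fun q => Z q i K) (fun t => hZ.smAt (add_smul_mem_ov hp h.1 t) i K)
    (fun t => h.2 _ (add_smul_mem_ov hp h.1 t) i K) s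

lemma Moves.evn_apply {k : EvenIdx m n} {w : Pt m n} (h : Moves x Z k w)
  (hZ : FibSubst x x' Z) {p : Pt m n} (hp : p ∈ ov n {x}) (s : ℝ) :
  evn (Z (p + s • w)) = fun c => evn (Z p) c +
      (Pi.single k (algebraMap ℝ _ s) : EvenIdx m n → Gr (Par 0 m n)) c := by
  ext c
  rw [evn, h.apply hZ hp]
  by_cases hc : c = k
  · subst hc; simp [Algebra.algebraMap_eq_smul_one]
  · rw [if_neg (fun h => hc (Subtype.ext h)), Pi.single_eq_of_ne hc, smul_zero]

lemma Moves.odn_apply {k : EvenIdx m n} {w : Pt m n} (h : Moves x Z k w)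
  (hZ : FibSubst x x' Z) {p : Pt m n} (hp : p ∈ ov n {x}) (s : ℝ) :
  odn t0 (Z (p + s • w)) = odn t0 (Z p) := by
  ext c
  obtain ⟨c, rfl⟩ := eq_parO c
  change Z _ c.1.1 c.1.2 = Z p c.1.1 c.1.2
  rw [h.apply hZ hp, if_neg (fun h => c.2 (by rw [show c.1 = k.1 from h]; exact k.2)),
    smul_zero, add_zero]

lemma bod_mem (hZ : FibSubst x x' Z) {p : Pt m n} (hp : p ∈ ov n {x}) :
  bod (evn (Z p)) ∈ ov n {x'} := hZ.base p hp

lemma Moves.fderiv_subS {k : EvenIdx m n} {w : Pt m n} (h : Moves x Z k w)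
  (hZ : FibSubst x x' Z) {p : Pt m n} (hp : p ∈ ov n {x}) {f : SFun 0 m n}
  (hf : ∀ q ∈ ov n {x'}, SmAt f q) : fderiv ℝ (subS Z f) p w = subS Z (pd k f) p := by
  have hfp := hf _ (bod_mem hZ hp)
  have hA0 : Adm (Z p) := (hZ.adm p hp).self_of_nhds
  have hsub : SmAt (subS Z f) p := by
    refine SmAt.gsub (fun c => hZ.smAt hp _ _) (fun s => ?_) hfp
    obtain ⟨c, rfl⟩ := eq_parO s
    exact hZ.smAt hp _ _
  let A : ℝ → EvenIdx m n → Gr (Par 0 m n) := fun s c => evn (Z p) c +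
    (Pi.single k (algebraMap ℝ _ s) : EvenIdx m n → Gr (Par 0 m n)) c
  have hA : ∀ c, HasFDerivAt (fun s => A s c) (ContinuousLinearMap.toSpanSingleton ℝ
      (if c = k then (1 : Gr (Par 0 m n)) else 0)) 0 := fun c => by
    by_cases hc : c = k
    · subst hc
      have : (fun s => A s c) = fun s : ℝ => evn (Z p) c + s • (1 : Gr (Par 0 m n)) := by
        ext s; simp [A, Algebra.algebraMap_eq_smul_one]
      rw [this, if_pos rfl]
      exact (((hasDerivAt_id (0 : ℝ)).smul_const _).const_add _).hasFDerivAt.congr_fderiv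
        (by ext; simp)
    · have : (fun s => A s c) = fun s : ℝ => evn (Z p) c := by
        ext s; simp [A, Pi.single_eq_of_ne hc]
      rw [this, if_neg hc]
      simpa using hasFDerivAt_const (evn (Z p) c) (0 : ℝ)
  have hAs : ∀ c, SmAt (fun s => A s c) 0 := fun c => by
    by_cases hc : c = k
    · subst hc
      have : (fun s => A s c) = fun s : ℝ => evn (Z p) c + algebraMap ℝ (Gr (Par 0 m n)) s := by
        ext s; simp [A]
      rw [this]
      exact (SmAt.const _ _).add (SmAt.algebraMap (smAt_of_contDiff contDiff_id _))
    · have : (fun s => A s c) = fun s : ℝ => evn (Z p) c := by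
        ext s; simp [A, Pi.single_eq_of_ne hc]
      rw [this]; exact SmAt.const _ _
  have hA00 : A 0 = evn (Z p) := by ext c; simp [A]
  have h1 : HasDerivAt (fun t : ℝ => subS Z f (p + t • w)) (fderiv ℝ (subS Z f) p w) 0 := by
    have h1 : HasDerivAt (fun t : ℝ => p + t • w) w 0 := by
      simpa using ((hasDerivAt_id (0 : ℝ)).smul_const w).const_add p
    have h2 : HasFDerivAt (subS Z f) (fderiv ℝ (subS Z f) p) (p + (0 : ℝ) • w) := by
      simpa using hsub.differentiableAt.hasFDerivAt
    exact h2.comp_hasDerivAt (0 : ℝ) h1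
  have h2 : (fun t : ℝ => subS Z f (p + t • w)) = fun t => ∑ S,
      taylor (fun q => coeff S (f q)) (A t) * ordProd S (odn t0 (Z p)) := by
    ext t; rw [subS, h.evn_apply hZ hp, h.odn_apply hZ hp]; rfl
  have hfA : SmAt f (bod (A 0)) := by rw [hA00]; exact hfp
  have hT : ∀ S : Finset (Par 0 m n), DifferentiableAt ℝ
      (fun t => taylor (fun q => coeff S (f q)) (A t)) 0 := fun S =>
    (SmAt.taylor hAs (hfA.coeff S)).differentiableAt
  rw [h2] at h1
  rw [← h1.deriv, ← fderiv_apply_one_eq_deriv,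
    fderiv_sum_apply (fun S _ => (hT S).fun_mul (differentiableAt_const _)), subS, gsub]
  refine sum_congr rfl fun S _ => ?_
  rw [fderiv_mul_apply (hT S) (differentiableAt_const _), fderiv_taylor hAs
    (Eventually.of_forall fun s c => Submodule.add_mem _ (hA0.evn c) (by
      by_cases hc : c = k
      · subst hc; rw [Pi.single_eq_same]; exact algebraMap_mem_pty _
      · rw [Pi.single_eq_of_ne hc]; exact zero_mem _)) (hfA.coeff S)]
  simp only [(hA _).fderiv]
  rw [sum_eq_single k (by intro c _ hc; simp [hc]) (by simp), hA00]
  simp only [if_pos, ContinuousLinearMap.toSpanSingleton_apply, one_smul, one_mul,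
    fderiv_fun_const, Pi.zero_apply, zero_apply, mul_zero, add_zero]
  rw [taylor_congr (h' := fun q => coeff S (pd k f q)) ((hfp.coeff S).pd k) (coeff_pd hfp S k)]

end

section

variable {x x' : Bs m}
  {Z Z' : Pt m n → Fin m → Ix n → Gr (Par 0 m n)}

lemma integral_fderiv_fib {h : Pt m n → ℝ}
  (hh : Cl (ov n {x}) (DE (ov n {x})) 1 h) {w : Pt m n} (hw : baseOf w = 0) :
  ∫ y : FibIdx m n → ℝ, fderiv ℝ h (assemble x y) w = 0 := by
  simp_rw [fderiv_eq_sum_pd]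
  rw [integral_finsetSum _ fun c _ => show Integrable
    (fun y => w c • pd c h (assemble x y)) from (Cl.integrable (hh.2 c)).smul (w c)]
  refine sum_eq_zero fun c _ => ?_
  obtain ⟨⟨i, K⟩, hK⟩ := c
  rw [integral_smul]
  rcases K.eq_empty_or_nonempty with rfl | hne
  · rw [show w ⟨(i, ∅), hK⟩ = 0 from congrFun hw i, zero_smul]
  · rw [integral_pd_fib hh ⟨(i, K), hK, hne⟩, smul_zero]

lemma nilp_pow_eq_zero (a : Gr ι) :
  nilp a ^ (Fintype.card ι + 1) = 0 := by
  refine fil_eq_zero (Nat.lt_succ_self _) ?_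
  have := fil_list_prod (List.replicate (Fintype.card ι + 1) (nilp a)) fun y hy => by
    rw [List.eq_of_mem_replicate hy]; exact nilp_mem_fil a
  rwa [List.prod_replicate, List.length_replicate] at this

lemma Cl.pow {κ A : Type} [Fintype κ] [DecidableEq κ] [NormedRing A] [NormedAlgebra ℝ A]
  {Ω : Set (Vec κ)} {f : Vec κ → A} (hf : ∀ k, Cl Ω (PG Ω) k f) (j k : ℕ) :
  Cl Ω (PG Ω) k fun p => f p ^ j := by
  induction j with
  | zero => simpa using Cl.const k (1 : A)
  | succ j ih => simp_rw [pow_succ]; exact ih.mul (hf k)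

lemma fderiv_pow_eq_zero {E A : Type} [NormedAddCommGroup E] [NormedSpace ℝ E] [NormedRing A]
  [NormedAlgebra ℝ A] {f : E → A} {p w : E} (hf : DifferentiableAt ℝ f p)
  (h0 : fderiv ℝ f p w = 0) (j : ℕ) :
  fderiv ℝ (fun q => f q ^ j) p w = 0 := by
  induction j with
  | zero => simp
  | succ j ih =>
    simp_rw [pow_succ]
    rw [fderiv_mul_apply (hf.fun_pow j) hf, ih, h0, zero_mul, mul_zero, add_zero]

lemma Cl.iterate_pd {κ V : Type} [Fintype κ] [DecidableEq κ] [NormedAddCommGroup V]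
  [NormedSpace ℝ V] {Ω : Set (Vec κ)} {Q : (Vec κ → ℝ) → Prop} {f : Vec κ → V}
  (hf : ∀ k, Cl Ω Q k f) (c : κ) (j k : ℕ) : Cl Ω Q k ((pd c)^[j] f) := by
  induction j generalizing k with
  | zero => exact hf k
  | succ j ih => rw [Function.iterate_succ_apply']; exact (ih (k + 1)).2 c

lemma FibSubst.add_coord (hZ : FibSubst x x' Z) {k : Fin m × Ix n}
  (hk : k.2.Nonempty) {g : Pt m n → Gr (Par 0 m n)}
  (hg : ∀ j, Cl (ov n {x}) (PG (ov n {x})) j g)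
  (hg0 : ∀ p ∈ ov n {x}, ∀ᶠ q in 𝓝 p, g q ∈ pty _ (k.2.card : ZMod 2))
  (hZ' : ∀ p i K, Z' p i K = Z p i K + if (i, K) = k then g p else 0)
  (hgr : ∃ (C : ℝ) (r : ℕ), ∀ p ∈ ov n {x}, 1 + ‖p‖ ≤ C * (1 + ‖bod (evn (Z' p))‖) ^ r) :
  FibSubst x x' Z' where
  tame j i K := by
    simp_rw [hZ']
    refine (hZ.tame j i K).add ?_
    split_ifs
    · exact hg j
    · exact Cl.const_zero j
  adm p hp := by
    filter_upwards [hZ.adm p hp, hg0 p hp] with q hq hq' i K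
    rw [hZ']
    refine add_mem (hq i K) ?_
    split_ifs with h
    · rw [← h] at hq'; exact hq'
    · exact zero_mem _
  base p hp := by
    rw [← hZ.base p hp]
    ext i
    change body (Z' p i ∅) = body (Z p i ∅)
    rw [hZ', if_neg fun h => by rw [← h] at hk; simp at hk, add_zero]
  growth := hgr

lemma FibSubst.add_odd (hZ : FibSubst x x' Z) (k : OddIdx m n)
  {g : Pt m n → Gr (Par 0 m n)}
  (hg : ∀ j, Cl (ov n {x}) (PG (ov n {x})) j g)
  (hg0 : ∀ p ∈ ov n {x}, ∀ᶠ q in 𝓝 p, g q ∈ pty _ (k.1.2.card : ZMod 2))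
  (hZ' : ∀ p i K, Z' p i K = Z p i K + if (i, K) = k.1 then g p else 0)
  {I : Type} [Fintype I] (w : I → ℝ) (d : I → OddIdx m n)
  (hw : ∀ p ∈ ov n {x}, ∀ i K, ∑ c, w c • dLeft (parO (d c)) (Z p i K) =
      if (i, K) = k.1 then 1 else 0)
  (hgw : ∀ p ∈ ov n {x}, ∑ c, w c • dLeft (parO (d c)) (g p) = 0) :
  FibSubst x x' Z' ∧ ∀ f : SFun 0 m n, (∀ j, Cl (ov n {x'}) (DE (ov n {x'})) j f) →
      fint ∅ (subS Z' f) x = fint ∅ (subS Z f) x := by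
  have hev : ∀ p, evn (Z' p) = evn (Z p) := fun p => by
    ext c
    rw [evn, hZ', if_neg fun h => k.2 (by rw [← h]; exact c.2), add_zero]
  refine ⟨hZ.add_coord (card_pos.1 (Nat.pos_of_ne_zero fun h => k.2 (by simp [h])))
    hg hg0 hZ' (by simp_rw [hev]; exact hZ.growth), fun f hf => ?_⟩
  rw [fint, fint]
  refine integral_congr_ae (Eventually.of_forall fun y => ?_)
  have hp : assemble x y ∈ ov n {x} := assemble_mem (mem_singleton x) y
  set p := assemble x y
  have hfp := (hf 0).smAt (bod_mem hZ hp)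
  have hA : Adm (Z p) := (hZ.adm p hp).self_of_nhds
  have hgp : g p ∈ pty _ 1 := by rw [← odd_cast k.2]; exact (hg0 p hp).self_of_nhds
  have hb := hA.odn (L := 0) t0_mem
  have hod : odn t0 (Z' p) = fun s => odn t0 (Z p) s +
      (Pi.single (parO k) (g p) : Par 0 m n → Gr (Par 0 m n)) s := by
    ext s
    obtain ⟨c, rfl⟩ := eq_parO s
    change Z' p c.1.1 c.1.2 = Z p c.1.1 c.1.2 + _
    rw [hZ']
    by_cases hc : c = k
    · subst hc
      rw [if_pos rfl, Pi.single_eq_same]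
    · rw [if_neg fun h => hc (Subtype.ext h), Pi.single_eq_of_ne]
      exact fun h => hc (Sum.inr.inj (toLex.injective h))
  have h1 : subS Z' f p = subS Z f p + g p * subS Z (fun q => dLeft (parO k) (f q)) p := by
    rw [subS, hev, hod]; exact gsub_add_single_odd hfp hA.evn hb hgp _
  have hder : ∀ c : OddIdx m n, dLeft (parO c) (subS Z f p) =
      ∑ e, dLeft (parO c) (evn (Z p) e) * subS Z (pd e f) p +
      ∑ s, dLeft (parO c) (odn t0 (Z p) s) * subS Z (fun q => dLeft s (f q)) p := fun c => by
    refine derivation_gsub (EvenDer.dLeft _) (-1) (fun a ha b => ?_) hfp hA.evn hb fun s t => ?_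
    · rw [dLeft_mul_odd _ ha, neg_one_smul, sub_eq_add_neg]
    · have : dLeft (parO c) (odn t0 (Z p) t) ∈ pty _ 0 := by
        have := dLeft_mem_pty (parO c) (hb t)
        rwa [show (1 + 1 : ZMod 2) = 0 from rfl] at this
      rw [neg_one_smul, (even_commute this _).eq]
  have h2 : ∑ c, w c • dLeft (parO (d c)) (subS Z f p) = subS Z (fun q => dLeft (parO k) (f q)) p := by
    simp_rw [hder, smul_add, smul_sum, ← smul_mul_assoc]
    rw [sum_add_distrib, sum_comm, sum_comm (γ := I)]
    simp_rw [← sum_mul]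
    rw [sum_eq_zero, zero_add, sum_eq_single (parO k)]
    · have := hw p hp k.1.1 k.1.2
      rw [if_pos rfl] at this
      change (∑ c, w c • dLeft (parO (d c)) (Z p k.1.1 k.1.2)) * _ = _
      rw [this, one_mul]
    · intro s _ hs
      obtain ⟨c, rfl⟩ := eq_parO s
      change (∑ e, w e • dLeft (parO (d e)) (Z p c.1.1 c.1.2)) * _ = _
      rw [hw p hp, if_neg fun h => hs (congrArg parO (Subtype.ext h)), zero_mul]
    · simp
    · intro e _
      change (∑ c, w c • dLeft (parO (d c)) (Z p e.1.1 e.1.2)) * _ = _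
      rw [hw p hp, if_neg fun h => k.2 (by rw [← h]; exact e.2), zero_mul]
  have h3 : ∑ c, w c • dLeft (parO (d c)) (g p * subS Z f p) =
      -(g p * subS Z (fun q => dLeft (parO k) (f q)) p) := by
    simp_rw [dLeft_mul_odd _ hgp, smul_sub]
    rw [sum_sub_distrib]
    simp_rw [← smul_mul_assoc]
    rw [← sum_mul, hgw p hp, zero_mul, zero_sub, ← h2, mul_sum]
    simp_rw [smul_mul_assoc, mul_smul_comm]
  have h4 := congrArg (top m n ∅) h3
  simp only [map_sum, map_smul, map_neg, top_dLeft, smul_zero, Finset.sum_const_zero] at h4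
  dsimp only
  rw [h1, map_add, neg_eq_zero.1 h4.symm, add_zero]

lemma FibSubst.add_even (hZ : FibSubst x x' Z) (k : EvenIdx m n) (hk : k.1.2.Nonempty)
  {g : Pt m n → Gr (Par 0 m n)}
  (hg : ∀ j, Cl (ov n {x}) (PG (ov n {x})) j g)
  (hg0 : ∀ p ∈ ov n {x}, ∀ᶠ q in 𝓝 p, g q ∈ pty _ (k.1.2.card : ZMod 2))
  (hZ' : ∀ p i K, Z' p i K = Z p i K + if (i, K) = k.1 then g p else 0)
  {w : Pt m n} (hw : Moves x Z k w)
  (hgw : ∀ p ∈ ov n {x}, fderiv ℝ g p w = 0) :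
  FibSubst x x' Z' ∧ ∀ f : SFun 0 m n, (∀ j, Cl (ov n {x'}) (DE (ov n {x'})) j f) →
      fint ∅ (subS Z' f) x = fint ∅ (subS Z f) x := by
  have hν : ∀ j, Cl (ov n {x}) (PG (ov n {x})) j fun p => nilp (g p) := fun j =>
    (hg j).linear (LinearMap.id - (Algebra.linearMap ℝ (Gr (Par 0 m n))).comp
      (body (ι := Par 0 m n)).toLinearMap)
  have hβ : ∀ j, Cl (ov n {x}) (PG (ov n {x})) j fun p => body (g p) := fun j =>
    (hg j).linear (body (ι := Par 0 m n)).toLinearMap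
  have hgs : ∀ p ∈ ov n {x}, ∀ s : ℝ, g (p + s • w) = g p := fun p hp s => by
    have := add_smul_of_fderiv (h := g) (fun t => (hg 0).smAt (add_smul_mem_ov hp hw.1 t))
      (fun t => hgw _ (add_smul_mem_ov hp hw.1 t)) s
    rwa [smul_zero, add_zero] at this
  have hgp : ∀ p ∈ ov n {x}, g p ∈ pty _ 0 := fun p hp => by
    rw [← even_cast k.2]; exact (hg0 p hp).self_of_nhds
  have hev : ∀ p ∈ ov n {x}, evn (Z' p) = fun c => evn (Z (p + body (g p) • w)) c +
      (Pi.single k (nilp (g p)) : EvenIdx m n → Gr (Par 0 m n)) c := fun p hp => by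
    ext c
    rw [hw.evn_apply hZ hp, evn, hZ']
    by_cases hc : c = k
    · subst hc; simp only [if_pos, Pi.single_eq_same, nilp]; rw [add_assoc]; abel_nf
    · dsimp only
      rw [if_neg fun h => hc (Subtype.ext h), Pi.single_eq_of_ne hc, Pi.single_eq_of_ne hc,
        add_zero, add_zero]
  have hod : ∀ p ∈ ov n {x}, odn t0 (Z' p) = odn t0 (Z (p + body (g p) • w)) := fun p hp => by
    rw [hw.odn_apply hZ hp]
    ext s
    obtain ⟨c, rfl⟩ := eq_parO s
    change Z' p c.1.1 c.1.2 = Z p c.1.1 c.1.2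
    rw [hZ', if_neg fun h => c.2 (by rw [show c.1 = k.1 from h]; exact k.2), add_zero]
  refine ⟨hZ.add_coord hk hg hg0 hZ' ?_, fun f hf => ?_⟩
  · obtain ⟨C, r, hC⟩ := hZ.growth
    obtain ⟨N, D, hD, hN⟩ := (hβ 0).2
    have hC0 : ∀ t : ℝ, 0 ≤ ‖t‖ := norm_nonneg
    refine ⟨(1 + D * ‖w‖) * |C| ^ (N + 1), r * (N + 1), fun p hp => ?_⟩
    have hq := add_smul_mem_ov hp hw.1 (body (g p))
    have hb : bod (evn (Z' p)) = bod (evn (Z (p + body (g p) • w))) := by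
      ext c
      rw [bod, hev p hp, map_add]
      by_cases hc : c = k
      · subst hc; simp [nilp]
      · simp [Pi.single_eq_of_ne hc]
    have h1 := hC _ hq
    have h2 := hN _ hq
    simp only [hgs p hp] at h2
    rw [hb]
    set q := p + body (g p) • w
    have h3 : ‖p‖ ≤ ‖q‖ + D * (1 + ‖q‖) ^ N * ‖w‖ := by
      have : p = q - body (g p) • w := by simp [q]
      calc ‖p‖ = ‖q - body (g p) • w‖ := by rw [← this]
        _ ≤ ‖q‖ + ‖body (g p) • w‖ := norm_sub_le _ _
        _ ≤ _ := by rw [norm_smul]; gcongr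
    have h4 := one_le_one_add_norm q
    have h5 : 1 + ‖q‖ ≤ |C| * (1 + ‖bod (evn (Z q))‖) ^ r :=
      h1.trans (mul_le_mul_of_nonneg_right (le_abs_self C) (by positivity))
    calc 1 + ‖p‖ ≤ (1 + ‖q‖) + D * (1 + ‖q‖) ^ N * ‖w‖ := by linarith
      _ ≤ (1 + ‖q‖) ^ (N + 1) + D * (1 + ‖q‖) ^ (N + 1) * ‖w‖ := by
          gcongr
          · exact le_self_pow₀ h4 (by omega)
          · omega
      _ = (1 + D * ‖w‖) * (1 + ‖q‖) ^ (N + 1) := by ring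
      _ ≤ (1 + D * ‖w‖) * (|C| * (1 + ‖bod (evn (Z q))‖) ^ r) ^ (N + 1) := by gcongr
      _ = _ := by rw [mul_pow, pow_mul]; ring
  set N := Fintype.card (Par 0 m n) + 1
  let H : SFun 0 m n := fun p => ∑ j ∈ Finset.range (N + 1),
    ((j.factorial : ℝ)⁻¹) • (nilp (g p) ^ j * subS Z ((pd k)^[j] f) p)
  have hH : ∀ p ∈ ov n {x}, subS Z' f p = H (p + body (g p) • w) := fun p hp => by
    have hq := add_smul_mem_ov hp hw.1 (body (g p))
    simp only [H, hgs p hp]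
    rw [subS, hev p hp, hod p hp]
    exact gsub_add_single_even _ ((hf 0).smAt (bod_mem hZ hq))
      (hZ.adm _ hq).self_of_nhds.evn (nilp_mem_pty (hgp p hp)) (mem_fil_one.1 (nilp_mem_fil _))
      (nilp_pow_eq_zero _) k
  let w' : FibIdx m n → ℝ := fun c => w ⟨c.1, c.2.1⟩
  have hasm : ∀ (y : FibIdx m n → ℝ) (s : ℝ), assemble x (y + s • w') = assemble x y + s • w := by
    intro y s
    ext ⟨⟨i, K⟩, hK⟩
    rcases K.eq_empty_or_nonempty with rfl | hne
    · have := congrFun hw.1 i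
      simp only [baseOf, Pi.zero_apply] at this
      simp [assemble, this]
    · simp [assemble, hne.ne_empty, w']
  have hm : ∀ y : FibIdx m n → ℝ, assemble x y ∈ ov n {x} := assemble_mem (mem_singleton x)
  have hterm : ∀ j, Cl (ov n {x}) (DE (ov n {x})) 0 fun p =>
      top m n ∅ (nilp (g p) ^ j * subS Z ((pd k)^[j] f) p) := fun j =>
    Cl.top (Cl.mul (Cl.pow hν j 0) (hZ.cl (Cl.iterate_pd hf k j) 0)) ∅
  have h0 : ∀ j, ∫ y : FibIdx m n → ℝ, top m n ∅ (nilp (g (assemble x y)) ^ (j + 1) *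
      subS Z ((pd k)^[j + 1] f) (assemble x y)) = 0 := fun j => by
    have hν' := Cl.pow hν (j + 1) 1
    have hS := hZ.cl (Cl.iterate_pd hf k j) 1
    refine (integral_congr_ae (Eventually.of_forall fun y => ?_)).trans
      (integral_fderiv_fib (Cl.top (Cl.mul hν' hS) ∅) hw.1)
    have hν0 : fderiv ℝ (fun q => nilp (g q)) (assemble x y) w = 0 := by
      have := fderiv_linear_comp (LinearMap.id - (Algebra.linearMap ℝ (Gr (Par 0 m n))).comp
        (body (ι := Par 0 m n)).toLinearMap) ((hg 0).smAt (hm y)).differentiableAt w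
      rw [hgw _ (hm y), map_zero] at this
      exact this
    rw [fderiv_linear_comp (top m n ∅) (((hν'.smAt (hm y)).mul (hS.smAt (hm y))).differentiableAt),
      fderiv_mul_apply (hν'.smAt (hm y)).differentiableAt (hS.smAt (hm y)).differentiableAt,
      fderiv_pow_eq_zero ((hν 0).smAt (hm y)).differentiableAt hν0, zero_mul, zero_add,
      hw.fderiv_subS hZ (hm y) (fun q hq => (Cl.iterate_pd hf k j 0).smAt hq),
      Function.iterate_succ_apply']
  rw [fint, fint]
  simp_rw [fun y => hH _ (hm y), ← hasm]
  rw [integral_shear (F := fun y => top m n ∅ (H (assemble x y)))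
    (β := fun y => body (g (assemble x y)))
    (fun y => ((hβ 0).smAt (hm y)).differentiableAt.comp y
      (hasFDerivAt_assemble_fib x y).differentiableAt)
    (fun y s => by simp only [hasm]; rw [hgs _ (hm y)])]
  simp only [H, map_sum, map_smul]
  rw [integral_finsetSum _ fun j _ => show Integrable (fun y => ((j.factorial : ℝ)⁻¹) • top m n ∅
    (nilp (g (assemble x y)) ^ j * subS Z ((pd k)^[j] f) (assemble x y))) from
      (Cl.integrable (hterm j)).smul ((j.factorial : ℝ)⁻¹)]
  simp_rw [integral_smul]
  rw [sum_range_succ', sum_eq_zero fun j _ => by rw [h0, smul_zero]]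
  simp

end

section

variable {x : Bs m} {ψ : Bs m → Bs m}

/-- The Jacobian matrix of `ψ`. -/
def jacM (ψ : Bs m → Bs m) (x : Bs m) : Matrix (Fin m) (Fin m) ℝ :=
  Matrix.of fun i j => pd j (fun y => ψ y i) x

lemma Cl.pcoord (hψ : ∀ i, SmAt (fun y => ψ y i) x) (k : ℕ) (i : Fin m) (K : Ix n) :
  Cl (ov n {x}) (PG (ov n {x})) k fun p => pcoord 0 ψ p i K := by
  have hb : ∀ p ∈ ov n {x}, bod (gcurve (Worm.coordFun (n := n) (L := 0) p)) = x :=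
    fun p hp => by rw [bod_gcurve_coordFun]; exact hp
  have hS : Subst (ov n {x}) (PG (ov n {x})) {x} (fun _ => True)
      (fun p => gcurve (Worm.coordFun (n := n) (L := 0) p)) := by
    refine ⟨fun k i => Cl.sum fun I _ => Cl.linear
      (sgnRev I • (LinearMap.mulLeft ℝ (tm _ I)).comp (inr n _).toLinearMap)
      (Cl.coordFun k i I), hb, fun u _ => ?_⟩
    exact (wt_PG _).mono (PG.const _ (u x)) fun p hp => by rw [hb p hp]
  have hw : Wt {x} (fun _ : ((Bs m → ℝ)) => True) :=
    ⟨fun _ _ => trivial, trivial, fun _ _ => trivial, fun _ _ _ => trivial⟩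
  have h1 := Cl.linear (sgnRev K • thetaL (n := n) (g := Par 0 m n) K) (Cl.taylor
    hS (cl_of_iteratedFDeriv (Ω := {x}) (Q := fun _ => True) (f := fun y => ψ y i)
      (fun p hp => by rw [hp]; exact hψ i)
      fun _ => trivial) k)
  exact h1.congr fun p _ => Eventually.of_forall fun q => by
    dsimp only
    rw [LinearMap.smul_apply, thetaL_apply]; rfl

/-- The pullback along `ψ` on the coordinates in `A` and along `x`, and its linearization on the
other fibre coordinates. -/
def mixed (ψ : Bs m → Bs m) (x : Bs m) (A : Finset (Fin m × Ix n))
  (p : Pt m n) (i : Fin m) (K : Ix n) : Gr (Par 0 m n) :=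
  if K = ∅ ∨ (i, K) ∈ A then Worm.pcoord 0 ψ p i K else ∑ j, jacM ψ x i j • coordFun p j K

variable {A : Finset (Fin m × Ix n)}

lemma Cl.linCoord (r : Bs m) (k : ℕ) (K : Ix n) :
  Cl (ov n {x}) (PG (ov n {x})) k
      fun p : Pt m n => ∑ j, r j • Worm.coordFun (L := 0) p j K :=
  Cl.sum fun j _ => (Cl.const k (r j)).smul (Cl.coordFun k j K)

lemma pd_linCoord (r : Bs m) (c : EvenIdx m n) (K : Ix n) (p : Pt m n) :
  pd c (fun p : Pt m n => ∑ j, r j • coordFun (L := 0) p j K) p =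
      algebraMap ℝ _ (if K = c.1.2 then r c.1.1 else 0) := by
  rw [pd, fderiv_sum_apply fun j _ =>
    ((SmAt.const (r j) p).smul (smAt_coordFun j K p)).differentiableAt]
  have : ∀ j, fderiv ℝ (fun p : Pt m n => r j • coordFun (L := 0) p j K) p
      (Pi.single c 1) = r j • if c.1 = (j, K) then 1 else 0 := fun j => by
    rw [← pd_coordFun]; exact (pd_const_smul (r j) (smAt_coordFun j K p) c).self_of_nhds
  simp_rw [this]
  rw [sum_eq_single c.1.1]
  · by_cases h : K = c.1.2
    · subst h; simp [Algebra.algebraMap_eq_smul_one]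
    · rw [if_neg fun e => h (congrArg Prod.snd e).symm, if_neg h]; simp
  · intro j _ hj
    rw [if_neg fun e => hj (congrArg Prod.fst e).symm, smul_zero]
  · simp

lemma dLeft_linCoord (r : Bs m) (c : OddIdx m n) (K : Ix n)
  (p : Pt m n) : dLeft (parO c) (∑ j, r j • coordFun (L := 0) p j K) =
      algebraMap ℝ _ (if K = c.1.2 then r c.1.1 else 0) := by
  simp_rw [map_sum, map_smul, dLeft_coordFun]
  rw [sum_eq_single c.1.1]
  · by_cases h : K = c.1.2
    · subst h; simp [Algebra.algebraMap_eq_smul_one]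
    · rw [if_neg fun e => h (congrArg Prod.snd e).symm, if_neg h]; simp
  · intro j _ hj
    rw [if_neg fun e => hj (congrArg Prod.fst e).symm, smul_zero]
  · simp

lemma pd_mixed (hψ : ∀ i, SmAt (fun y => ψ y i) x) (c : EvenIdx m n)
  (hA : ∀ a ∈ A, a.2.card ≤ c.1.2.card) {p : Pt m n} (hp : p ∈ ov n {x}) (i : Fin m)
  (K : Ix n) : pd c (fun q => mixed ψ x A q i K) p =
      algebraMap ℝ _ (if K = c.1.2 then jacM ψ x i c.1.1 else 0) := by
  rw [mem_ov_singleton] at hp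
  unfold mixed
  by_cases h : K = ∅ ∨ (i, K) ∈ A
  · have := pd_pcoord (L := 0) (p := p) (by rwa [hp]) c i (K := K)
      (h.elim (fun h => by simp [h]) fun h => hA _ h)
    simp_rw [if_pos h]
    rw [this, hp]; rfl
  · simp_rw [if_neg h]
    exact pd_linCoord _ c K p

lemma dLeft_mixed (hψ : ∀ i, SmAt (fun y => ψ y i) x) (c : OddIdx m n)
  (hA : ∀ a ∈ A, a.2.card ≤ c.1.2.card) {p : Pt m n} (hp : p ∈ ov n {x}) (i : Fin m)
  (K : Ix n) : dLeft (parO c) (mixed ψ x A p i K) =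
      algebraMap ℝ _ (if K = c.1.2 then jacM ψ x i c.1.1 else 0) := by
  rw [mem_ov_singleton] at hp
  unfold mixed
  by_cases h : K = ∅ ∨ (i, K) ∈ A
  · have := dLeft_pcoord (L := 0) (p := p) (by rwa [hp]) c i (K := K)
      (h.elim (fun h => by simp [h]) fun h => hA _ h)
    rw [if_pos h, this, hp]; rfl
  · rw [if_neg h, dLeft_linCoord]

lemma evn_mixed_empty (hψ : ∀ i, SmAt (fun y => ψ y i) x) {p : Pt m n}
  (hp : p ∈ ov n {x}) (c : EvenIdx m n) : evn (mixed ψ x ∅ p) c = algebraMap ℝ _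
      (if c.1.2 = ∅ then ψ x c.1.1 else ∑ j, jacM ψ x c.1.1 j * p ⟨(j, c.1.2), c.2⟩) := by
  obtain ⟨⟨i, K⟩, hK⟩ := c
  rw [mem_ov_singleton] at hp
  by_cases h : K = ∅
  · subst h
    simp only [evn, mixed, true_or, if_true]
    rw [pcoord_empty (by rwa [hp]), hp]
  · simp only [evn, mixed, h, Finset.notMem_empty, or_self, if_false, coordFun, hK, dif_pos,
      map_sum, map_mul, Algebra.smul_def]

lemma fibSubst_mixed_empty (hψ : ∀ i, SmAt (fun y => ψ y i) x) (hB : (jacM ψ x).det ≠ 0) :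
  FibSubst x (ψ x) (mixed (n := n) ψ x ∅) where
  tame k i K := by
    unfold mixed
    split_ifs
    · exact Cl.pcoord hψ k i K
    · exact Cl.linCoord _ k K
  adm p hp := by
    have h1 : ∀ᶠ q : Pt m n in 𝓝 p, ∀ i, SmAt (fun y => ψ y i) (baseOf q) := by
      refine continuous_baseOf.continuousAt.eventually (eventually_all.2 fun i => ?_)
      rw [mem_ov_singleton.1 hp]
      exact (hψ i).eventually
    filter_upwards [h1] with q hq i K
    unfold mixed
    split_ifs
    · exact adm_pcoord hq i K
    · exact Submodule.sum_mem _ fun j _ => Submodule.smul_mem _ _ (adm_coordFun q j K)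
  base p hp := by
    ext i
    rw [baseOf, bod, evn_mixed_empty hψ hp]
    simp [body]
  growth := by
    refine ⟨1 + ‖x‖ + ∑ i, ∑ j, |(jacM ψ x)⁻¹ i j|, 1, fun p hp => ?_⟩
    set b := bod (evn (mixed ψ x ∅ p))
    have h0 : 0 ≤ ∑ i, ∑ j, |(jacM ψ x)⁻¹ i j| := by positivity
    have h1 : ‖p‖ ≤ ‖x‖ + (∑ i, ∑ j, |(jacM ψ x)⁻¹ i j|) * ‖b‖ := by
      refine (pi_norm_le_iff_of_nonneg (by positivity)).2 fun c => ?_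
      obtain ⟨⟨i, K⟩, hK⟩ := c
      by_cases h : K = ∅
      · subst h
        rw [show p ⟨(i, ∅), hK⟩ = x i from congrFun hp i]
        exact (norm_le_pi_norm x i).trans (le_add_of_nonneg_right (by positivity))
      · have hb : ∀ l, b ⟨(l, K), hK⟩ = ∑ j, jacM ψ x l j * p ⟨(j, K), hK⟩ := fun l => by
          simp only [b, bod]
          rw [evn_mixed_empty hψ hp, if_neg h]; simp [body]
        have h2 : p ⟨(i, K), hK⟩ = ∑ l, (jacM ψ x)⁻¹ i l * b ⟨(l, K), hK⟩ := by
          have := congrFun (congrArg (fun N => N.mulVec fun j => p ⟨(j, K), hK⟩)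
            (Matrix.nonsing_inv_mul (jacM ψ x) (isUnit_iff_ne_zero.2 hB))) i
          simp only [← Matrix.mulVec_mulVec, Matrix.one_mulVec] at this
          rw [← this]
          simp only [Matrix.mulVec, dotProduct, hb]
        rw [h2]
        calc ‖∑ l, (jacM ψ x)⁻¹ i l * b ⟨(l, K), hK⟩‖
            ≤ ∑ l, |(jacM ψ x)⁻¹ i l| * ‖b‖ := (norm_sum_le _ _).trans
              (sum_le_sum fun l _ => by
                rw [norm_mul, Real.norm_eq_abs]; gcongr; exact norm_le_pi_norm b _)
          _ = (∑ l, |(jacM ψ x)⁻¹ i l|) * ‖b‖ := by rw [sum_mul]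
          _ ≤ (∑ i, ∑ l, |(jacM ψ x)⁻¹ i l|) * ‖b‖ := by
              refine mul_le_mul_of_nonneg_right ?_ (norm_nonneg _)
              exact Finset.single_le_sum (f := fun i => ∑ l, |(jacM ψ x)⁻¹ i l|)
                (fun i _ => by positivity) (Finset.mem_univ i)
          _ ≤ _ := le_add_of_nonneg_left (norm_nonneg x)
    have h2 := norm_nonneg b
    have h3 := norm_nonneg x
    rw [pow_one]
    nlinarith [mul_nonneg h3 h2]

lemma sum_kron {X I β V : Type} [Fintype X] [Fintype I] [Fintype β] [DecidableEq β]
  [AddCommMonoid V] [Module ℝ V] (e : X ≃ I × β) (R : I → ℝ) (b : β) (y : X → V) :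
  ∑ c, (R (e c).1 * (1 : Matrix β β ℝ) b (e c).2) • y c = ∑ j, R j • y (e.symm (j, b)) := by
  rw [← e.symm.sum_comp, Fintype.sum_prod_type]
  refine sum_congr rfl fun j _ => ?_
  rw [sum_eq_single b]
  · rw [e.apply_symm_apply, Matrix.one_apply_eq, mul_one]
  · intro b' _ hb; rw [e.apply_symm_apply, Matrix.one_apply_ne hb.symm, mul_zero, zero_smul]
  · simp

lemma fint_mixed_empty (hn : 2 ≤ n) (hψ : ∀ i, SmAt (fun y => ψ y i) x)
  (hB : (jacM ψ x).det ≠ 0) {f : SFun 0 m n} (hf : ∀ q ∈ ov n {ψ x}, SmAt f q) :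
  fint ∅ (subS (mixed ψ x ∅) f) x = |(jacM ψ x).det| * fint ∅ f (ψ x) := by
  let eF : FibIdx m n ≃ Fin m × {K : Ix n // Even K.card ∧ K.Nonempty} :=
    pairEquiv m fun K : Ix n => Even K.card ∧ K.Nonempty
  let eO : OddIdx m n ≃ Fin m × {K : Ix n // ¬ Even K.card} :=
    pairEquiv m fun K : Ix n => ¬ Even K.card
  let Re : Matrix (FibIdx m n) (FibIdx m n) ℝ := Matrix.of fun c c' =>
    jacM ψ x (eF c).1 (eF c').1 * (1 : Matrix _ _ ℝ) (eF c).2 (eF c').2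
  let Ro : Matrix (OddIdx m n) (OddIdx m n) ℝ := Matrix.of fun c c' =>
    jacM ψ x (eO c).1 (eO c').1 * (1 : Matrix _ _ ℝ) (eO c).2 (eO c').2
  have hRe : Re.det = _ := det_pairs eF (jacM ψ x) 1
  have hRo : Ro.det = _ := det_pairs eO (jacM ψ x) 1
  rw [Matrix.det_one, one_pow, mul_one] at hRe hRo
  let b : Par 0 m n → Gr (Par 0 m n) :=
    odn t0 fun i K => ∑ j, jacM ψ x i j • coordFun (0 : Pt m n) j K
  have hb : Odds b := Adm.odn (fun i K => Submodule.sum_mem _ fun j _ =>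
    Submodule.smul_mem _ _ (adm_coordFun _ j K)) t0_mem
  have hcO : ∀ (p : Pt m n) (c : OddIdx m n), coordFun (L := 0) p c.1.1 c.1.2 =
      gen (parO c) := fun p c => by rw [coordFun, dif_neg c.2]; rfl
  rw [fint_linear (x' := ψ x) (f := f) Re (by rw [hRe]; exact pow_ne_zero _ hB) Ro b hb, hRe, hRo]
  · obtain ⟨h1, h2⟩ := card_odd_even hn
    rw [abs_pow]
    have h3 := abs_ne_zero.2 hB
    rw [← h2.pow_abs, h1, pow_succ]
    field_simp
  · intro c
    change ∑ j, _ • coordFun (L := 0) 0 j c.1.2 = _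
    have := sum_kron eO (jacM ψ x c.1.1) ⟨c.1.2, c.2⟩ fun c => (gen (parO c) : Gr (Par 0 m n))
    simp_rw [← hcO 0] at this ⊢
    exact this.symm
  · intro y
    have hp : assemble x y ∈ ov n {x} := assemble_mem (mem_singleton x) y
    have hev : evn (mixed ψ x ∅ (assemble x y)) =
        fun c => algebraMap ℝ _ (assemble (ψ x) (Re.mulVec y) c) := by
      ext c
      rw [evn_mixed_empty hψ hp]
      obtain ⟨⟨i, K⟩, hK⟩ := c
      congr 1
      by_cases h : K = ∅
      · simp [assemble, h]
      · have := sum_kron eF (jacM ψ x i) ⟨K, hK, Finset.nonempty_iff_ne_empty.2 h⟩ y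
        simp only [assemble, h, if_false, dif_neg, not_false_eq_true]
        exact this.symm
    have hod : odn t0 (mixed ψ x ∅ (assemble x y)) = b := by
      ext s
      obtain ⟨c, rfl⟩ := eq_parO s
      have hne : c.1.2 ≠ ∅ := fun h => c.2 (by simp [h])
      change mixed ψ x ∅ _ c.1.1 c.1.2 = ∑ j, _ • coordFun (L := 0) 0 j c.1.2
      rw [mixed, if_neg (by simp [hne])]
      simp [coordFun, c.2]
    rw [subS, hev, hod]
    exact gsub_scalar (hf _ (assemble_mem (mem_singleton _) _)) hb

lemma mixed_law (hn : 2 ≤ n) (hψ : ∀ i, SmAt (fun y => ψ y i) x) (hB : (jacM ψ x).det ≠ 0)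
  (A : Finset (Fin m × Ix n)) : FibSubst x (ψ x) (mixed (n := n) ψ x A) ∧
      ∀ f : SFun 0 m n, (∀ j, Cl (ov n {ψ x}) (DE (ov n {ψ x})) j f) →
        fint ∅ (subS (mixed ψ x A) f) x = |(jacM ψ x).det| * fint ∅ f (ψ x) := by
  refine Finset.induction_on_max_value (fun c : Fin m × Ix n => c.2.card) A ?_ ?_
  · exact ⟨fibSubst_mixed_empty hψ hB, fun f hf => fint_mixed_empty hn hψ hB fun q hq =>
      (hf 0).smAt hq⟩
  · intro k A hkA hmax ih
    by_cases hk : k.2 = ∅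
    · have : mixed (n := n) ψ x (insert k A) = mixed ψ x A := by
        ext p i K
        unfold mixed
        refine if_congr ?_ rfl rfl
        rw [Finset.mem_insert]
        constructor
        · rintro (h | h | h)
          · exact Or.inl h
          · exact Or.inl (by rw [← hk, ← h])
          · exact Or.inr h
        · rintro (h | h)
          · exact Or.inl h
          · exact Or.inr (Or.inr h)
      rw [this]; exact ih
    have hne : k.2.Nonempty := Finset.nonempty_iff_ne_empty.2 hk
    let l : SFun 0 m n := fun p => ∑ j, jacM ψ x k.1 j • coordFun p j k.2
    let g : SFun 0 m n := fun p => pcoord 0 ψ p k.1 k.2 + (-1 : ℝ) • l p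
    have hg : ∀ j, Cl (ov n {x}) (PG (ov n {x})) j g := fun j =>
      (Cl.pcoord hψ j _ _).add
        ((Cl.const j (-1 : ℝ)).smul (Cl.linCoord _ j _))
    have hZ' : ∀ p i K, mixed ψ x (insert k A) p i K =
        mixed ψ x A p i K + if (i, K) = k then g p else 0 := fun p i K => by
      by_cases h : (i, K) = k
      · subst h
        simp only [mixed, hk, hkA, Finset.mem_insert, true_or, or_true, or_self, if_true, if_false,
          g, l]
        module
      · simp only [mixed, Finset.mem_insert, h, false_or, if_false, add_zero]
    have hg0 : ∀ p ∈ ov n {x}, ∀ᶠ q in 𝓝 p, g q ∈ pty _ (k.2.card : ZMod 2) := fun p hp => by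
      have h1 : ∀ᶠ q : Pt m n in 𝓝 p, ∀ i, SmAt (fun y => ψ y i) (baseOf q) := by
        refine continuous_baseOf.continuousAt.eventually (eventually_all.2 fun i => ?_)
        rw [mem_ov_singleton.1 hp]
        exact (hψ i).eventually
      filter_upwards [h1] with q hq
      exact add_mem (adm_pcoord hq _ _) (Submodule.smul_mem _ _ (Submodule.sum_mem _ fun j _ =>
        Submodule.smul_mem _ _ (adm_coordFun q j _)))
    let v : Fin m → ℝ := fun j => (jacM ψ x)⁻¹ j k.1
    have hv : ∀ i, ∑ j, v j * jacM ψ x i j = if i = k.1 then 1 else 0 := fun i => by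
      have := congrFun (congrFun (Matrix.mul_nonsing_inv (jacM ψ x) (isUnit_iff_ne_zero.2 hB)) i)
        k.1
      rw [Matrix.mul_apply, Matrix.one_apply] at this
      rw [← this]; exact sum_congr rfl fun j _ => mul_comm _ _
    have hval : ∀ i (K : Ix n), ∑ j, v j • algebraMap ℝ (Gr (Par 0 m n))
        (if K = k.2 then jacM ψ x i j else 0) = if (i, K) = k then 1 else 0 := fun i K => by
      simp_rw [Algebra.smul_def, ← map_mul]
      rw [← map_sum]
      by_cases h : K = k.2
      · simp_rw [if_pos h, hv]
        by_cases hi : i = k.1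
        · rw [if_pos hi, if_pos (Prod.ext hi h), map_one]
        · rw [if_neg hi, if_neg fun e => hi (congrArg Prod.fst e), map_zero]
      · simp_rw [if_neg h, if_neg fun e : (i, K) = k => h (congrArg Prod.snd e)]
        simp
    by_cases hev : Even k.2.card
    · let d : Fin m → EvenIdx m n := fun j => ⟨(j, k.2), hev⟩
      let w : Pt m n := ∑ j, v j • Pi.single (d j) 1
      have hw0 : baseOf w = 0 := by
        ext i
        simp only [baseOf, w, Finset.sum_apply, Pi.smul_apply, Pi.zero_apply]
        refine sum_eq_zero fun j _ => ?_
        rw [Pi.single_eq_of_ne, smul_zero]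
        exact fun e => hk (congrArg (fun c : EvenIdx m n => c.1.2) e).symm
      have hfd : ∀ (h : SFun 0 m n) p, fderiv ℝ h p w = ∑ j, v j • pd (d j) h p := fun h p => by
        simp only [w, map_sum, map_smul]; rfl
      have hmov : Moves x (mixed ψ x A) ⟨k, hev⟩ w := ⟨hw0, fun p hp i K => by
        rw [hfd, ← hval i K]
        exact sum_congr rfl fun j _ => by rw [pd_mixed hψ (d j) hmax hp]⟩
      have hgw : ∀ p ∈ ov n {x}, fderiv ℝ g p w = 0 := fun p hp => by
        rw [hfd]
        refine sum_eq_zero fun j _ => ?_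
        have hs : ∀ i, SmAt (fun y => ψ y i) (baseOf p) := by rwa [mem_ov_singleton.1 hp]
        have hl : SmAt l p := (Cl.linCoord _ 0 _).smAt hp
        have h1 := (pd_add (smAt_pcoord (L := 0) hs k.1 k.2) ((SmAt.const (-1 : ℝ) p).smul hl)
          (d j)).self_of_nhds
        have h2 := (pd_const_smul (-1) hl (d j)).self_of_nhds
        have h3 := pd_pcoord (L := 0) hs (d j) k.1 (K := k.2) le_rfl
        have h4 := pd_linCoord (jacM ψ x k.1) (d j) k.2 p
        change pd (d j) g p = _ at h1
        change pd (d j) l p = _ at h4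
        rw [h1]
        beta_reduce
        rw [h2, h3]
        beta_reduce
        rw [h4, mem_ov_singleton.1 hp]
        change v j • (algebraMap ℝ _ (if _ then jacM ψ x k.1 j else 0) + _) = _
        simp [d]
      have := ih.1.add_even ⟨k, hev⟩ hne hg hg0 hZ' hmov hgw
      exact ⟨this.1, fun f hf => (this.2 f hf).trans (ih.2 f hf)⟩
    · let d : Fin m → OddIdx m n := fun j => ⟨(j, k.2), hev⟩
      have := ih.1.add_odd ⟨k, hev⟩ hg hg0 hZ' v d (fun p hp i K => by
        rw [← hval i K]
        exact sum_congr rfl fun j _ => by rw [dLeft_mixed hψ (d j) hmax hp])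
        (fun p hp => sum_eq_zero fun j _ => by
          rw [map_add, map_smul, dLeft_pcoord (by rwa [mem_ov_singleton.1 hp]) (d j) k.1 le_rfl,
            dLeft_linCoord, mem_ov_singleton.1 hp]
          change v j • (algebraMap ℝ _ (if _ then jacM ψ x k.1 j else 0) + _) = _
          simp [d])
      exact ⟨this.1, fun f hf => (this.2 f hf).trans (ih.2 f hf)⟩

/-- The transformation law of the fibre integral. -/
lemma fint_pullAlong (hn : 2 ≤ n) (hψ : ∀ i, SmAt (fun y => ψ y i) x)
  (hB : (jacM ψ x).det ≠ 0) {f : SFun 0 m n}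
  (hf : ∀ j, Cl (ov n {ψ x}) (DE (ov n {ψ x})) j f) :
  fint ∅ (pullAlong ψ f) x = |(jacM ψ x).det| * fint ∅ f (ψ x) := by
  have h : pullAlong ψ f = subS (mixed ψ x Finset.univ) f := by
    ext p
    have h1 : mixed ψ x Finset.univ p = pcoord 0 ψ p := by ext; simp [mixed]
    have h2 : (fun t : Fin 0 => (gen (parL t) : Gr (Par 0 m n))) = t0 := funext fun t => t.elim0
    rw [pullAlong_eq, subS, h1, h2]
  rw [h, (mixed_law hn hψ hB Finset.univ).2 f hf]

end

section

lemma kl_inr (y : Gr (OddIdx m n)) : kl L m n (inr L _ y) = inr 0 _ y := by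
  refine LinearMap.congr_fun (linearMap_ext_mon (f := ((kl L m n).comp (inr L _)).toLinearMap)
    (g := (inr 0 (OddIdx m n)).toLinearMap) fun S => ?_) y
  have h : ∀ N : ℕ, (inr N (OddIdx m n)) (mon S) = ordProd S fun c => gen (inrE N _ c) := fun N => by
    rw [mon_eq_ordProd, map_ordProd]
    simp_rw [rename_gen (inrE N (OddIdx m n)).injective]
  change kl L m n (inr L _ (mon S)) = inr 0 _ (mon S)
  rw [h, h, map_ordProd]
  congr 1
  ext c
  exact lam_gen _ _ _

lemma top_kl (x : Gr (Par L m n)) : top m n ∅ (kl L m n x) = top m n ∅ x := by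
  refine LinearMap.congr_fun (linearMap_ext_mon (f := (top m n ∅).comp (kl L m n).toLinearMap)
    (g := top m n ∅) fun S => ?_) x
  obtain ⟨⟨T, U⟩, rfl⟩ := (jmEquiv L (OddIdx m n)).surjective S
  change coeff (jm ∅ Finset.univ) (kl L m n (mon (jm T U))) =
    coeff (jm ∅ Finset.univ) (mon (jm T U))
  have hc : ∀ (N : ℕ) (T : Finset (Fin N)) (U : Finset (OddIdx m n)), coeff (jm ∅ Finset.univ)
      (mon (jm T U)) = if T = ∅ ∧ U = Finset.univ then (1 : ℝ) else 0 := fun N T U => by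
    rw [coeff_mon]; exact if_congr (by rw [jm_inj]; tauto) rfl rfl
  rw [hc, mon_jm, map_mul, kl_inr]
  rcases T.eq_empty_or_nonempty with rfl | hT
  · have h : ∀ N : ℕ, tm (OddIdx m n) (∅ : Finset (Fin N)) = 1 := fun N => by
      rw [tm, mon_eq_ordProd, ordProd_empty, map_one]
    rw [h, map_one, ← h 0, ← mon_jm, hc]; simp
  · rw [kl_mT hT, zero_mul, map_zero, if_neg fun h => hT.ne_empty h.1]

variable (φ : OddDiffeo n L)

lemma cm_bd_eq_zero {K I : Ix n} (h : ¬ (Even I.card ↔ Even K.card)) :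
  cm φ.bd K I = 0 := by
  refine coeff_eq_zero_of_mem_pty (ordProd_mem_pty I fun a _ => bd_mem_pty φ a) fun e => h ?_
  rw [← ZMod.natCast_eq_zero_iff_even, ← ZMod.natCast_eq_zero_iff_even, e]

lemma bd_mem_fil (a : Fin n) : φ.bd a ∈ fil (Fin n) 1 := mem_fil_one_of_odd (bd_mem_pty φ a)

/-- The matrix of the body of the substitution on the coordinates indexed by `P`. -/
def zrM (P : Ix n → Prop) : Matrix {I // P I} {I // P I} ℝ :=
  Matrix.of fun K I => sgnRev K.1 * sgnRev I.1 * cm φ.bd K.1 I.1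

lemma det_zrM {P : Ix n → Prop} [DecidablePred P]
  (hP : ∀ I J, P I → I.card = J.card → P J) {N : ℕ}
  (hN : ∀ a : Fin n, (Finset.univ.filter fun I : {I // P I} => a ∈ I.1).card = N) :
  (zrM φ P).det = φ.jac.det ^ N := by
  rw [← det_cmP_lf hP hN, ← det_cmP_bd]
  have h : zrM φ P = Matrix.diagonal (fun K : {I // P I} => sgnRev K.1) * cmP P φ.bd *
      Matrix.diagonal fun K : {I // P I} => sgnRev K.1 := by
    ext K I
    rw [Matrix.mul_diagonal, Matrix.diagonal_mul, zrM, cmP, Matrix.of_apply, Matrix.of_apply]; ring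
  rw [h, Matrix.det_mul, Matrix.det_mul, Matrix.det_diagonal]
  have : (∏ K : {I // P I}, sgnRev K.1) * ∏ K : {I // P I}, sgnRev K.1 = 1 := by
    rw [← Finset.prod_mul_distrib]; exact Finset.prod_eq_one fun K _ => sgnRev_mul_self _
  linear_combination (cmP P φ.bd).det * this

lemma sum_subtype_of_zero {X V : Type} [Fintype X] [AddCommMonoid V] (P : X → Prop)
  [DecidablePred P] (F : X → V) (h : ∀ I, ¬ P I → F I = 0) : ∑ I, F I = ∑ I : {I // P I}, F I := by
  rw [← Finset.sum_filter_of_ne (p := P) fun I _ hI => by_contra fun hP => hI (h I hP)]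
  exact sum_subtype _ (by simp) _

lemma card_subtype_filter {P : Ix n → Prop} [DecidablePred P] (a : Fin n) :
  (Finset.univ.filter fun I : {I // P I} => a ∈ I.1).card =
      (Finset.univ.filter fun I : Ix n => a ∈ I ∧ P I).card := by
  refine Finset.card_bij (fun I _ => I.1) (fun I hI => ?_) (fun I _ J _ h => Subtype.ext h)
    fun I hI => ?_
  · simpa [I.2] using hI
  · simp only [mem_filter, Finset.mem_univ, true_and] at hI
    exact ⟨⟨I, hI.2⟩, by simpa using hI.1, rfl⟩

/-- The parameter-free part of the Berezin integral of a pullback along `φ`. -/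
lemma fint_rpar_empty (hn : 2 ≤ n) {x : Bs m} {f : SFun 0 m n}
  (hf : ∀ q ∈ ov n {x}, SmAt f q) : fint ∅ (rpar φ f) x =
      Real.sign φ.jac.det ^ (m * 2 ^ (n - 2)) * fint ∅ f x := by
  have hd : φ.jac.det ≠ 0 := φ.invertible.ne_zero
  let PF : Ix n → Prop := fun K => Even K.card ∧ K.Nonempty
  let PO : Ix n → Prop := fun K => ¬ Even K.card
  let eF : FibIdx m n ≃ {K // PF K} × Fin m := (pairEquiv m PF).trans (Equiv.prodComm _ _)
  let eO : OddIdx m n ≃ {K // PO K} × Fin m := (pairEquiv m PO).trans (Equiv.prodComm _ _)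
  let Re : Matrix (FibIdx m n) (FibIdx m n) ℝ := Matrix.of fun c c' =>
    zrM φ PF (eF c).1 (eF c').1 * (1 : Matrix _ _ ℝ) (eF c).2 (eF c').2
  let Ro : Matrix (OddIdx m n) (OddIdx m n) ℝ := Matrix.of fun c c' =>
    zrM φ PO (eO c).1 (eO c').1 * (1 : Matrix _ _ ℝ) (eO c).2 (eO c').2
  have hRe : Re.det = _ := det_pairs eF (zrM φ PF) 1
  have hRo : Ro.det = _ := det_pairs eO (zrM φ PO) 1
  rw [Matrix.det_one, one_pow, mul_one, Fintype.card_fin] at hRe hRo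
  rw [det_zrM φ (N := 2 ^ (n - 2)) (fun I J hI h => ⟨h ▸ hI.1, card_pos.1
    (h ▸ hI.2.card_pos)⟩) fun a => by
      rw [card_subtype_filter, ← card_filter_mem_even hn a true]
      congr 1; ext I
      simp only [mem_filter, Finset.mem_univ, true_and, iff_true, PF]
      exact ⟨fun h => ⟨h.1, h.2.1⟩, fun h => ⟨h.1, h.2, a, h.1⟩⟩] at hRe
  rw [det_zrM φ (N := 2 ^ (n - 2)) (fun I J hI h => by simp only [PO] at hI ⊢; rwa [← h]) fun a => by
      rw [card_subtype_filter, ← card_filter_mem_even hn a false]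
      congr 1; ext I; simp [PO]] at hRo
  have hcO : ∀ (p : Pt m n) (c : OddIdx m n), coordFun (L := 0) p c.1.1 c.1.2 =
      gen (parO c) := fun p c => by rw [coordFun, dif_neg c.2]; rfl
  let b : Par 0 m n → Gr (Par 0 m n) := odn t0 fun i K => kl L m n (zr φ 0 i K)
  have hz : ∀ p : Pt m n, Adm fun i K => kl L m n (zr φ p i K) := fun p i K =>
    map_mem_pty kl_mem (adm_zr φ p i K)
  have hb : Odds b := (hz 0).odn t0_mem
  have hkO : ∀ (p : Pt m n) (c : OddIdx m n), kl L m n (zr φ p c.1.1 c.1.2) =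
      ∑ c', Ro c c' • gen (parO c') := fun p c => by
    rw [kl_zr, sum_subtype_of_zero PO _ fun I hI => by
      rw [cm_bd_eq_zero φ (by have := c.2; simp only [PO] at hI; tauto), mul_zero, zero_smul]]
    have := sum_kron eO (zrM φ PO ⟨c.1.2, c.2⟩) c.1.1 fun c => (gen (parO c) : Gr (Par 0 m n))
    simp_rw [← hcO p] at this ⊢
    exact this.symm
  have key : fint ∅ (rpar φ f) x = fint ∅ (fun p => kl L m n (rpar φ f p)) x := by
    simp only [fint, top_kl]
  rw [key, fint_linear (x' := x) (f := f) Re (by rw [hRe]; exact pow_ne_zero _ (pow_ne_zero _ hd))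
    Ro b hb (hkO 0), hRe, hRo, ← pow_mul, mul_comm (2 ^ (n - 2)), abs_pow]
  · congr 1
    rw [← inv_pow, ← mul_pow]
    congr 1
    rcases lt_or_gt_of_ne hd with h | h
    · rw [Real.sign_of_neg h, abs_of_neg h]; field_simp
    · rw [Real.sign_of_pos h, abs_of_pos h]; field_simp
  · intro y
    have hq : bod (evn (zr φ (assemble x y))) ∈ ov n {x} := by
      rw [mem_ov_singleton, baseOf_bod_zr, baseOf_assemble]
    have hod : odn t0 (fun i K => kl L m n (zr φ (assemble x y) i K)) = b := by
      ext s
      obtain ⟨c, rfl⟩ := eq_parO s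
      exact (hkO _ c).trans (hkO _ c).symm
    have hev : evn (fun i K => kl L m n (zr φ (assemble x y) i K)) =
        fun c => algebraMap ℝ _ (assemble x (Re.mulVec y) c) := by
      ext c
      obtain ⟨⟨i, K⟩, hK⟩ := c
      rw [evn, kl_zr]
      by_cases h : K = ∅
      · subst h
        rw [sum_eq_single ∅]
        · simp [coordFun, assemble, sgnRev_empty, cm, ordProd_empty, ← body_eq_coeff]
        · intro I _ hI
          rw [cm_eq_zero (bd_mem_fil φ) (by
            rw [Finset.card_empty, card_pos]; exact Finset.nonempty_iff_ne_empty.2 hI),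
            mul_zero, zero_smul]
        · exact fun h => absurd (Finset.mem_univ _) h
      · have h1 : cm φ.bd K ∅ = 0 := by
          rw [cm, Matrix.of_apply, ordProd_empty, ← ordProd_empty (gen : Fin n → Gr (Fin n)),
            ← mon_eq_ordProd, coeff_mon, if_neg h]
        rw [sum_subtype_of_zero PF _ fun I hI => by
          rcases I.eq_empty_or_nonempty with rfl | hI'
          · rw [h1, mul_zero, zero_smul]
          · rw [cm_bd_eq_zero φ (by simp only [PF] at hI; tauto), mul_zero, zero_smul]]
        have := sum_kron eF (zrM φ PF ⟨K, hK, Finset.nonempty_iff_ne_empty.2 h⟩) i y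
        simp only [assemble, h, dif_neg, not_false_eq_true]
        rw [show Re.mulVec y ⟨(i, K), _⟩ = _ from this, map_sum]
        refine sum_congr rfl fun I _ => ?_
        rw [coordFun, dif_pos I.2.1, smul_eq_mul, map_mul, Algebra.smul_def,
          show assemble x y ⟨(i, I.1), I.2.1⟩ = y (eF.symm (I, i)) from dif_neg I.2.2.ne_empty]
        rfl
    rw [kl_rpar φ (hf _ hq), hev, hod]
    exact gsub_scalar (hf _ (assemble_mem (mem_singleton _) _)) hb

end

section

lemma Cl.base {K : Set (Bs m)} (hK : IsCompact K) {h : Bs m → ℝ}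
  (hh : ∀ x ∈ K, SmAt h x) (k : ℕ) :
  Cl (ov n K) (PG (ov n K)) k fun p => h (baseOf p) := by
  refine Cl.comp (Ω := ov n K) (Ω' := K) (Q' := PG K)
    (φ := fun d (p : Pt m n) => p ⟨(d, ∅), by simp⟩) (fun k d => Cl.coord _ k) (fun p hp => hp) ?_
    (cl_of_iteratedFDeriv hh (fun j => ?_) k)
  · rintro u ⟨N, C, hC, h⟩
    exact ⟨N, C, hC, fun p hp => (h _ hp).trans (by gcongr; exact norm_baseOf_le p)⟩
  · have hc : ContinuousOn (fun p => _root_.iteratedFDeriv ℝ j h p) K := fun x hx =>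
      (((hh x hx).contDiffAt.iteratedFDeriv_right (m := 0) (i := j)
        (by exact_mod_cast le_top)).continuousAt).continuousWithinAt
    obtain ⟨C, hC⟩ := hK.exists_bound_of_continuousOn hc
    exact ⟨0, |C|, abs_nonneg _, fun p hp => by simpa using (hC p hp).trans (le_abs_self C)⟩

variable [IsManifold 𝓘(ℝ, Fin m → ℝ) ∞ M] {χ : M → ℝ}

lemma smAt_chart (hχ : ContMDiff 𝓘(ℝ, Fin m → ℝ) 𝓘(ℝ, ℝ) ∞ χ) (e : Coord m M) {x : Bs m}
  (hx : x ∈ e.1.target) : SmAt (fun y => χ (e.1.symm y)) x := by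
  have h : ContDiffOn ℝ ∞ (fun y => χ (e.1.symm y)) e.1.target :=
    (hχ.comp_contMDiffOn (contMDiffOn_symm_of_mem_maximalAtlas e.2)).contDiffOn
  filter_upwards [e.1.open_target.mem_nhds hx] with y hy using
    h.contDiffAt (e.1.open_target.mem_nhds hy)

lemma smAt_baseOf {h : Bs m → ℝ} {p : Pt m n} (hh : SmAt h (baseOf p)) :
  SmAt (fun q => h (baseOf q)) p :=
  SmAt.comp (f := baseOf) hh (smAt_of_contDiff (contDiff_pi.2 fun _ => contDiff_apply ℝ ℝ _) p)

lemma IsWorm.mulFun (hχ : ContMDiff 𝓘(ℝ, Fin m → ℝ) 𝓘(ℝ, ℝ) ∞ χ) {α : Family m M L n}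
  (hα : IsWorm α) : IsWorm (mulFun χ α) where
  smooth := contDiffOn_of_smAt fun e p hp => (smAt_baseOf (smAt_chart hχ e hp)).smul (hα.smAt hp)
  compatible e e' p hp hp' := by
    have hψ : ∀ i, SmAt (fun x => e'.1 (e.1.symm x) i) (baseOf p) := fun i =>
      (smAt_transition e e' hp hp').apply i
    have hq : bod (evn (pcoord L (fun x => e'.1 (e.1.symm x)) p)) ∈ dom n e' := by
      change baseOf (bod (evn (pcoord L _ p))) ∈ e'.1.target
      rw [baseOf_bod_pcoord hψ]; exact e'.1.map_source hp'
    have hb := smAt_baseOf (smAt_chart hχ e' hq)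
    rw [Worm.mulFun, hα.compatible e e' p hp hp', pullAlong_eq, pullAlong_eq]
    refine Eq.trans ?_ (gsub_smul hb (hα.smAt hq) (adm_pcoord hψ).evn
      ((adm_pcoord hψ).odn tparL_mem)).symm
    have h1 := taylor_comp (adm_pcoord hψ).evn (g := fun i (q : Pt m n) => q ⟨(i, ∅), by simp⟩)
      (fun i => smAt_of_contDiff (contDiff_apply ℝ ℝ _) _) (smAt_chart hχ e' hq)
    simp only [taylor_coord (adm_pcoord hψ).evn, evn, pcoord_empty hψ] at h1
    have h2 := taylor_scalar (ι := Par L m n) (smAt_chart hχ e' (e'.1.map_source hp'))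
    rw [e'.1.left_inv hp'] at h2
    rw [Algebra.smul_def]
    exact congrArg (· * _) (h1.trans h2).symm

lemma RapidlyDecreasing.mulFun (hχ : ContMDiff 𝓘(ℝ, Fin m → ℝ) 𝓘(ℝ, ℝ) ∞ χ)
  {α : Family m M L n} (hα : IsWorm α) (h : RapidlyDecreasing α) :
  RapidlyDecreasing (mulFun χ α) :=
  rapidlyDecreasing_of_rd fun e K hK hKe k =>
    (Cl.base hK (fun _ hx => smAt_chart hχ e (hKe hx)) k).smul (h.rd hα e K hK hKe k)

/-- Extension by zero of the coordinate expression. -/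
def ext0 (α : Family m M L n) (e : Coord m M) : SFun L m n :=
  fun p => open Classical in if p ∈ dom n e then α e p else 0

lemma ext0_eventually (α : Family m M L n) (e : Coord m M) {p : Pt m n}
  (hp : p ∈ dom n e) : ext0 α e =ᶠ[𝓝 p] α e := by
  filter_upwards [(isOpen_dom e).mem_nhds hp] with q hq using if_pos hq

lemma ext0_eventually_zero (α : Family m M L n) (e : Coord m M) {C : Set M} (hC : IsCompact C)
  (hCe : C ⊆ e.1.source) (h0 : ∀ p ∈ dom n e, point e p ∉ C → α e p = 0)
  {p : Pt m n} (hp : baseOf p ∉ e.1 '' C) : ext0 α e =ᶠ[𝓝 p] fun _ => 0 := by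
  filter_upwards [((hC.image_of_continuousOn (e.1.continuousOn.mono hCe)).isClosed.isOpen_compl.preimage
    continuous_baseOf).mem_nhds hp] with q hq
  unfold ext0
  split_ifs with hd
  · exact h0 q hd fun hc => hq ⟨_, hc, e.1.right_inv hd⟩
  · rfl

/-- A worm supported over a compact subset of a coordinate domain is rapidly decreasing in all
directions. -/
lemma cl_ext0 [T2Space M] {α : Family m M L n} (hα : IsWorm α) (h : RapidlyDecreasing α)
  (e : Coord m M) {C : Set M} (hC : IsCompact C) (hCe : C ⊆ e.1.source)
  (h0 : ∀ p ∈ dom n e, point e p ∉ C → α e p = 0) (k : ℕ) :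
  Cl univ (DE univ) k (ext0 α e) := by
  have hK := hC.image_of_continuousOn (e.1.continuousOn.mono hCe)
  have hKe : e.1 '' C ⊆ e.1.target := by rintro _ ⟨q, hq, rfl⟩; exact e.1.map_source (hCe hq)
  have hz := fun p => ext0_eventually_zero (p := p) α e hC hCe h0
  have h1 : ∀ k, Cl (ov n (e.1 '' C)) (DE (ov n (e.1 '' C))) k (ext0 α e) := fun k =>
    (h.rd hα e _ hK hKe k).congr fun p hp => ext0_eventually α e (hKe hp)
  have key : ∀ k (f : SFun L m n), Cl (ov n (e.1 '' C)) (DE (ov n (e.1 '' C))) k f →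
      (∀ p : Pt m n, baseOf p ∉ e.1 '' C → f =ᶠ[𝓝 p] fun _ => 0) →
      Cl univ (DE univ) k f := by
    have h0 : ∀ f : SFun L m n, Cl (ov n (e.1 '' C)) (DE (ov n (e.1 '' C))) 0 f →
      (∀ p : Pt m n, baseOf p ∉ e.1 '' C → f =ᶠ[𝓝 p] fun _ => 0) →
      Cl univ (DE univ) 0 f := fun f hf hz => by
      refine ⟨fun p _ => ?_, fun N => ?_⟩
      · by_cases hp : baseOf p ∈ e.1 '' C
        · exact hf.1 p hp
        · exact (SmAt.const 0 p).congr (hz p hp)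
      · obtain ⟨D, hD⟩ := hf.2 N
        refine ⟨|D|, fun p _ => ?_⟩
        by_cases hp : baseOf p ∈ e.1 '' C
        · exact (hD p hp).trans (le_abs_self D)
        · simp [(hz p hp).self_of_nhds]
    intro k
    induction k with
    | zero => exact h0
    | succ k ih =>
      intro f hf hz
      refine ⟨h0 f hf.zero hz, fun c => ih _ (hf.2 c) fun p hp => ?_⟩
      have := pd_congr (hz p hp) c
      rwa [pd_const] at this
  exact key k _ (h1 k) hz

end

section

lemma det_fderiv_eq {ψ : Bs m → Bs m} {x : Bs m} (h : DifferentiableAt ℝ ψ x) :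
  (fderiv ℝ ψ x).det = (jacM ψ x).det := by
  rw [ContinuousLinearMap.det, ← LinearMap.det_toMatrix']
  congr 1
  ext i j
  rw [LinearMap.toMatrix'_apply, jacM, Matrix.of_apply, pd]
  have h1 := (hasFDerivAt_pi'.1 h.hasFDerivAt i).fderiv
  rw [h1]
  simp [Pi.single_apply, Pi.single, Function.update_apply]

/-- The change of coordinates from `e` to `e'`. -/
def tr (e e' : Coord m M) (x : Bs m) : Fin m → ℝ := e'.1 (e.1.symm x)

/-- The coordinates in `e` of the part of the domain of `e` in `V`. -/
def ovl (e : Coord m M) (V : Set M) : Set (Bs m) := e.1.target ∩ e.1.symm ⁻¹' V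

lemma isOpen_ovl (e : Coord m M) {V : Set M} (hV : IsOpen V) : IsOpen (ovl e V) :=
  e.1.isOpen_inter_preimage_symm hV

lemma image_eq_ovl (e : Coord m M) {V : Set M} (hV : V ⊆ e.1.source) : e.1 '' V = ovl e V := by
  rw [e.1.image_eq_target_inter_inv_preimage hV]; rfl

lemma injOn_tr (e e' : Coord m M) {V : Set M} (hV : V ⊆ e'.1.source) : InjOn (tr e e') (ovl e V) :=
  fun _ hx _ hy h => e.1.symm.injOn hx.1 hy.1 (e'.1.injOn (hV hx.2) (hV hy.2) h)

lemma tr_tr {e e' : Coord m M} {x : Bs m} (hx : x ∈ ovl e e'.1.source) :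
  tr e' e (tr e e' x) = x := by
  simp only [tr]; rw [e'.1.left_inv hx.2, e.1.right_inv hx.1]

lemma tr_mem {e e' : Coord m M} {V : Set M} (hV : V ⊆ e'.1.source) {x : Bs m}
  (hx : x ∈ ovl e V) : tr e e' x ∈ ovl e' V := by
  refine ⟨e'.1.map_source (hV hx.2), ?_⟩
  simp only [tr, mem_preimage]; rw [e'.1.left_inv (hV hx.2)]; exact hx.2

lemma tr_image {e e' : Coord m M} {V : Set M} (hV : V ⊆ e.1.source ∩ e'.1.source) :
  tr e e' '' ovl e V = ovl e' V := by
  have h := fun x hx => (hV (a := x) hx)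
  refine Subset.antisymm ?_ fun y hy => ⟨tr e' e y, tr_mem (fun x hx => (h x hx).1) hy,
    tr_tr ⟨hy.1, (h _ hy.2).1⟩⟩
  rintro _ ⟨x, hx, rfl⟩
  exact tr_mem (fun x hx => (h x hx).2) hx

variable [IsManifold 𝓘(ℝ, Fin m → ℝ) ∞ M]

lemma smAt_tr {e e' : Coord m M} {x : Bs m} (hx : x ∈ ovl e e'.1.source) : SmAt (tr e e') x :=
  smAt_transition e e' hx.1 hx.2

lemma det_tr_ne_zero {e e' : Coord m M} {x : Bs m} (hx : x ∈ ovl e e'.1.source) :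
  (fderiv ℝ (tr e e') x).det ≠ 0 := by
  have hy : tr e e' x ∈ ovl e' e.1.source := ⟨e'.1.map_source hx.2, by
    simp only [tr, mem_preimage]; rw [e'.1.left_inv hx.2]; exact e.1.map_target hx.1⟩
  have h := ((smAt_tr hy).differentiableAt.hasFDerivAt.comp x
    (smAt_tr hx).differentiableAt.hasFDerivAt)
  have hid : (tr e' e ∘ tr e e') =ᶠ[𝓝 x] id := by
    filter_upwards [(isOpen_ovl e e'.1.open_source).mem_nhds hx] with z hz using tr_tr hz
  have h2 := h.unique ((hasFDerivAt_id x).congr_of_eventuallyEq hid)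
  intro h0
  have h3 : LinearMap.det ((fderiv ℝ (tr e' e) (tr e e' x)).toLinearMap ∘ₗ
      (fderiv ℝ (tr e e') x).toLinearMap) = 1 := by
    have := congrArg (fun A : Bs m →L[ℝ] (Bs m) => LinearMap.det A.toLinearMap) h2
    simpa using this
  rw [LinearMap.det_comp] at h3
  rw [ContinuousLinearMap.det] at h0
  rw [h0, mul_zero] at h3
  exact zero_ne_one h3

/-- A measurable density on `M`, in coordinates. -/
structure IsDens (d : Coord m M → Bs m → ℝ) : Prop where
  meas : ∀ e, AEStronglyMeasurable (d e) (volume.restrict e.1.target)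
  law : ∀ e e' : Coord m M, ∀ x ∈ ovl e e'.1.source,
  d e x = |(fderiv ℝ (tr e e') x).det| * d e' (tr e e' x)

lemma lintegral_tr {c : Coord m M → Bs m → ENNReal} (e e' : Coord m M)
  (hc : ∀ x ∈ ovl e e'.1.source,
      c e x = ENNReal.ofReal |(fderiv ℝ (tr e e') x).det| * c e' (tr e e' x))
  {g : M → ENNReal} (hg : ∀ q, q ∉ e.1.source ∩ e'.1.source → g q = 0) :
  ∫⁻ x in e.1.target, g (e.1.symm x) * c e x = ∫⁻ x in e'.1.target, g (e'.1.symm x) * c e' x := by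
  set V := e.1.source ∩ e'.1.source
  have hVo : IsOpen V := e.1.open_source.inter e'.1.open_source
  have hr : ∀ f : Coord m M, ∫⁻ x in f.1.target, g (f.1.symm x) * c f x =
      ∫⁻ x in ovl f V, g (f.1.symm x) * c f x := fun f => by
    rw [← lintegral_indicator f.1.open_target.measurableSet,
      ← lintegral_indicator (isOpen_ovl f hVo).measurableSet]
    congr 1
    ext x
    by_cases h : x ∈ f.1.target <;> by_cases h' : f.1.symm x ∈ V <;>
      simp [ovl, indicator, h, h', hg]
  rw [hr e, hr e', ← tr_image (e := e) (e' := e') subset_rfl,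
    lintegral_image_eq_lintegral_abs_det_fderiv_mul volume (isOpen_ovl e hVo).measurableSet
      (f' := fun x => fderiv ℝ (tr e e') x) (fun x hx =>
        (smAt_tr ⟨hx.1, hx.2.2⟩).differentiableAt.hasFDerivAt.hasFDerivWithinAt)
      (injOn_tr e e' inter_subset_right)]
  refine setLIntegral_congr_fun (isOpen_ovl e hVo).measurableSet fun x hx => ?_
  rw [hc x ⟨hx.1, hx.2.2⟩]
  have : e'.1.symm (tr e e' x) = e.1.symm x := e'.1.left_inv hx.2.2
  rw [this]; ring

/-- Integration of a nonnegative density with weights. -/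
def lint {J : Type*} (ch : J → Coord m M) (w : J → M → ENNReal)
  (c : Coord m M → Bs m → ENNReal) : ENNReal :=
  ∑' j, ∫⁻ x in (ch j).1.target, w j ((ch j).1.symm x) * c (ch j) x

lemma lint_refine [MeasurableSpace M] [BorelSpace M] {J J' : Type*}
  {ch : J → Coord m M} {w : J → M → ENNReal} {w' : J' → M → ENNReal}
  {c : Coord m M → Bs m → ENNReal} (hJ : (Function.support w').Countable)
  (hm : ∀ e : Coord m M, AEMeasurable (c e) (volume.restrict e.1.target))
  (hw : ∀ j, Measurable (w j)) (hw' : ∀ j, Measurable (w' j))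
  (h : ∀ e : Coord m M, ∀ x ∈ e.1.target, (∑' j, w' j (e.1.symm x)) * c e x = c e x) :
  lint ch w c = ∑' i, ∑' k, ∫⁻ x in (ch i).1.target,
      (w i * w' k) ((ch i).1.symm x) * c (ch i) x := by
  refine tsum_congr fun i => ?_
  have := hJ.to_subtype
  have hq : ∀ k : Function.support w', AEMeasurable
      (fun x => (w i * w' k) ((ch i).1.symm x) * c (ch i) x) (volume.restrict (ch i).1.target) :=
    fun k => AEMeasurable.mul (((hw i).mul (hw' k)).comp_aemeasurable
      ((ch i).1.continuousOn_symm.aemeasurable (ch i).1.open_target.measurableSet)) (hm _)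
  rw [← tsum_subtype_eq_of_support_subset (s := Function.support w') fun k hk h0 => hk ?_,
    ← lintegral_tsum hq]
  · refine setLIntegral_congr_fun (ch i).1.open_target.measurableSet fun x hx => ?_
    simp only [Pi.mul_apply]
    conv_lhs => rw [← h _ x hx, ← tsum_subtype_eq_of_support_subset (s := Function.support w')
      fun k hk h0 => hk (by simp [h0])]
    rw [← mul_assoc, ← ENNReal.tsum_mul_left, ← ENNReal.tsum_mul_right]
  · simp [h0]

lemma lint_indep [MeasurableSpace M] [BorelSpace M] {J J' : Type*}
  {ch : J → Coord m M} {ch' : J' → Coord m M} {w : J → M → ENNReal} {w' : J' → M → ENNReal}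
  {c : Coord m M → Bs m → ENNReal}
  (hJ : (Function.support w).Countable) (hJ' : (Function.support w').Countable)
  (hm : ∀ e : Coord m M, AEMeasurable (c e) (volume.restrict e.1.target))
  (hc : ∀ e e' : Coord m M, ∀ x ∈ ovl e e'.1.source,
      c e x = ENNReal.ofReal |(fderiv ℝ (tr e e') x).det| * c e' (tr e e' x))
  (hw : ∀ j, Measurable (w j)) (hw' : ∀ j, Measurable (w' j))
  (h0 : ∀ j q, q ∉ (ch j).1.source → w j q = 0) (h0' : ∀ j q, q ∉ (ch' j).1.source → w' j q = 0)
  (h1 : ∀ e : Coord m M, ∀ x ∈ e.1.target, (∑' j, w j (e.1.symm x)) * c e x = c e x)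
  (h1' : ∀ e : Coord m M, ∀ x ∈ e.1.target, (∑' j, w' j (e.1.symm x)) * c e x = c e x) :
  lint ch w c = lint ch' w' c := by
  rw [lint_refine hJ' hm hw hw' h1', lint_refine hJ hm hw' hw h1, ENNReal.tsum_comm]
  refine tsum_congr fun k => tsum_congr fun j => ?_
  rw [mul_comm]
  refine lintegral_tr _ _ (hc _ _) fun q hq => ?_
  by_cases h : q ∈ (ch j).1.source
  · simp [h0' k q fun h' => hq ⟨h, h'⟩]
  · simp [h0 j q h]

lemma IsDens.setIntegral {d : Coord m M → Bs m → ℝ} (hd : IsDens d) (e e' : Coord m M)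
  {V : Set M} (hV : IsOpen V) (h : V ⊆ e.1.source ∩ e'.1.source) :
  (IntegrableOn (d e) (e.1 '' V) ↔ IntegrableOn (d e') (e'.1 '' V)) ∧
      ∫ x in e.1 '' V, d e x = ∫ x in e'.1 '' V, d e' x := by
  have h1 := fun x hx => (h (a := x) hx).2
  have hs := (isOpen_ovl e hV).measurableSet
  have hf : ∀ x ∈ ovl e V, HasFDerivWithinAt (tr e e') (fderiv ℝ (tr e e') x) (ovl e V) x :=
    fun x hx => (smAt_tr ⟨hx.1, h1 _ hx.2⟩).differentiableAt.hasFDerivAt.hasFDerivWithinAt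
  have hl : EqOn (d e) (fun x => |(fderiv ℝ (tr e e') x).det| • d e' (tr e e' x)) (ovl e V) :=
    fun x hx => hd.law e e' x ⟨hx.1, h1 _ hx.2⟩
  rw [image_eq_ovl e fun x hx => (h hx).1, image_eq_ovl e' h1, ← tr_image h,
    integrableOn_image_iff_integrableOn_abs_det_fderiv_smul volume hs hf (injOn_tr e e' h1),
    integral_image_eq_integral_abs_det_fderiv_smul volume hs hf (injOn_tr e e' h1)]
  exact ⟨integrableOn_congr_fun hl hs, setIntegral_congr_fun hs hl⟩

lemma isDens_fint (hn : 2 ≤ n) {α : Family m M 0 n} (hα : IsWorm α) (h : RapidlyDecreasing α) :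
  IsDens fun e => fint ∅ (α e) where
  meas e := by
    have hc : ContinuousOn (fun z : (Bs m) × (FibIdx m n → ℝ) =>
        top m n (∅ : Finset (Fin 0)) (α e (assemble z.1 z.2))) (e.1.target ×ˢ univ) := fun z hz => by
      have h1 : assemble z.1 z.2 ∈ dom n e := assemble_mem hz.1 z.2
      exact ((LinearMap.continuous_of_finiteDimensional _).continuousAt.comp
        (ContinuousAt.comp (f := fun z : (Bs m) × (FibIdx m n → ℝ) => assemble z.1 z.2)
          (hα.smAt h1).contDiffAt.continuousAt
          (asmL m n).continuous.continuousAt)).continuousWithinAt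
    have hm := hc.aestronglyMeasurable (μ := (volume : Measure (Bs m)).prod
      (volume : Measure (FibIdx m n → ℝ))) (e.1.open_target.prod isOpen_univ).measurableSet
    rw [← Measure.prod_restrict, Measure.restrict_univ] at hm
    exact hm.integral_prod_right'
  law e e' x hx := by
    have hs := smAt_tr hx
    have hd := det_fderiv_eq hs.differentiableAt
    have hne := det_tr_ne_zero hx
    rw [hd] at hne ⊢
    rw [← fint_pullAlong hn (fun i => SmAt.apply hs i) hne fun j =>
      h.rd hα e' {tr e e' x} isCompact_singleton
        (singleton_subset_iff.2 (e'.1.map_source hx.2)) j]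
    refine integral_congr_ae (Eventually.of_forall fun y => ?_)
    have hb : baseOf (assemble x y : Pt m n) = x := assemble_mem (mem_singleton x) y
    simp only
    rw [hα.compatible e e' (assemble x y) (by rw [dom, mem_ofPred_eq, hb]; exact hx.1)
      (by rw [point, hb]; exact hx.2)]
    rfl

end

section

variable {J : Type*} {P : CoordPartition J m M} {d : Coord m M → Bs m → ℝ}

/-- Absolute integrability of a density. -/
def DInt (P : CoordPartition J m M) (d : Coord m M → Bs m → ℝ) : Prop :=
  (∀ j, IntegrableOn (fun x => P.part j ((P.chart j).1.symm x) * d (P.chart j) x)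
    (P.chart j).1.target) ∧
  Summable fun j => ∫ x in (P.chart j).1.target, |P.part j ((P.chart j).1.symm x) * d (P.chart j) x|

/-- The integral of a density. -/
def DI (P : CoordPartition J m M) (d : Coord m M → Bs m → ℝ) : ℝ :=
  ∑' j, ∫ x in (P.chart j).1.target, P.part j ((P.chart j).1.symm x) * d (P.chart j) x

lemma DInt.summable (h : DInt P d) : Summable fun j => ∫ x in (P.chart j).1.target,
  P.part j ((P.chart j).1.symm x) * d (P.chart j) x :=
  h.2.of_norm_bounded fun _ => norm_integral_le_integral_norm _

lemma DInt.congr {d' : Coord m M → Bs m → ℝ} (h : DInt P d)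
  (hd : ∀ e : Coord m M, ∀ x ∈ e.1.target, d' e x = d e x) : DInt P d' ∧ DI P d' = DI P d := by
  have h1 : ∀ j, EqOn (fun x => P.part j ((P.chart j).1.symm x) * d' (P.chart j) x)
      (fun x => P.part j ((P.chart j).1.symm x) * d (P.chart j) x) (P.chart j).1.target :=
    fun j x hx => by simp only [hd _ x hx]
  have hs := fun j => (P.chart j).1.open_target.measurableSet
  refine ⟨⟨fun j => (integrableOn_congr_fun (h1 j) (hs j)).2 (h.1 j), h.2.congr fun j => ?_⟩,
    tsum_congr fun j => setIntegral_congr_fun (hs j) (h1 j)⟩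
  exact setIntegral_congr_fun (hs j) fun x hx => congrArg abs (h1 j hx).symm

lemma DInt.sum {ι : Type*} {s : Finset ι} {r : ι → ℝ} {D : ι → Coord m M → Bs m → ℝ}
  (h : ∀ i ∈ s, DInt P (D i)) : DInt P (fun e x => ∑ i ∈ s, r i * D i e x) ∧
      DI P (fun e x => ∑ i ∈ s, r i * D i e x) = ∑ i ∈ s, r i * DI P (D i) := by
  have he : ∀ j x, P.part j ((P.chart j).1.symm x) * ∑ i ∈ s, r i * D i (P.chart j) x =
      ∑ i ∈ s, r i * (P.part j ((P.chart j).1.symm x) * D i (P.chart j) x) := fun j x => by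
    rw [mul_sum]; exact sum_congr rfl fun i _ => by ring
  have hi : ∀ j, ∀ i ∈ s, IntegrableOn (fun x => r i * (P.part j ((P.chart j).1.symm x) *
    D i (P.chart j) x)) (P.chart j).1.target := fun j i hi => ((h i hi).1 j).const_mul _
  have hI : ∀ j, IntegrableOn (fun x => ∑ i ∈ s, r i * (P.part j ((P.chart j).1.symm x) *
    D i (P.chart j) x)) (P.chart j).1.target := fun j => integrable_finsetSum _ (hi j)
  refine ⟨⟨fun j => by simpa only [he] using hI j, ?_⟩, ?_⟩
  · refine Summable.of_nonneg_of_le (fun j => integral_nonneg fun _ => abs_nonneg _) (fun j => ?_)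
      (summable_sum fun i hi => (h i hi).2.mul_left |r i|)
    simp only [he, ← integral_const_mul]
    rw [← integral_finsetSum _ fun i hi => (((h i hi).1 j).abs.const_mul _)]
    refine integral_mono (hI j).abs
      (integrable_finsetSum _ fun i hi => (((h i hi).1 j).abs.const_mul _)) fun x => ?_
    exact (Finset.abs_sum_le_sum_abs _ _).trans (le_of_eq (by simp only [abs_mul]))
  · simp only [DI, he, ← tsum_mul_left, ← integral_const_mul]
    rw [← Summable.tsum_finsetSum fun i hi => by
      simpa only [integral_const_mul] using (h i hi).summable.mul_left (r i)]
    exact tsum_congr fun j => integral_finsetSum _ (hi j)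

/-- The weights of a partition of unity. -/
def wt (P : CoordPartition J m M) (j : J) (q : M) : ENNReal := ENNReal.ofReal (P.part j q)

variable {Φ : ℝ → ENNReal}

/-- Functions which are positively homogeneous. -/
structure PosHom (Φ : ℝ → ENNReal) : Prop where
  meas : Measurable Φ
  hom : ∀ a t : ℝ, 0 ≤ a → Φ (a * t) = ENNReal.ofReal a * Φ t

lemma posHom_enorm : PosHom fun t : ℝ => ‖t‖ₑ :=
  ⟨measurable_enorm, fun a t ha => by rw [enorm_mul, Real.enorm_eq_ofReal ha]⟩

lemma posHom_ofReal : PosHom ENNReal.ofReal :=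
  ⟨ENNReal.measurable_ofReal, fun _ _ ha => ENNReal.ofReal_mul ha⟩

lemma posHom_ofReal_neg : PosHom fun t => ENNReal.ofReal (-t) :=
  ⟨ENNReal.measurable_ofReal.comp measurable_neg,
    fun a t ha => by rw [← mul_neg, ENNReal.ofReal_mul ha]⟩

lemma lint_wt (hΦ : PosHom Φ) (d : Coord m M → Bs m → ℝ) :
  lint P.chart (wt P) (fun e x => Φ (d e x)) = ∑' j, ∫⁻ x in (P.chart j).1.target,
      Φ (P.part j ((P.chart j).1.symm x) * d (P.chart j) x) := by
  simp only [lint, wt, hΦ.hom _ _ (P.part.nonneg _ _)]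

lemma aestronglyMeasurable_part (hm : ∀ e, AEStronglyMeasurable (d e) (volume.restrict e.1.target))
  (j : J) : AEStronglyMeasurable (fun x => P.part j ((P.chart j).1.symm x) * d (P.chart j) x)
      (volume.restrict (P.chart j).1.target) :=
  (((P.part j).contMDiff.continuous.comp_continuousOn
    (P.chart j).1.continuousOn_symm).aestronglyMeasurable
      (P.chart j).1.open_target.measurableSet).mul (hm _)

lemma dInt_iff (hm : ∀ e, AEStronglyMeasurable (d e) (volume.restrict e.1.target)) :
  DInt P d ↔ lint P.chart (wt P) (fun e x => ‖d e x‖ₑ) ≠ ⊤ := by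
  rw [lint_wt posHom_enorm]
  have hi : ∀ j, ∫ x in (P.chart j).1.target, |P.part j ((P.chart j).1.symm x) * d (P.chart j) x| =
      (∫⁻ x in (P.chart j).1.target,
        ‖P.part j ((P.chart j).1.symm x) * d (P.chart j) x‖ₑ).toReal := fun j =>
    integral_norm_eq_lintegral_enorm (aestronglyMeasurable_part hm j)
  simp only [DInt, hi]
  constructor
  · rintro ⟨h1, h2⟩
    have := ENNReal.ofReal_tsum_of_nonneg (fun _ => ENNReal.toReal_nonneg) h2
    simp only [fun j => ENNReal.ofReal_toReal (h1 j).2.ne] at this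
    rw [← this]; exact ENNReal.ofReal_ne_top
  · exact fun h => ⟨fun j => ⟨aestronglyMeasurable_part hm j,
      lt_top_iff_ne_top.2 (ENNReal.ne_top_of_tsum_ne_top h j)⟩, ENNReal.summable_toReal h⟩

lemma DInt.eq_sub (h : DInt P d)
  (hm : ∀ e, AEStronglyMeasurable (d e) (volume.restrict e.1.target)) :
  DI P d = (lint P.chart (wt P) fun e x => ENNReal.ofReal (d e x)).toReal -
      (lint P.chart (wt P) fun e x => ENNReal.ofReal (-d e x)).toReal := by
  have h' := (dInt_iff hm).1 h
  rw [lint_wt posHom_enorm] at h'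
  have hs : ∀ {Φ : ℝ → ENNReal}, (∀ t, Φ t ≤ ‖t‖ₑ) → ∑' j, ∫⁻ x in (P.chart j).1.target,
      Φ (P.part j ((P.chart j).1.symm x) * d (P.chart j) x) ≠ ⊤ := fun hΦ =>
    ne_top_of_le_ne_top h' (ENNReal.tsum_le_tsum fun j => lintegral_mono fun x => hΦ _)
  have h1 := hs Real.ofReal_le_enorm
  have h2 := hs (Φ := fun t => ENNReal.ofReal (-t)) fun t =>
    (Real.ofReal_le_enorm (-t)).trans_eq (enorm_neg t)
  rw [lint_wt posHom_ofReal, lint_wt posHom_ofReal_neg,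
    ENNReal.tsum_toReal_eq (ENNReal.ne_top_of_tsum_ne_top h1),
    ENNReal.tsum_toReal_eq (ENNReal.ne_top_of_tsum_ne_top h2),
    ← (ENNReal.summable_toReal h1).tsum_sub (ENNReal.summable_toReal h2)]
  exact tsum_congr fun j => integral_eq_lintegral_pos_part_sub_lintegral_neg_part (h.1 j)

variable [IsManifold 𝓘(ℝ, Fin m → ℝ) ∞ M] [SigmaCompactSpace M]

lemma countable_support_wt (P : CoordPartition J m M) : (Function.support (wt P)).Countable := by
  have := (P.part.locallyFinite.comp_injective
    (Subtype.val_injective (p := fun j => (Function.support (P.part j)).Nonempty))).countable_univ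
    fun j => j.2
  refine (countable_coe_iff.1 (countable_univ_iff.1 this)).mono fun j hj => ?_
  by_contra h
  exact hj (funext fun q => by
    have : P.part j q = 0 := by by_contra h1; exact h ⟨q, h1⟩
    simp [wt, this])

lemma measurable_wt [MeasurableSpace M] [BorelSpace M] (P : CoordPartition J m M) (j : J) :
  Measurable (wt P j) := (P.part j).contMDiff.continuous.measurable.ennreal_ofReal

lemma part_eq_zero (P : CoordPartition J m M) {j : J} {q : M} (hq : q ∉ (P.chart j).1.source) :
  P.part j q = 0 := image_eq_zero_of_notMem_tsupport fun h => hq (P.subordinate j h)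

lemma tsum_wt (P : CoordPartition J m M) (q : M) : ∑' j, wt P j q = 1 := by
  have hf : (Function.support fun j => P.part j q).Finite := P.part.locallyFinite.point_finite _
  simp only [wt]
  rw [← ENNReal.ofReal_tsum_of_nonneg (fun _ => P.part.nonneg _ _)
    (summable_of_hasFiniteSupport hf), tsum_eq_finsum hf, P.part.sum_eq_one (mem_univ _),
    ENNReal.ofReal_one]

lemma IsDens.lint_part (hd : IsDens d) (hΦ : PosHom Φ) [MeasurableSpace M] [BorelSpace M]
  {J' : Type*} {ch' : J' → Coord m M} {w' : J' → M → ENNReal}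
  (hJ' : (Function.support w').Countable) (hw' : ∀ j, Measurable (w' j))
  (h0' : ∀ j q, q ∉ (ch' j).1.source → w' j q = 0)
  (h1' : ∀ e : Coord m M, ∀ x ∈ e.1.target,
      (∑' j, w' j (e.1.symm x)) * Φ (d e x) = Φ (d e x)) :
  lint P.chart (wt P) (fun e x => Φ (d e x)) = lint ch' w' fun e x => Φ (d e x) :=
  lint_indep (countable_support_wt P) hJ'
    (fun e => hΦ.meas.comp_aemeasurable (hd.meas e).aemeasurable)
    (fun e e' x hx => by rw [hd.law e e' x hx, hΦ.hom _ _ (abs_nonneg _)])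
    (measurable_wt P) hw' (fun j q hq => by rw [wt, part_eq_zero P hq, ENNReal.ofReal_zero]) h0'
    (fun e x _ => by rw [tsum_wt, one_mul]) h1'

lemma IsDens.part_indep (hd : IsDens d) {J' : Type*} (P' : CoordPartition J' m M) :
  (DInt P d ↔ DInt P' d) ∧ (DInt P d → DI P d = DI P' d) := by
  borelize M
  have h : ∀ {Φ : ℝ → ENNReal}, PosHom Φ → lint P.chart (wt P) (fun e x => Φ (d e x)) =
      lint P'.chart (wt P') fun e x => Φ (d e x) := fun hΦ =>
    hd.lint_part hΦ (countable_support_wt P') (measurable_wt P')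
      (fun j q hq => by rw [wt, part_eq_zero P' hq, ENNReal.ofReal_zero])
      fun e x _ => by rw [tsum_wt, one_mul]
  have h1 : DInt P d ↔ DInt P' d := by
    rw [dInt_iff hd.meas, dInt_iff hd.meas, h posHom_enorm]
  exact ⟨h1, fun hi => by
    rw [hi.eq_sub hd.meas, (h1.1 hi).eq_sub hd.meas, h posHom_ofReal, h posHom_ofReal_neg]⟩

/-- A density which is supported over one coordinate domain. -/
lemma IsDens.single (hd : IsDens d) (e : Coord m M)
  (h0 : ∀ e' : Coord m M, ∀ x ∈ e'.1.target, e'.1.symm x ∉ e.1.source → d e' x = 0)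
  (hi : IntegrableOn (d e) e.1.target) : DInt P d ∧ DI P d = ∫ x in e.1.target, d e x := by
  borelize M
  have h : ∀ {Φ : ℝ → ENNReal}, PosHom Φ → lint P.chart (wt P) (fun e x => Φ (d e x)) =
      ∫⁻ x in e.1.target, Φ (d e x) := fun {Φ} hΦ => by
    rw [hd.lint_part hΦ (J' := Unit) (ch' := fun _ => e) (w' := fun _ => e.1.source.indicator 1)
      (to_countable _) (fun _ => measurable_one.indicator e.1.open_source.measurableSet)
      (fun _ q hq => indicator_of_notMem hq _) fun e' x hx => ?_]
    · simp only [lint, tsum_fintype, Finset.univ_unique, sum_singleton]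
      exact setLIntegral_congr_fun e.1.open_target.measurableSet fun x hx => by
        simp [indicator_of_mem (e.1.map_target hx)]
    · by_cases hq : e'.1.symm x ∈ e.1.source
      · simp [hq]
      · have := hΦ.hom 0 0 le_rfl
        simp_all
  have h1 : DInt P d := (dInt_iff hd.meas).2 (by rw [h posHom_enorm]; exact hi.2.ne)
  refine ⟨h1, ?_⟩
  rw [h1.eq_sub hd.meas, h posHom_ofReal, h posHom_ofReal_neg]
  exact (integral_eq_lintegral_pos_part_sub_lintegral_neg_part hi).symm

end

section

/-- Rapidly decreasing worms. -/
structure Nice (α : Family m M L n) : Prop where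
  worm : IsWorm α
  rd : RapidlyDecreasing α

lemma Nice.flat {α : Family m M 0 n} (h : Nice α) (u : OddVF n) : Nice (flat u α) :=
  ⟨h.worm.flat u, h.rd.flat h.worm u⟩

lemma Nice.cl {α : Family m M L n} (h : Nice α) {e : Coord m M} {x : Bs m}
  (hx : x ∈ e.1.target) (k : ℕ) : Cl (ov n {x}) (DE (ov n {x})) k (α e) :=
  h.rd.rd h.worm e {x} isCompact_singleton (singleton_subset_iff.2 hx) k

lemma Nice.integrable {α : Family m M L n} (h : Nice α) {e : Coord m M} {x : Bs m}
  (hx : x ∈ e.1.target) (T : Finset (Fin L)) :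
  Integrable fun y => top m n T (α e (assemble x y)) :=
  Cl.integrable (Cl.top (h.cl hx 0) T)

lemma fint_sum {ι : Type*} {s : Finset ι} {r : ι → ℝ} {β : ι → Family m M L n}
  {S : ι → Finset (Fin L)} (hβ : ∀ i ∈ s, Nice (β i)) {L' : ℕ} {T : Finset (Fin L')}
  {F : SFun L' m n} {e : Coord m M} {x : Bs m} (hx : x ∈ e.1.target)
  (hF : ∀ p, baseOf p = x → top m n T (F p) = ∑ i ∈ s, r i * top m n (S i) (β i e p)) :
  fint T F x = ∑ i ∈ s, r i * fint (S i) (β i e) x := by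
  simp only [fint, hF _ (baseOf_assemble x _), ← integral_const_mul]
  exact integral_finsetSum _ fun i hi => ((hβ i hi).integrable hx (S i)).const_mul _

lemma flatS_congr {u : OddVF n} {f g : SFun L m n} {p : Pt m n} (h : f =ᶠ[𝓝 p] g) :
  flatS u f p = flatS u g p := by
  simp only [flatS, (pd_congr h _).self_of_nhds, h.self_of_nhds]

lemma flatS_zero (u : OddVF n) (p : Pt m n) :
  flatS u (fun _ => 0 : SFun L m n) p = 0 := by simp [flatS, pd_const]

lemma flatS_sum {u : OddVF n} {ι : Type*} {s : Finset ι} {f : ι → SFun L m n}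
  {p : Pt m n} (hf : ∀ i ∈ s, SmAt (f i) p) :
  flatS u (fun q => ∑ i ∈ s, f i q) p = ∑ i ∈ s, flatS u (f i) p := by
  have h : ∀ c, pd c (fun q => ∑ i ∈ s, f i q) p = ∑ i ∈ s, pd c (f i) p := fun c => by
    simp only [pd]
    rw [fderiv_fun_sum fun i hi => (hf i hi).differentiableAt, sum_apply]
  simp only [flatS, h, map_sum, mul_sum, sum_add_distrib]
  rw [sum_comm, sum_comm (s := Finset.univ) (t := s)]

variable [T2Space M]

lemma eventually_zero {β : Family m M L n} {C : Set M} (hC : IsClosed C)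
  (h0 : ∀ (e : Coord m M), ∀ p ∈ dom n e, point e p ∉ C → β e p = 0) {e : Coord m M}
  {p : Pt m n} (hp : p ∈ dom n e) (hpC : point e p ∉ C) : β e =ᶠ[𝓝 p] fun _ => 0 := by
  filter_upwards [((isOpen_ovl e hC.isOpen_compl).preimage continuous_baseOf).mem_nhds
    (show baseOf p ∈ ovl e Cᶜ from ⟨hp, hpC⟩)] with q hq using h0 e q hq.1 hq.2

lemma flat_zero {β : Family m M 0 n} (hβ : Nice β) (u : OddVF n) {C : Set M} (hC : IsClosed C)
  (h0 : ∀ (e : Coord m M), ∀ p ∈ dom n e, point e p ∉ C → β e p = 0) (e : Coord m M)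
  (p : Pt m n) (hp : p ∈ dom n e) (hpC : point e p ∉ C) : flat u β e p = 0 := by
  rw [flat_eq hβ.worm u hp, flatS_congr (eventually_zero hC h0 hp hpC), flatS_zero, neg_zero]

lemma compactBase_flat {β : Family m M 0 n} (hβ : Nice β) (u : OddVF n) (h : CompactBase β) :
  CompactBase (flat u β) :=
  h.imp fun _ h => ⟨h.1, flat_zero hβ u h.1.isClosed h.2⟩

variable [IsManifold 𝓘(ℝ, Fin m → ℝ) ∞ M] {χ : M → ℝ}

lemma Nice.mulFun {α : Family m M L n} (h : Nice α)
  (hχ : ContMDiff 𝓘(ℝ, Fin m → ℝ) 𝓘(ℝ, ℝ) ∞ χ) : Nice (mulFun χ α) :=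
  ⟨h.worm.mulFun hχ, h.rd.mulFun hχ h.worm⟩

lemma fint_mulFun (χ : M → ℝ) (α : Family m M L n) (T : Finset (Fin L)) (e : Coord m M)
  (x : Bs m) : fint T (Worm.mulFun χ α e) x = χ (e.1.symm x) * fint T (α e) x := by
  simp only [fint, Worm.mulFun, point, baseOf_assemble, map_smul, smul_eq_mul, integral_const_mul]

variable [SigmaCompactSpace M] {J : Type*} {P : CoordPartition J m M}

lemma Nice.single (hn : 2 ≤ n) {γ : Family m M 0 n} (hγ : Nice γ) {e : Coord m M} {C : Set M}
  (hC : IsCompact C) (hCe : C ⊆ e.1.source)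
  (h0 : ∀ (e' : Coord m M), ∀ p ∈ dom n e', point e' p ∉ C → γ e' p = 0) :
  DInt P (fun e => fint ∅ (γ e)) ∧
      DI P (fun e => fint ∅ (γ e)) = ∫ x, fint ∅ (ext0 γ e) x := by
  have hi : Integrable (fint ∅ (ext0 γ e)) := (Cl.integrable_prod (Cl.top
    (cl_ext0 hγ.worm hγ.rd e hC hCe (h0 e) 0) ∅)).integral_prod_left
  have he : EqOn (fint ∅ (γ e)) (fint ∅ (ext0 γ e)) e.1.target := fun x hx => by
    simp only [fint, ext0, if_pos (show assemble x _ ∈ dom n e from assemble_mem hx _)]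
  have hs := e.1.open_target.measurableSet
  have h := (isDens_fint hn hγ.worm hγ.rd).single (P := P) e (fun e' x hx hq => by
    simp only [fint, fun y => h0 e' (assemble x y) (assemble_mem hx y)
      (by rw [point, baseOf_assemble]; exact fun h => hq (hCe h)), map_zero, integral_zero]) ((integrableOn_congr_fun he hs).2 hi.integrableOn)
  refine ⟨h.1, h.2.trans ?_⟩
  rw [setIntegral_congr_fun hs he, setIntegral_eq_integral_of_forall_compl_eq_zero fun x hx => ?_]
  have hx' : ∀ y, assemble x y ∉ dom n e := fun y h => hx (baseOf_assemble x y ▸ h :)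
  simp only [fint, ext0, if_neg (hx' _), map_zero, integral_zero]

/-- Vanishing of the integral of a density. -/
def Z (P : CoordPartition J m M) (d : Coord m M → Bs m → ℝ) : Prop := DInt P d ∧ DI P d = 0

lemma Z.congr {d d' : Coord m M → Bs m → ℝ} (h : Z P d)
  (hd : ∀ e : Coord m M, ∀ x ∈ e.1.target, d' e x = d e x) : Z P d' :=
  ⟨(h.1.congr hd).1, (h.1.congr hd).2.trans h.2⟩

lemma Z.sum {ι : Type*} {s : Finset ι} {r : ι → ℝ} {D : ι → Coord m M → Bs m → ℝ}
  (h : ∀ i ∈ s, Z P (D i)) : Z P fun e x => ∑ i ∈ s, r i * D i e x :=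
  have h' := DInt.sum fun i hi => (h i hi).1
  ⟨h'.1, h'.2.trans (sum_eq_zero fun i hi => by rw [(h i hi).2, mul_zero])⟩

lemma stokes_single (hn : 2 ≤ n) {β : Family m M 0 n} (hβ : Nice β) (u : OddVF n) {e : Coord m M}
  {C : Set M} (hC : IsCompact C) (hCe : C ⊆ e.1.source)
  (h0 : ∀ (e' : Coord m M), ∀ p ∈ dom n e', point e' p ∉ C → β e' p = 0) :
  Z P fun e => fint ∅ (flat u β e) := by
  have h := (hβ.flat u).single (P := P) hn hC hCe (flat_zero hβ u hC.isClosed h0)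
  refine ⟨h.1, h.2.trans ?_⟩
  have : ∀ p, ext0 (Worm.flat u β) e p = -flatS u (ext0 β e) p := fun p => by
    by_cases hp : p ∈ dom n e
    · rw [ext0, if_pos hp, flat_eq hβ.worm u hp, flatS_congr (ext0_eventually β e hp)]
    · rw [ext0, if_neg hp, flatS_congr (ext0_eventually_zero β e hC hCe (h0 e) fun ⟨q, hq, h⟩ =>
        hp (h ▸ e.1.map_source (hCe hq) : baseOf p ∈ e.1.target)), flatS_zero, neg_zero]
  have h2 := integral_fint_flatS hn u ∅ (cl_ext0 hβ.worm hβ.rd e hC hCe (h0 e) 1)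
  simp only [fint, this, map_neg, integral_neg] at h2 ⊢
  rw [h2, neg_zero]

lemma CompactBase.decomp {γ : Family m M 0 n} (h : CompactBase γ) (P : CoordPartition J m M) :
  ∃ (s : Finset J) (C : J → Set M), (∀ j, IsCompact (C j) ∧ C j ⊆ (P.chart j).1.source ∧
      ∀ (e : Coord m M), ∀ p ∈ dom n e, point e p ∉ C j → Worm.mulFun (P.part j) γ e p = 0) ∧
      ∀ (e : Coord m M), ∀ p ∈ dom n e, γ e p = ∑ j ∈ s, Worm.mulFun (P.part j) γ e p := by
  obtain ⟨K, hK, h0⟩ := h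
  have hf := P.part.locallyFinite.finite_nonempty_inter_compact hK
  refine ⟨hf.toFinset, fun j => tsupport (P.part j) ∩ K, fun j => ⟨hK.inter_left
    (isClosed_tsupport _), inter_subset_left.trans (P.subordinate j), fun e p hp hq => ?_⟩,
    fun e p hp => ?_⟩
  · by_cases h1 : point e p ∈ K
    · rw [Worm.mulFun, image_eq_zero_of_notMem_tsupport fun h2 => hq ⟨h2, h1⟩, zero_smul]
    · rw [Worm.mulFun, h0 e p hp h1, smul_zero]
  · by_cases h1 : point e p ∈ K
    · simp only [Worm.mulFun, ← sum_smul]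
      rw [← finsum_eq_sum_of_support_subset _ fun j hj => ?_, P.part.sum_eq_one (mem_univ _),
        one_smul]
      simpa using ⟨_, hj, h1⟩
    · simp [Worm.mulFun, h0 e p hp h1]

lemma Nice.dInt_compact (hn : 2 ≤ n) {γ : Family m M 0 n} (hγ : Nice γ) (h : CompactBase γ) :
  DInt P fun e => fint ∅ (γ e) := by
  obtain ⟨s, C, hC, hs⟩ := h.decomp P
  have hN := fun j => hγ.mulFun (P.part j).contMDiff
  refine ((DInt.sum (s := s) (r := fun _ => 1) fun j _ =>
    ((hN j).single (P := P) hn (hC j).1 (hC j).2.1 (hC j).2.2).1).1.congr fun e x hx => ?_).1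
  exact fint_sum (fun j _ => hN j) hx fun p hp => by
    simp [hs e p (by rw [dom, mem_ofPred_eq, hp]; exact hx)]

lemma Nice.fint_flat_zero (hn : 2 ≤ n) {β : Family m M 0 n} (hβ : Nice β) {u : OddVF n}
  (h : ∀ a, coeff ∅ (u a) = 0) {e : Coord m M} {x : Bs m} (hx : x ∈ e.1.target) :
  fint ∅ (Worm.flat u β e) x = 0 := by
  have := fint_flatS hn h ∅ (hβ.cl hx 1)
  rw [fint] at this ⊢
  simp_rw [fun y => flat_eq hβ.worm u (assemble_mem hx y : assemble x y ∈ dom n e), map_neg,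
    integral_neg, this, neg_zero]

/-- Stokes' theorem. -/
lemma Nice.stokes (hn : 2 ≤ n) {β : Family m M 0 n} (hβ : Nice β) (u : OddVF n)
  (h : CompactBase β ∨ ∀ a, coeff ∅ (u a) = 0) : Z P fun e => fint ∅ (Worm.flat u β e) := by
  have hd : ∀ {e : Coord m M} {x : Bs m}, x ∈ e.1.target →
      ∀ p : Pt m n, baseOf p = x → p ∈ dom n e := fun hx p hp => by
    rw [dom, mem_ofPred_eq, hp]; exact hx
  rcases h with h | h
  · obtain ⟨s, C, hC, hs⟩ := h.decomp P
    have hN := fun j => hβ.mulFun (P.part j).contMDiff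
    refine (Z.sum (s := s) (r := fun _ => 1) fun j _ =>
      stokes_single hn (hN j) u (hC j).1 (hC j).2.1 (hC j).2.2).congr fun e x hx => ?_
    refine fint_sum (fun j _ => (hN j).flat u) hx fun p hp => ?_
    have hp' := hd hx p hp
    have he : β e =ᶠ[𝓝 p] fun q => ∑ j ∈ s, Worm.mulFun (P.part j) β e q := by
      filter_upwards [(isOpen_dom e).mem_nhds hp'] with q hq using hs e q hq
    rw [flat_eq hβ.worm u hp', flatS_congr he, flatS_sum fun j _ => (hN j).worm.smAt hp', map_neg,
      map_sum, ← sum_neg_distrib]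
    exact sum_congr rfl fun j _ => by rw [flat_eq (hN j).worm u hp', map_neg, one_mul]
  · exact (Z.sum (s := (∅ : Finset Unit)) (r := 0) (D := 0) (by simp)).congr fun e x hx => by
      simp [hβ.fint_flat_zero hn h hx]

end

section

lemma coeff_mon_mul (A U : Finset ι) (W : Gr ι) :
  coeff U (mon A * W) =
      if A ⊆ U then coeff U (mon A * mon (U \ A)) * coeff (U \ A) W else 0 := by
  rw [← sum_coeff_mon W, mul_sum]
  simp only [map_sum, mul_smul_comm, map_smul, smul_eq_mul, coeff_mon]
  by_cases h : A ⊆ U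
  · rw [if_pos h, sum_eq_single (U \ A) (fun S _ hS => ?_) (by simp)]
    · simp [mul_comm]
    · by_contra h0
      have := coeff_mon_mul_mon (right_ne_zero_of_mul h0)
      exact hS (by rw [this.2, Finset.union_sdiff_cancel_left this.1])
  · rw [if_neg h]
    refine sum_eq_zero fun S _ => ?_
    by_contra h0
    exact h ((coeff_mon_mul_mon (right_ne_zero_of_mul h0)).2 ▸ Finset.subset_union_left)

lemma inl_mem_topIdx {T : Finset (Fin L)} {t : Fin L} :
  toLex (Sum.inl t) ∈ topIdx m n T ↔ t ∈ T := by simp [topIdx]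

lemma inr_mem_topIdx {T : Finset (Fin L)} {c : OddIdx m n} :
  toLex (Sum.inr c) ∈ topIdx m n T := by simp [topIdx]

lemma top_mT_mul (T S : Finset (Fin L)) : ∃ ε : ℝ, (¬ S ⊆ T → ε = 0) ∧ ∀ W,
  top m n T (mT m n S * W) = ε * top m n (T \ S) W := by
  have h1 : S.map (parLE L m n) ⊆ topIdx m n T ↔ S ⊆ T := by
    refine ⟨fun h t ht => inl_mem_topIdx.1 (h (Finset.mem_map_of_mem _ ht)), fun h s hs => ?_⟩
    obtain ⟨t, ht, rfl⟩ := Finset.mem_map.1 hs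
    exact inl_mem_topIdx.2 (h ht)
  have h2 : ∀ _ : DecidableEq (Par L m n), topIdx m n T \ S.map (parLE L m n) = topIdx m n (T \ S) := by
    intro _
    ext s
    obtain ⟨s, rfl⟩ := toLex.surjective s
    rw [Finset.mem_sdiff]
    rcases s with t | c
    · rw [inl_mem_topIdx, inl_mem_topIdx, Finset.mem_sdiff]
      exact and_congr_right' (not_congr (Finset.mem_map' (parLE L m n)))
    · simp only [inr_mem_topIdx, true_and, iff_true, Finset.mem_map, not_exists, not_and]
      exact fun t _ h => Sum.inl_ne_inr (toLex.injective h)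
  refine ⟨if S ⊆ T then coeff (topIdx m n T) (mT m n S * mon (topIdx m n (T \ S))) else 0,
    fun h => if_neg h, fun W => ?_⟩
  rw [top, coeff_mon_mul, h2]
  by_cases h : S ⊆ T
  · rw [if_pos h, if_pos (h1.2 h)]
  · rw [if_neg h, if_neg (mt h1.1 h), zero_mul]

variable [T2Space M]
  [IsManifold 𝓘(ℝ, Fin m → ℝ) ∞ M] [SigmaCompactSpace M] {J : Type*} {P : CoordPartition J m M}
  (φ : OddDiffeo n L)

lemma Nice.reparam {α : Family m M 0 n} (h : Nice α) : Nice (reparam φ α) :=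
  ⟨h.worm.reparam φ, rapidlyDecreasing_reparam φ h.worm h.rd⟩

lemma rpar_flatS {β : Family m M 0 n} (hβ : Nice β) (u : OddVF n) {e : Coord m M}
  {p : Pt m n} (hp : p ∈ dom n e) :
  rpar φ (flatS u (β e)) p = -rpar φ (flat u β e) p := by
  have hd : bod (evn (zr φ p)) ∈ dom n e := by
    change baseOf _ ∈ e.1.target
    rw [baseOf_bod_zr]; exact hp
  have hf := (hβ.worm.smAt hd).flatS (u := u)
  rw [rpar, rpar, gsub_congr (SmAt.smul (SmAt.const _ _) hf) (flat_eventually hβ.worm u hd),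
    gsub_const_smul _ hf (adm_zr φ p).evn ((adm_zr φ p).odn t0_mem), neg_one_smul, neg_neg]

lemma fint_reparam_empty (hn : 2 ≤ n) {β : Family m M 0 n} (hβ : Nice β) {e : Coord m M}
  {x : Bs m} (hx : x ∈ e.1.target) : fint ∅ (Worm.reparam φ β e) x =
      Real.sign φ.jac.det ^ (m * 2 ^ (n - 2)) * fint ∅ (β e) x :=
  fint_rpar_empty φ hn fun q hq => hβ.worm.smAt (by
    rw [mem_ov_singleton] at hq; rw [dom, mem_ofPred_eq, hq]; exact hx)

/-- The components of the integral of a pullback which depend on the parameters vanish. -/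
lemma Nice.z_reparam (hn : 2 ≤ n) {T : Finset (Fin L)} (hT : T.Nonempty) {β : Family m M 0 n}
  (hβ : Nice β) (h : CompactBase β ∨ φ.FixesOrigin) :
  Z P fun e => fint T (Worm.reparam φ β e) := by
  obtain ⟨w, hw, hwφ, hw0, hwf⟩ := exists_generator φ
  induction hN : T.card using Nat.strong_induction_on generalizing T β with
  | _ N ih =>
  subst hN
  choose ε hε0 hε using fun S => top_mT_mul (m := m) (n := n) T S
  have hT0 : (T.card : ℝ) ≠ 0 := by exact_mod_cast hT.card_pos.ne'
  refine (Z.sum (s := Finset.univ.filter fun S => S ⊆ T ∧ S.Nonempty)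
    (r := fun S => -(ε S / T.card)) (D := fun S e =>
      fint (T \ S) (Worm.reparam φ (Worm.flat (coeffVF w S) β) e)) fun S hS => ?_).congr
    fun e x hx => ?_
  · obtain ⟨hST, hS⟩ := (mem_filter.1 hS).2
    have hβ' := hβ.flat (coeffVF w S)
    rcases (T \ S).eq_empty_or_nonempty with h0 | h0
    · have hz := hβ.stokes (P := P) hn (coeffVF w S) (h.imp_right fun hf a => by
        rw [coeff_coeffVF, hwf hf])
      refine (Z.sum (s := {()}) (r := fun _ => Real.sign φ.jac.det ^ (m * 2 ^ (n - 2)))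
        fun _ _ => hz).congr fun e x hx => ?_
      rw [h0, fint_reparam_empty φ hn hβ' hx, sum_singleton]
    · exact ih _ (Finset.card_lt_card (Finset.sdiff_ssubset hST hS)) h0 hβ'
        (h.imp_left (compactBase_flat hβ _)) rfl
  · refine fint_sum (fun S _ => (hβ.flat _).reparam φ) hx fun p hp => ?_
    have hp' : p ∈ dom n e := by rw [dom, mem_ofPred_eq, hp]; exact hx
    have he := congrArg (top m n T) (euler_rpar φ hw hwφ (f := β e) (p := p) (hβ.worm.smAt (by
      change baseOf _ ∈ e.1.target
      rw [baseOf_bod_zr]; exact hp')))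
    have hc : ∀ _ : DecidableEq (Par L m n),
        Finset.univ.map (parLE L m n) ∩ topIdx m n T = T.map (parLE L m n) := by
      intro _
      ext s
      simp only [Finset.mem_inter, Finset.mem_map, Finset.mem_univ, true_and]
      constructor
      · rintro ⟨⟨t, rfl⟩, h⟩
        exact ⟨t, inl_mem_topIdx.1 h, rfl⟩
      · rintro ⟨t, h, rfl⟩
        exact ⟨⟨t, rfl⟩, inl_mem_topIdx.2 h⟩
    rw [top, coeff_euler, hc, card_map, map_sum] at he
    rw [← mul_right_inj' hT0, reparam_eq]
    refine he.trans ?_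
    rw [mul_sum, sum_filter]
    refine sum_congr rfl fun S _ => ?_
    rw [hε, rpar_flatS φ hβ _ hp']
    split_ifs with hS
    · rw [map_neg, reparam_eq]; field_simp
    · by_cases hST : S ⊆ T
      · have hS0 : S = ∅ := Finset.not_nonempty_iff_eq_empty.1 fun h => hS ⟨hST, h⟩
        have hv : coeffVF w S = 0 := funext fun a => gr_ext fun K => by
          rw [coeff_coeffVF, hS0, hw0]; simp
        rw [← rpar_flatS φ hβ _ hp', hv]
        simp [zero_flatS, rpar, gsub_const _ _ ((adm_zr φ p).odn t0_mem)]
      · rw [hε0 S hST, zero_mul]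

end

section

variable [T2Space M]
  [IsManifold 𝓘(ℝ, Fin m → ℝ) ∞ M] [SigmaCompactSpace M] {J : Type*} {P : CoordPartition J m M}

lemma Nice.fint_flat_eq (hn : 2 ≤ n) {β : Family m M 0 n} (hβ : Nice β) (u : OddVF n)
  {e : Coord m M} {x : Bs m} (hx : x ∈ e.1.target) : fint ∅ (Worm.flat u β e) x =
      ∑ a, coeff ∅ (u a) * fint ∅ (Worm.flat (partialTheta a) β e) x := by
  let c : Fin n → ℝ := fun a => coeff ∅ (u a)
  let v : Option (Fin n) → OddVF n := fun o => o.elim (u - ∑ a, c a • partialTheta a) partialTheta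
  let r : Option (Fin n) → ℝ := fun o => o.elim 1 c
  have hv : u = ∑ o, r o • v o := by rw [Fintype.sum_option]; simp [v, r]
  rw [fint_sum (s := Finset.univ) (r := r) (S := fun _ => ∅) (β := fun o => Worm.flat (v o) β)
    (fun o _ => hβ.flat _) hx fun p hp => ?_, Fintype.sum_option,
    hβ.fint_flat_zero hn (fun a => ?_) hx, mul_zero, zero_add]
  · rfl
  · have : coeff ∅ (1 : Gr (Fin n)) = 1 := by
      rw [← ordProd_empty (ι := Fin n) gen, ← mon_eq_ordProd, coeff_mon, if_pos rfl]
    simp [v, c, partialTheta, Finset.sum_apply, Pi.single_apply, apply_ite, this]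
  · have hp' : p ∈ dom n e := by rw [dom, mem_ofPred_eq, hp]; exact hx
    rw [flat_eq hβ.worm u hp', flatS_sum_smul r v hv, map_neg, map_sum, ← sum_neg_distrib]
    exact sum_congr rfl fun o _ => by
      rw [flat_eq hβ.worm _ hp', map_neg, mul_neg, map_smul, smul_eq_mul]

lemma DInt.abs_le {d : Coord m M → Bs m → ℝ} (h : DInt P d) :
  |DI P d| ≤ ∑' j, ∫ x in (P.chart j).1.target,
      |P.part j ((P.chart j).1.symm x) * d (P.chart j) x| := by
  have h' : Summable fun j => ‖∫ x in (P.chart j).1.target,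
      P.part j ((P.chart j).1.symm x) * d (P.chart j) x‖ :=
    h.2.of_nonneg_of_le (fun _ => norm_nonneg _) fun _ => norm_integral_le_integral_norm _
  exact (norm_tsum_le_tsum_norm h').trans
    (h'.tsum_le_tsum (fun _ => norm_integral_le_integral_norm _) h.2)

lemma compactBase_mulFun {χ : M → ℝ} (h : HasCompactSupport χ) (α : Family m M 0 n) :
  CompactBase (Worm.mulFun χ α) :=
  ⟨_, h, fun e p _ hq => by rw [mulFun, image_eq_zero_of_notMem_tsupport hq, zero_smul]⟩

lemma Nice.abs_le_flux (hn : 2 ≤ n) {α : Family m M 0 n} (hα : Nice α) (u : OddVF n) {χ : M → ℝ}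
  (hχ : ContMDiff 𝓘(ℝ, Fin m → ℝ) 𝓘(ℝ, ℝ) ∞ χ) (hc : HasCompactSupport χ) :
  |DI P fun e x => χ (e.1.symm x) * fint ∅ (Worm.flat u α e) x| ≤
      ∑ a, |coeff ∅ (u a)| * absIntegral P (flatComm a χ α) := by
  have hD : ∀ a, DInt P fun e x => χ (e.1.symm x) * fint ∅ (Worm.flat (partialTheta a) α e) x := fun a =>
    ((((hα.flat (partialTheta a)).mulFun hχ).dInt_compact (P := P) hn
      (compactBase_mulFun hc _)).congr fun e x _ => (fint_mulFun χ _ ∅ e x).symm).1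
  have hz := fun a => (hα.mulFun hχ).stokes (P := P) hn (partialTheta a)
    (.inl (compactBase_mulFun hc _))
  have hC : ∀ a, DInt P (fun e => fint ∅ (flatComm a χ α e)) ∧
      DI P (fun e => fint ∅ (flatComm a χ α e)) =
        -DI P fun e x => χ (e.1.symm x) * fint ∅ (Worm.flat (partialTheta a) α e) x := fun a => by
    have h := DInt.sum (P := P) (s := Finset.univ) (r := fun b : Bool => cond b 1 (-1))
      (D := fun b e x => cond b (fint ∅ (Worm.flat (partialTheta a) (Worm.mulFun χ α) e) x)
        (χ (e.1.symm x) * fint ∅ (Worm.flat (partialTheta a) α e) x))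
      (by rintro (_ | _) _; exacts [hD a, (hz a).1])
    have h' := h.1.congr (d' := fun e => fint ∅ (flatComm a χ α e)) fun e x hx => by
      rw [fint_sum (T := ∅) (s := Finset.univ) (r := fun b : Bool => cond b 1 (-1))
        (S := fun _ => ∅) (β := fun b => cond b (Worm.flat (partialTheta a) (Worm.mulFun χ α))
        (Worm.mulFun χ (Worm.flat (partialTheta a) α))) (e := e) (by
          rintro (_ | _) _; exacts [(hα.flat _).mulFun hχ, (hα.mulFun hχ).flat _]) hx fun p _ => by
        simp [flatComm, sub_eq_add_neg]]
      simp [fint_mulFun]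
    refine ⟨h'.1, h'.2.trans (h.2.trans ?_)⟩
    simp [(hz a).2]
  have hs := DInt.sum (P := P) (s := Finset.univ) (r := fun a => coeff ∅ (u a)) fun a _ => hD a
  rw [(hs.1.congr fun e x hx => ?_).2, hs.2]
  · refine (Finset.abs_sum_le_sum_abs _ _).trans (sum_le_sum fun a _ => ?_)
    rw [abs_mul, ← abs_neg (DI P _), ← (hC a).2]
    exact mul_le_mul_of_nonneg_left (hC a).1.abs_le (abs_nonneg _)
  · rw [hα.fint_flat_eq hn u hx, mul_sum]
    exact sum_congr rfl fun a _ => by ring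

lemma DInt.tendsto {d : Coord m M → Bs m → ℝ} (h : DInt P d) {χ : ℕ → M → ℝ}
  (hχ : ∀ k, Continuous (χ k)) (h1 : ∀ k q, |χ k q| ≤ 1)
  (hl : ∀ q, ∀ᶠ k in atTop, χ k q = 1) :
  Tendsto (fun k => DI P fun e x => χ k (e.1.symm x) * d e x) atTop (𝓝 (DI P d)) := by
  have hb : ∀ k j x, ‖P.part j ((P.chart j).1.symm x) *
      (χ k ((P.chart j).1.symm x) * d (P.chart j) x)‖ ≤
        |P.part j ((P.chart j).1.symm x) * d (P.chart j) x| := fun k j x => by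
    rw [mul_left_comm, norm_mul]
    exact mul_le_of_le_one_left (norm_nonneg _) (h1 _ _)
  refine tendsto_tsum_of_dominated_convergence h.2 (fun j => ?_) (Eventually.of_forall fun k j =>
    norm_integral_le_of_norm_le (h.1 j).abs (Eventually.of_forall (hb k j)))
  refine tendsto_integral_of_dominated_convergence _ (fun k => ?_) (h.1 j).abs
    (fun k => Eventually.of_forall (hb k j)) (Eventually.of_forall fun x => ?_)
  · simp_rw [mul_left_comm _ (χ k _)]
    exact (((hχ k).comp_continuousOn (P.chart j).1.continuousOn_symm).aestronglyMeasurable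
      (P.chart j).1.open_target.measurableSet).mul (h.1 j).1
  · exact tendsto_const_nhds.congr' ((hl ((P.chart j).1.symm x)).mono fun k hk => by
      simp only [hk, one_mul])

lemma Nice.stokes_of_noFlux (hn : 2 ≤ n) {α : Family m M 0 n} (hα : Nice α) (u : OddVF n)
  (h : NoFlux P α) (hd : DInt P fun e => fint ∅ (Worm.flat u α e)) :
  DI P (fun e => fint ∅ (Worm.flat u α e)) = 0 := by
  obtain ⟨χ, hc, h01, hK, hf⟩ := h
  refine tendsto_nhds_unique (hd.tendsto (χ := fun k => χ k)
    (fun k => (χ k).contMDiff.continuous)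
    (fun k q => abs_le.2 ⟨by linarith [(h01 k q).1], (h01 k q).2⟩)
    fun q => (hK {q} isCompact_singleton).mono fun k hk => hk q rfl) ?_
  refine squeeze_zero_norm (fun k => hα.abs_le_flux hn u (χ k).contMDiff (hc k)) ?_
  simpa using tendsto_finsetSum Finset.univ fun a _ => (hf a).const_mul |coeff ∅ (u a)|

end

section

variable [IsManifold 𝓘(ℝ, Fin m → ℝ) ∞ M] (F : Diffeomorph 𝓘(ℝ, Fin m → ℝ) 𝓘(ℝ, Fin m → ℝ) M M ∞)

/-- The coordinates `e ∘ F⁻¹`. -/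
def push (e : Coord m M) : Coord m M :=
  ⟨F.symm.toHomeomorph.transOpenPartialHomeomorph e.1,
    OpenPartialHomeomorph.mem_maximalAtlas_of_contMDiffOn _
      ((contMDiffOn_of_mem_maximalAtlas e.2).comp F.symm.contMDiff.contMDiffOn fun _ hx => hx)
      (F.contMDiff.comp_contMDiffOn (contMDiffOn_symm_of_mem_maximalAtlas e.2))⟩

lemma pullM_eq {α : Family m M L n} (hα : IsWorm α) {e : Coord m M} {p : Pt m n}
  (hp : p ∈ dom n e) : pullM F α e p = α (push F e) p :=
  (hα.compatible (push F e) ⟨chartAt (Bs m) (F (point e p)),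
    IsManifold.chart_mem_maximalAtlas _⟩ p hp
      (mem_chart_source _ _)).symm

lemma pullM_eventually {α : Family m M L n} (hα : IsWorm α) {e : Coord m M} {p : Pt m n}
  (hp : p ∈ dom n e) : pullM F α e =ᶠ[𝓝 p] α (push F e) := by
  filter_upwards [(isOpen_dom e).mem_nhds hp] with q hq using pullM_eq F hα hq

lemma Nice.pullM {α : Family m M L n} (h : Nice α) : Nice (pullM F α) where
  worm :=
    { smooth := contDiffOn_of_smAt fun e p hp =>
        (h.worm.smAt (e := push F e) hp).congr (pullM_eventually F h.worm hp)
      compatible := fun e e' p hp hp' => by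
        have hψ : ∀ i, SmAt (fun x => e'.1 (e.1.symm x) i) (baseOf p) :=
          fun i => (smAt_transition e e' hp hp').apply i
        have hd : bod (evn (pcoord L (fun x => e'.1 (e.1.symm x)) p)) ∈ dom n e' := by
          change baseOf _ ∈ e'.1.target
          rw [baseOf_bod_pcoord hψ]; exact e'.1.map_source hp'
        have ht : (fun x => (push F e').1 ((push F e).1.symm x)) = fun x => e'.1 (e.1.symm x) :=
          funext fun x => congrArg e'.1 (F.symm_apply_apply _)
        have hs : point (push F e) p ∈ (push F e').1.source := by
          change F.symm (F (e.1.symm (baseOf p))) ∈ e'.1.source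
          rw [F.symm_apply_apply]; exact hp'
        have hc := h.worm.compatible (push F e) (push F e') p hp hs
        rw [ht, pullAlong_eq] at hc
        rw [pullM_eq F h.worm hp, hc, pullAlong_eq]
        exact (gsub_congr (h.worm.smAt (e := push F e') hd) (pullM_eventually F h.worm hd)).symm }
  rd := rapidlyDecreasing_of_rd fun e K hK hKe k =>
    (h.rd.rd h.worm (push F e) K hK hKe k).congr fun p hp =>
      pullM_eventually F h.worm (hKe hp)

/-- The transported partition of unity. -/
def CoordPartition.push {J : Type*} (P : CoordPartition J m M) : CoordPartition J m M where
  part :=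
    { toFun := fun j => ⟨fun q => P.part j (F.symm q), (P.part j).contMDiff.comp F.symm.contMDiff⟩
      locallyFinite' := P.part.locallyFinite.preimage_continuous F.symm.continuous
      nonneg' := fun _ _ => P.part.nonneg _ _
      sum_eq_one' := fun _ _ => P.part.sum_eq_one (mem_univ _)
      sum_le_one' := fun _ => P.part.sum_le_one _ }
  chart j := Worm.push F (P.chart j)
  subordinate j := by
    have h : tsupport (fun q => P.part j (F.symm q)) = F.symm ⁻¹' tsupport (P.part j) :=
      (tsupport_comp_eq_preimage (P.part j) F.symm.toHomeomorph)
    refine h.trans_subset ((preimage_mono (P.subordinate j)).trans fun q hq => ?_)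
    simpa [Worm.push] using hq

lemma DInt.pullM {J : Type*} {P : CoordPartition J m M} {d : Coord m M → Bs m → ℝ}
  (h : DInt (P.push F) d) : DInt P (fun e => d (push F e)) ∧
      DI P (fun e => d (push F e)) = DI (P.push F) d := by
  have hq : ∀ j x, (P.push F).part j (((P.push F).chart j).1.symm x) =
      P.part j ((P.chart j).1.symm x) := fun j x => congrArg (P.part j) (F.symm_apply_apply _)
  simp only [DInt, DI, hq] at h ⊢
  exact ⟨h, rfl⟩

end

section

variable {J : Type*} {P : CoordPartition J m M}

lemma integral_eq_algebraMap {α : Family m M L n}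
  (h : ∀ T : Finset (Fin L), T.Nonempty → DI P (fun e => fint T (α e)) = 0) :
  integral P α = algebraMap ℝ _ (DI P fun e => fint ∅ (α e)) := by
  change ∑ T : Finset (Fin L), DI P (fun e => fint T (α e)) • mon T = _
  rw [sum_eq_single ∅ (fun T _ hT => by
      rw [h T (Finset.nonempty_iff_ne_empty.2 hT), zero_smul]) (by simp), mon_eq_ordProd,
    ordProd_empty, Algebra.algebraMap_eq_smul_one]

lemma integral_eq (P : CoordPartition J m M) (α : Family m M 0 n) :
  integral P α = algebraMap ℝ _ (DI P fun e => fint ∅ (α e)) :=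
  integral_eq_algebraMap fun T hT => by obtain ⟨t, _⟩ := hT; exact t.elim0

lemma absInt_iff (P : CoordPartition J m M) (α : Family m M 0 n) :
  AbsInt P α ↔ DInt P fun e => fint ∅ (α e) :=
  ⟨fun h => h ∅, fun h T => by rw [Finset.eq_empty_of_isEmpty T]; exact h⟩

end

end Worm

end

theorem mainTheorem4 (m n : ℕ) (hn : 2 ≤ n) (M : Type*) [TopologicalSpace M] [T2Space M]
    [SigmaCompactSpace M] [ChartedSpace (Fin m → ℝ) M]
    [IsManifold 𝓘(ℝ, Fin m → ℝ) ∞ M]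
    (α : Worm.Family m M 0 n) (hα : Worm.IsWorm α) (hα' : Worm.RapidlyDecreasing α) :
    -- the coordinate integral converges along the fibres, and does not depend on coordinates
    (∀ (e : Worm.Coord m M), ∀ x ∈ e.1.target, Integrable (Worm.topCoeff e α ∅ x)) ∧
    (∀ (e e' : Worm.Coord m M) (V : Set M), IsOpen V → V ⊆ e.1.source ∩ e'.1.source →
      (IntegrableOn (Worm.fibreInt e α ∅) (e.1 '' V) ↔
        IntegrableOn (Worm.fibreInt e' α ∅) (e'.1 '' V)) ∧
      ∫ x in e.1 '' V, Worm.fibreInt e α ∅ x = ∫ x in e'.1 '' V, Worm.fibreInt e' α ∅ x) ∧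
    (∀ (J J' : Type*) (P : Worm.CoordPartition J m M) (P' : Worm.CoordPartition J' m M),
      (Worm.AbsInt P α ↔ Worm.AbsInt P' α) ∧
      (Worm.AbsInt P α → Worm.integral P α = Worm.integral P' α)) ∧
    -- invariance under diffeomorphisms of `M`
    (∀ F : Diffeomorph 𝓘(ℝ, Fin m → ℝ) 𝓘(ℝ, Fin m → ℝ) M M ∞,
      Worm.IsWorm (Worm.pullM F α) ∧ Worm.RapidlyDecreasing (Worm.pullM F α) ∧
      ∀ (J : Type*) (P : Worm.CoordPartition J m M), Worm.AbsInt P α →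
        Worm.AbsInt P (Worm.pullM F α) ∧
        Worm.integral P (Worm.pullM F α) = Worm.integral P α) ∧
    -- invariance under diffeomorphisms of the odd space
    (∀ (L : ℕ) (φ : Worm.OddDiffeo n L),
      Worm.IsWorm (Worm.reparam φ α) ∧ Worm.RapidlyDecreasing (Worm.reparam φ α) ∧
      ∀ (J : Type*) (P : Worm.CoordPartition J m M), Worm.AbsInt P α →
        (Worm.CompactBase α ∨ φ.FixesOrigin) →
        Worm.AbsInt P (Worm.reparam φ α) ∧
        Worm.integral P (Worm.reparam φ α) =
          algebraMap ℝ _ (Real.sign φ.jac.det ^ (m * 2 ^ (n - 2)) *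
            Worm.body (Worm.integral P α))) ∧
    -- Stokes' theorem
    (∀ u : Worm.OddVF n,
      Worm.IsWorm (Worm.flat u α) ∧ Worm.RapidlyDecreasing (Worm.flat u α) ∧
      ∀ (J : Type*) (P : Worm.CoordPartition J m M), Worm.AbsInt P α →
        ((Worm.CompactBase α ∨ ∀ a, Worm.coeff ∅ (u a) = 0) →
          Worm.AbsInt P (Worm.flat u α) ∧ Worm.integral P (Worm.flat u α) = 0) ∧
        (Worm.NoFlux P α → Worm.AbsInt P (Worm.flat u α) →
          Worm.integral P (Worm.flat u α) = 0)) := by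
  have hN : Worm.Nice α := ⟨hα, hα'⟩
  have hd := Worm.isDens_fint hn hα hα'
  refine ⟨fun e x hx => hN.integrable hx ∅, fun e e' V hV h => hd.setIntegral e e' hV h,
    fun J J' P P' => ?_, fun F => ?_, fun L φ => ?_, fun u => ?_⟩
  · rw [Worm.absInt_iff, Worm.absInt_iff, Worm.integral_eq, Worm.integral_eq]
    have h := hd.part_indep (P := P) P'
    exact ⟨h.1, fun hi => by rw [h.2 hi]⟩
  · have hF := hN.pullM F
    refine ⟨hF.worm, hF.rd, fun J P hi => ?_⟩
    rw [Worm.absInt_iff] at hi ⊢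
    have h := hd.part_indep (P := P) (P.push F)
    have h1 := (h.1.1 hi).pullM F
    have h2 := h1.1.congr (d' := fun e => Worm.fint ∅ (Worm.pullM F α e)) fun e x hx =>
      integral_congr_ae (Eventually.of_forall fun y => by
        simp only [Worm.pullM_eq F hα (Worm.assemble_mem hx y : Worm.assemble x y ∈ Worm.dom n e)])
    rw [Worm.integral_eq, Worm.integral_eq, h2.2, h1.2, h.2 hi]
    exact ⟨h2.1, rfl⟩
  · have hR := hN.reparam φ
    refine ⟨hR.worm, hR.rd, fun J P hi h => ?_⟩
    rw [Worm.absInt_iff] at hi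
    have hz := fun (T : Finset (Fin L)) (hT : T.Nonempty) => hN.z_reparam (P := P) φ hn hT h
    have h1 := Worm.DInt.sum (P := P) (s := {()})
      (r := fun _ => Real.sign φ.jac.det ^ (m * 2 ^ (n - 2)))
      (D := fun _ e => Worm.fint ∅ (α e)) fun _ _ => hi
    have h2 := h1.1.congr (d' := fun e => Worm.fint ∅ (Worm.reparam φ α e)) fun e x hx => by
      rw [Worm.fint_reparam_empty φ hn hN hx, Finset.sum_singleton]
    refine ⟨fun T => ?_, ?_⟩
    · rcases T.eq_empty_or_nonempty with rfl | hT
      exacts [h2.1, (hz T hT).1]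
    · rw [Worm.integral_eq_algebraMap fun T hT => (hz T hT).2, Worm.integral_eq, AlgHom.commutes,
        h2.2, h1.2, Finset.sum_singleton]
      rfl
  · have hU := hN.flat u
    refine ⟨hU.worm, hU.rd, fun J P hi => ?_⟩
    rw [Worm.absInt_iff, Worm.integral_eq]
    refine ⟨fun h => ?_, fun h hf => ?_⟩
    · have hz := hN.stokes (P := P) hn u h
      exact ⟨hz.1, by rw [hz.2, map_zero]⟩
    · rw [hN.stokes_of_noFlux hn u h hf, map_zero]
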